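/- **Setting.** For every security parameter $k$ let public parameters be given: a safe prime $P=2q+1$ ($q$ prime), a generator $g$ of the group $\mathbb G$ of quadratic residues modulo $P$, a finite alphabet $\mathbb D\neq\emptyset$, a password length $n$, a threshold $1\le t\le n$, and an injective encoding $\mathbb D^n\to\mathbb G$ (passwords are identified with their encodings). The bit length of $q$ and the number $n$ are polynomial in $k$ and the encoding is computable in polynomial time. Write $x\approx_t y$ if $x,y\in\mathbb D^n$ agree in at least $t$ positions. In the random oracle model, $\mathfrak h_i,\mathfrak g_i:\{0,1\}^k\times\mathbb D\to\mathbb Z_q$ ($1\le i\le n$) and $H:\mathbb D^n\to\{0,1\}^k$ are independent uniformly random functions that all parties can query. **Protocol.** *Registration* of $p\in\mathbb D^n$: choose uniformly $v_1,v_2\in\{0,1\}^k$, $r\in\mathbb Z_q$ and $a_0,\dots,a_{t-1}\in\mathbb Z_q$; put $\alpha=a_0$, $f(X)=\sum_{j<t}a_jX^j$, $h=g^{\alpha}$, $x_i=\mathfrak h_i(v_1,p_i)$, $\alpha_i=f(x_i)$, $c=(g^{r},p\,h^{r})$, $y_i=\alpha_i-\mathfrak g_i(v_2,p_i)$. The server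 stores $H(p)$, $pk=(q,g,h)$, $v_1,v_2$, $c=(a,b)$, $y_1,\dots,y_n$. *Log in* with $p'$: the server accepts iff $H(p')$ equals the stored hash. *Password recovery* with guess $p'\in\mathbb D^n$: the server draws a fresh uniform $r'\in\mathbb Z_q$, puts $c'=(a',b')=(a g^{r'},b h^{r'})$ and $c'_i=(a')^{\,y_i+\mathfrak g_i(v_2,p'_i)}$, and sends $v_1,pk,c',c'_1,\dots,c'_n$. **Attack.** An adversary $A$ is a probabilistic polynomial-time machine; it is given the public parameters and possibly an auxiliary input, and it has access to the random oracles. It fixes a password $p$ when it wishes, which is then honestly registered, and afterwards adaptively makes any number of recovery and log-in requests, interleaved with random oracle queries. Finally it outputs a bit. (All machines may toss coins and draw uniform elements of $\mathbb Z_q$.) **Ideal situation and simulator.** The ideal oracle holds $p$; on a guess $p'$ it returns $p$ if $p'\approx_t p$ and the empty string otherwise. A simulator $I$ is a probabilistic polynomial-time machine that plays the server towards $A$ without being given $p$: it gets the public parameters, and for each request of $A$ it gets the guess $p'$ in it, its kind (recovery or log in) and the ideal oracle's answer to that same $p'$, and it computes the reply. It can query the same random oracles as $A$ (it cannot program them)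 but has no other access to $p$. **Theorem (the privacy of the server).** In the random oracle model there is a simulator $I$ such that the following holds for every auxiliary input. If the decision Diffie–Hellman assumption holds for the groups $\mathbb G$ (no probabilistic polynomial-time machine with that auxiliary input distinguishes $(g^{x},g^{y},g^{xy})$ from $(g^{x},g^{y},g^{z})$, for uniform $x,y,z\in\mathbb Z_q$, with non-negligible advantage in $k$), then no probabilistic polynomial-time adversary $A$ with that auxiliary input distinguishes $I$ from the real server with non-negligible advantage: the difference between the probabilities that $A$ outputs $1$ against the real server and against $I$ is negligible in $k$. -/

import Mathlib

/-! ### Machines: values, programs, running time -/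

/-- Data handled by machines: binary trees whose leaves are natural numbers. -/
inductive Val : Type
  | nat (a : ℕ) : Val
  | pair (u v : Val) : Val

namespace Val

/-- Length of a description of the value in bits, up to a constant factor. -/
def size : Val → ℕ
  | nat a => Nat.size a + 1
  | pair u v => u.size + v.size + 1

def fst : Val → Val
  | nat _ => nat 0
  | pair u _ => u

def snd : Val → Val
  | nat _ => nat 0
  | pair _ v => v

def toNat : Val → ℕ
  | nat a => a
  | pair _ _ => 0

def isPair : Val → ℕ
  | nat _ => 0
  | pair _ _ => 1

/-- Lists, coded by nested pairs and ended by `nat 0`. -/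
def ofList (l : List Val) : Val := l.foldr pair (nat 0)

/-- The number at position `i` of a coded list. -/
def entry (v : Val) (i : ℕ) : ℕ := (snd^[i] v).fst.toNat

end Val

/-- Arithmetic instructions on natural numbers in binary. -/
inductive ArithOp : Type
  | add | sub | mul | div | mod

def ArithOp.apply : ArithOp → ℕ → ℕ → ℕ
  | add, a, b => a + b
  | sub, a, b => a - b
  | mul, a, b => a * b
  | div, a, b => a / b
  | mod, a, b => a % b

/-- Programs. `comp f e` runs `e` and then `f`; `branch c f e` runs `f` unless `c` returns `nat 0`,
in which case it runs `e`; `loop f` takes a pair `(a, x)` and applies `f` to `x` exactly `a` times. -/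
inductive Prog : Type
  | id : Prog
  | const (a : ℕ) : Prog
  | fst : Prog
  | snd : Prog
  | isPair : Prog
  | size : Prog
  | arith (op : ArithOp) : Prog
  | pair (f e : Prog) : Prog
  | comp (f e : Prog) : Prog
  | branch (c f e : Prog) : Prog
  | loop (f : Prog) : Prog

namespace Prog

/-- The value that a program returns. -/
def eval : Prog → Val → Val
  | id, v => v
  | const a, _ => .nat a
  | fst, v => v.fst
  | snd, v => v.snd
  | isPair, v => .nat v.isPair
  | size, v => .nat v.size
  | arith op, v => .nat (op.apply v.fst.toNat v.snd.toNat)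
  | pair f e, v => .pair (f.eval v) (e.eval v)
  | comp f e, v => f.eval (e.eval v)
  | branch c f e, v => match c.eval v with
    | .nat 0 => e.eval v
    | _ => f.eval v
  | loop f, v => f.eval^[v.fst.toNat] v.snd

/-- The running time of a program with logarithmic cost: a basic instruction costs the bit length
of what it reads and writes, and every repetition of a loop is paid for. -/
def cost : Prog → Val → ℕ
  | pair f e, v => f.cost v + e.cost v + 1
  | comp f e, v => e.cost v + f.cost (e.eval v) + 1
  | branch c f e, v => c.cost v + (match c.eval v with
    | .nat 0 => e.cost v
    | _ => f.cost v) + 1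
  | loop f, v => v.size + 1 +
      ∑ i ∈ Finset.range v.fst.toNat, (f.cost (f.eval^[i] v.snd) + 1)
  | id, v => v.size + v.size
  | const a, v => v.size + (Val.nat a).size
  | fst, v => v.size + v.fst.size
  | snd, v => v.size + v.snd.size
  | isPair, v => v.size + (Val.nat v.isPair).size
  | size, v => v.size + (Val.nat v.size).size
  | arith op, v => v.size + (Val.nat (op.apply v.fst.toNat v.snd.toNat)).size

end Prog

/-! ### Probabilistic interactive machines -/

/-- What a machine can do at the end of an activation: stop with an output, toss a coin,
draw a uniform exponent modulo the group order, or send a message to its oracle. -/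
inductive MachineAction : Type
  | halt (v : Val) : MachineAction
  | coin : MachineAction
  | draw : MachineAction
  | call (v : Val) : MachineAction

def MachineAction.ofVal : Val → MachineAction
  | .pair (.nat 0) v => .halt v
  | .pair (.nat 1) _ => .coin
  | .pair (.nat 2) _ => .draw
  | .pair (.nat 3) v => .call v
  | _ => .halt (.nat 0)

namespace Prog

/-- One activation of an interactive machine: from its input, its memory `s` and the message `a`
that has just arrived, it computes its new memory and its next action. -/
def activate (M : Prog) (inp s a : Val) : Val × MachineAction :=
  ((M.eval (.pair inp (.pair s a))).fst, MachineAction.ofVal (M.eval (.pair inp (.pair s a))).snd)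

/-- The memory after the messages in `as` have arrived; initially it is `nat 0`. -/
def memory (M : Prog) (inp : Val) (as : List Val) : Val :=
  as.foldl (fun s a => (M.activate inp s a).1) (.nat 0)

/-- Polynomial time: each activation, whatever messages have arrived, takes time polynomial in the
security parameter `k` and the total length of the messages received so far. As reading the input
is paid for, this can only hold if the inputs `inp k` have length polynomial in `k`. -/
def Efficient (M : Prog) (inp : ℕ → Val) : Prop :=
  ∃ c : ℕ, ∀ (k : ℕ) (as : List Val) (a : Val),
    M.cost (.pair (inp k) (.pair (M.memory (inp k) as) a)) ≤
      (k + (as.map Val.size).sum + a.size) ^ c + c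

/-- Run the machine `M` with a (stateful, randomized) oracle `O` for at most the given number of
activations, from memory `s`, arriving message `a` and oracle state `e`. The result is the output,
the final memory and the final oracle state; if the activations are used up, the output is
`nat 0`. -/
noncomputable def run {σ : Type} (M : Prog) (inp : Val) (q : ℕ) [NeZero q]
    (O : σ → Val → PMF (Val × σ)) : ℕ → Val → Val → σ → PMF (Val × Val × σ)
  | 0, s, _, e => PMF.pure (.nat 0, s, e)
  | T + 1, s, a, e =>
    match M.activate inp s a with
    | (s₁, .halt v) => PMF.pure (v, s₁, e)
    | (s₁, .coin) =>
        (PMF.uniformOfFintype Bool).bind fun b => M.run inp q O T s₁ (.nat b.toNat) e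
    | (s₁, .draw) =>
        (PMF.uniformOfFintype (ZMod q)).bind fun z => M.run inp q O T s₁ (.nat z.val) e
    | (s₁, .call v) => (O e v).bind fun r => M.run inp q O T s₁ r.1 r.2

end Prog

/-- The polynomials in the security parameter that serve as bounds. -/
def polyBound (c k : ℕ) : ℕ := k ^ c + c

def PolyBounded (f : ℕ → ℕ) : Prop := ∃ c : ℕ, ∀ k, f k ≤ polyBound c k

def Negligible (f : ℕ → ℝ) : Prop :=
  Asymptotics.SuperpolynomialDecay Filter.atTop (fun k : ℕ => (k : ℝ)) f

/-- The probability that a machine outputs `1`. -/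
noncomputable def probOne {σ : Type} (d : PMF (Val × Val × σ)) : ℝ :=
  ((d.map Prod.fst) (.nat 1)).toReal

/-! ### System parameters and the decision Diffie-Hellman assumption -/

/-- Public parameters: the group of quadratic residues modulo the safe prime `2 * q + 1` with a
generator `g`; passwords of length `n` over an alphabet of `m` letters; the threshold `t`; an
injective encoding of passwords as group elements. -/
structure Params where
  q : ℕ
  prime_q : q.Prime
  prime_modulus : (2 * q + 1).Prime
  g : (ZMod (2 * q + 1))ˣ
  g_generates : ∀ x : (ZMod (2 * q + 1))ˣ, x ∈ Subgroup.zpowers g ↔ IsSquare x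
  n : ℕ
  m : ℕ
  m_pos : 0 < m
  t : ℕ
  t_pos : 0 < t
  t_le : t ≤ n
  encode : (Fin n → Fin m) → (ZMod (2 * q + 1))ˣ
  encode_mem : ∀ p, encode p ∈ Subgroup.zpowers g
  encode_injective : Function.Injective encode

namespace Params

instance (P : Params) : NeZero P.q := ⟨P.prime_q.ne_zero⟩

instance (P : Params) : NeZero P.m := ⟨P.m_pos.ne'⟩

/-- The units modulo the safe prime, which contain the group of quadratic residues. -/
abbrev Grp (P : Params) : Type := (ZMod (2 * P.q + 1))ˣ

abbrev Password (P : Params) : Type := Fin P.n → Fin P.m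

/-- Powers of a group element, with exponents modulo `q`. -/
def pow (P : Params) (x : P.Grp) (z : ZMod P.q) : P.Grp := x ^ z.val

/-- A group element as a number, the least residue. -/
def elt (P : Params) (x : P.Grp) : Val := .nat (x : ZMod (2 * P.q + 1)).val

def passwordVal (P : Params) (p : P.Password) : Val :=
  .ofList (List.ofFn fun i => .nat (p i))

/-- Read a password from a message; `none` if the message does not contain one. -/
def readPassword (P : Params) (v : Val) : Option P.Password :=
  if hv : ∀ i : Fin P.n, v.entry i < P.m then some fun i => ⟨v.entry i, hv i⟩ else none

/-- Two passwords match if they agree in at least `t` positions. -/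
def Matches (P : Params) (x y : P.Password) : Prop :=
  P.t ≤ (Finset.univ.filter fun i => x i = y i).card

instance (P : Params) (x y : P.Password) : Decidable (P.Matches x y) :=
  inferInstanceAs (Decidable (_ ≤ _))

/-- The public description of the parameters, including the security parameter. -/
def pub (P : Params) (k : ℕ) : Val :=
  .ofList [.nat k, .nat P.q, P.elt P.g, .nat P.n, .nat P.t, .nat P.m]

end Params

/-- The sizes of the parameters are polynomial in the security parameter, and the encoding of
passwords in the group is computable in polynomial time. -/
def Feasible (P : ℕ → Params) : Prop :=
  PolyBounded (fun k => Nat.size (P k).q) ∧ PolyBounded (fun k => (P k).n) ∧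
    ∃ (E : Prog) (c : ℕ), ∀ (k : ℕ) (p : (P k).Password),
      E.eval (.pair ((P k).pub k) ((P k).passwordVal p)) = (P k).elt ((P k).encode p) ∧
      E.cost (.pair ((P k).pub k) ((P k).passwordVal p)) ≤ polyBound c k

/-- The input of an adversary: the public parameters and an auxiliary input. -/
def advInput (P : ℕ → Params) (aux : ℕ → Val) (k : ℕ) : Val := .pair ((P k).pub k) (aux k)

/-- The probability that `M`, given `g ^ x`, `g ^ y`, `g ^ z` where the exponents have the law `D`,
outputs `1` within `T` activations. There is no oracle: every call is answered by `nat 0`. -/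
noncomputable def ddhProb (P : Params) (inp : Val) (M : Prog) (T : ℕ)
    (D : PMF (ZMod P.q × ZMod P.q × ZMod P.q)) : ℝ :=
  probOne (D.bind fun d =>
    M.run inp P.q (fun (_ : Unit) _ => PMF.pure (.nat 0, ())) T (.nat 0)
      (.ofList [P.elt (P.pow P.g d.1), P.elt (P.pow P.g d.2.1), P.elt (P.pow P.g d.2.2)]) ())

/-- The decision Diffie-Hellman assumption for the given groups, against probabilistic
polynomial-time machines that get the auxiliary inputs `aux`. -/
def DDH (P : ℕ → Params) (aux : ℕ → Val) : Prop :=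
  ∀ (M : Prog) (c : ℕ), M.Efficient (advInput P aux) →
    Negligible fun k =>
      |ddhProb (P k) (advInput P aux k) M (polyBound c k)
          ((PMF.uniformOfFintype (ZMod (P k).q × ZMod (P k).q)).map fun d => (d.1, d.2, d.1 * d.2))
        - ddhProb (P k) (advInput P aux k) M (polyBound c k)
          (PMF.uniformOfFintype (ZMod (P k).q × ZMod (P k).q × ZMod (P k).q))|

/-! ### Random oracles -/

/-- Bit strings of length `k`, as numbers below `2 ^ k`. -/
abbrev BitString (k : ℕ) : Type := Fin (2 ^ k)

/-- The three independent hash functions, in this order: the keyed hashes of letters `h` and `g`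
(one function for every position, with a key of `k` bits), and the password hash `H`. -/
abbrev HashFunctions (P : Params) (k : ℕ) : Type :=
  (Fin P.n → BitString k → Fin P.m → ZMod P.q) × (Fin P.n → BitString k → Fin P.m → ZMod P.q) ×
    (P.Password → BitString k)

/-- The answer of a keyed hash function to a message that lists a position, a key and a letter. -/
def keyedAnswer (P : Params) (k : ℕ) (f : Fin P.n → BitString k → Fin P.m → ZMod P.q)
    (v : Val) : Val :=
  if hv : v.entry 0 < P.n ∧ v.entry 1 < 2 ^ k ∧ v.entry 2 < P.m then
    .nat (f ⟨v.entry 0, hv.1⟩ ⟨v.entry 1, hv.2.1⟩ ⟨v.entry 2, hv.2.2⟩).val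
  else .nat 0

/-- Access to the random oracles: message tag `0` for `h`, `1` for `g`, `2` for `H`. -/
def hashAnswer (P : Params) (k : ℕ) (ρ : HashFunctions P k) : Val → Val
  | .pair (.nat 0) v => keyedAnswer P k ρ.1 v
  | .pair (.nat 1) v => keyedAnswer P k ρ.2.1 v
  | .pair (.nat 2) v => match P.readPassword v with
    | some p => .nat (ρ.2.2 p)
    | none => .nat 0
  | _ => .nat 0

/-! ### The real server -/

/-- A server as a client sees it: registration of a password, and its (randomized, stateful)
reactions to a password recovery request and to a log in request. -/
structure Server (P : Params) where
  State : Type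
  register : P.Password → PMF State
  recover : State → P.Password → PMF (Val × State)
  login : State → P.Password → PMF (Val × State)

/-- What the server keeps for the account: the hash `H(p)` and the recovery data, that is the
public key `pubKey = g ^ α`, the keys `v₁` and `v₂`, the ciphertext `c = (c₁, c₂)` and the numbers
`y i = α_i - g_i(p_i)`. -/
structure Record (P : Params) (k : ℕ) where
  hashed : BitString k
  pubKey : P.Grp
  v₁ : BitString k
  v₂ : BitString k
  c₁ : P.Grp
  c₂ : P.Grp
  y : Fin P.n → ZMod P.q

/-- The record for the password `p`, the keys `v₁, v₂`, the encryption randomness `r` and the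
coefficients `a` of the sharing polynomial, whose constant term is the secret key. -/
def mkRecord (P : Params) (k : ℕ) (ρ : HashFunctions P k) (p : P.Password)
    (v₁ v₂ : BitString k) (r : ZMod P.q) (a : Fin P.t → ZMod P.q) : Record P k where
  hashed := ρ.2.2 p
  pubKey := P.pow P.g (a ⟨0, P.t_pos⟩)
  v₁ := v₁
  v₂ := v₂
  c₁ := P.pow P.g r
  c₂ := P.encode p * P.pow (P.pow P.g (a ⟨0, P.t_pos⟩)) r
  y i := (∑ j : Fin P.t, a j * ρ.1 i v₁ (p i) ^ (j : ℕ)) - ρ.2.1 i v₂ (p i)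

/-- The message `v₁, (q, g, g ^ α), (a', b'), (c'_1, …, c'_n)` sent in a recovery. -/
def recoveryMessage (P : Params) {k : ℕ} (v₁ : BitString k) (pubKey a b : P.Grp)
    (c : Fin P.n → P.Grp) : Val :=
  .ofList [.nat v₁, .ofList [.nat P.q, P.elt P.g, P.elt pubKey], .ofList [P.elt a, P.elt b],
    .ofList (List.ofFn fun i => P.elt (c i))]

/-- The recovery message for the guess `x`, with re-randomization `r`. -/
def recoverWith (P : Params) (k : ℕ) (ρ : HashFunctions P k) (d : Record P k)
    (x : P.Password) (r : ZMod P.q) : Val :=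
  recoveryMessage P d.v₁ d.pubKey (d.c₁ * P.pow P.g r) (d.c₂ * P.pow d.pubKey r)
    fun i => P.pow (d.c₁ * P.pow P.g r) (d.y i + ρ.2.1 i d.v₂ (x i))

/-- The server of the protocol. The record is the result of an honest registration. -/
noncomputable def realServer (P : Params) (k : ℕ) (ρ : HashFunctions P k) : Server P where
  State := Record P k
  register p :=
    (PMF.uniformOfFintype
      (BitString k × BitString k × ZMod P.q × (Fin P.t → ZMod P.q))).map
        fun z => mkRecord P k ρ p z.1 z.2.1 z.2.2.1 z.2.2.2
  recover d x :=
    (PMF.uniformOfFintype (ZMod P.q)).map fun r => (recoverWith P k ρ d x r, d)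
  login d x := PMF.pure (.nat (if ρ.2.2 x = d.hashed then 1 else 0), d)

/-! ### The ideal situation and simulators -/

/-- The ideal oracle: it returns the password `p` if the guess matches it, and otherwise nothing. -/
def idealOracle (P : Params) (p x : P.Password) : Option P.Password :=
  if P.Matches x p then some p else none

def idealAnswerVal (P : Params) : Option P.Password → Val
  | some p => .pair (.nat 1) (P.passwordVal p)
  | none => .nat 0

/-- The server played by a simulator, a machine `I` that makes at most `T` activations per request.
The state consists of the registered password, which only the ideal oracle uses, and the memory of
`I`. On a request with the guess `x` the ideal oracle is asked once, about `x` itself, and `I`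
receives the kind of the request (`0` for recovery, `1` for log in), `x`, and the answer of the
ideal oracle. It may then toss coins, draw exponents and call the same random oracles as everybody
else, and its output is the reply to the request. -/
noncomputable def simulatedServer (P : Params) (k : ℕ) (ρ : HashFunctions P k) (I : Prog)
    (T : ℕ) : Server P where
  State := P.Password × Val
  register p := PMF.pure (p, .nat 0)
  recover s x :=
    (I.run (P.pub k) P.q (fun (_ : Unit) v => PMF.pure (hashAnswer P k ρ v, ())) T s.2
      (.ofList [.nat 0, P.passwordVal x, idealAnswerVal P (idealOracle P s.1 x)]) ()).map
        fun z => (z.1, (s.1, z.2.1))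
  login s x :=
    (I.run (P.pub k) P.q (fun (_ : Unit) v => PMF.pure (hashAnswer P k ρ v, ())) T s.2
      (.ofList [.nat 1, P.passwordVal x, idealAnswerVal P (idealOracle P s.1 x)]) ()).map
        fun z => (z.1, (s.1, z.2.1))

/-! ### The distinguishing experiment -/

/-- What an adversary can call. Tag `3` fixes the password of the account, once, and has it
registered; afterwards tag `4` is a recovery request and tag `5` a log in request. Other messages
go to the random oracles. Whatever does not fit is answered by `nat 0`. -/
noncomputable def attackOracle (P : Params) (k : ℕ) (ρ : HashFunctions P k) (S : Server P) :
    Option S.State → Val → PMF (Val × Option S.State)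
  | none, .pair (.nat 3) v => match P.readPassword v with
    | some p => (S.register p).map fun s => (.nat 0, some s)
    | none => PMF.pure (.nat 0, none)
  | some s, .pair (.nat 4) v => match P.readPassword v with
    | some x => (S.recover s x).map fun r => (r.1, some r.2)
    | none => PMF.pure (.nat 0, some s)
  | some s, .pair (.nat 5) v => match P.readPassword v with
    | some x => (S.login s x).map fun r => (r.1, some r.2)
    | none => PMF.pure (.nat 0, some s)
  | e, v => PMF.pure (hashAnswer P k ρ v, e)

/-- The probability that the adversary `A` outputs `1` within `T` activations when it attacks the
server `S`, over the random choice of the hash functions and all random choices made later. -/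
noncomputable def attackProb (P : Params) (k : ℕ) (S : HashFunctions P k → Server P)
    (inp : Val) (A : Prog) (T : ℕ) : ℝ :=
  probOne ((PMF.uniformOfFintype (HashFunctions P k)).bind fun ρ =>
    (A.run inp P.q (attackOracle P k ρ (S ρ)) T (.nat 0) (.nat 0) none).map
      fun z => (z.1, z.2.1, ()))

/-! The simulator draws the keys `v₁`, `v₂` and the sharing polynomial itself and queries the real
random oracles. If a guess matches, the ideal oracle hands it the password and it answers exactly as
the server would. If a guess does not match, it sends a ciphertext and shares built from independent
uniform exponents. A log in is accepted when the guess equals the revealed password. Two differences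
to the real server remain: passwords instead of their hash values are compared at log in, and
replies to guesses without a match are random instead of honest.

The first difference shows only after a collision of `H`, which costs at most `T * T / 2 ^ k` for
`T` activations (`keyedGame_login`). For the second one, observe that `v₂` is never sent and `v₁` is
unknown before the registration. Unless a key is guessed, which has probability at most `T / 2 ^ k`,
the rows of the two letter hashes at these keys are tables independent of all that was queried under
other keys (`keyedGame_rows`). The unmasked exponent at a position is then the share of the secret
if the letter of the guess is right, and an independent uniform exponent attached to the position
and the letter otherwise (`lateRowGame_eq_ideal`). A guess without a match thus involves fewer than
`t` shares. Together with the secret these can take arbitrary values, by Lagrange interpolation at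
`0` and at the hash values of the letters, as soon as the latter are distinct and nonzero
(`exists_coeffs`).

All replies use the same secret exponents, so the Diffie-Hellman assumption is needed to replace
them one after the other by random ones. Given `g ^ x`, `g ^ y`, `g ^ z`, write the polynomial and
the exponents of wrong letters as `y * v + w` with known `v` and `w`. Honest replies can be computed
from `g ^ y`. The reply number `J`, if it is not for a match, gets the randomness `x`, with `z` in
the place of `x * y`. Its exponents are the honest ones plus `δ = z - x * y` times the `v`-part. For
`δ = 0` the reply is honest. For `δ ≠ 0` the `v`-part is a fresh mask, since `w` hides `v`
everywhere else, and interpolation shows that the reply is uniform (`maskedReply_uniform`). A random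
choice of `J` converts the difference between the first and the last hybrid into an advantage
against Diffie-Hellman, with a loss of a factor `2 * T` and errors of order `T * n ^ 2 / q`. Here `1
/ q` is negligible because otherwise the assumption would fail for a trivial reason (`DDH.one_div`).

Games are compared by two principles for a machine with an oracle: a kernel between oracle states
that commutes with all transitions preserves winning probabilities (`Prog.win_intertwine`), and
oracles that agree up to a bad event are controlled by a potential that pays for it
(`Prog.win_hop`). The programs of the simulator and of the reduction are instances of one scheme, a
machine that collects randomness and oracle answers in batches (`BatchScript`). The functions it
computes between batches are polynomial time by closure properties (`PolyTime`). Since the reduction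
has no random oracle, it samples the random functions into tables when they are used (`lazyGame`).
-/

open scoped ENNReal

/-! ### Expectations -/

/-- The expectation of a nonnegative function. -/
noncomputable def PMF.ev {α : Type} (d : PMF α) (f : α → ℝ≥0∞) : ℝ≥0∞ := ∑' a, d a * f a

namespace PMF

variable {α β γ : Type}

@[simp] theorem ev_pure (a : α) (f : α → ℝ≥0∞) : (PMF.pure a).ev f = f a := by
  classical
  unfold ev
  rw [tsum_eq_single a]
  · simp [PMF.pure_apply]
  · intro b hb
    simp [PMF.pure_apply, hb]

@[simp] theorem ev_bind (d : PMF α) (k : α → PMF β) (f : β → ℝ≥0∞) :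
    (d.bind k).ev f = d.ev fun a => (k a).ev f := by
  unfold ev
  simp only [PMF.bind_apply, ← ENNReal.tsum_mul_right, ← ENNReal.tsum_mul_left, mul_assoc]
  exact ENNReal.tsum_comm

@[simp] theorem ev_map (d : PMF α) (g : α → β) (f : β → ℝ≥0∞) :
    (d.map g).ev f = d.ev fun a => f (g a) := by
  rw [PMF.map, ev_bind]
  simp

theorem ev_mono {d : PMF α} {f g : α → ℝ≥0∞} (h : ∀ a, f a ≤ g a) : d.ev f ≤ d.ev g :=
  ENNReal.tsum_le_tsum fun a => mul_le_mul_right (h a) _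

theorem ev_add (d : PMF α) (f g : α → ℝ≥0∞) : d.ev (fun a => f a + g a) = d.ev f + d.ev g := by
  unfold ev
  simp only [mul_add]
  exact ENNReal.tsum_add

@[simp] theorem ev_const (d : PMF α) (c : ℝ≥0∞) : d.ev (fun _ => c) = c := by
  unfold ev
  rw [ENNReal.tsum_mul_right, d.tsum_coe, one_mul]

theorem ev_comm (d : PMF α) (e : PMF β) (f : α → β → ℝ≥0∞) :
    (d.ev fun a => e.ev fun b => f a b) = e.ev fun b => d.ev fun a => f a b := by
  unfold ev
  simp only [← ENNReal.tsum_mul_left]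
  rw [ENNReal.tsum_comm]
  exact tsum_congr fun b => tsum_congr fun a => by ring

theorem ev_le_const {d : PMF α} {f : α → ℝ≥0∞} {c : ℝ≥0∞} (h : ∀ a, f a ≤ c) : d.ev f ≤ c :=
  (ev_mono h).trans_eq (ev_const d c)

theorem ev_congr {d : PMF α} {f g : α → ℝ≥0∞} (h : ∀ a, f a = g a) : d.ev f = d.ev g := by
  rw [funext h]

theorem ev_uniform [Fintype α] [Nonempty α] (f : α → ℝ≥0∞) :
    (PMF.uniformOfFintype α).ev f = (∑ a, f a) / Fintype.card α := by
  unfold ev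
  rw [tsum_fintype, ENNReal.div_eq_inv_mul, Finset.mul_sum]
  simp

theorem ev_eq_apply (d : PMF α) (a : α) [DecidablePred fun x => x = a] :
    d.ev (fun x => if x = a then 1 else 0) = d a := by
  unfold ev
  rw [tsum_eq_single a]
  · simp
  · intro b hb
    simp [hb]

/-- Distributions are compared by testing against functions throughout: binds and maps become nested
expectations, and independent samples are reordered by `ev_comm`. -/
theorem ext_ev {d e : PMF α} (h : ∀ f, d.ev f = e.ev f) : d = e := by
  classical
  ext a
  rw [← ev_eq_apply d a, h, ev_eq_apply]

/-! ### Uniform distributions -/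

theorem map_uniform_of_bijective [Fintype α] [Nonempty α] [Fintype β] [Nonempty β] {f : α → β}
    (hf : Function.Bijective f) :
    (PMF.uniformOfFintype α).map f = PMF.uniformOfFintype β := by
  apply ext_ev
  intro F
  rw [ev_map, ev_uniform, ev_uniform, Fintype.card_of_bijective hf]
  congr 1
  exact Fintype.sum_bijective f hf _ _ fun _ => rfl

theorem uniform_prod [Fintype α] [Nonempty α] [Fintype β] [Nonempty β] (F : α × β → ℝ≥0∞) :
    (PMF.uniformOfFintype (α × β)).ev F =
      (PMF.uniformOfFintype α).ev fun a => (PMF.uniformOfFintype β).ev fun b => F (a, b) := by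
  simp only [ev_uniform, Fintype.sum_prod_type, Fintype.card_prod, ENNReal.div_eq_inv_mul,
    Nat.cast_mul, Finset.mul_sum]
  refine Finset.sum_congr rfl fun a _ => Finset.sum_congr rfl fun b _ => ?_
  rw [← mul_assoc, ENNReal.mul_inv (by simp) (by simp)]

/-- A surjective homomorphism, composed with a translation, preserves uniform distributions. -/
theorem map_uniform_of_surjective [AddGroup α] [Fintype α] [AddGroup β] [Fintype β]
    (π : α →+ β) (c : β) (hπ : Function.Surjective π) :
    (PMF.uniformOfFintype α).map (fun a => π a + c) = PMF.uniformOfFintype β := by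
  classical
  -- All fibres are translates of the kernel, so they have the same cardinality.
  have hfib : ∀ b, (Finset.univ.filter fun a => π a = b).card
      = (Finset.univ.filter fun a => π a = 0).card := by
    intro b
    obtain ⟨a₀, rfl⟩ := hπ b
    refine Finset.card_bij' (fun a _ => a - a₀) (fun a _ => a + a₀) ?_ ?_ ?_ ?_ <;>
      simp +contextual
  have hcard : Fintype.card α
      = Fintype.card β * (Finset.univ.filter fun a => π a = 0).card := by
    rw [← Finset.card_univ, Finset.card_eq_sum_card_fiberwise (f := π) (t := Finset.univ)
      (by simp)]
    simp [hfib]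
  have hpos : (Finset.univ.filter fun a => π a = 0).card ≠ 0 :=
    Finset.card_ne_zero.2 ⟨0, by simp⟩
  have h0 : (PMF.uniformOfFintype α).map π = PMF.uniformOfFintype β := by
    apply ext_ev
    intro F
    rw [ev_map, ev_uniform, ev_uniform, ← Finset.sum_fiberwise (s := Finset.univ) (g := π), hcard]
    have : ∀ b, (∑ a ∈ Finset.univ.filter (fun a => π a = b), F (π a))
        = (Finset.univ.filter fun a => π a = 0).card * F b := by
      intro b
      rw [Finset.sum_congr rfl (g := fun _ => F b) (by simp +contextual), Finset.sum_const,
        hfib, nsmul_eq_mul]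
    simp only [this]
    rw [← Finset.mul_sum, mul_comm, Nat.cast_mul]
    exact ENNReal.mul_div_mul_right _ _ (by exact_mod_cast hpos) (by simp)
  have h1 := map_uniform_of_bijective (f := fun b : β => b + c) (Equiv.addRight c).bijective
  rw [← h1, ← h0, PMF.map_comp]
  rfl

theorem map_uniform_fst [Fintype α] [Nonempty α] [Fintype β] [Nonempty β] :
    (PMF.uniformOfFintype (α × β)).map Prod.fst = PMF.uniformOfFintype α :=
  ext_ev fun f => by simp [uniform_prod]

theorem map_uniform_snd [Fintype α] [Nonempty α] [Fintype β] [Nonempty β] :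
    (PMF.uniformOfFintype (α × β)).map Prod.snd = PMF.uniformOfFintype β :=
  ext_ev fun f => by simp [uniform_prod]

theorem ev_uniform_fst [Fintype α] [Nonempty α] [Fintype β] [Nonempty β] (F : α → ℝ≥0∞) :
    (PMF.uniformOfFintype (α × β)).ev (fun u => F u.1) = (PMF.uniformOfFintype α).ev F := by
  rw [← map_uniform_fst (α := α) (β := β), ev_map]

theorem ev_uniform_snd [Fintype α] [Nonempty α] [Fintype β] [Nonempty β] (F : β → ℝ≥0∞) :
    (PMF.uniformOfFintype (α × β)).ev (fun u => F u.2) = (PMF.uniformOfFintype β).ev F := by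
  rw [← map_uniform_snd (α := α) (β := β), ev_map]

/-- Two images of uniform distributions agree if the two maps differ by a map that preserves
uniform distributions. -/
theorem map_uniform_congr [Fintype α] [Nonempty α] [Fintype β] [Nonempty β] {f : β → γ}
    {g : α → γ} (π : α → β)
    (hπ : (PMF.uniformOfFintype α).map π = PMF.uniformOfFintype β) (h : ∀ a, g a = f (π a)) :
    (PMF.uniformOfFintype α).map g = (PMF.uniformOfFintype β).map f := by
  rw [← hπ, PMF.map_comp]
  exact congrArg (fun g => PMF.map g _) (funext h)

theorem ev_uniform_congr [Fintype α] [Nonempty α] [Fintype β] [Nonempty β] {f : β → ℝ≥0∞}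
    {g : α → ℝ≥0∞} (π : α → β)
    (hπ : (PMF.uniformOfFintype α).map π = PMF.uniformOfFintype β) (h : ∀ a, g a = f (π a)) :
    (PMF.uniformOfFintype α).ev g = (PMF.uniformOfFintype β).ev f := by
  rw [← hπ, ev_map]
  exact ev_congr h

/-- Exchanging two functions on `S` is an involution of pairs, hence preserves the uniform
distribution; the claim is its first component. This is the basic device for resampling a part of a
random function. -/
theorem map_uniform_piecewise [Fintype α] [DecidableEq α] [Fintype β] [Nonempty β] (S : Finset α) :
    (PMF.uniformOfFintype ((α → β) × (α → β))).map (fun u => S.piecewise u.1 u.2) =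
      PMF.uniformOfFintype (α → β) := by
  have h : Function.Involutive fun u : (α → β) × (α → β) =>
      (S.piecewise u.1 u.2, S.piecewise u.2 u.1) := by
    intro u
    ext x <;> by_cases hx : x ∈ S <;> simp [hx]
  have h' := congrArg (PMF.map Prod.fst) (map_uniform_of_bijective h.bijective)
  rw [PMF.map_comp, map_uniform_fst] at h'
  exact h'

theorem map_uniform_eval [Fintype α] [DecidableEq α] [Fintype β] [Nonempty β] (x : α) :
    (PMF.uniformOfFintype (α → β)).map (fun F => F x) = PMF.uniformOfFintype β := by
  rw [← map_uniform_fst (α := β) (β := {j // j ≠ x} → β),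
    ← map_uniform_of_bijective (Equiv.funSplitAt x β).bijective, PMF.map_comp]
  rfl

theorem ev_uniform_eq [Fintype α] [Nonempty α] [DecidableEq α] (c : α) :
    (PMF.uniformOfFintype α).ev (fun b => if b = c then 1 else 0) = 1 / Fintype.card α := by
  rw [ev_eq_apply]
  simp

/-- A value of a random function is hit with probability `1 / card β` by anything that does not
depend on it. -/
theorem ev_uniform_hit [Fintype α] [DecidableEq α] [Fintype β] [Nonempty β] [DecidableEq β] (x : α)
    (c : (α → β) → β) (hc : ∀ F G : α → β, (∀ y ≠ x, F y = G y) → c F = c G) :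
    (PMF.uniformOfFintype (α → β)).ev (fun F => if F x = c F then 1 else 0)
      = 1 / Fintype.card β := by
  -- The function is composed of a fresh value at `x` and an independent function `G` elsewhere. For
  -- fixed `G` the target is a constant.
  rw [← map_uniform_piecewise {x}, ev_map, uniform_prod, ev_comm]
  have : ∀ G : α → β, ((PMF.uniformOfFintype (α → β)).ev fun F =>
      if ({x} : Finset α).piecewise F G x = c (({x} : Finset α).piecewise F G)
        then (1 : ℝ≥0∞) else 0) = 1 / Fintype.card β := by
    intro G
    rw [← ev_uniform_eq (c G), ← map_uniform_eval (β := β) x, ev_map]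
    refine ev_congr fun F => ?_
    rw [hc (({x} : Finset α).piecewise F G) G fun y hy => by simp [hy]]
    simp
  simp only [this, ev_const]

/-- The probability of an event under a uniform distribution, bounded by counting. -/
theorem ev_uniform_le [Fintype α] [Nonempty α] (p : α → Prop) [DecidablePred p] {c : ℕ}
    (h : (Finset.univ.filter p).card ≤ c) :
    (PMF.uniformOfFintype α).ev (fun a => if p a then 1 else 0) ≤ c / Fintype.card α := by
  rw [ev_uniform]
  gcongr
  simpa using h

end PMF

/-! ### Winning probabilities -/

/-- The indicator function of the output `1`. -/
noncomputable def Val.accepts : Val → ℝ≥0∞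
  | .nat 1 => 1
  | _ => 0

theorem Val.accepts_le_one (v : Val) : v.accepts ≤ 1 := by
  unfold Val.accepts
  split <;> simp

namespace Prog

variable {σ τ : Type} (M : Prog) (inp : Val) (q : ℕ) [NeZero q]

/-- The probability that the machine outputs `1`. -/
noncomputable def win (O : σ → Val → PMF (Val × σ)) (T : ℕ) (s a : Val) (e : σ) : ℝ≥0∞ :=
  (M.run inp q O T s a e).ev fun z => z.1.accepts

theorem probOne_eq (d : PMF (Val × Val × σ)) :
    probOne d = (d.ev fun z => z.1.accepts).toReal := by
  classical
  unfold probOne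
  rw [← PMF.ev_eq_apply (d.map Prod.fst), PMF.ev_map]
  congr 2
  funext z
  rcases z with ⟨_ | _, _⟩ <;> simp [Val.accepts]
  split <;> simp_all

theorem win_le_one (O : σ → Val → PMF (Val × σ)) (T : ℕ) (s a : Val) (e : σ) :
    M.win inp q O T s a e ≤ 1 :=
  PMF.ev_le_const fun z => z.1.accepts_le_one

@[simp] theorem win_zero (O : σ → Val → PMF (Val × σ)) (s a : Val) (e : σ) :
    M.win inp q O 0 s a e = 0 := by
  simp [win, run, Val.accepts]

/-- The winning probability when the action `act` is due, with `T` activations left. -/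
noncomputable def winAct (O : σ → Val → PMF (Val × σ)) (T : ℕ) (s : Val) (e : σ) :
    MachineAction → ℝ≥0∞
  | .halt v => v.accepts
  | .coin => (PMF.uniformOfFintype Bool).ev fun b => M.win inp q O T s (.nat b.toNat) e
  | .draw => (PMF.uniformOfFintype (ZMod q)).ev fun z => M.win inp q O T s (.nat z.val) e
  | .call v => (O e v).ev fun r => M.win inp q O T s r.1 r.2

theorem win_succ (O : σ → Val → PMF (Val × σ)) (T : ℕ) (s a : Val) (e : σ) :
    M.win inp q O (T + 1) s a e =
      M.winAct inp q O T (M.activate inp s a).1 e (M.activate inp s a).2 := by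
  unfold win
  rw [run]
  rcases h : M.activate inp s a with ⟨s₁, _ | _ | _ | _⟩ <;> simp [winAct, win]

/-- If the states of two oracles are related by a kernel that commutes with their transitions, then
the kernel also relates the winning probabilities. -/
theorem win_intertwine {O : σ → Val → PMF (Val × σ)} {O' : τ → Val → PMF (Val × τ)}
    (Φ : σ → PMF τ)
    (h : ∀ e v, (Φ e).bind (fun e' => O' e' v) =
      (O e v).bind fun r => (Φ r.2).map fun e' => (r.1, e')) :
    ∀ T s a e, ((Φ e).ev fun e' => M.win inp q O' T s a e') = M.win inp q O T s a e := by
  intro T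
  induction T with
  | zero => simp
  | succ T ih =>
    intro s a e
    simp only [win_succ]
    rcases M.activate inp s a with ⟨s₁, _ | _ | _ | v⟩
    · simp [winAct]
    · simp only [winAct]
      rw [PMF.ev_comm]
      simp only [ih]
    · simp only [winAct]
      rw [PMF.ev_comm]
      simp only [ih]
    -- The commutation of the kernel with the transitions is tested against the winning probability
    -- after the call, to which the induction hypothesis applies.
    · have := congrArg (fun d => PMF.ev d fun r => M.win inp q O' T s₁ r.1 r.2) (h e v)
      simp only [PMF.ev_bind, PMF.ev_map, ih] at this
      exact this

theorem win_intertwine_map {O : σ → Val → PMF (Val × σ)} {O' : τ → Val → PMF (Val × τ)}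
    (φ : σ → τ) (h : ∀ e v, O' (φ e) v = (O e v).map fun r => (r.1, φ r.2)) (T : ℕ) (s a : Val)
    (e : σ) : M.win inp q O' T s a (φ e) = M.win inp q O T s a e := by
  rw [← win_intertwine M inp q (O := O) (O' := O') (fun e => PMF.pure (φ e))]
  · simp
  · intro e v
    simp [h, PMF.pure_bind, PMF.map, Function.comp_def]

/-- Two oracles that differ only when a bad event happens give winning probabilities whose
difference is bounded by a potential that pays for the bad events. The states of the second oracle
are produced from those of a third one by a kernel. -/
theorem win_hop {O : σ → Val → PMF (Val × σ)} {O₁ O₂ : τ → Val → PMF (Val × τ)} (Φ : σ → PMF τ)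
    (bad : τ → Val → Prop) [∀ e v, Decidable (bad e v)] (L : ℕ → σ → ℝ≥0∞)
    (h : ∀ e v, (Φ e).bind (fun e' => O₂ e' v) =
      (O e v).bind fun r => (Φ r.2).map fun e' => (r.1, e'))
    (heq : ∀ e v, ¬ bad e v → O₁ e v = O₂ e v)
    (hL : ∀ T e v, L (T + 1) e < 1 → ((Φ e).ev fun e' => if bad e' v then 1 else 0)
      + ((O e v).ev fun r => L T r.2) ≤ L (T + 1) e)
    (hmono : ∀ T e, L T e ≤ L (T + 1) e) :
    ∀ T s a e, (((Φ e).ev fun e' => M.win inp q O₁ T s a e')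
        ≤ ((Φ e).ev fun e' => M.win inp q O₂ T s a e') + L T e) ∧
      (((Φ e).ev fun e' => M.win inp q O₂ T s a e')
        ≤ ((Φ e).ev fun e' => M.win inp q O₁ T s a e') + L T e) := by
  intro T
  induction T with
  | zero => simp
  | succ T ih =>
    intro s a e
    -- A potential of at least `1` makes both bounds trivial. This is why `hL` is only required
    -- below `1`, so that a potential may jump to `1` at states where the bad event has become
    -- visible.
    by_cases hL1 : 1 ≤ L (T + 1) e
    · exact ⟨(PMF.ev_le_const fun e' => M.win_le_one inp q O₁ _ s a e').trans
        (hL1.trans le_add_self), (PMF.ev_le_const fun e' => M.win_le_one inp q O₂ _ s a e').trans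
        (hL1.trans le_add_self)⟩
    simp only [win_succ]
    rcases M.activate inp s a with ⟨s₁, _ | _ | _ | v⟩
    · simp [winAct]
    · simp only [winAct]
      rw [PMF.ev_comm, PMF.ev_comm (Φ e)]
      refine ⟨(PMF.ev_mono fun b => (ih _ _ e).1).trans ?_,
        (PMF.ev_mono fun b => (ih _ _ e).2).trans ?_⟩ <;>
      · rw [PMF.ev_add, PMF.ev_const]
        gcongr
        exact hmono T e
    · simp only [winAct]
      rw [PMF.ev_comm, PMF.ev_comm (Φ e)]
      refine ⟨(PMF.ev_mono fun b => (ih _ _ e).1).trans ?_,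
        (PMF.ev_mono fun b => (ih _ _ e).2).trans ?_⟩ <;>
      · rw [PMF.ev_add, PMF.ev_const]
        gcongr
        exact hmono T e
    · have key : ∀ F : Val → τ → ℝ≥0∞, ((Φ e).ev fun e' => (O₂ e' v).ev fun r => F r.1 r.2)
          = (O e v).ev fun r => (Φ r.2).ev fun e' => F r.1 e' := by
        intro F
        have := congrArg (fun d => PMF.ev d fun r => F r.1 r.2) (h e v)
        simpa only [PMF.ev_bind, PMF.ev_map] using this
      have hstep : ∀ F : Val × τ → ℝ≥0∞, (∀ r, F r ≤ 1) → ∀ e',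
          ((O₁ e' v).ev F ≤ (O₂ e' v).ev F + if bad e' v then 1 else 0) ∧
          ((O₂ e' v).ev F ≤ (O₁ e' v).ev F + if bad e' v then 1 else 0) := by
        intro F hF e'
        by_cases hb : bad e' v
        · simp only [hb, if_true]
          exact ⟨(PMF.ev_le_const hF).trans le_add_self, (PMF.ev_le_const hF).trans le_add_self⟩
        · simp [hb, heq e' v hb]
      simp only [winAct]
      constructor
      -- The present transition is changed first, at the price of the bad event. Then the kernel is
      -- moved behind the transition, and the induction hypothesis changes the later ones.
      · calc _ ≤ (Φ e).ev fun e' => (O₂ e' v).ev (fun r => M.win inp q O₁ T s₁ r.1 r.2)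
              + if bad e' v then 1 else 0 :=
            PMF.ev_mono fun e' => (hstep _ (fun r => win_le_one ..) e').1
          _ = ((O e v).ev fun r => (Φ r.2).ev fun e' => M.win inp q O₁ T s₁ r.1 e')
              + (Φ e).ev fun e' => if bad e' v then 1 else 0 := by rw [PMF.ev_add, key]
          _ ≤ ((O e v).ev fun r => ((Φ r.2).ev fun e' => M.win inp q O₂ T s₁ r.1 e') + L T r.2)
              + (Φ e).ev fun e' => if bad e' v then 1 else 0 := by
            gcongr
            exact PMF.ev_mono fun r => (ih s₁ r.1 r.2).1
          _ ≤ _ := by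
            rw [PMF.ev_add, key, add_assoc]
            gcongr
            rw [add_comm]
            exact hL T e v (not_le.1 hL1)
      · calc ((Φ e).ev fun e' => (O₂ e' v).ev fun r => M.win inp q O₂ T s₁ r.1 r.2)
            = ((O e v).ev fun r => (Φ r.2).ev fun e' => M.win inp q O₂ T s₁ r.1 e') :=
            key fun v e' => M.win inp q O₂ T s₁ v e'
          _ ≤ ((O e v).ev fun r => ((Φ r.2).ev fun e' => M.win inp q O₁ T s₁ r.1 e') + L T r.2) :=
            PMF.ev_mono fun r => (ih s₁ r.1 r.2).2
          _ = ((Φ e).ev fun e' => (O₂ e' v).ev fun r => M.win inp q O₁ T s₁ r.1 r.2)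
              + (O e v).ev fun r => L T r.2 := by
            rw [PMF.ev_add, key]
          _ ≤ ((Φ e).ev fun e' => (O₁ e' v).ev (fun r => M.win inp q O₁ T s₁ r.1 r.2)
              + if bad e' v then 1 else 0) + (O e v).ev fun r => L T r.2 := by
            gcongr
            exact PMF.ev_mono fun e' => (hstep _ (fun r => win_le_one ..) e').2
          _ ≤ _ := by
            rw [PMF.ev_add, add_assoc]
            gcongr
            exact hL T e v (not_le.1 hL1)

/-- A parameter that an oracle uses at most once may be sampled when it is used. -/
theorem win_of_single_use {ι : Type} (D : PMF ι) {O : σ → Val → PMF (Val × σ)}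
    {O' : ι → σ → Val → PMF (Val × σ)} (used : σ → Prop)
    (hused : ∀ e v, used e → ∀ i, O' i e v = O e v)
    (hstay : ∀ e v, used e → ∀ r ∈ (O e v).support, used r.2)
    (hstep : ∀ e v, ¬ used e → (∀ i, O' i e v = O e v) ∨
      (O e v = D.bind fun i => O' i e v) ∧ ∀ i, ∀ r ∈ (O' i e v).support, used r.2) :
    ∀ T s a e, (used e → ∀ i, M.win inp q (O' i) T s a e = M.win inp q O T s a e) ∧
      (D.ev fun i => M.win inp q (O' i) T s a e) = M.win inp q O T s a e := by
  have hcongr : ∀ (d : PMF (Val × σ)) (f g : Val × σ → ℝ≥0∞), (∀ r ∈ d.support, f r = g r) →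
      d.ev f = d.ev g := by
    intro d f g hfg
    unfold PMF.ev
    refine tsum_congr fun r => ?_
    by_cases hr : r ∈ d.support
    · rw [hfg r hr]
    · rw [(PMF.apply_eq_zero_iff d r).2 hr, zero_mul, zero_mul]
  intro T
  induction T with
  | zero => simp
  | succ T ih =>
    intro s a e
    simp only [win_succ]
    rcases M.activate inp s a with ⟨s₁, _ | _ | _ | v⟩
    · simp [winAct]
    · simp only [winAct]
      refine ⟨fun hu i => PMF.ev_congr fun b => (ih _ _ e).1 hu i, ?_⟩
      rw [PMF.ev_comm]
      exact PMF.ev_congr fun b => (ih _ _ e).2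
    · simp only [winAct]
      refine ⟨fun hu i => PMF.ev_congr fun b => (ih _ _ e).1 hu i, ?_⟩
      rw [PMF.ev_comm]
      exact PMF.ev_congr fun b => (ih _ _ e).2
    · simp only [winAct]
      have h1 : used e → ∀ i, ((O' i e v).ev fun r => M.win inp q (O' i) T s₁ r.1 r.2)
          = (O e v).ev fun r => M.win inp q O T s₁ r.1 r.2 := by
        intro hu i
        rw [hused e v hu i]
        exact hcongr _ _ _ fun r hr => (ih s₁ r.1 r.2).1 (hstay e v hu r hr) i
      refine ⟨h1, ?_⟩
      by_cases hu : used e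
      · simp [h1 hu]
      -- Either this step ignores the parameter, and the sampling is postponed, or it consumes the
      -- parameter. In the latter case the remaining runs no longer depend on it.
      · rcases hstep e v hu with h | ⟨h, h'⟩
        · simp only [h]
          rw [PMF.ev_comm]
          exact PMF.ev_congr fun r => (ih _ _ _).2
        · rw [h, PMF.ev_bind]
          refine PMF.ev_congr fun i => ?_
          exact hcongr _ _ _ fun r hr => (ih s₁ r.1 r.2).1 (h' i r hr) i

end Prog

/-! ### The group -/

namespace Params

variable (P : Params)

instance : Fact P.q.Prime := ⟨P.prime_q⟩

instance : Fact (2 * P.q + 1).Prime := ⟨P.prime_modulus⟩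

/-- The generator is a square `u * u`, and `u ^ (2 * q) = 1` by Fermat's theorem. -/
theorem g_pow_q : P.g ^ P.q = 1 := by
  obtain ⟨u, hu⟩ := (P.g_generates P.g).1 (Subgroup.mem_zpowers _)
  have h := ZMod.units_pow_card_sub_one_eq_one (2 * P.q + 1) u
  rw [hu, ← pow_two, ← pow_mul]
  simpa using h

/-- If `g = 1`, every unit has square `1`, so only `1` and `-1` are units; but there are `2 * q ≥ 4`
units. -/
theorem g_ne_one : P.g ≠ 1 := by
  intro hg
  have hsq : ∀ u : P.Grp, u * u = 1 := by
    intro u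
    have := (P.g_generates (u * u)).2 ⟨u, rfl⟩
    rwa [hg, Subgroup.zpowers_one_eq_bot, Subgroup.mem_bot] at this
  have hu : ∀ u : P.Grp, u = 1 ∨ u = -1 := by
    intro u
    have h := congrArg Units.val (hsq u)
    rcases mul_self_eq_one_iff.1 (by simpa using h) with h | h
    · exact .inl (Units.ext h)
    · exact .inr (Units.ext (by simpa using h))
  have hcard : Fintype.card P.Grp ≤ 2 := by
    rw [← Finset.card_univ]
    exact (Finset.card_le_card (t := {1, -1}) fun u _ => by simpa using hu u).trans
      Finset.card_le_two
  rw [ZMod.card_units] at hcard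
  have := P.prime_q.two_le
  omega

theorem orderOf_g : orderOf P.g = P.q :=
  orderOf_eq_prime P.g_pow_q P.g_ne_one

theorem g_pow_mod (z : ℕ) : P.g ^ (z % P.q) = P.g ^ z := by
  have h := pow_mod_orderOf P.g z
  rwa [orderOf_g] at h

theorem pow_natCast (z : ℕ) : P.pow P.g (z : ZMod P.q) = P.g ^ z := by
  unfold pow
  rw [ZMod.val_natCast, g_pow_mod]

theorem pow_add (a b : ZMod P.q) : P.pow P.g (a + b) = P.pow P.g a * P.pow P.g b := by
  obtain ⟨a, rfl⟩ := ZMod.natCast_zmod_surjective a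
  obtain ⟨b, rfl⟩ := ZMod.natCast_zmod_surjective b
  rw [← Nat.cast_add, pow_natCast, pow_natCast, pow_natCast, _root_.pow_add]

theorem pow_zero : P.pow P.g 0 = 1 := by
  simpa using P.pow_natCast 0

theorem pow_pow (a b : ZMod P.q) : P.pow (P.pow P.g a) b = P.pow P.g (a * b) := by
  obtain ⟨a, rfl⟩ := ZMod.natCast_zmod_surjective a
  obtain ⟨b, rfl⟩ := ZMod.natCast_zmod_surjective b
  rw [← Nat.cast_mul, pow_natCast, pow_natCast, pow, ← pow_mul, ZMod.val_natCast,
    ← P.g_pow_mod (a * b), Nat.mul_mod, ← Nat.mod_mod b, ← Nat.mul_mod, g_pow_mod, Nat.mod_mod]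

theorem pow_injective : Function.Injective (P.pow P.g) := by
  intro a b h
  unfold pow at h
  rw [pow_inj_mod, orderOf_g, Nat.mod_eq_of_lt a.val_lt, Nat.mod_eq_of_lt b.val_lt] at h
  exact ZMod.val_injective _ h

theorem exists_pow {x : P.Grp} (hx : x ∈ Subgroup.zpowers P.g) : ∃ z, P.pow P.g z = x := by
  have hfin : IsOfFinOrder P.g := isOfFinOrder_of_finite P.g
  obtain ⟨n, rfl⟩ := hfin.mem_powers_iff_mem_zpowers.2 hx
  exact ⟨n, P.pow_natCast n⟩

end Params

/-! ### Requests -/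

/-- What a message of the adversary asks for. -/
inductive Req (P : Params) (k : ℕ) : Type
  | register (p : P.Password)
  | ask (login : Bool) (x : P.Password)
  | letterHash (i : Fin P.n) (κ : BitString k) (l : Fin P.m)
  | maskHash (i : Fin P.n) (κ : BitString k) (l : Fin P.m)
  | passwordHash (p : P.Password)
  | other

namespace Req

variable {P : Params} {k : ℕ}

def keyed (f : Fin P.n → BitString k → Fin P.m → Req P k) (v : Val) : Req P k :=
  if hv : v.entry 0 < P.n ∧ v.entry 1 < 2 ^ k ∧ v.entry 2 < P.m then
    f ⟨v.entry 0, hv.1⟩ ⟨v.entry 1, hv.2.1⟩ ⟨v.entry 2, hv.2.2⟩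
  else other

def withPassword (f : P.Password → Req P k) (v : Val) : Req P k :=
  (P.readPassword v).elim other f

/-- Every malformed message becomes `other`. The games below are defined on requests, so the
encoding of messages matters only here and where a program has to decode them. -/
def parse : Val → Req P k
  | .pair (.nat 0) v => keyed letterHash v
  | .pair (.nat 1) v => keyed maskHash v
  | .pair (.nat 2) v => withPassword passwordHash v
  | .pair (.nat 3) v => withPassword register v
  | .pair (.nat 4) v => withPassword (ask false) v
  | .pair (.nat 5) v => withPassword (ask true) v
  | _ => other

/-- The answer of the random oracles. -/
def hashReply (ρ : HashFunctions P k) : Req P k → Val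
  | letterHash i κ l => .nat (ρ.1 i κ l).val
  | maskHash i κ l => .nat (ρ.2.1 i κ l).val
  | passwordHash p => .nat (ρ.2.2 p)
  | _ => .nat 0

theorem hashReply_withPassword (ρ : HashFunctions P k) {f : P.Password → Req P k}
    (hf : ∀ p, hashReply ρ (f p) = .nat 0) (v : Val) :
    hashReply ρ (withPassword f v) = .nat 0 := by
  unfold withPassword
  cases P.readPassword v
  · rfl
  · exact hf _

theorem hashAnswer_eq (ρ : HashFunctions P k) (v : Val) :
    hashAnswer P k ρ v = hashReply ρ (parse v) := by
  unfold hashAnswer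
  split
  · simp only [parse, keyed, keyedAnswer]
    split_ifs <;> rfl
  · simp only [parse, keyed, keyedAnswer]
    split_ifs <;> rfl
  · simp only [parse, withPassword]
    cases P.readPassword _ <;> rfl
  · unfold parse
    split
    · simp_all
    · simp_all
    · simp_all
    · rw [hashReply_withPassword _ fun _ => rfl]
    · rw [hashReply_withPassword _ fun _ => rfl]
    · rw [hashReply_withPassword _ fun _ => rfl]
    · rfl

end Req

/-! ### Games -/

/-- The oracle of a game: `hash` answers the queries to random oracles, `reg` registers a password,
and `serve` reacts to the requests of clients. The state consists of a part that does not change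
and the state of the server after the registration. -/
noncomputable def gameOracle {P : Params} {k : ℕ} {E S : Type} (hash : E → Option S → Req P k → Val)
    (reg : E → P.Password → PMF S) (serve : E → S → Bool → P.Password → PMF (Val × S)) :
    E × Option S → Req P k → PMF (Val × (E × Option S))
  | (e, none), .register p => (reg e p).map fun s => (.nat 0, (e, some s))
  | (e, some s), .ask b x => (serve e s b x).map fun r => (r.1, (e, some r.2))
  | (e, o), r => PMF.pure (hash e o r, (e, o))

/-- A kernel between the states of two games that commutes with the transitions. -/
theorem gameOracle_intertwine {P : Params} {k : ℕ} {E S E' S' W₀ W₁ : Type}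
    {hash : E → Option S → Req P k → Val} {reg : E → P.Password → PMF S}
    {serve : E → S → Bool → P.Password → PMF (Val × S)}
    {hash' : E' → Option S' → Req P k → Val} {reg' : E' → P.Password → PMF S'}
    {serve' : E' → S' → Bool → P.Password → PMF (Val × S')}
    (D₀ : PMF W₀) (f₀ : E → W₀ → E') (D₁ : E → S → PMF W₁) (f₁ : E → S → W₁ → E' × S')
    (hhash₀ : ∀ e w r, hash' (f₀ e w) none r = hash e none r)
    (hhash₁ : ∀ e s w r, hash' (f₁ e s w).1 (some (f₁ e s w).2) r = hash e (some s) r)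
    (hreg : ∀ e p, (D₀.bind fun w => (reg' (f₀ e w) p).map fun s' => (f₀ e w, s')) =
      (reg e p).bind fun s => (D₁ e s).map (f₁ e s))
    (hserve : ∀ e s b x, ((D₁ e s).bind fun w => (serve' (f₁ e s w).1 (f₁ e s w).2 b x).map fun r =>
        (r.1, (f₁ e s w).1, r.2)) =
      (serve e s b x).bind fun r => (D₁ e r.2).map fun w => (r.1, f₁ e r.2 w)) :
    let Φ : E × Option S → PMF (E' × Option S') := fun e => match e with
      | (e, none) => D₀.map fun w => (f₀ e w, none)
      | (e, some s) => (D₁ e s).map fun w => ((f₁ e s w).1, some (f₁ e s w).2)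
    ∀ e r, ((Φ e).bind fun e' => gameOracle hash' reg' serve' e' r) =
      (gameOracle hash reg serve e r).bind fun z => (Φ z.2).map fun e' => (z.1, e') := by
  intro Φ e r
  apply PMF.ext_ev
  intro f
  obtain ⟨e, _ | s⟩ := e
  · cases r with
    | register p =>
      have := congrArg (fun d => PMF.ev d fun z => f (.nat 0, z.1, some z.2)) (hreg e p)
      simpa [Φ, gameOracle] using this
    | _ => simp [Φ, gameOracle, hhash₀]
  · cases r with
    | ask b x =>
      have := congrArg (fun d => PMF.ev d fun z => f (z.1, z.2.1, some z.2.2)) (hserve e s b x)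
      simpa [Φ, gameOracle] using this
    | _ => simp [Φ, gameOracle, hhash₁]

/-- The oracle of a game, for messages instead of requests. -/
def onMessages {P : Params} {k : ℕ} {σ : Type} (O : σ → Req P k → PMF (Val × σ)) (e : σ) (v : Val) :
    PMF (Val × σ) :=
  O e (Req.parse v)

section Games

variable (P : Params) (k : ℕ)

/-- The probability that an adversary outputs `1` in a game. -/
noncomputable abbrev gameWin {σ : Type} (A : Prog) (inp : Val) (O : σ → Req P k → PMF (Val × σ))
    (T : ℕ) (e : σ) : ℝ≥0∞ :=
  A.win inp P.q (onMessages O) T (.nat 0) (.nat 0) e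

/-- The game in which the adversary attacks a server. -/
noncomputable def serverGame (ρ : HashFunctions P k) (S : Server P) :
    Unit × Option S.State → Req P k → PMF (Val × (Unit × Option S.State)) :=
  gameOracle (fun _ _ r => r.hashReply ρ) (fun _ => S.register)
    fun _ s b x => bif b then S.login s x else S.recover s x

/-- Both sides distinguish the same cases, in a different order: the game parses the message first,
the attack looks at the state first. The component `()` is the empty constant part of the game
state. -/
theorem attackOracle_eq (ρ : HashFunctions P k) (S : Server P) (e : Option S.State) (v : Val) :
    onMessages (serverGame P k ρ S) ((), e) v =
      (attackOracle P k ρ S e v).map fun r => (r.1, ((), r.2)) := by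
  have hw : ∀ (f : P.Password → Req P k) (v : Val) (F : Req P k → PMF (Val × (Unit × Option S.State)))
      (F' : P.Password → PMF (Val × (Unit × Option S.State))), (∀ p, F (f p) = F' p) →
      F (Req.withPassword f v) = (P.readPassword v).elim (F .other) F' := by
    intro f v F F' h
    unfold Req.withPassword
    cases P.readPassword v <;> simp [h]
  have hk : ∀ (f : Fin P.n → BitString k → Fin P.m → Req P k) (v : Val)
      (F F' : Req P k → PMF (Val × (Unit × Option S.State))),
      (∀ i κ l, F (f i κ l) = F' (f i κ l)) → F .other = F' .other →
      F (Req.keyed f v) = F' (Req.keyed f v) := by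
    intro f v F F' h h'
    unfold Req.keyed
    split_ifs <;> simp [h, h']
  unfold onMessages attackOracle
  split
  · simp only [Req.parse]
    rw [hw _ _ (serverGame P k ρ S ((), none)) (fun p => (S.register p).map fun s =>
      (.nat 0, ((), some s))) (fun p => rfl)]
    cases P.readPassword _
    · simp [serverGame, gameOracle, Req.hashReply, PMF.pure_map]
    · simp [PMF.map_comp, Function.comp_def]
  · simp only [Req.parse]
    rw [hw _ _ (serverGame P k ρ S ((), some _)) (fun p => (S.recover _ p).map fun s =>
      (s.1, ((), some s.2))) (fun p => rfl)]
    cases P.readPassword _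
    · simp [serverGame, gameOracle, Req.hashReply, PMF.pure_map]
    · simp [PMF.map_comp, Function.comp_def]
  · simp only [Req.parse]
    rw [hw _ _ (serverGame P k ρ S ((), some _)) (fun p => (S.login _ p).map fun s =>
      (s.1, ((), some s.2))) (fun p => rfl)]
    cases P.readPassword _
    · simp [serverGame, gameOracle, Req.hashReply, PMF.pure_map]
    · simp [PMF.map_comp, Function.comp_def]
  · rename_i h1 h2 h3
    rw [Req.hashAnswer_eq, PMF.pure_map]
    unfold Req.parse
    split
    · exact hk _ _ (serverGame P k ρ S ((), e)) (fun r => PMF.pure (r.hashReply ρ, ((), e)))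
        (fun _ _ _ => by cases e <;> rfl) (by cases e <;> rfl)
    · exact hk _ _ (serverGame P k ρ S ((), e)) (fun r => PMF.pure (r.hashReply ρ, ((), e)))
        (fun _ _ _ => by cases e <;> rfl) (by cases e <;> rfl)
    · rename_i v
      rw [hw _ _ (serverGame P k ρ S ((), e)) (fun p => PMF.pure ((Req.passwordHash p).hashReply ρ,
        ((), e))) (fun p => by cases e <;> rfl)]
      unfold Req.withPassword
      cases P.readPassword v <;> cases e <;> rfl
    · rename_i v
      cases e with
      | none => exact (h1 v rfl rfl).elim
      | some s =>
        unfold Req.withPassword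
        cases P.readPassword v <;> rfl
    · rename_i v
      cases e with
      | some s => exact (h2 s v rfl rfl).elim
      | none =>
        unfold Req.withPassword
        cases P.readPassword v <;> rfl
    · rename_i v
      cases e with
      | some s => exact (h3 s v rfl rfl).elim
      | none =>
        unfold Req.withPassword
        cases P.readPassword v <;> rfl
    · cases e <;> rfl

theorem attackProb_eq (S : HashFunctions P k → Server P) (inp : Val) (A : Prog) (T : ℕ) :
    attackProb P k S inp A T = ((PMF.uniformOfFintype (HashFunctions P k)).ev fun ρ =>
      gameWin P k A inp (serverGame P k ρ (S ρ)) T ((), none)).toReal := by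
  unfold attackProb
  rw [Prog.probOne_eq]
  simp only [PMF.ev_bind, PMF.ev_map]
  congr 2
  funext ρ
  exact (Prog.win_intertwine_map A inp P.q (fun e => ((), e))
    (fun e v => attackOracle_eq P k ρ (S ρ) e v) T _ _ none).symm

end Games

/-! ### Replies to requests -/

section Replies

variable (P : Params) {k : ℕ}

/-- The coefficients of a sharing polynomial. -/
abbrev Coeffs : Type := Fin P.t → ZMod P.q

/-- Exponents for all positions and letters. -/
abbrev LetterTable : Type := Fin P.n → Fin P.m → ZMod P.q

variable {P}

/-- The constant coefficient. -/
def Coeffs.secret (a : Coeffs P) : ZMod P.q := a ⟨0, P.t_pos⟩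

/-- The value of the sharing polynomial. -/
def Coeffs.share (a : Coeffs P) (x : ZMod P.q) : ZMod P.q := ∑ j : Fin P.t, a j * x ^ (j : ℕ)

/-- A recovery message given by its exponents. -/
def expMessage (v₁ : BitString k) (a₀ s : ZMod P.q) (b : P.Grp) (e : Fin P.n → ZMod P.q) : Val :=
  recoveryMessage P v₁ (P.pow P.g a₀) (P.pow P.g s) b fun i => P.pow P.g (e i)

/-- The reply of the real server with randomness `s`, where `β` lists the exponents that belong to
the guess. -/
def honestReply (v₁ : BitString k) (p : P.Password) (a₀ : ZMod P.q) (β : Fin P.n → ZMod P.q)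
    (s : ZMod P.q) : Val :=
  expMessage v₁ a₀ s (P.encode p * P.pow P.g (a₀ * s)) fun i => s * β i

/-- A reply that hides the password if `hide` is set and the guess does not match. -/
noncomputable def replyDist (hide : Bool) (v₁ : BitString k) (p : P.Password) (a₀ : ZMod P.q)
    (β : Fin P.n → ZMod P.q) (x : P.Password) : PMF Val :=
  (PMF.uniformOfFintype (ZMod P.q × ZMod P.q × (Fin P.n → ZMod P.q))).map fun u =>
    if hide = true ∧ ¬ P.Matches x p then expMessage v₁ a₀ u.1 (P.pow P.g u.2.1) u.2.2
    else honestReply v₁ p a₀ β u.1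

theorem replyDist_of_not (hide : Bool) (v₁ : BitString k) (p : P.Password) (a₀ : ZMod P.q)
    (β : Fin P.n → ZMod P.q) (x : P.Password) (h : ¬ (hide = true ∧ ¬ P.Matches x p)) :
    replyDist hide v₁ p a₀ β x =
      (PMF.uniformOfFintype (ZMod P.q)).map (honestReply v₁ p a₀ β) := by
  unfold replyDist
  exact PMF.map_uniform_congr Prod.fst PMF.map_uniform_fst fun u => by rw [if_neg h]

theorem PMF.map_uniform_add {G : Type} [AddCommGroup G] [Fintype G] (c : G) :
    (PMF.uniformOfFintype G).map (fun a => c + a) = PMF.uniformOfFintype G :=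
  PMF.map_uniform_of_bijective (Equiv.addLeft c).bijective

/-- Re-randomization merely adds `r'` to the exponent `r` of the stored ciphertext. As the sum is
uniform for every `r`, the stored exponent plays no role and each reply is a fresh encryption. -/
theorem recoverWith_mkRecord (ρ : HashFunctions P k) (p : P.Password) (v₁ v₂ : BitString k)
    (r : ZMod P.q) (a : Coeffs P) (x : P.Password) (r' : ZMod P.q) :
    recoverWith P k ρ (mkRecord P k ρ p v₁ v₂ r a) x r' =
      honestReply v₁ p a.secret
        (fun i => a.share (ρ.1 i v₁ (p i)) - ρ.2.1 i v₂ (p i) + ρ.2.1 i v₂ (x i)) (r + r') := by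
  unfold recoverWith honestReply expMessage mkRecord
  simp only [← P.pow_add, P.pow_pow]
  rw [mul_assoc, ← P.pow_add, ← mul_add]
  rfl

end Replies

/-! ### The game with keys -/

section KeyedGame

variable (P : Params) (k : ℕ)

/-- What the server has fixed at the registration: the password, the sharing polynomial, and the
number of recovery requests so far. -/
abbrev Account : Type := P.Password × Coeffs P × ℕ

variable {P k}

/-- The exponents for the guess `x`. -/
def keyedExponents (ρ : HashFunctions P k) (v₁ v₂ : BitString k) (a : Coeffs P)
    (p x : P.Password) (i : Fin P.n) : ZMod P.q :=
  a.share (ρ.1 i v₁ (p i)) - ρ.2.1 i v₂ (p i) + ρ.2.1 i v₂ (x i)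

/-- The answer to a log in request, which is accepted if `c` holds. -/
def loginReply (c : Prop) [Decidable c] : Val := .nat (if c then 1 else 0)

/-- Registration: the sharing polynomial is drawn. -/
noncomputable def openAccount (p : P.Password) : PMF (Account P) :=
  (PMF.uniformOfFintype (Coeffs P)).map fun a => (p, a, 0)

variable (P k)

/-- The game with a server whose keys are chosen in advance. The recovery requests whose number
satisfies `R` get replies that hide the password. Log in requests are decided by comparison of
hash values if `coll` is set, and otherwise by comparison of passwords. -/
noncomputable def keyedGame (R : ℕ → Bool) (coll : Bool) :
    (HashFunctions P k × BitString k × BitString k) × Option (Account P) → Req P k →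
      PMF (Val × ((HashFunctions P k × BitString k × BitString k) × Option (Account P))) :=
  gameOracle (fun e _ r => r.hashReply e.1) (fun _ => openAccount) fun e s b x =>
    bif b then PMF.pure
      (bif coll then loginReply (e.1.2.2 x = e.1.2.2 s.1) else loginReply (x = s.1), s)
    else (replyDist (R s.2.2) e.2.1 s.1 s.2.1.secret
      (keyedExponents e.1 e.2.1 e.2.2 s.2.1 s.1 x) x).map fun m => (m, (s.1, s.2.1, s.2.2 + 1))

/-- The real server, with all the random choices of the registration kept. -/
noncomputable def verboseGame (ρ : HashFunctions P k) :
    Unit × Option ((BitString k × BitString k) × ZMod P.q × Account P) → Req P k →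
      PMF (Val × (Unit × Option ((BitString k × BitString k) × ZMod P.q × Account P))) :=
  gameOracle (fun _ _ r => r.hashReply ρ)
    (fun _ p => (PMF.uniformOfFintype
      (BitString k × BitString k × ZMod P.q × Coeffs P)).map
        fun z => ((z.1, z.2.1), z.2.2.1, (p, z.2.2.2, 0)))
    fun _ s b x => bif b then PMF.pure (loginReply (ρ.2.2 x = ρ.2.2 s.2.2.1), s)
      else (PMF.uniformOfFintype (ZMod P.q)).map fun r =>
        (recoverWith P k ρ (mkRecord P k ρ s.2.2.1 s.1.1 s.1.2 s.2.1 s.2.2.2.1) x r,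
          (s.1, s.2.1, s.2.2.1, s.2.2.2.1, s.2.2.2.2 + 1))

variable {P k}

theorem Prog.win_intertwine_game (A : Prog) (inp : Val) {σ τ : Type}
    {O : σ → Req P k → PMF (Val × σ)} {O' : τ → Req P k → PMF (Val × τ)} (Φ : σ → PMF τ)
    (h : ∀ e v, (Φ e).bind (fun e' => O' e' v) =
      (O e v).bind fun r => (Φ r.2).map fun e' => (r.1, e')) (T : ℕ) (e : σ) :
    ((Φ e).ev fun e' => gameWin P k A inp O' T e') = gameWin P k A inp O T e :=
  A.win_intertwine inp P.q Φ (fun e v => h e (Req.parse v)) T _ _ e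

/-- The record of the real server is a function of the random choices of the registration, and
applying this function commutes with all reactions. -/
theorem verboseGame_eq_server (A : Prog) (inp : Val) (T : ℕ) (ρ : HashFunctions P k) :
    gameWin P k A inp (serverGame P k ρ (realServer P k ρ)) T ((), none) =
      gameWin P k A inp (verboseGame P k ρ) T ((), none) := by
  have h := gameOracle_intertwine (P := P) (k := k) (W₀ := Unit) (W₁ := Unit)
    (hash := fun _ _ r => r.hashReply ρ) (hash' := fun (_ : Unit) _ r => r.hashReply ρ)
    (reg' := fun _ p => (PMF.uniformOfFintype
      (BitString k × BitString k × ZMod P.q × (Fin P.t → ZMod P.q))).map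
        fun z => mkRecord P k ρ p z.1 z.2.1 z.2.2.1 z.2.2.2)
    (serve' := fun _ d b x => bif b then
      PMF.pure (.nat (if ρ.2.2 x = d.hashed then 1 else 0), d)
      else (PMF.uniformOfFintype (ZMod P.q)).map fun r => (recoverWith P k ρ d x r, d))
    (PMF.pure ()) (fun (_ : Unit) _ => ()) (fun _ _ => PMF.pure ())
    (fun (_ : Unit) (s : (BitString k × BitString k) × ZMod P.q × Account P) _ => ((),
      mkRecord P k ρ s.2.2.1 s.1.1 s.1.2 s.2.1 s.2.2.2.1))
    (fun _ _ _ => rfl) (fun _ _ _ _ => rfl) (reg := fun _ p => (PMF.uniformOfFintype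
      (BitString k × BitString k × ZMod P.q × Coeffs P)).map
        fun z => ((z.1, z.2.1), z.2.2.1, (p, z.2.2.2, 0)))
    (serve := fun _ s b x => bif b then PMF.pure (loginReply (ρ.2.2 x = ρ.2.2 s.2.2.1), s)
      else (PMF.uniformOfFintype (ZMod P.q)).map fun r =>
        (recoverWith P k ρ (mkRecord P k ρ s.2.2.1 s.1.1 s.1.2 s.2.1 s.2.2.2.1) x r,
          (s.1, s.2.1, s.2.2.1, s.2.2.2.1, s.2.2.2.2 + 1)))
    (by
      intro e p
      refine PMF.ext_ev fun f => ?_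
      simp)
    (by
      intro e s b x
      refine PMF.ext_ev fun f => ?_
      cases b
      · simp [mkRecord]
      · simp only [cond_true, PMF.ev_bind, PMF.ev_map, PMF.ev_pure]
        rfl)
  have := A.win_intertwine_game inp _ h T ((), none)
  simp only [PMF.ev_map, PMF.ev_pure] at this
  exact this

/-- The keys do not influence anything before the registration, so they may be drawn at the start.
The exponent `r` of the stored ciphertext is forgotten, because every reply is re-randomized. -/
theorem verboseGame_eq_keyed (A : Prog) (inp : Val) (T : ℕ) (ρ : HashFunctions P k) :
    ((PMF.uniformOfFintype (BitString k × BitString k)).ev fun v =>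
      gameWin P k A inp (keyedGame P k (fun _ => false) true) T ((ρ, v), none)) =
      gameWin P k A inp (verboseGame P k ρ) T ((), none) := by
  have h := gameOracle_intertwine (P := P) (k := k) (W₁ := Unit)
    (hash := fun _ _ r => r.hashReply ρ)
    (hash' := fun (e : HashFunctions P k × BitString k × BitString k) _ r => r.hashReply e.1)
    (reg' := fun _ => openAccount)
    (serve' := fun e s b x =>
      bif b then PMF.pure
        (bif true then loginReply (e.1.2.2 x = e.1.2.2 s.1) else loginReply (x = s.1), s)
      else (replyDist false e.2.1 s.1 s.2.1.secret
        (keyedExponents e.1 e.2.1 e.2.2 s.2.1 s.1 x) x).map fun m => (m, (s.1, s.2.1, s.2.2 + 1)))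
    (PMF.uniformOfFintype (BitString k × BitString k)) (fun (_ : Unit) v => (ρ, v))
    (fun _ _ => PMF.pure ())
    (fun (_ : Unit) (s : (BitString k × BitString k) × ZMod P.q × Account P) _ =>
      ((ρ, s.1), s.2.2))
    (fun _ _ _ => rfl) (fun _ _ _ _ => rfl) (reg := fun _ p => (PMF.uniformOfFintype
      (BitString k × BitString k × ZMod P.q × Coeffs P)).map
        fun z => ((z.1, z.2.1), z.2.2.1, (p, z.2.2.2, 0)))
    (serve := fun _ s b x => bif b then PMF.pure (loginReply (ρ.2.2 x = ρ.2.2 s.2.2.1), s)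
      else (PMF.uniformOfFintype (ZMod P.q)).map fun r =>
        (recoverWith P k ρ (mkRecord P k ρ s.2.2.1 s.1.1 s.1.2 s.2.1 s.2.2.2.1) x r,
          (s.1, s.2.1, s.2.2.1, s.2.2.2.1, s.2.2.2.2 + 1)))
    (by
      intro e p
      refine PMF.ext_ev fun f => ?_
      simp [openAccount, PMF.uniform_prod])
    (by
      intro e s b x
      refine PMF.ext_ev fun f => ?_
      cases b
      · simp only [cond_false, PMF.ev_bind, PMF.ev_map, PMF.ev_pure]
        rw [replyDist_of_not _ _ _ _ _ _ (by simp), PMF.ev_map]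
        -- The translation by the stored exponent absorbs it into the new randomness.
        refine (PMF.ev_uniform_congr _ (PMF.map_uniform_add s.2.1) fun r => ?_).symm
        rw [recoverWith_mkRecord]
        rfl
      · simp)
  have := A.win_intertwine_game inp _ h T ((), none)
  simp only [PMF.ev_map] at this
  exact this

/-- The real attack is the game with keys chosen in advance. -/
theorem attackProb_real (A : Prog) (inp : Val) (T : ℕ) :
    attackProb P k (realServer P k) inp A T =
      ((PMF.uniformOfFintype (HashFunctions P k × BitString k × BitString k)).ev fun e =>
        gameWin P k A inp (keyedGame P k (fun _ => false) true) T (e, none)).toReal := by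
  rw [attackProb_eq, PMF.uniform_prod (α := HashFunctions P k)]
  simp only [verboseGame_eq_keyed, verboseGame_eq_server]

/-- The keys and the polynomial of a simulator. -/
abbrev Setup (P : Params) (k : ℕ) : Type := (BitString k × BitString k) × Coeffs P

variable (P k)

/-- The conditional law of the setup given the history: fixed once it has been drawn, uniform
before. -/
noncomputable def fillSetup : Option (Setup P k) → PMF (Setup P k)
  | some z => PMF.pure z
  | none => PMF.uniformOfFintype (Setup P k)

/-- The game with a simulator that draws its keys and its polynomial when it gets its first
request. -/
noncomputable def simulatorGame (ρ : HashFunctions P k) :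
    Unit × Option (P.Password × Option (Setup P k) × ℕ) → Req P k →
      PMF (Val × (Unit × Option (P.Password × Option (Setup P k) × ℕ))) :=
  gameOracle (fun _ _ r => r.hashReply ρ) (fun _ p => PMF.pure (p, none, 0))
    fun _ s b x => (fillSetup P k s.2.1).bind fun z =>
      bif b then PMF.pure (loginReply (x = s.1), (s.1, some z, s.2.2))
      else (replyDist true z.1.1 s.1 z.2.secret
        (keyedExponents ρ z.1.1 z.1.2 z.2 s.1 x) x).map fun m => (m, (s.1, some z, s.2.2 + 1))

variable {P k}

/-- A simulator is not told about the registration and can draw its keys only at the first request.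
No answer depends on them earlier, so completing the state with `fillSetup` commutes with every
transition. -/
theorem simulatorGame_eq_keyed (A : Prog) (inp : Val) (T : ℕ) (ρ : HashFunctions P k) :
    ((PMF.uniformOfFintype (BitString k × BitString k)).ev fun v =>
      gameWin P k A inp (keyedGame P k (fun _ => true) false) T ((ρ, v), none)) =
      gameWin P k A inp (simulatorGame P k ρ) T ((), none) := by
  have h := gameOracle_intertwine (P := P) (k := k)
    (hash := fun _ _ r => r.hashReply ρ)
    (hash' := fun (e : HashFunctions P k × BitString k × BitString k) _ r => r.hashReply e.1)
    (reg' := fun _ => openAccount)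
    (serve' := fun e s b x =>
      bif b then PMF.pure
        (bif false then loginReply (e.1.2.2 x = e.1.2.2 s.1) else loginReply (x = s.1), s)
      else (replyDist true e.2.1 s.1 s.2.1.secret
        (keyedExponents e.1 e.2.1 e.2.2 s.2.1 s.1 x) x).map fun m => (m, (s.1, s.2.1, s.2.2 + 1)))
    (PMF.uniformOfFintype (BitString k × BitString k)) (fun (_ : Unit) v => (ρ, v))
    (fun _ s => fillSetup P k s.2.1)
    (fun (_ : Unit) (s : P.Password × Option (Setup P k) × ℕ) z =>
      ((ρ, z.1), (s.1, z.2, s.2.2)))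
    (fun _ _ _ => rfl) (fun _ _ _ _ => rfl) (reg := fun _ p => PMF.pure (p, none, 0))
    (serve := fun _ s b x => (fillSetup P k s.2.1).bind fun z =>
      bif b then PMF.pure (loginReply (x = s.1), (s.1, some z, s.2.2))
      else (replyDist true z.1.1 s.1 z.2.secret
        (keyedExponents ρ z.1.1 z.1.2 z.2 s.1 x) x).map fun m => (m, (s.1, some z, s.2.2 + 1)))
    (by
      intro e p
      refine PMF.ext_ev fun f => ?_
      simp [openAccount, fillSetup, PMF.uniform_prod])
    (by
      intro e s b x
      refine PMF.ext_ev fun f => ?_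
      cases b <;> simp [fillSetup])
  have := A.win_intertwine_game inp _ h T ((), none)
  simp only [PMF.ev_map] at this
  exact this

end KeyedGame

/-! ### Log in requests -/

section Login

variable {P : Params} {k : ℕ}

abbrev KeyedState (P : Params) (k : ℕ) : Type :=
  (HashFunctions P k × BitString k × BitString k) × Option (Account P)

/-- The password hash, redrawn outside the set of the passwords that have been queried. -/
def redrawn (s : KeyedState P k) (D : Finset P.Password) (H : P.Password → BitString k) :
    KeyedState P k :=
  (((s.1.1.1, s.1.1.2.1, D.piecewise s.1.1.2.2 H), s.1.2), s.2)

/-- The game with log in by comparison of passwords in which the password hash is sampled when it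
is queried. -/
noncomputable def lazyHashGame (R : ℕ → Bool) :
    KeyedState P k × Finset P.Password → Req P k →
      PMF (Val × (KeyedState P k × Finset P.Password))
  | (s, D), .passwordHash p => (PMF.uniformOfFintype (P.Password → BitString k)).map fun H =>
      (.nat (D.piecewise s.1.1.2.2 H p), (redrawn s D H, insert p D))
  | (s, D), r => (keyedGame P k R false s r).map fun z => (z.1, (z.2, D))

/-- The hash values outside the queried set are uniform given everything the adversary has seen. -/
noncomputable def redraw (s : KeyedState P k × Finset P.Password) : PMF (KeyedState P k) :=
  (PMF.uniformOfFintype (P.Password → BitString k)).map (redrawn s.1 s.2)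

/-- In the game that compares passwords, the password hash is consulted only by explicit queries.
All other transitions commute with redrawing for trivial reasons, since they neither read nor change
the function. -/
theorem lazyHashGame_intertwine (R : ℕ → Bool) (s : KeyedState P k × Finset P.Password)
    (r : Req P k) :
    ((redraw s).bind fun e => keyedGame P k R false e r) =
      (lazyHashGame R s r).bind fun z => (redraw z.2).map fun e => (z.1, e) := by
  obtain ⟨⟨⟨⟨h, g, H⟩, v⟩, o⟩, D⟩ := s
  refine PMF.ext_ev fun f => ?_
  cases r with
  | passwordHash p =>
    have hL : ∀ H' : P.Password → BitString k, (keyedGame P k R false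
        (redrawn (((h, g, H), v), o) D H') (.passwordHash p)) = PMF.pure
          (.nat (D.piecewise H H' p), (redrawn (((h, g, H), v), o) D H')) := by
      intro H'
      cases o <;> rfl
    simp only [redraw, lazyHashGame, PMF.ev_bind, PMF.ev_map, hL, PMF.ev_pure]
    rw [← PMF.uniform_prod fun u : (P.Password → BitString k) × (P.Password → BitString k) =>
      f (.nat (D.piecewise H u.1 p), redrawn (redrawn (((h, g, H), v), o) D u.1) (insert p D) u.2)]
    -- Redrawing outside `D`, and then once more outside `insert p D`, has the same law as a single
    -- redrawing outside `D`; the value at `p` comes from the first function in both cases.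
    refine (PMF.ev_uniform_congr _ (PMF.map_uniform_piecewise (insert p D)) fun u => ?_).symm
    have h1 : D.piecewise H u.1 p = D.piecewise H ((insert p D).piecewise u.1 u.2) p := by
      by_cases hp : p ∈ D <;> simp [hp]
    have h2 : (insert p D).piecewise (D.piecewise H u.1) u.2
        = D.piecewise H ((insert p D).piecewise u.1 u.2) := by
      ext x
      by_cases hx : x ∈ D
      · simp [hx]
      · by_cases hxp : x = p
        · subst hxp
          simp [hx]
        · simp [hx, hxp]
    simp only [redrawn, h1, h2]
  | register p =>
    cases o with
    | none =>
      simp only [redraw, lazyHashGame, keyedGame, gameOracle, redrawn, PMF.ev_bind, PMF.ev_map]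
      rw [PMF.ev_comm]
    | some s => simp [redraw, lazyHashGame, keyedGame, gameOracle, redrawn, Req.hashReply]
  | ask b x =>
    cases o with
    | none => simp [redraw, lazyHashGame, keyedGame, gameOracle, redrawn, Req.hashReply]
    | some s =>
      cases b
      · simp only [redraw, lazyHashGame, keyedGame, gameOracle, redrawn, PMF.ev_bind, PMF.ev_map,
          cond_false]
        rw [PMF.ev_comm]
        rfl
      · simp [redraw, lazyHashGame, keyedGame, gameOracle, redrawn]
  | letterHash i κ l => cases o <;> simp [redraw, lazyHashGame, keyedGame, gameOracle, redrawn,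
      Req.hashReply]
  | maskHash i κ l => cases o <;> simp [redraw, lazyHashGame, keyedGame, gameOracle, redrawn,
      Req.hashReply]
  | other => cases o <;> simp [redraw, lazyHashGame, keyedGame, gameOracle, redrawn,
      Req.hashReply]

/-- A log in request whose decision depends on whether hashes or passwords are compared. -/
def LoginCollision (s : KeyedState P k) : Req P k → Prop
  | .ask true x => ∃ a, s.2 = some a ∧ x ≠ a.1 ∧ s.1.1.2.2 x = s.1.1.2.2 a.1
  | _ => False

theorem keyedGame_eq_of_not_collision (R : ℕ → Bool) (s : KeyedState P k) (r : Req P k)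
    (h : ¬ LoginCollision s r) : keyedGame P k R true s r = keyedGame P k R false s r := by
  obtain ⟨e, _ | a⟩ := s
  · cases r <;> rfl
  · cases r with
    | ask b x =>
      cases b
      · rfl
      · have : e.1.2.2 x = e.1.2.2 a.1 ↔ x = a.1 := by
          refine ⟨fun he => ?_, fun he => by rw [he]⟩
          by_contra hx
          exact h ⟨a, rfl, hx, he⟩
        simp [keyedGame, gameOracle, loginReply, this]
    | _ => rfl

/-- Values on the queried set are fixed, so a collision among them is not covered by any further
randomness. The potential has to be `1` from then on. -/
def HasCollision (H : P.Password → BitString k) (D : Finset P.Password) : Prop :=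
  ∃ x ∈ D, ∃ y ∈ D, x ≠ y ∧ H x = H y

open Classical in
/-- An upper bound for the probability of a collision in `T` further activations. -/
noncomputable def collisionBound (T : ℕ) (s : KeyedState P k × Finset P.Password) : ℝ≥0∞ :=
  if HasCollision s.1.1.1.2.2 s.2 then 1 else (T * (s.2.card + T) : ℕ) / (2 ^ k : ℕ)

-- In one activation, a new hash query hits one of the `D.card` known values with probability at
-- most `D.card / 2 ^ k`, while a log in request compares two values of which at least one is still
-- random, or two known ones that differ. The queried set grows by at most one each time, so every
-- activation costs at most `(D.card + T) / 2 ^ k`.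
open Classical in
theorem collisionBound_step (R : ℕ → Bool) (T : ℕ) (s : KeyedState P k × Finset P.Password)
    (r : Req P k) (hlt : collisionBound (T + 1) s < 1) :
    ((redraw s).ev fun e => if LoginCollision e r then 1 else 0)
      + ((lazyHashGame R s r).ev fun z => collisionBound T z.2) ≤ collisionBound (T + 1) s := by
  obtain ⟨⟨⟨⟨h, g, H⟩, v⟩, o⟩, D⟩ := s
  have hno : ¬ HasCollision H D := by
    intro hc
    simp [collisionBound, hc] at hlt
  have hcard : Fintype.card (BitString k) = 2 ^ k := by simp
  have hsame : ∀ (v' : BitString k × BitString k) (o' : Option (Account P)) (T : ℕ),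
      collisionBound T ((((h, g, H), v'), o'), D) = (T * (D.card + T) : ℕ) / (2 ^ k : ℕ) := by
    intro v' o' T
    simp [collisionBound, hno]
  have hle : ∀ c d : ℕ, c ≤ d → (c : ℝ≥0∞) / (2 ^ k : ℕ) ≤ (d : ℝ≥0∞) / (2 ^ k : ℕ) := by
    intro c d hcd
    gcongr
  have htriv : (0 : ℝ≥0∞) + (T * (D.card + T) : ℕ) / (2 ^ k : ℕ)
      ≤ ((T + 1) * (D.card + (T + 1)) : ℕ) / (2 ^ k : ℕ) := by
    rw [zero_add]
    exact hle _ _ (Nat.mul_le_mul (by omega) (by omega))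
  have hb : ∀ r : Req P k, (∀ e : KeyedState P k, ¬ LoginCollision e r) →
      ((redraw ((((h, g, H), v), o), D)).ev fun e => if LoginCollision e r then (1 : ℝ≥0∞) else 0)
        = 0 := by
    intro r hr
    simp [hr]
  rw [hsame]
  cases r with
  | passwordHash p =>
    rw [hb _ fun _ => by simp [LoginCollision], zero_add]
    simp only [lazyHashGame, PMF.ev_map]
    by_cases hp : p ∈ D
    · have : ∀ H', collisionBound T (redrawn (((h, g, H), v), o) D H', insert p D) =
          (T * (D.card + T) : ℕ) / (2 ^ k : ℕ) := by
        intro H'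
        have : ¬ HasCollision (D.piecewise H H') D := by
          rintro ⟨x, hx, y, hy, hxy, he⟩
          exact hno ⟨x, hx, y, hy, hxy, by simpa [hx, hy] using he⟩
        simp [collisionBound, redrawn, Finset.insert_eq_of_mem hp, this]
      simp only [this, PMF.ev_const]
      rwa [zero_add] at htriv
    · have : ∀ H' : P.Password → BitString k,
          collisionBound T (redrawn (((h, g, H), v), o) D H', insert p D) ≤
          (if H' p ∈ D.image H then 1 else 0) + (T * (D.card + 1 + T) : ℕ) / (2 ^ k : ℕ) := by
        intro H'
        unfold collisionBound
        split_ifs with hc hi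
        · exact le_self_add
        · exfalso
          obtain ⟨x, hx, y, hy, hxy, he⟩ := hc
          simp only [redrawn] at he
          rw [Finset.mem_insert] at hx hy
          rcases hx with rfl | hx <;> rcases hy with rfl | hy
          · exact hxy rfl
          · exact hi (Finset.mem_image.2 ⟨y, hy, by simpa [hp, hy] using he.symm⟩)
          · exact hi (Finset.mem_image.2 ⟨x, hx, by simpa [hp, hx] using he⟩)
          · exact hno ⟨x, hx, y, hy, hxy, by simpa [hx, hy] using he⟩
        · simp [Finset.card_insert_of_notMem hp]
        · simp [Finset.card_insert_of_notMem hp]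
      refine (PMF.ev_mono this).trans ?_
      rw [PMF.ev_add, PMF.ev_const]
      have h1 : ((PMF.uniformOfFintype (P.Password → BitString k)).ev fun H' =>
          if H' p ∈ D.image H then (1 : ℝ≥0∞) else 0) ≤ (D.card : ℕ) / (2 ^ k : ℕ) := by
        have := PMF.ev_uniform_le (α := BitString k) (fun b => b ∈ D.image H) (c := D.card)
          (by
            rw [Finset.filter_mem_eq_inter, Finset.univ_inter]
            exact Finset.card_image_le)
        rw [← PMF.map_uniform_eval p, PMF.ev_map, hcard] at this
        exact this
      refine (add_le_add_left h1 _).trans ?_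
      rw [← ENNReal.add_div, ← Nat.cast_add]
      exact hle _ _ (by ring_nf; omega)
  | register p =>
    rw [hb _ fun _ => by simp [LoginCollision]]
    cases o <;> simpa [lazyHashGame, keyedGame, gameOracle, openAccount, hsame] using htriv
  | ask b x =>
    cases b
    · rw [hb _ fun _ => by simp [LoginCollision]]
      cases o <;> simpa [lazyHashGame, keyedGame, gameOracle, hsame] using htriv
    · cases o with
      | none =>
        simpa [lazyHashGame, keyedGame, gameOracle, redraw, redrawn, hsame, LoginCollision]
          using htriv
      | some a =>
        have h1 : ((redraw ((((h, g, H), v), some a), D)).ev fun e =>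
            if LoginCollision e (.ask true x) then (1 : ℝ≥0∞) else 0) ≤ (1 : ℕ) / (2 ^ k : ℕ) := by
          simp only [redraw, PMF.ev_map]
          by_cases hx : x = a.1
          · simp [LoginCollision, redrawn, hx]
          · have hev : ∀ H' : P.Password → BitString k,
                LoginCollision (redrawn (((h, g, H), v), some a) D H') (.ask true x) ↔
                  D.piecewise H H' x = D.piecewise H H' a.1 := by
              intro H'
              simp [LoginCollision, redrawn, hx]
            simp only [hev]
            -- If both values are known they differ, as there is no collision so far. Otherwise one
            -- of them is uniform and independent of the other, and `PMF.ev_uniform_hit` applies.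
            by_cases hxD : x ∈ D
            · by_cases haD : a.1 ∈ D
              · have : H x ≠ H a.1 := fun he => hno ⟨x, hxD, a.1, haD, hx, he⟩
                simp [hxD, haD, this]
              · have := PMF.ev_uniform_hit (β := BitString k) a.1 (fun _ => H x) fun _ _ _ => rfl
                simp only [hxD, haD, Finset.piecewise_eq_of_mem, Finset.piecewise_eq_of_notMem,
                  not_false_eq_true, eq_comm (a := H x), this, hcard, Nat.cast_one, le_refl]
            · have := PMF.ev_uniform_hit (β := BitString k) x (fun H' => D.piecewise H H' a.1)
                fun F G hFG => by
                  by_cases haD : a.1 ∈ D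
                  · simp [haD]
                  · simp [haD, hFG a.1 (Ne.symm hx)]
              simp only [hxD, Finset.piecewise_eq_of_notMem, not_false_eq_true, this, hcard,
                Nat.cast_one, le_refl]
        refine (add_le_add_left h1 _).trans ?_
        simp only [lazyHashGame, keyedGame, gameOracle, hsame, PMF.ev_map, PMF.ev_const]
        rw [← ENNReal.add_div, ← Nat.cast_add]
        exact hle _ _ (by ring_nf; omega)
  | letterHash i κ l =>
    rw [hb _ fun _ => by simp [LoginCollision]]
    cases o <;> simpa [lazyHashGame, keyedGame, gameOracle, hsame] using htriv
  | maskHash i κ l =>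
    rw [hb _ fun _ => by simp [LoginCollision]]
    cases o <;> simpa [lazyHashGame, keyedGame, gameOracle, hsame] using htriv
  | other =>
    rw [hb _ fun _ => by simp [LoginCollision]]
    cases o <;> simpa [lazyHashGame, keyedGame, gameOracle, hsame] using htriv

open Classical in
theorem collisionBound_mono (T : ℕ) (s : KeyedState P k × Finset P.Password) :
    collisionBound T s ≤ collisionBound (T + 1) s := by
  unfold collisionBound
  split_ifs
  · exact le_rfl
  · gcongr <;> omega

/-- Comparing passwords instead of their hash values changes the winning probability by at most
the probability of a collision. -/
theorem keyedGame_login (A : Prog) (inp : Val) (T : ℕ) (R : ℕ → Bool) (c : Bool) :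
    ((PMF.uniformOfFintype (HashFunctions P k × BitString k × BitString k)).ev fun e =>
        gameWin P k A inp (keyedGame P k R c) T (e, none)) ≤
      ((PMF.uniformOfFintype (HashFunctions P k × BitString k × BitString k)).ev fun e =>
        gameWin P k A inp (keyedGame P k R !c) T (e, none)) + (T * T : ℕ) / (2 ^ k : ℕ) := by
  classical
  have h := fun s => A.win_hop inp P.q (O₁ := onMessages (keyedGame P k R true))
    (O₂ := onMessages (keyedGame P k R false)) (O := onMessages (lazyHashGame R)) redraw
    (fun e v => LoginCollision e (Req.parse v)) collisionBound
    (fun e v => lazyHashGame_intertwine R e _)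
    (fun e v h => keyedGame_eq_of_not_collision R e _ h)
    (fun T e v h => collisionBound_step R T e _ h) collisionBound_mono T (.nat 0) (.nat 0) s
  have h0 : ∀ e : HashFunctions P k × BitString k × BitString k,
      collisionBound T ((e, none), ∅) = (T * T : ℕ) / (2 ^ k : ℕ) := by
    intro e
    simp [collisionBound, HasCollision]
  -- At the start nothing has been queried, so redrawing replaces the whole password hash by an
  -- independent uniform one.
  have hΦ : ∀ (F : KeyedState P k → ℝ≥0∞),
      ((PMF.uniformOfFintype (HashFunctions P k × BitString k × BitString k)).ev fun e =>
        (redraw ((e, none), ∅)).ev F) =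
      (PMF.uniformOfFintype (HashFunctions P k × BitString k × BitString k)).ev fun e =>
        F (e, none) := by
    intro F
    simp only [redraw, PMF.ev_map, redrawn, Finset.piecewise_empty, PMF.uniform_prod, PMF.ev_const]
    refine PMF.ev_congr fun _ => PMF.ev_congr fun _ => ?_
    rw [PMF.ev_comm (PMF.uniformOfFintype (P.Password → BitString k))]
    refine PMF.ev_congr fun _ => ?_
    rw [PMF.ev_comm]
  have key : ∀ c : Bool, ((PMF.uniformOfFintype
      (HashFunctions P k × BitString k × BitString k)).ev fun e =>
        (redraw ((e, none), ∅)).ev fun e' => gameWin P k A inp (keyedGame P k R c) T e') ≤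
      ((PMF.uniformOfFintype (HashFunctions P k × BitString k × BitString k)).ev fun e =>
        (redraw ((e, none), ∅)).ev fun e' => gameWin P k A inp (keyedGame P k R !c) T e') +
        (T * T : ℕ) / (2 ^ k : ℕ) := by
    intro c
    rw [← PMF.ev_const (PMF.uniformOfFintype (HashFunctions P k × BitString k × BitString k))
      ((T * T : ℕ) / (2 ^ k : ℕ)), ← PMF.ev_add]
    refine PMF.ev_mono fun e => ?_
    rw [← h0 e]
    cases c
    · exact (h ((e, none), ∅)).2
    · exact (h ((e, none), ∅)).1
  have := key c
  rwa [hΦ, hΦ] at this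

end Login

/-! ### Independent rows -/

section Rows

variable {P : Params} {k : ℕ}

/-- A keyed hash function with the row of one key replaced. -/
def withRow (h : Fin P.n → BitString k → Fin P.m → ZMod P.q) (v : BitString k)
    (X : LetterTable P) : Fin P.n → BitString k → Fin P.m → ZMod P.q :=
  fun i κ l => if κ = v then X i l else h i κ l

/-- Keys, hash functions and separate tables for the two keys. -/
abbrev RowState (P : Params) (k : ℕ) : Type :=
  (HashFunctions P k × BitString k × BitString k) × LetterTable P × LetterTable P

def RowState.hashes (e : RowState P k) : HashFunctions P k :=
  (withRow e.1.1.1 e.1.2.1 e.2.1, withRow e.1.1.2.1 e.1.2.2 e.2.2, e.1.1.2.2)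

/-- Exchanging the rows of the two keys with the separate tables is an involution of the set of
states, so it preserves the uniform distribution; the hash functions that result are its first
component. -/
theorem map_uniform_hashes : (PMF.uniformOfFintype (RowState P k)).map
    (fun e => (e.hashes, e.1.2)) =
      PMF.uniformOfFintype (HashFunctions P k × BitString k × BitString k) := by
  have h : Function.Involutive fun e : RowState P k =>
      (((e.hashes, e.1.2), (fun i l => e.1.1.1 i e.1.2.1 l, fun i l => e.1.1.2.1 i e.1.2.2 l)) :
        RowState P k) := by
    rintro ⟨⟨⟨h, g, H⟩, v₁, v₂⟩, X, G⟩
    refine Prod.ext (Prod.ext (Prod.ext ?_ (Prod.ext ?_ rfl)) rfl) ?_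
    · funext i κ l
      by_cases hκ : κ = v₁ <;> simp [RowState.hashes, withRow, hκ]
    · funext i κ l
      by_cases hκ : κ = v₂ <;> simp [RowState.hashes, withRow, hκ]
    · simp [RowState.hashes, withRow]
  have h' := congrArg (PMF.map Prod.fst) (PMF.map_uniform_of_bijective h.bijective)
  rw [PMF.map_comp, PMF.map_uniform_fst] at h'
  exact h'

/-- Serving requests with given exponents. -/
noncomputable def serveAccount (R : ℕ → Bool) (v₁ : BitString k)
    (β : P.Password → Fin P.n → ZMod P.q) (s : Account P) (b : Bool) (x : P.Password) :
    PMF (Val × Account P) :=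
  bif b then PMF.pure (loginReply (x = s.1), s)
  else (replyDist (R s.2.2) v₁ s.1 s.2.1.secret (β x) x).map fun m => (m, (s.1, s.2.1, s.2.2 + 1))

/-- The exponents for the guess `x` computed from the rows. -/
def rowExponents (X G : LetterTable P) (a : Coeffs P) (p x : P.Password) (i : Fin P.n) :
    ZMod P.q :=
  a.share (X i (p i)) - G i (p i) + G i (x i)

/-- The game with keys, in terms of separate rows. -/
noncomputable def rowGame (R : ℕ → Bool) :
    RowState P k × Option (Account P) → Req P k →
      PMF (Val × (RowState P k × Option (Account P))) :=
  gameOracle (fun e _ r => r.hashReply e.hashes) (fun _ => openAccount) fun e s =>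
    serveAccount R e.1.2.1 (rowExponents e.2.1 e.2.2 s.2.1 s.1) s

/-- The random oracles after the registration: the row for the key `v` is replaced. -/
def rowReply (ρ : HashFunctions P k) (o : Option (BitString k × LetterTable P)) (r : Req P k) :
    Val :=
  match o with
  | none => r.hashReply ρ
  | some z => r.hashReply (withRow ρ.1 z.1 z.2, ρ.2)

/-- The game in which the rows for the keys are used only by the server and, after the
registration, for queries with the first key. -/
noncomputable def freshRowGame (R : ℕ → Bool) :
    RowState P k × Option (Account P) → Req P k →
      PMF (Val × (RowState P k × Option (Account P))) :=
  gameOracle (fun e o r => rowReply e.1.1 (o.map fun _ => (e.1.2.1, e.2.1)) r)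
    (fun _ => openAccount) fun e s =>
    serveAccount R e.1.2.1 (rowExponents e.2.1 e.2.2 s.2.1 s.1) s

/-- The same game, in which the first key and the rows are chosen at the registration. -/
noncomputable def lateRowGame (R : ℕ → Bool) :
    HashFunctions P k × Option ((BitString k × LetterTable P × LetterTable P) × Account P) →
      Req P k → PMF (Val × (HashFunctions P k ×
        Option ((BitString k × LetterTable P × LetterTable P) × Account P))) :=
  gameOracle (fun ρ o r => rowReply ρ (o.map fun s => (s.1.1, s.1.2.1)) r)
    (fun _ p => (PMF.uniformOfFintype (BitString k × LetterTable P × LetterTable P)).bind fun z =>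
      (openAccount p).map fun s => (z, s)) fun _ s b x =>
    (serveAccount R s.1.1 (rowExponents s.1.2.1 s.1.2.2 s.2.2.1 s.2.1) s.2 b x).map
      fun r => (r.1, (s.1, r.2))

/-- Since both keys are part of the state, installing the separate tables at these keys yields
uniform hash functions. The server reads precisely the installed rows. -/
theorem rowGame_eq_keyed (A : Prog) (inp : Val) (T : ℕ) (R : ℕ → Bool) :
    ((PMF.uniformOfFintype (HashFunctions P k × BitString k × BitString k)).ev fun e =>
        gameWin P k A inp (keyedGame P k R false) T (e, none)) =
      (PMF.uniformOfFintype (RowState P k)).ev fun e =>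
        gameWin P k A inp (rowGame R) T (e, none) := by
  rw [← map_uniform_hashes, PMF.ev_map]
  refine PMF.ev_congr fun e => ?_
  have h := gameOracle_intertwine (P := P) (k := k) (W₀ := Unit) (W₁ := Unit)
    (hash := fun (e : RowState P k) _ r => r.hashReply e.hashes)
    (hash' := fun (e : HashFunctions P k × BitString k × BitString k) _ r => r.hashReply e.1)
    (reg := fun _ => openAccount) (reg' := fun _ => openAccount)
    (serve := fun e s => serveAccount R e.1.2.1 (rowExponents e.2.1 e.2.2 s.2.1 s.1) s)
    (serve' := fun e s => serveAccount R e.2.1 (keyedExponents e.1 e.2.1 e.2.2 s.2.1 s.1) s)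
    (PMF.pure ()) (fun e _ => (e.hashes, e.1.2)) (fun _ _ => PMF.pure ())
    (fun e s _ => ((e.hashes, e.1.2), s)) (fun _ _ _ => rfl) (fun _ _ _ _ => rfl)
    (by
      intro e p
      refine PMF.ext_ev fun f => ?_
      simp)
    (by
      intro e s b x
      refine PMF.ext_ev fun f => ?_
      have : ∀ x, keyedExponents e.hashes e.1.2.1 e.1.2.2 s.2.1 s.1 x
          = rowExponents e.2.1 e.2.2 s.2.1 s.1 x := by
        intro x
        funext i
        simp [keyedExponents, rowExponents, RowState.hashes, withRow]
      simp [this, serveAccount])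
  have := A.win_intertwine_game inp _ h T (e, none)
  simp only [PMF.ev_map, PMF.ev_pure] at this
  exact this

/-- A query that reveals the difference between hash functions and separate rows. -/
def RowQuery (e : RowState P k × Option (Account P)) : Req P k → Prop
  | .letterHash _ κ _ => e.2 = none ∧ κ = e.1.1.2.1
  | .maskHash _ κ _ => κ = e.1.1.2.2
  | _ => False

theorem rowGame_eq_fresh (R : ℕ → Bool) (e : RowState P k × Option (Account P)) (r : Req P k)
    (h : ¬ RowQuery e r) : rowGame R e r = freshRowGame R e r := by
  obtain ⟨⟨⟨⟨f, g, H⟩, v₁, v₂⟩, X, G⟩, _ | s⟩ := e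
  · cases r with
    | letterHash i κ l =>
      have : κ ≠ v₁ := fun hκ => h ⟨rfl, hκ⟩
      simp [rowGame, freshRowGame, gameOracle, rowReply, Req.hashReply, RowState.hashes, withRow,
        this]
    | maskHash i κ l =>
      have : κ ≠ v₂ := fun hκ => h hκ
      simp [rowGame, freshRowGame, gameOracle, rowReply, Req.hashReply, RowState.hashes, withRow,
        this]
    | _ => rfl
  · cases r with
    | maskHash i κ l =>
      have : κ ≠ v₂ := fun hκ => h hκ
      simp [rowGame, freshRowGame, gameOracle, rowReply, Req.hashReply, RowState.hashes, withRow,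
        this]
    | _ => rfl

/-- Separate rows instead of the hash functions change the winning probability by at most the
probability that a key is guessed. -/
theorem keyedGame_rows (A : Prog) (inp : Val) (T : ℕ) (R : ℕ → Bool) :
    (((PMF.uniformOfFintype (HashFunctions P k × BitString k × BitString k)).ev fun e =>
        gameWin P k A inp (keyedGame P k R false) T (e, none)) ≤
      ((PMF.uniformOfFintype (HashFunctions P k)).ev fun ρ =>
        gameWin P k A inp (lateRowGame R) T (ρ, none)) + (T : ℕ) / (2 ^ k : ℕ)) ∧
    ((PMF.uniformOfFintype (HashFunctions P k)).ev fun ρ =>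
        gameWin P k A inp (lateRowGame R) T (ρ, none)) ≤
      ((PMF.uniformOfFintype (HashFunctions P k × BitString k × BitString k)).ev fun e =>
        gameWin P k A inp (keyedGame P k R false) T (e, none)) + (T : ℕ) / (2 ^ k : ℕ) := by
  classical
  rw [rowGame_eq_keyed]
  -- With fresh rows, no reply ever depends on the key `v₂`, and before the registration none
  -- depends on `v₁` or on the rows. The kernel therefore fills in these parts uniformly.
  have h := gameOracle_intertwine (P := P) (k := k)
    (hash := fun (ρ : HashFunctions P k)
      (o : Option ((BitString k × LetterTable P × LetterTable P) × Account P)) r =>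
        rowReply ρ (o.map fun s => (s.1.1, s.1.2.1)) r)
    (hash' := fun (e : RowState P k) (o : Option (Account P)) r =>
      rowReply e.1.1 (o.map fun _ => (e.1.2.1, e.2.1)) r)
    (reg := fun _ p => (PMF.uniformOfFintype (BitString k × LetterTable P × LetterTable P)).bind
      fun z => (openAccount p).map fun s => (z, s)) (reg' := fun _ => openAccount)
    (serve := fun _ s b x =>
      (serveAccount R s.1.1 (rowExponents s.1.2.1 s.1.2.2 s.2.2.1 s.2.1) s.2 b x).map
        fun r => (r.1, (s.1, r.2)))
    (serve' := fun e s => serveAccount R e.1.2.1 (rowExponents e.2.1 e.2.2 s.2.1 s.1) s)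
    (PMF.uniformOfFintype ((BitString k × BitString k) × LetterTable P × LetterTable P))
    (fun ρ w => ((ρ, w.1), w.2)) (fun _ _ => PMF.uniformOfFintype (BitString k))
    (fun ρ s v₂ => (((ρ, (s.1.1, v₂)), s.1.2), s.2)) (fun _ _ _ => rfl) (fun _ _ _ _ => rfl)
    (by
      intro e p
      refine PMF.ext_ev fun f => ?_
      simp only [PMF.ev_bind, PMF.ev_map, PMF.uniform_prod]
      refine PMF.ev_congr fun v₁ => ?_
      rw [PMF.ev_comm]
      refine PMF.ev_congr fun X => ?_
      rw [PMF.ev_comm]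
      refine PMF.ev_congr fun G => ?_
      rw [PMF.ev_comm])
    (by
      intro e s b x
      refine PMF.ext_ev fun f => ?_
      simp only [PMF.ev_bind, PMF.ev_map]
      rw [PMF.ev_comm])
  have hbad : ∀ (v : BitString k), ((PMF.uniformOfFintype (BitString k)).ev fun w =>
      if v = w then (1 : ℝ≥0∞) else 0) = (1 : ℕ) / (2 ^ k : ℕ) := by
    intro v
    simp only [eq_comm (a := v), PMF.ev_uniform_eq, Fintype.card_fin, Nat.cast_one]
  have hT : ∀ T : ℕ, (1 : ℕ) / (2 ^ k : ℕ) + (T : ℕ) / (2 ^ k : ℕ)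
      = ((T + 1 : ℕ) : ℝ≥0∞) / (2 ^ k : ℕ) := by
    intro T
    rw [← ENNReal.add_div, ← Nat.cast_add, add_comm]
  -- The potential is a union bound: one activation tests one key, which equals the relevant uniform
  -- key with probability `1 / 2 ^ k`. After the registration only queries for the second key are
  -- bad, because the row of the first key is then given to the adversary consistently.
  have hop := fun ρ => A.win_hop inp P.q (O₁ := onMessages (rowGame R))
    (O₂ := onMessages (freshRowGame R)) (O := onMessages (lateRowGame R)) _
    (fun e v => RowQuery e (Req.parse v)) (fun T _ => (T : ℕ) / (2 ^ k : ℕ))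
    (fun e v => h e (Req.parse v))
    (fun e v h => rowGame_eq_fresh R e _ h)
    (fun T e v _ => by
      obtain ⟨ρ, _ | s⟩ := e
      · rw [PMF.ev_const, ← hT]
        refine add_le_add_left ?_ _
        simp only [PMF.ev_map]
        cases hr : (Req.parse v : Req P k) with
        | letterHash i κ l =>
          refine (PMF.ev_congr (g := fun a => if κ = a.1.1 then 1 else 0) fun a =>
            if_congr (by simp [RowQuery]) rfl rfl).trans_le ?_
          rw [PMF.ev_uniform_fst fun u : BitString k × BitString k => if κ = u.1 then 1 else 0,
            PMF.ev_uniform_fst fun w : BitString k => if κ = w then 1 else 0]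
          exact (hbad κ).le
        | maskHash i κ l =>
          refine (PMF.ev_congr (g := fun a => if κ = a.1.2 then 1 else 0) fun a =>
            if_congr (by simp [RowQuery]) rfl rfl).trans_le ?_
          rw [PMF.ev_uniform_fst fun u : BitString k × BitString k => if κ = u.2 then 1 else 0,
            PMF.ev_uniform_snd fun w : BitString k => if κ = w then 1 else 0]
          exact (hbad κ).le
        | _ => simp [RowQuery]
      · rw [PMF.ev_const, ← hT]
        refine add_le_add_left ?_ _
        simp only [PMF.ev_map]
        cases hr : (Req.parse v : Req P k) with
        | letterHash i κ l => simp [RowQuery]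
        | maskHash i κ l =>
          refine (PMF.ev_congr (g := fun a => if κ = a then 1 else 0) fun a =>
            if_congr (by simp [RowQuery]) rfl rfl).trans_le ?_
          exact (hbad κ).le
        | _ => simp [RowQuery])
    (fun T e => by gcongr; omega) T (.nat 0) (.nat 0) (ρ, none)
  have hW := fun ρ => A.win_intertwine_game inp _ h T (ρ, none)
  have hΦ : ∀ F : RowState P k → ℝ≥0∞, (PMF.uniformOfFintype (RowState P k)).ev F =
      (PMF.uniformOfFintype (HashFunctions P k)).ev fun ρ =>
        (PMF.uniformOfFintype ((BitString k × BitString k) × LetterTable P × LetterTable P)).ev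
          fun w => F ((ρ, w.1), w.2) := by
    intro F
    rw [PMF.uniform_prod (α := HashFunctions P k × BitString k × BitString k),
      PMF.uniform_prod (α := HashFunctions P k)]
    refine PMF.ev_congr fun ρ => ?_
    rw [PMF.uniform_prod (α := BitString k × BitString k)]
  rw [hΦ, ← PMF.ev_const (PMF.uniformOfFintype (HashFunctions P k)) ((T : ℕ) / (2 ^ k : ℕ)),
    ← PMF.ev_add, ← PMF.ev_add]
  constructor
  · refine PMF.ev_mono fun ρ => ?_
    have := (hop ρ).1
    simp only [PMF.ev_map] at this
    have h2 := hW ρ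
    simp only [PMF.ev_map] at h2
    unfold lateRowGame
    rw [← h2]
    exact this
  · refine PMF.ev_mono fun ρ => ?_
    have := (hop ρ).2
    simp only [PMF.ev_map] at this
    have h2 := hW ρ
    simp only [PMF.ev_map] at h2
    unfold lateRowGame
    rw [← h2]
    exact this

end Rows

/-! ### The ideal game -/

section Ideal

variable {P : Params} {k : ℕ}

/-- The random choices of the ideal registration: the key, the hash values of the letters of the
password, the row for other letters, the exponents for letters that do not occur in the password,
and the polynomial. -/
abbrev Draws (P : Params) (k : ℕ) : Type :=
  BitString k × (Fin P.n → ZMod P.q) × LetterTable P × LetterTable P × Coeffs P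

/-- A table with prescribed values at the letters of a password. -/
def overwrite (p : P.Password) (x : Fin P.n → ZMod P.q) (X : LetterTable P) : LetterTable P :=
  fun i l => if l = p i then x i else X i l

/-- The exponents for the guess `y` in the ideal game. -/
def idealExponents (d : Draws P k) (p y : P.Password) (i : Fin P.n) : ZMod P.q :=
  if y i = p i then d.2.2.2.2.share (d.2.1 i) else d.2.2.2.1 i (y i)

abbrev IdealState (P : Params) (k : ℕ) : Type := Draws P k × P.Password × ℕ

/-- The ideal game with replies `rep`. -/
noncomputable def idealGame (rep : IdealState P k → P.Password → PMF Val) :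
    HashFunctions P k × Option (IdealState P k) → Req P k →
      PMF (Val × (HashFunctions P k × Option (IdealState P k))) :=
  gameOracle
    (fun ρ o r => rowReply ρ (o.map fun s => (s.1.1, overwrite s.2.1 s.1.2.1 s.1.2.2.1)) r)
    (fun _ p => (PMF.uniformOfFintype (Draws P k)).map fun d => (d, p, 0))
    fun _ s b y => bif b then PMF.pure (loginReply (y = s.2.1), s)
      else (rep s y).map fun m => (m, (s.1, s.2.1, s.2.2 + 1))

/-- The replies that hide the password in the requests whose numbers satisfy `R`. -/
noncomputable def idealReply (R : ℕ → Bool) (s : IdealState P k) (y : P.Password) : PMF Val :=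
  replyDist (R s.2.2) s.1.1 s.2.1 s.1.2.2.2.2.secret (idealExponents s.1 s.2.1 y) y

/-- The row of the second key that leads to given exponents. -/
def maskRow (p : P.Password) (X Δ : LetterTable P) (a : Coeffs P) : LetterTable P :=
  fun i l => if l = p i then Δ i l else Δ i l - a.share (X i (p i)) + Δ i (p i)

/-- The map is injective: the entries of `Δ` at the letters of the password are unchanged, and once
they are known the others are only translated. -/
theorem map_uniform_maskRow (p : P.Password) (X : LetterTable P) (a : Coeffs P) :
    (PMF.uniformOfFintype (LetterTable P)).map (fun Δ => maskRow p X Δ a) =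
      PMF.uniformOfFintype (LetterTable P) := by
  refine PMF.map_uniform_of_bijective ((Finite.injective_iff_bijective).1 fun Δ Δ' h => ?_)
  have hp : ∀ i, Δ i (p i) = Δ' i (p i) := by
    intro i
    have := congrFun (congrFun h i) (p i)
    simpa [maskRow] using this
  funext i l
  have := congrFun (congrFun h i) l
  by_cases hl : l = p i
  · rw [hl, hp]
  · simpa [maskRow, hl, hp] using this

/-- Overwriting is a surjective homomorphism of additive groups; the entries of the table at the
letters of the password are discarded. -/
theorem map_uniform_overwrite (p : P.Password) :
    (PMF.uniformOfFintype ((Fin P.n → ZMod P.q) × LetterTable P)).map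
        (fun u => overwrite p u.1 u.2) =
      PMF.uniformOfFintype (LetterTable P) := by
  let π : ((Fin P.n → ZMod P.q) × LetterTable P) →+ LetterTable P :=
    { toFun := fun u => overwrite p u.1 u.2
      map_zero' := by
        funext i l
        simp [overwrite]
      map_add' := by
        intro u w
        funext i l
        simp only [overwrite, Prod.fst_add, Prod.snd_add, Pi.add_apply]
        split_ifs <;> rfl }
  have := PMF.map_uniform_of_surjective π 0 fun X => ⟨(fun i => X i (p i), X), by
    funext i l
    by_cases hl : l = p i
    · simp [π, overwrite, hl]
    · simp [π, overwrite, hl]⟩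
  simpa [π] using this

/-- The row of the second key occurs only in the exponents `α_i - G i (p i) + G i l`. This equals
`α_i` for `l = p i`. For other letters the substitution `maskRow` turns it into `Δ i l`, so these
exponents are independent of each other and of the polynomial. -/
theorem lateRowGame_eq_ideal (A : Prog) (inp : Val) (T : ℕ) (R : ℕ → Bool)
    (ρ : HashFunctions P k) : gameWin P k A inp (lateRowGame R) T (ρ, none) =
      gameWin P k A inp (idealGame (idealReply R)) T (ρ, none) := by
  have h := gameOracle_intertwine (P := P) (k := k) (W₀ := Unit) (W₁ := Unit)
    (hash' := fun (ρ : HashFunctions P k)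
      (o : Option ((BitString k × LetterTable P × LetterTable P) × Account P)) r =>
        rowReply ρ (o.map fun s => (s.1.1, s.1.2.1)) r)
    (reg' := fun _ p => (PMF.uniformOfFintype (BitString k × LetterTable P × LetterTable P)).bind
      fun z => (openAccount p).map fun s => (z, s))
    (serve' := fun _ s b x =>
      (serveAccount R s.1.1 (rowExponents s.1.2.1 s.1.2.2 s.2.2.1 s.2.1) s.2 b x).map
        fun r => (r.1, (s.1, r.2)))
    (hash := fun (ρ : HashFunctions P k) (o : Option (IdealState P k)) r =>
      rowReply ρ (o.map fun s => (s.1.1, overwrite s.2.1 s.1.2.1 s.1.2.2.1)) r)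
    (reg := fun _ p => (PMF.uniformOfFintype (Draws P k)).map fun d => (d, p, 0))
    (serve := fun _ s b y => bif b then PMF.pure (loginReply (y = s.2.1), s)
      else (idealReply R s y).map fun m => (m, (s.1, s.2.1, s.2.2 + 1)))
    (PMF.pure ()) (fun ρ _ => ρ) (fun _ _ => PMF.pure ())
    (fun ρ s _ => (ρ, ((s.1.1, overwrite s.2.1 s.1.2.1 s.1.2.2.1,
      maskRow s.2.1 (overwrite s.2.1 s.1.2.1 s.1.2.2.1) s.1.2.2.2.1 s.1.2.2.2.2),
      (s.2.1, s.1.2.2.2.2, s.2.2))))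
    (fun _ _ _ => rfl) (fun _ _ _ _ => rfl)
    (by
      intro e p
      refine PMF.ext_ev fun f => ?_
      simp only [openAccount, PMF.ev_bind, PMF.ev_map, PMF.ev_pure]
      simp only [PMF.uniform_prod]
      refine PMF.ev_congr fun v₁ => ?_
      have hX : ∀ F : LetterTable P → ℝ≥0∞, (PMF.uniformOfFintype (LetterTable P)).ev F =
          (PMF.uniformOfFintype (Fin P.n → ZMod P.q)).ev fun x =>
            (PMF.uniformOfFintype (LetterTable P)).ev fun X => F (overwrite p x X) := by
        intro F
        conv_lhs => rw [← map_uniform_overwrite p, PMF.ev_map, PMF.uniform_prod]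
      conv_lhs => rw [hX]
      refine PMF.ev_congr fun x => PMF.ev_congr fun X => ?_
      -- The substitution depends on the polynomial, so the polynomial is drawn before the table.
      rw [PMF.ev_comm]
      conv_rhs => rw [PMF.ev_comm]
      refine PMF.ev_congr fun a => ?_
      conv_lhs => rw [← map_uniform_maskRow p (overwrite p x X) a, PMF.ev_map])
    (by
      intro e s b y
      refine PMF.ext_ev fun f => ?_
      have : rowExponents (overwrite s.2.1 s.1.2.1 s.1.2.2.1)
          (maskRow s.2.1 (overwrite s.2.1 s.1.2.1 s.1.2.2.1) s.1.2.2.2.1 s.1.2.2.2.2)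
          s.1.2.2.2.2 s.2.1 y = idealExponents s.1 s.2.1 y := by
        funext i
        by_cases hy : y i = s.2.1 i <;> simp [rowExponents, idealExponents, maskRow, overwrite, hy]
      cases b <;> simp [serveAccount, idealReply, this])
  have := A.win_intertwine_game inp _ h T (ρ, none)
  simp only [PMF.ev_map, PMF.ev_pure] at this
  exact this

end Ideal

/-! ### Interpolation -/

section Hybrid

variable {P : Params} {k : ℕ}

/-- Fewer than `t` values of a sharing polynomial at distinct nonzero points and its constant
coefficient can be prescribed. -/
theorem exists_coeffs (x u : Fin P.n → ZMod P.q) (w : ZMod P.q) (S : Finset (Fin P.n))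
    (hS : S.card < P.t) (hx : Function.Injective x) (hx0 : ∀ i, x i ≠ 0) :
    ∃ a : Coeffs P, a.secret = w ∧ ∀ i ∈ S, a.share (x i) = u i := by
  classical
  -- The additional node `none` is the point `0`, where the value is the secret. There are `S.card +
  -- 1 ≤ t` nodes, which is what the degree bound allows.
  let nodes : Option (Fin P.n) → ZMod P.q := fun o => o.elim 0 x
  let vals : Option (Fin P.n) → ZMod P.q := fun o => o.elim w u
  have hinj : Set.InjOn nodes (Finset.insertNone S) := by
    rintro (_ | i) _ (_ | j) _ h
    · rfl
    · exact absurd h.symm (hx0 j)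
    · exact absurd h (hx0 i)
    · exact congrArg some (hx h)
  let f := Lagrange.interpolate (Finset.insertNone S) nodes vals
  have hdeg : f.natDegree < P.t := by
    by_cases hf : f = 0
    · rw [hf]
      exact P.t_pos
    · have h1 : f.degree < _ := Lagrange.degree_interpolate_lt vals hinj
      rw [Polynomial.degree_eq_natDegree hf, Finset.card_insertNone] at h1
      have : f.natDegree < S.card + 1 := by exact_mod_cast h1
      omega
  have heval : ∀ z, Coeffs.share (P := P) (fun j => f.coeff j) z = f.eval z := by
    intro z
    rw [Polynomial.eval_eq_sum_range' hdeg, Coeffs.share,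
      Fin.sum_univ_eq_sum_range fun j => f.coeff j * z ^ j]
  refine ⟨fun j => f.coeff j, ?_, fun i hi => ?_⟩
  · have := Lagrange.eval_interpolate_at_node vals hinj (i := none) (by simp)
    rw [Coeffs.secret, Polynomial.coeff_zero_eq_eval_zero]
    exact this
  · rw [heval]
    exact Lagrange.eval_interpolate_at_node vals hinj (i := some i) (by simpa using hi)

/-! ### Replies from a Diffie-Hellman instance -/

/-- A random exponent and a random vector of exponents, which are used in one reply. -/
abbrev Mask (P : Params) : Type := ZMod P.q × Coeffs P × LetterTable P

/-- The exponents that belong to a vector. -/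
def maskExponents (x : Fin P.n → ZMod P.q) (p y : P.Password) (a : Coeffs P) (Δ : LetterTable P)
    (i : Fin P.n) : ZMod P.q :=
  if y i = p i then a.share (x i) else Δ i (y i)

/-- The honest reply with `δ` times the mask added to the exponents. -/
def maskedReply (δ : ZMod P.q) (θ : Mask P) (s : IdealState P k) (y : P.Password) : Val :=
  expMessage s.1.1 s.1.2.2.2.2.secret θ.1
    (P.encode s.2.1 * P.pow P.g (s.1.2.2.2.2.secret * θ.1 + δ * θ.2.1.secret))
    fun i => θ.1 * idealExponents s.1 s.2.1 y i +
      δ * maskExponents s.1.2.1 s.2.1 y θ.2.1 θ.2.2 i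

/-- Hash values at which a sharing polynomial can be interpolated, also at `0`. -/
def GoodNodes (x : Fin P.n → ZMod P.q) : Prop := Function.Injective x ∧ ∀ i, x i ≠ 0

theorem Coeffs.share_add (a b : Coeffs P) (x : ZMod P.q) :
    Coeffs.share (a + b) x = a.share x + b.share x := by
  simp [Coeffs.share, add_mul, Finset.sum_add_distrib]

/-- The exponents of the reply are an affine function of the mask. The positions where the guess is
right number fewer than `t`, so interpolation prescribes the share there along with the secret, and
the remaining positions have free table entries. Hence the linear part is onto and the image of the
uniform distribution is uniform. -/
theorem maskedReply_uniform {δ : ZMod P.q} (hδ : δ ≠ 0) (s : IdealState P k) (y : P.Password)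
    (hy : ¬ P.Matches y s.2.1) (hx : GoodNodes s.1.2.1) :
    ((PMF.uniformOfFintype (Mask P)).map fun θ => maskedReply δ θ s y) =
      replyDist true s.1.1 s.2.1 s.1.2.2.2.2.secret (idealExponents s.1 s.2.1 y) y := by
  obtain ⟨d, p, c⟩ := s
  -- The encoded password is a power of the generator, so it only contributes a translation of one
  -- exponent.
  obtain ⟨ep, hep⟩ := P.exists_pow (P.encode_mem p)
  let β := idealExponents d p y
  let π : Mask P →+ ZMod P.q × ZMod P.q × (Fin P.n → ZMod P.q) :=
    { toFun := fun θ => (θ.1, d.2.2.2.2.secret * θ.1 + δ * θ.2.1.secret,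
        fun i => θ.1 * β i + δ * maskExponents d.2.1 p y θ.2.1 θ.2.2 i)
      map_zero' := by
        simp only [Coeffs.secret, maskExponents, Coeffs.share]
        ext <;> simp
      map_add' := by
        intro θ η
        refine Prod.ext rfl (Prod.ext ?_ (funext fun i => ?_))
        · simp only [Coeffs.secret, Prod.fst_add, Prod.snd_add, Pi.add_apply]
          ring
        · simp only [maskExponents, Prod.fst_add, Prod.snd_add, Pi.add_apply, Coeffs.share_add]
          split_ifs <;> ring }
  -- A given target is reached by solving for the mask, which is possible because `δ` is invertible;
  -- the honest part `s * β i` is subtracted first.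
  have hπ : Function.Surjective π := by
    rintro ⟨s, w, u⟩
    obtain ⟨a, ha, ha'⟩ := exists_coeffs d.2.1 (fun i => δ⁻¹ * (u i - s * β i))
      (δ⁻¹ * (w - d.2.2.2.2.secret * s)) (Finset.univ.filter fun i => y i = p i)
      (not_le.1 hy) hx.1 hx.2
    refine ⟨(s, a, fun i _ => δ⁻¹ * (u i - s * β i)), ?_⟩
    refine Prod.ext rfl (Prod.ext ?_ (funext fun i => ?_))
    · simp [π, ha, hδ]
    · have : maskExponents d.2.1 p y a (fun i _ => δ⁻¹ * (u i - s * β i)) i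
          = δ⁻¹ * (u i - s * β i) := by
        unfold maskExponents
        split_ifs with hi
        · exact ha' i (by simpa using hi)
        · rfl
      simp [π, this, hδ]
  refine PMF.map_uniform_congr _ (PMF.map_uniform_of_surjective π (0, ep, 0) hπ) fun θ => ?_
  have hy' : ¬ P.Matches y p := hy
  simp only [hy', not_false_eq_true, and_self, if_true]
  simp only [maskedReply, ← hep, ← P.pow_add, π, AddMonoidHom.coe_mk, ZeroHom.coe_mk,
    Prod.mk_add_mk, add_zero, β]
  rw [add_comm ep]

/-! ### The hybrid games -/

/-- The recovery requests with numbers below `J`. -/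
def below (J : ℕ) : ℕ → Bool := fun c => decide (c < J)

/-- Whether a request is answered with the mask. -/
def UsesMask (J : ℕ) (s : IdealState P k) (y : P.Password) : Prop :=
  s.2.2 = J ∧ ¬ P.Matches y s.2.1

instance (J : ℕ) (s : IdealState P k) (y : P.Password) : Decidable (UsesMask J s y) :=
  inferInstanceAs (Decidable (_ ∧ _))

/-- The replies of the game in which the mask is fixed in advance. -/
noncomputable def fixedMaskReply (J : ℕ) (δ : ZMod P.q) (θ : Mask P) (s : IdealState P k)
    (y : P.Password) : PMF Val :=
  if UsesMask J s y then PMF.pure (maskedReply δ θ s y) else idealReply (below J) s y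

/-- The replies of the game in which the mask is drawn when it is used. -/
noncomputable def freshMaskReply (J : ℕ) (δ : ZMod P.q) (s : IdealState P k) (y : P.Password) :
    PMF Val :=
  if UsesMask J s y then (PMF.uniformOfFintype (Mask P)).map fun θ => maskedReply δ θ s y
  else idealReply (below J) s y

/-- With `δ = 0` the mask disappears and only its first component, the randomness of an honest
reply, is left. The request number `J` is not below `J`, so the ideal reply is honest as well. -/
theorem freshMaskReply_zero (J : ℕ) :
    freshMaskReply (P := P) (k := k) J 0 = idealReply (below J) := by
  funext s y
  unfold freshMaskReply
  split_ifs with h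
  · unfold idealReply
    rw [replyDist_of_not _ _ _ _ _ _ (by simp [below, h.1])]
    refine PMF.map_uniform_congr Prod.fst PMF.map_uniform_fst fun θ => ?_
    simp [maskedReply, honestReply]
  · rfl

/-- A mask with a nonzero factor makes the reply number `J` uniform if there is no match; all other
replies are the same for `below J` and `below (J + 1)`. -/
theorem freshMaskReply_of_good {δ : ZMod P.q} (hδ : δ ≠ 0) (J : ℕ) (s : IdealState P k)
    (y : P.Password) (hx : GoodNodes s.1.2.1) :
    freshMaskReply J δ s y = idealReply (below (J + 1)) s y := by
  unfold freshMaskReply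
  split_ifs with h
  · rw [maskedReply_uniform hδ s y h.2 hx, idealReply]
    simp [below, h.1]
  · unfold idealReply
    by_cases hm : P.Matches y s.2.1
    · rw [replyDist_of_not _ _ _ _ _ _ (by simp [hm]), replyDist_of_not _ _ _ _ _ _ (by simp [hm])]
    · have : s.2.2 ≠ J := fun hJ => h ⟨hJ, hm⟩
      have : below J s.2.2 = below (J + 1) s.2.2 := by
        simp only [below, decide_eq_decide]
        omega
      rw [this]

/-- A union bound: `n` events that a value is zero and at most `n * n` events that two values agree,
each of probability `1 / q` (or zero on the diagonal). -/
theorem ev_not_goodNodes [DecidablePred fun x : Fin P.n → ZMod P.q => GoodNodes x] :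
    ((PMF.uniformOfFintype (Fin P.n → ZMod P.q)).ev fun x => if GoodNodes x then 0 else 1) ≤
      (P.n + P.n * P.n : ℕ) / (P.q : ℕ) := by
  classical
  have hcard : Fintype.card (ZMod P.q) = P.q := ZMod.card P.q
  have hle : ∀ x : Fin P.n → ZMod P.q, (if GoodNodes x then (0 : ℝ≥0∞) else 1) ≤
      (∑ i, if x i = 0 then 1 else 0) + ∑ i, ∑ j, if i = j then 0 else if x i = x j then 1 else 0 := by
    intro x
    split_ifs with hx
    · exact zero_le
    · by_cases h0 : ∀ i, x i ≠ 0
      · have : ¬ Function.Injective x := fun hi => hx ⟨hi, h0⟩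
        simp only [Function.Injective, not_forall] at this
        obtain ⟨i, j, hij, hne⟩ := this
        refine le_trans ?_ le_add_self
        refine le_trans ?_ (Finset.single_le_sum (fun _ _ => zero_le) (Finset.mem_univ i))
        refine le_trans ?_ (Finset.single_le_sum (fun _ _ => zero_le) (Finset.mem_univ j))
        simp [hne, hij]
      · push Not at h0
        obtain ⟨i, hi⟩ := h0
        refine le_trans ?_ le_self_add
        refine le_trans ?_ (Finset.single_le_sum (fun _ _ => zero_le) (Finset.mem_univ i))
        simp [hi]
  have hsum : ∀ (s : Finset (Fin P.n)) (F : Fin P.n → (Fin P.n → ZMod P.q) → ℝ≥0∞) (c : ℝ≥0∞),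
      (∀ i, (PMF.uniformOfFintype (Fin P.n → ZMod P.q)).ev (F i) ≤ c) →
      (PMF.uniformOfFintype (Fin P.n → ZMod P.q)).ev (fun x => ∑ i ∈ s, F i x) ≤ s.card * c := by
    intro s F c hF
    induction s using Finset.induction_on with
    | empty => simp
    | insert i s hi ih =>
      simp only [Finset.sum_insert hi]
      rw [PMF.ev_add, Finset.card_insert_of_notMem hi, Nat.cast_add, add_mul, add_comm]
      gcongr
      simpa using hF i
  refine (PMF.ev_mono hle).trans ?_
  rw [PMF.ev_add]
  have h1 := hsum Finset.univ (fun i x => if x i = 0 then 1 else 0) (1 / P.q) fun i => by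
    rw [PMF.ev_uniform_hit i (fun _ => 0) fun _ _ _ => rfl, hcard]
  have h2 := hsum Finset.univ (fun i x => ∑ j, if i = j then 0 else if x i = x j then 1 else 0)
    ((Finset.univ : Finset (Fin P.n)).card * (1 / P.q)) fun i => hsum _ _ _ fun j => by
      by_cases hij : i = j
      · simp [hij]
      · simp only [hij, if_false]
        rw [PMF.ev_uniform_hit i (fun x => x j) fun F G h => h j (Ne.symm hij), hcard]
  refine (add_le_add h1 h2).trans_eq ?_
  simp only [Finset.card_univ, Fintype.card_fin]
  push_cast
  rw [ENNReal.div_eq_inv_mul, ENNReal.div_eq_inv_mul]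
  ring

/-- With a nonzero factor, a fresh mask hides the password in one more request. -/
theorem freshMask_hop {δ : ZMod P.q} (hδ : δ ≠ 0) (A : Prog) (inp : Val) (T J : ℕ)
    (ρ : HashFunctions P k) :
    (gameWin P k A inp (idealGame (freshMaskReply J δ)) T (ρ, none) ≤
      gameWin P k A inp (idealGame (idealReply (below (J + 1)))) T (ρ, none) +
        (P.n + P.n * P.n : ℕ) / (P.q : ℕ)) ∧
    gameWin P k A inp (idealGame (idealReply (below (J + 1)))) T (ρ, none) ≤
      gameWin P k A inp (idealGame (freshMaskReply J δ)) T (ρ, none) +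
        (P.n + P.n * P.n : ℕ) / (P.q : ℕ) := by
  classical
  let G := idealGame (P := P) (k := k) (idealReply (below (J + 1)))
  let bad : HashFunctions P k × Option (IdealState P k) → Val → Prop :=
    fun e _ => ∃ s, e.2 = some s ∧ ¬ GoodNodes s.1.2.1
  -- Before the registration the potential is the bound for the probability of bad nodes. The
  -- registration decides whether they are bad, and the potential becomes `0` or `1` for good.
  let L : ℕ → HashFunctions P k × Option (IdealState P k) → ℝ≥0∞ := fun _ e => match e.2 with
    | none => (P.n + P.n * P.n : ℕ) / (P.q : ℕ)
    | some s => if GoodNodes s.1.2.1 then 0 else 1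
  have hop := A.win_hop inp P.q (O₁ := onMessages (idealGame (freshMaskReply J δ)))
    (O₂ := onMessages G) (O := onMessages G) (fun e => PMF.pure e) bad L
    (fun e v => by
      refine PMF.ext_ev fun f => ?_
      simp)
    (fun e v hb => by
      obtain ⟨ρ, _ | s⟩ := e
      · unfold onMessages
        cases (Req.parse v : Req P k) <;> rfl
      · have hg : GoodNodes s.1.2.1 := by
          by_contra hg
          exact hb ⟨s, rfl, hg⟩
        unfold onMessages
        cases (Req.parse v : Req P k) with
        | ask b y => simp [G, idealGame, gameOracle, freshMaskReply_of_good hδ J s y hg]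
        | _ => rfl)
    (fun T e v hlt => by
      obtain ⟨ρ, _ | s⟩ := e
      · have hb : ¬ bad (ρ, none) v := by
          rintro ⟨s, hs, -⟩
          cases hs
        simp only [PMF.ev_pure, hb, if_false, zero_add]
        unfold onMessages
        cases (Req.parse v : Req P k) with
        | register p =>
          simp only [G, idealGame, gameOracle, PMF.ev_map, L]
          rw [PMF.ev_uniform_snd fun u : (Fin P.n → ZMod P.q) × LetterTable P × LetterTable P ×
            Coeffs P => if GoodNodes u.1 then 0 else 1, PMF.ev_uniform_fst fun x :
            Fin P.n → ZMod P.q => if GoodNodes x then 0 else 1]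
          exact ev_not_goodNodes
        | _ => simp [G, idealGame, gameOracle, L]
      · have hg : GoodNodes s.1.2.1 := by
          by_contra hg
          simp [L, hg] at hlt
        have hb : ¬ bad (ρ, some s) v := by
          rintro ⟨s', hs', h⟩
          cases hs'
          exact h hg
        simp only [PMF.ev_pure, hb, if_false, zero_add]
        unfold onMessages
        cases (Req.parse v : Req P k) with
        | ask b y => cases b <;> simp [G, idealGame, gameOracle, L, hg]
        | _ => simp [G, idealGame, gameOracle, L, hg])
    (fun T e => le_rfl) T (.nat 0) (.nat 0) (ρ, none)
  simpa only [PMF.ev_pure] using hop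

/-- Only the requests that can occur matter. -/
theorem idealGame_congr (A : Prog) (inp : Val) (T : ℕ) (R R' : ℕ → Bool)
    (h : ∀ c < T, R c = R' c) (ρ : HashFunctions P k) :
    gameWin P k A inp (idealGame (idealReply R)) T (ρ, none) =
      gameWin P k A inp (idealGame (idealReply R')) T (ρ, none) := by
  classical
  let G := idealGame (P := P) (k := k) (idealReply R')
  let count : HashFunctions P k × Option (IdealState P k) → ℕ := fun e => e.2.elim 0 fun s => s.2.2
  have hop := A.win_hop inp P.q (O₁ := onMessages (idealGame (idealReply R)))
    (O₂ := onMessages G) (O := onMessages G) (fun e => PMF.pure e)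
    -- Each activation raises the number of recoveries by at most one. From the initial state, the
    -- potential stays `0` for as long as activations remain, and the bad event is out of reach.
    (fun e _ => T ≤ count e) (fun T' e => if count e + T' ≤ T then 0 else 1)
    (fun e v => by
      refine PMF.ext_ev fun f => ?_
      simp)
    (fun e v hb => by
      obtain ⟨ρ, _ | s⟩ := e
      · unfold onMessages
        cases (Req.parse v : Req P k) <;> rfl
      · have hR : R s.2.2 = R' s.2.2 := h _ (not_le.1 hb)
        unfold onMessages
        cases (Req.parse v : Req P k) with
        | ask b y => simp [G, idealGame, gameOracle, idealReply, hR]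
        | _ => rfl)
    (fun T' e v hlt => by
      have hc : count e + (T' + 1) ≤ T := by
        by_contra hc
        simp [hc] at hlt
      have hb : ¬ T ≤ count e := by omega
      have h0 : ∀ e' : HashFunctions P k × Option (IdealState P k), count e' ≤ count e + 1 →
          (if count e' + T' ≤ T then (0 : ℝ≥0∞) else 1) = 0 := by
        intro e' he'
        rw [if_pos (by omega)]
      simp only [PMF.ev_pure, hb, hc, if_false, if_true, zero_add]
      refine le_of_eq ?_
      obtain ⟨ρ, _ | s⟩ := e
      · unfold onMessages
        cases (Req.parse v : Req P k) with
        | register p =>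
          simp only [G, idealGame, gameOracle, PMF.ev_map]
          exact (PMF.ev_congr (g := fun _ => 0) fun d => h0 (ρ, some (d, p, 0))
            (by simp [count])).trans (PMF.ev_const _ _)
        | _ => simp only [G, idealGame, gameOracle, PMF.ev_pure]; exact h0 _ (by simp [count])
      · unfold onMessages
        cases (Req.parse v : Req P k) with
        | ask b y =>
          cases b
          · simp only [G, idealGame, gameOracle, PMF.ev_map, cond_false]
            exact (PMF.ev_congr (g := fun _ => 0) fun d => h0
              (ρ, some (s.1, s.2.1, s.2.2 + 1)) (by simp [count])).trans (PMF.ev_const _ _)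
          · simp only [G, idealGame, gameOracle, PMF.ev_map, PMF.ev_pure, cond_true]
            exact h0 _ (by simp [count])
        | _ => simp only [G, idealGame, gameOracle, PMF.ev_pure]; exact h0 _ (by simp [count]))
    (fun T' e => by split_ifs <;> first | exact le_rfl | exact zero_le | omega)
    T (.nat 0) (.nat 0) (ρ, none)
  simp only [PMF.ev_pure, count, Option.elim_none, zero_add, le_refl, if_true, add_zero] at hop
  exact le_antisymm hop.1 hop.2

/-- The mask may be fixed in advance. -/
theorem fixedMask_eq_fresh (A : Prog) (inp : Val) (T J : ℕ) (δ : ZMod P.q)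
    (ρ : HashFunctions P k) :
    ((PMF.uniformOfFintype (Mask P)).ev fun θ =>
      gameWin P k A inp (idealGame (fixedMaskReply J δ θ)) T (ρ, none)) =
      gameWin P k A inp (idealGame (freshMaskReply J δ)) T (ρ, none) := by
  refine (A.win_of_single_use inp P.q (PMF.uniformOfFintype (Mask P))
    (O := onMessages (idealGame (freshMaskReply J δ)))
    (O' := fun θ => onMessages (idealGame (fixedMaskReply J δ θ)))
    -- The mask enters only the request number `J`, and the counter exceeds `J` as soon as that
    -- request has been answered.
    (fun e => ∃ s, e.2 = some s ∧ J < s.2.2) ?_ ?_ ?_ T (.nat 0) (.nat 0) (ρ, none)).2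
  · rintro ⟨ρ, o⟩ v ⟨s, hs, hJ⟩ θ
    simp only at hs
    subst hs
    unfold onMessages
    cases (Req.parse v : Req P k) with
    | ask b y =>
      have : ¬ UsesMask J s y := fun h => by
        have := h.1
        omega
      simp [idealGame, gameOracle, fixedMaskReply, freshMaskReply, this]
    | _ => rfl
  · rintro ⟨ρ, o⟩ v ⟨s, hs, hJ⟩ r hr
    simp only at hs
    subst hs
    unfold onMessages at hr
    cases hv : (Req.parse v : Req P k) with
    | ask b y =>
      rw [hv] at hr
      cases b
      · simp only [idealGame, gameOracle, cond_false, PMF.support_map, Set.mem_image] at hr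
        obtain ⟨_, ⟨_, _, rfl⟩, rfl⟩ := hr
        exact ⟨_, rfl, by simp; omega⟩
      · simp only [idealGame, gameOracle, cond_true, PMF.pure_map, PMF.support_pure,
          Set.mem_singleton_iff] at hr
        subst hr
        exact ⟨_, rfl, hJ⟩
    | _ =>
      rw [hv] at hr
      simp only [idealGame, gameOracle, PMF.support_pure, Set.mem_singleton_iff] at hr
      subst hr
      exact ⟨_, rfl, hJ⟩
  · rintro ⟨ρ, o⟩ v -
    unfold onMessages
    cases o with
    | none =>
      left
      intro θ
      cases (Req.parse v : Req P k) <;> rfl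
    | some s =>
      cases (Req.parse v : Req P k) with
      | ask b y =>
        cases b
        · by_cases hm : UsesMask J s y
          · right
            constructor
            · refine PMF.ext_ev fun f => ?_
              simp [idealGame, gameOracle, fixedMaskReply, freshMaskReply, hm]
            · intro θ r hr
              simp only [idealGame, gameOracle, fixedMaskReply, hm, if_true, cond_false,
                PMF.pure_map, PMF.support_pure, Set.mem_singleton_iff] at hr
              subst hr
              exact ⟨_, rfl, by simp [hm.1]⟩
          · left
            intro θ
            simp [idealGame, gameOracle, fixedMaskReply, freshMaskReply, hm]
        · left
          intro θ
          rfl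
      | _ =>
        left
        intro θ
        rfl

end Hybrid

/-! ### Polynomial bounds -/

theorem polyBound_mono (c : ℕ) {a b : ℕ} (h : a ≤ b) : polyBound c a ≤ polyBound c b :=
  Nat.add_le_add_right (Nat.pow_le_pow_left h c) c

/-- The base `k + 2` is at least `2`, so constants and sums can be absorbed into the exponent
without exceptions for small `k`. The closure properties of `PolyBounded` are proved in this form.
-/
theorem polyBound_le_pow (c k : ℕ) : polyBound c k ≤ (k + 2) ^ (c + 1) := by
  have h1 : k ^ c ≤ (k + 2) ^ c := Nat.pow_le_pow_left (by omega) c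
  have h2 : c ≤ (k + 2) ^ c :=
    (Nat.lt_two_pow_self (n := c)).le.trans (Nat.pow_le_pow_left (by omega) c)
  calc k ^ c + c ≤ (k + 2) ^ c * 2 := by omega
    _ ≤ (k + 2) ^ (c + 1) := by
      rw [pow_succ]
      exact Nat.mul_le_mul_left _ (by omega)

theorem pow_le_polyBound (c k : ℕ) : (k + 2) ^ c ≤ polyBound (2 * c + 3 ^ c) k := by
  unfold polyBound
  rcases Nat.lt_or_ge k 2 with hk | hk
  · have : (k + 2) ^ c ≤ 3 ^ c := Nat.pow_le_pow_left (by omega) c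
    exact this.trans ((Nat.le_add_left _ _).trans (Nat.le_add_left _ _))
  -- The bound `k + 2 ≤ k ^ 2` holds from `k = 2` on; the summand `3 ^ c` of the exponent takes care
  -- of `k ≤ 1`.
  · have h1 : (k + 2) ^ c ≤ (k ^ 2) ^ c := Nat.pow_le_pow_left (by nlinarith) c
    rw [← pow_mul] at h1
    have h2 : k ^ (2 * c) ≤ k ^ (2 * c + 3 ^ c) := Nat.pow_le_pow_right (by omega) (Nat.le_add_right _ _)
    exact (h1.trans h2).trans (Nat.le_add_right _ _)

namespace PolyBounded

variable {f g : ℕ → ℕ}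

theorem iff_pow : PolyBounded f ↔ ∃ c, ∀ k, f k ≤ (k + 2) ^ c :=
  ⟨fun ⟨c, hc⟩ => ⟨c + 1, fun k => (hc k).trans (polyBound_le_pow c k)⟩,
    fun ⟨c, hc⟩ => ⟨_, fun k => (hc k).trans (pow_le_polyBound c k)⟩⟩

theorem mono (hg : PolyBounded g) (h : ∀ k, f k ≤ g k) : PolyBounded f :=
  hg.imp fun _ hc k => (h k).trans (hc k)

theorem id : PolyBounded fun k => k :=
  ⟨1, fun k => by simp [polyBound]⟩

theorem const (a : ℕ) : PolyBounded fun _ => a :=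
  ⟨a, fun k => by simp [polyBound]⟩

theorem mul (hf : PolyBounded f) (hg : PolyBounded g) : PolyBounded fun k => f k * g k := by
  obtain ⟨c, hc⟩ := iff_pow.1 hf
  obtain ⟨d, hd⟩ := iff_pow.1 hg
  exact iff_pow.2 ⟨c + d, fun k => by
    rw [pow_add]
    exact Nat.mul_le_mul (hc k) (hd k)⟩

theorem add (hf : PolyBounded f) (hg : PolyBounded g) : PolyBounded fun k => f k + g k := by
  obtain ⟨c, hc⟩ := iff_pow.1 hf
  obtain ⟨d, hd⟩ := iff_pow.1 hg
  refine iff_pow.2 ⟨max c d + 1, fun k => ?_⟩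
  have h1 := (hc k).trans (Nat.pow_le_pow_right (by omega : 0 < k + 2) (le_max_left c d))
  have h2 := (hd k).trans (Nat.pow_le_pow_right (by omega : 0 < k + 2) (le_max_right c d))
  calc f k + g k ≤ (k + 2) ^ max c d * 2 := by omega
    _ ≤ (k + 2) ^ (max c d + 1) := by
      rw [pow_succ]
      exact Nat.mul_le_mul_left _ (by omega)

theorem pow (hf : PolyBounded f) (c : ℕ) : PolyBounded fun k => f k ^ c := by
  induction c with
  | zero => simpa using const 1
  | succ c ih => simpa only [pow_succ] using ih.mul hf

theorem polyBound (c : ℕ) (hf : PolyBounded f) : PolyBounded fun k => polyBound c (f k) :=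
  (hf.pow c).add (const c)

theorem comp (hf : PolyBounded f) (hg : PolyBounded g) : PolyBounded fun k => f (g k) := by
  obtain ⟨c, hc⟩ := hf
  exact (polyBound c hg).mono fun k => hc (g k)

end PolyBounded

/-! ### Sizes and costs -/

namespace Val

theorem one_le_size (v : Val) : 1 ≤ v.size := by
  cases v <;> simp [size]

theorem size_fst_le (v : Val) : v.fst.size ≤ v.size := by
  cases v with
  | nat a => simp [fst, size]
  | pair u v =>
    simp only [fst, size]
    omega

theorem size_snd_le (v : Val) : v.snd.size ≤ v.size := by
  cases v with
  | nat a => simp [snd, size]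
  | pair u v =>
    simp only [snd, size]
    omega

end Val

namespace Prog

/-- Reading the input is always paid for. Consequently, bounds on running times also bound the sizes
of public parameters and auxiliary inputs. -/
theorem size_le_cost (p : Prog) (v : Val) : v.size ≤ p.cost v := by
  induction p generalizing v with
  | pair f e hf he =>
    have := hf v
    simp only [cost]
    omega
  | comp f e hf he =>
    have := he v
    simp only [cost]
    omega
  | branch c f e hc hf he =>
    have := hc v
    simp only [cost]
    omega
  | loop f hf =>
    simp only [cost]
    omega
  | _ => simp [cost]

/-- Writing the result is paid for too, so bounds on costs propagate through compositions of
programs. -/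
theorem size_eval_le_cost (p : Prog) (v : Val) : (p.eval v).size ≤ p.cost v := by
  induction p generalizing v with
  | pair f e hf he =>
    have h1 := hf v
    have h2 := he v
    simp only [cost, eval, Val.size]
    omega
  | comp f e hf he =>
    have := hf (e.eval v)
    simp only [cost, eval]
    omega
  | branch c f e hc hf he =>
    simp only [cost, eval]
    split
    · have := he v
      omega
    · have := hf v
      omega
  | loop f hf =>
    simp only [cost, eval]
    rcases h : v.fst.toNat with _ | n
    · have := v.size_snd_le
      simp
      omega
    · rw [Function.iterate_succ_apply', Finset.sum_range_succ]
      have := hf (f.eval^[n] v.snd)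
      omega
  | _ => simp [cost, eval]

end Prog

theorem Nat.size_le_self' (n : ℕ) : Nat.size n ≤ n :=
  Nat.size_le.2 Nat.lt_two_pow_self

/-! ### Functions computable in polynomial time -/

/-- Types whose elements are represented by values. -/
class Coded (α : Type) where
  code : α → Val

open Coded

section

variable {α β γ σ : Type}

instance : Coded Val := ⟨id⟩

instance : Coded ℕ := ⟨Val.nat⟩

instance [Coded α] [Coded β] : Coded (α × β) := ⟨fun x => .pair (code x.1) (code x.2)⟩

instance [Coded α] : Coded (List α) := ⟨fun l => .ofList (l.map code)⟩

/-- Like the empty list, `none` is represented by `nat 0`. This is the initial memory of a machine,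
and `isPair` separates the two cases. -/
instance [Coded α] : Coded (Option α) := ⟨fun o => o.elim (.nat 0) fun a => .pair (.nat 0) (code a)⟩

/-- The size of the representation. -/
def csize [Coded α] (a : α) : ℕ := (code a).size

section Csize

variable [Coded α] [Coded β]

theorem one_le_csize (a : α) : 1 ≤ csize a := Val.one_le_size _

@[simp] theorem csize_prod (a : α) (b : β) : csize (a, b) = csize a + csize b + 1 := rfl

@[simp] theorem csize_nat (n : ℕ) : csize n = Nat.size n + 1 := rfl

@[simp] theorem csize_nil : csize ([] : List α) = 1 := rfl

@[simp] theorem csize_cons (a : α) (l : List α) : csize (a :: l) = csize a + csize l + 1 := rfl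

@[simp] theorem csize_none : csize (none : Option α) = 1 := rfl

@[simp] theorem csize_some (a : α) : csize (some a) = csize a + 2 := by
  simp [csize, code, Val.size]
  omega

theorem length_lt_csize (l : List α) : l.length < csize l := by
  induction l with
  | nil => simp
  | cons a l ih =>
    simp only [List.length_cons, csize_cons]
    omega

theorem csize_append (l₁ l₂ : List α) : csize (l₁ ++ l₂) + 1 = csize l₁ + csize l₂ := by
  induction l₁ with
  | nil => simp [add_comm]
  | cons a l ih =>
    simp only [List.cons_append, csize_cons]
    omega

theorem csize_reverse (l : List α) : csize l.reverse = csize l := by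
  induction l with
  | nil => rfl
  | cons a l ih =>
    have := csize_append l.reverse [a]
    simp only [List.reverse_cons, csize_cons, csize_nil] at *
    omega

theorem csize_le_of_mem {a : α} {l : List α} (h : a ∈ l) : csize a ≤ csize l := by
  induction l with
  | nil => simp at h
  | cons b l ih =>
    rcases List.mem_cons.1 h with rfl | h
    · simp only [csize_cons]
      omega
    · have := ih h
      simp only [csize_cons]
      omega

theorem csize_le_of_forall {l : List α} {m : ℕ} (h : ∀ a ∈ l, csize a ≤ m) :
    csize l ≤ l.length * (m + 1) + 1 := by
  induction l with
  | nil => simp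
  | cons a l ih =>
    have h1 := h a (by simp)
    have h2 := ih fun b hb => h b (by simp [hb])
    simp only [csize_cons, List.length_cons, Nat.add_mul]
    omega

theorem csize_drop_le (l : List α) (i : ℕ) : csize (l.drop i) ≤ csize l := by
  induction l generalizing i with
  | nil => simp
  | cons a l ih =>
    cases i with
    | zero => simp
    | succ i =>
      have := ih i
      simp only [List.drop_succ_cons, csize_cons]
      omega

theorem csize_take_le (l : List α) (i : ℕ) : csize (l.take i) ≤ csize l := by
  have := csize_append (l.take i) (l.drop i)
  rw [List.take_append_drop] at this
  have := one_le_csize (l.drop i)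
  omega

end Csize

/-- Functions that a program computes in time polynomial in the size of the input. -/
@[fun_prop]
def PolyTime [Coded α] [Coded β] (f : α → β) : Prop :=
  ∃ (p : Prog) (c : ℕ), ∀ a : α, p.eval (code a) = code (f a) ∧ p.cost (code a) ≤ polyBound c (csize a)

namespace PolyTime

variable [Coded α] [Coded β] [Coded γ] [Coded σ]

theorem intro {f : α → β} (p : Prog) {F : ℕ → ℕ} (hF : PolyBounded F)
    (he : ∀ a : α, p.eval (code a) = code (f a)) (hc : ∀ a : α, p.cost (code a) ≤ F (csize a)) :
    PolyTime f := by
  obtain ⟨c, h⟩ := hF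
  exact ⟨p, c, fun a => ⟨he a, (hc a).trans (h _)⟩⟩

/-- A program together with a monotone polynomial that bounds its cost and the size of its
result. -/
theorem elim {f : α → β} (hf : PolyTime f) : ∃ (p : Prog) (F : ℕ → ℕ), PolyBounded F ∧ Monotone F ∧
    ∀ a : α, p.eval (code a) = code (f a) ∧ p.cost (code a) ≤ F (csize a) ∧
      csize (f a) ≤ F (csize a) := by
  obtain ⟨p, c, h⟩ := hf
  refine ⟨p, polyBound c, PolyBounded.id.polyBound c, fun a b h => polyBound_mono c h, fun a =>
    ⟨(h a).1, (h a).2, ?_⟩⟩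
  rw [csize, ← (h a).1]
  exact (p.size_eval_le_cost _).trans (h a).2

theorem csize_bound {f : α → β} (hf : PolyTime f) :
    ∃ F : ℕ → ℕ, PolyBounded F ∧ Monotone F ∧ ∀ a : α, csize (f a) ≤ F (csize a) := by
  obtain ⟨p, F, h, hm, hF⟩ := hf.elim
  exact ⟨F, h, hm, fun a => (hF a).2.2⟩

@[fun_prop]
theorem id : PolyTime fun x : α => x :=
  intro .id (F := fun n => n + n) (PolyBounded.id.add PolyBounded.id) (fun _ => rfl) fun _ => le_rfl

@[fun_prop]
theorem comp {f : β → γ} {g : α → β} (hf : PolyTime f) (hg : PolyTime g) :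
    PolyTime fun x => f (g x) := by
  obtain ⟨p, F, hF, hm, hp⟩ := hf.elim
  obtain ⟨r, G, hG, -, hr⟩ := hg.elim
  refine intro (.comp p r) ((hG.add (hF.comp hG)).add (PolyBounded.const 1)) (fun a => ?_)
    fun a => ?_
  · simp [Prog.eval, hr, hp]
  · simp only [Prog.cost, (hr a).1]
    have h1 := (hr a).2.1
    have h2 := (hp (g a)).2.1.trans (hm (hr a).2.2)
    omega

@[fun_prop]
theorem prodMk {f : α → β} {g : α → γ} (hf : PolyTime f) (hg : PolyTime g) :
    PolyTime fun x => (f x, g x) := by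
  obtain ⟨p, F, hF, -, hp⟩ := hf.elim
  obtain ⟨r, G, hG, -, hr⟩ := hg.elim
  refine intro (.pair p r) ((hF.add hG).add (PolyBounded.const 1)) (fun a => ?_) fun a => ?_
  · simp [Prog.eval, hr, hp, code]
  · have h1 := (hp a).2.1
    have h2 := (hr a).2.1
    simp only [Prog.cost]
    omega

theorem fst' : PolyTime (Prod.fst : α × β → α) :=
  intro .fst (F := fun n => n + n) (PolyBounded.id.add PolyBounded.id) (fun _ => rfl) fun _ =>
    Nat.add_le_add_left (Val.size_fst_le _) _

theorem snd' : PolyTime (Prod.snd : α × β → β) :=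
  intro .snd (F := fun n => n + n) (PolyBounded.id.add PolyBounded.id) (fun _ => rfl) fun _ =>
    Nat.add_le_add_left (Val.size_snd_le _) _

@[fun_prop]
theorem fst {f : α → β × γ} (hf : PolyTime f) : PolyTime fun x => (f x).1 := fst'.comp hf

@[fun_prop]
theorem snd {f : α → β × γ} (hf : PolyTime f) : PolyTime fun x => (f x).2 := snd'.comp hf

/-- A function that has the same values on codes. -/
theorem of_code_eq {f : α → β} {g : α → γ} (hf : PolyTime f) (h : ∀ a, code (g a) = code (f a)) :
    PolyTime g := by
  obtain ⟨p, c, hp⟩ := hf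
  exact ⟨p, c, fun a => ⟨(hp a).1.trans (h a).symm, (hp a).2⟩⟩

theorem constVal (v : Val) : PolyTime fun _ : α => v := by
  induction v with
  | nat n =>
    exact intro (.const n) (F := fun m => m + (Nat.size n + 1))
      (PolyBounded.id.add (PolyBounded.const _)) (fun _ => rfl) fun _ => le_rfl
  | pair u v hu hv => exact (hu.prodMk hv).of_code_eq fun _ => rfl

@[fun_prop]
theorem const (b : β) : PolyTime fun _ : α => b := (constVal (code b)).of_code_eq fun _ => rfl

/-- The representation of a result as a value. -/
@[fun_prop]
theorem codeOf {f : α → β} (hf : PolyTime f) : PolyTime fun x => code (f x) :=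
  hf.of_code_eq fun _ => rfl

@[fun_prop]
theorem csizeOf {f : α → β} (hf : PolyTime f) : PolyTime fun x => csize (f x) := by
  refine PolyTime.comp (f := fun b : β => _root_.csize b) ?_ hf
  refine intro .size (F := fun n => n + (n + 1)) (PolyBounded.id.add
    (PolyBounded.id.add (PolyBounded.const 1))) (fun _ => rfl) fun b => ?_
  simp only [Prog.cost, Val.size]
  have := Nat.size_le_self' (Coded.code b).size
  simp only [_root_.csize]
  omega

theorem valFst {f : α → Val} (hf : PolyTime f) : PolyTime fun x => (f x).fst := by
  refine PolyTime.comp (f := Val.fst) ?_ hf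
  exact intro .fst (F := fun n => n + n) (PolyBounded.id.add PolyBounded.id) (fun _ => rfl) fun _ =>
    Nat.add_le_add_left (Val.size_fst_le _) _

theorem valSnd {f : α → Val} (hf : PolyTime f) : PolyTime fun x => (f x).snd := by
  refine PolyTime.comp (f := Val.snd) ?_ hf
  exact intro .snd (F := fun n => n + n) (PolyBounded.id.add PolyBounded.id) (fun _ => rfl) fun _ =>
    Nat.add_le_add_left (Val.size_snd_le _) _

theorem valIsPair {f : α → Val} (hf : PolyTime f) : PolyTime fun x => (f x).isPair := by
  refine PolyTime.comp (f := Val.isPair) ?_ hf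
  refine intro .isPair (F := fun n => n + 2) (PolyBounded.id.add (PolyBounded.const 2))
    (fun _ => rfl) fun x => ?_
  refine Nat.add_le_add_left (m := 2) (n := (Val.nat x.isPair).size) ?_ _
  cases x <;> simp [Val.isPair, Val.size]

attribute [fun_prop] valFst valSnd valIsPair

theorem branch {c : α → ℕ} {f g : α → β} (hc : PolyTime c) (hf : PolyTime f) (hg : PolyTime g) :
    PolyTime fun x => if c x = 0 then g x else f x := by
  obtain ⟨p, F, hF, -, hp⟩ := hc.elim
  obtain ⟨r, G, hG, -, hr⟩ := hf.elim
  obtain ⟨s, H, hH, -, hs⟩ := hg.elim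
  refine intro (.branch p r s) ((hF.add (hG.add hH)).add (PolyBounded.const 1)) (fun a => ?_)
    fun a => ?_
  · simp only [Prog.eval, (hp a).1, (hr a).1, (hs a).1]
    rcases h : c a with _ | n <;> simp [Coded.code]
  · have h1 := (hp a).2.1
    have h2 := (hr a).2.1
    have h3 := (hs a).2.1
    simp only [Prog.cost]
    split <;> omega

theorem arith {f g : α → ℕ} (op : ArithOp) (hf : PolyTime f) (hg : PolyTime g)
    (h : ∀ a b, Nat.size (op.apply a b) ≤ Nat.size a + Nat.size b + 1) :
    PolyTime fun x => op.apply (f x) (g x) := by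
  refine PolyTime.comp (f := fun z : ℕ × ℕ => op.apply z.1 z.2) ?_ (hf.prodMk hg)
  refine intro (.arith op) (F := fun n => n + n) (PolyBounded.id.add PolyBounded.id)
    (fun _ => rfl) fun x => ?_
  obtain ⟨a, b⟩ := x
  have := h a b
  simp only [Prog.cost, Coded.code, Val.fst, Val.snd, Val.toNat, Val.size, csize_prod, csize_nat]
  omega

@[fun_prop]
theorem add {f g : α → ℕ} (hf : PolyTime f) (hg : PolyTime g) : PolyTime fun x => f x + g x := by
  refine arith .add hf hg fun a b => ?_
  rw [Nat.size_le]
  have h1 := Nat.lt_size_self a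
  have h2 := Nat.lt_size_self b
  have h3 : 2 ^ Nat.size a ≤ 2 ^ (Nat.size a + Nat.size b) :=
    Nat.pow_le_pow_right (by omega) (by omega)
  have h4 : 2 ^ Nat.size b ≤ 2 ^ (Nat.size a + Nat.size b) :=
    Nat.pow_le_pow_right (by omega) (by omega)
  simp only [ArithOp.apply, pow_succ]
  omega

@[fun_prop]
theorem sub {f g : α → ℕ} (hf : PolyTime f) (hg : PolyTime g) : PolyTime fun x => f x - g x :=
  arith .sub hf hg fun a b => by
    have := Nat.size_le_size (Nat.sub_le a b)
    simp only [ArithOp.apply]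
    omega

@[fun_prop]
theorem mul {f g : α → ℕ} (hf : PolyTime f) (hg : PolyTime g) : PolyTime fun x => f x * g x :=
  arith .mul hf hg fun a b => by
    refine (Nat.size_le.2 ?_).trans (Nat.le_succ _)
    rw [pow_add]
    exact Nat.mul_lt_mul'' (Nat.lt_size_self a) (Nat.lt_size_self b)

@[fun_prop]
theorem div {f g : α → ℕ} (hf : PolyTime f) (hg : PolyTime g) : PolyTime fun x => f x / g x :=
  arith .div hf hg fun a b => by
    have := Nat.size_le_size (Nat.div_le_self a b)
    simp only [ArithOp.apply]
    omega

@[fun_prop]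
theorem mod {f g : α → ℕ} (hf : PolyTime f) (hg : PolyTime g) : PolyTime fun x => f x % g x :=
  arith .mod hf hg fun a b => by
    have := Nat.size_le_size (Nat.mod_le a b)
    simp only [ArithOp.apply]
    omega

@[fun_prop]
theorem iteEq {f g : α → ℕ} {u v : α → β} (hf : PolyTime f) (hg : PolyTime g) (hu : PolyTime u)
    (hv : PolyTime v) : PolyTime fun x => if f x = g x then u x else v x := by
  have := branch (c := fun x => (f x - g x) + (g x - f x)) (by fun_prop) hv hu
  refine this.of_code_eq fun x => ?_
  by_cases h : f x = g x
  · simp [h]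
  · rw [if_neg h, if_neg (by omega)]

@[fun_prop]
theorem iteLt {f g : α → ℕ} {u v : α → β} (hf : PolyTime f) (hg : PolyTime g) (hu : PolyTime u)
    (hv : PolyTime v) : PolyTime fun x => if f x < g x then u x else v x := by
  have := branch (c := fun x => g x - f x) (by fun_prop) hu hv
  refine this.of_code_eq fun x => ?_
  by_cases h : f x < g x
  · rw [if_pos h, if_neg (by omega)]
  · rw [if_neg h, if_pos (by omega)]

theorem valToNat {f : α → Val} (hf : PolyTime f) : PolyTime fun x => (f x).toNat := by
  have h : PolyTime fun x => if (f x).isPair = 0 then f x else .nat 0 :=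
    branch (valIsPair hf) (const (Val.nat 0)) hf
  refine h.of_code_eq fun x => ?_
  cases f x <;> simp [Val.isPair, Val.toNat, Coded.code]

attribute [fun_prop] valToNat

/-! #### Loops -/

/-- A polynomial number of rounds is not enough, as the state could grow with each of them; hence
the separate hypothesis that all intermediate states stay polynomially small. The parameter `c` is
carried through the loop next to the state. -/
theorem iterate {N : γ → ℕ} {init : γ → σ} {step : γ → σ → σ} (hN : PolyTime N)
    (hi : PolyTime init) (hs : PolyTime fun z : γ × σ => step z.1 z.2) {F : ℕ → ℕ}
    (hF : PolyBounded F) (hNF : ∀ c, N c ≤ F (_root_.csize c))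
    (hb : ∀ c, ∀ i ≤ N c, _root_.csize ((step c)^[i] (init c)) ≤ F (_root_.csize c)) :
    PolyTime fun c => (step c)^[N c] (init c) := by
  have hpre : PolyTime fun c => (N c, (c, init c)) := by fun_prop
  obtain ⟨p, G, hG, -, hp⟩ := hpre.elim
  obtain ⟨r, H, hH, hHm, hr⟩ := hs.elim
  let body : Prog := .pair .fst r
  have hbody : ∀ (c : γ) (s : σ), body.eval (Coded.code (c, s)) = Coded.code (c, step c s) := by
    intro c s
    have := (hr (c, s)).1
    simp only [body, Prog.eval, this]
    rfl
  have hiter : ∀ (c : γ) (i : ℕ), body.eval^[i] (Coded.code (c, init c))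
      = Coded.code (c, (step c)^[i] (init c)) := by
    intro c i
    induction i with
    | zero => rfl
    | succ i ih => rw [Function.iterate_succ_apply', ih, hbody, Function.iterate_succ_apply']
  -- The cost of one round, for a parameter of size `n` and a state of size at most `F n`.
  let B : ℕ → ℕ := fun n => 2 * (n + F n + 1) + H (n + F n + 1) + 2
  have hB : PolyBounded B := by
    have h1 : PolyBounded fun n => n + F n + 1 :=
      (PolyBounded.id.add hF).add (PolyBounded.const 1)
    exact (((PolyBounded.const 2).mul h1).add (hH.comp h1)).add (PolyBounded.const 2)
  have hL : PolyTime fun c => (c, (step c)^[N c] (init c)) := by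
    refine intro (.comp (.loop body) p) (F := fun n => G n + (G n + 1 + F n * B n) + 1)
      ((hG.add ((hG.add (PolyBounded.const 1)).add (hF.mul hB))).add (PolyBounded.const 1))
      (fun c => ?_) fun c => ?_
    · simp only [Prog.eval, (hp c).1]
      exact hiter c (N c)
    · have hsum : ∑ i ∈ Finset.range (N c),
          (body.cost (body.eval^[i] (Coded.code (c, init c))) + 1)
            ≤ F (_root_.csize c) * B (_root_.csize c) := by
        refine (Finset.sum_le_card_nsmul _ _ (B (_root_.csize c)) fun i hi => ?_).trans ?_
        · rw [hiter]
          have h1 := hb c i (Finset.mem_range.1 hi).le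
          have h2 := (hr (c, (step c)^[i] (init c))).2.1
          have h3 : _root_.csize (c, (step c)^[i] (init c))
              ≤ _root_.csize c + F (_root_.csize c) + 1 := by
            rw [csize_prod]
            omega
          have h4 := h2.trans (hHm h3)
          have h5 := Val.size_fst_le (Coded.code (c, (step c)^[i] (init c)))
          simp only [body, Prog.cost, B]
          simp only [_root_.csize] at *
          omega
        · rw [Finset.card_range, smul_eq_mul]
          exact Nat.mul_le_mul_right _ (hNF c)
      have h1 := (hp c).2.1
      have h2 := (hp c).2.2
      have h3 : (Prog.loop body).cost (p.eval (Coded.code c)) = _root_.csize (N c, (c, init c)) + 1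
          + ∑ i ∈ Finset.range (N c),
            (body.cost (body.eval^[i] (Coded.code (c, init c))) + 1) := by
        rw [(hp c).1]
        rfl
      simp only [Prog.cost] at h3 ⊢
      omega
  exact hL.snd

theorem listCases {l : γ → List α} {f : γ → β} {g : γ → α → List α → β} (hl : PolyTime l)
    (hf : PolyTime f) (hg : PolyTime fun z : γ × α × List α => g z.1 z.2.1 z.2.2) :
    PolyTime fun x => match l x with
      | [] => f x
      | a :: t => g x a t := by
  obtain ⟨p, F, hF, -, hp⟩ := hl.elim
  obtain ⟨r, G, hG, hGm, hr⟩ := hg.elim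
  obtain ⟨s, H, hH, -, hs⟩ := hf.elim
  -- For a nonempty list, head and tail are the two components of the code of the list, so this
  -- program prepares the argument of `g`.
  let e : Prog := .pair .id (.pair (.comp .fst p) (.comp .snd p))
  let E : ℕ → ℕ := fun n => 2 * n + 6 * F n + 4
  have hE : PolyBounded E := (((PolyBounded.const 2).mul PolyBounded.id).add
    ((PolyBounded.const 6).mul hF)).add (PolyBounded.const 4)
  refine intro (.branch (.comp .isPair p) (.comp r e) s)
    (F := fun n => (2 * F n + 3) + (E n + G (E n) + 1 + H n) + 1)
    (((((PolyBounded.const 2).mul hF).add (PolyBounded.const 3)).add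
      (((hE.add (hG.comp hE)).add (PolyBounded.const 1)).add hH)).add (PolyBounded.const 1))
    (fun a => ?_) fun a => ?_
  · simp only [Prog.eval, (hp a).1, (hs a).1]
    rcases h : l a with _ | ⟨b, t⟩
    · rfl
    · have := (hr (a, b, t)).1
      simp only [e, Prog.eval, (hp a).1, h]
      exact this
  · have h1 := (hp a).2.1
    have h1' := (hp a).2.2
    have h3 := (hs a).2.1
    have hc : (Prog.comp .isPair p).cost (Coded.code a) ≤ 2 * F (_root_.csize a) + 3 := by
      simp only [Prog.cost, (hp a).1]
      have : (Val.nat (Coded.code (l a)).isPair).size ≤ 2 := by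
        cases Coded.code (l a) <;> simp [Val.isPair, Val.size]
      simp only [_root_.csize] at *
      omega
    have he : e.cost (Coded.code a) ≤ E (_root_.csize a) := by
      simp only [e, Prog.cost, (hp a).1, E]
      have h5 := Val.size_fst_le (Coded.code (l a))
      have h6 := Val.size_snd_le (Coded.code (l a))
      simp only [_root_.csize] at *
      omega
    rcases h : l a with _ | ⟨b, t⟩
    · have hev : (Prog.comp .isPair p).eval (Coded.code a) = .nat 0 := by
        simp only [Prog.eval, (hp a).1, h]
        rfl
      simp only [Prog.cost] at hc ⊢
      rw [hev]
      simp only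
      omega
    · have hev : (Prog.comp .isPair p).eval (Coded.code a) = .nat 1 := by
        simp only [Prog.eval, (hp a).1, h]
        rfl
      have hee : e.eval (Coded.code a) = Coded.code (a, b, t) := by
        simp only [e, Prog.eval, (hp a).1, h]
        rfl
      have h4 := (hr (a, b, t)).2.1
      have h5 : _root_.csize (a, b, t) ≤ E (_root_.csize a) := by
        rw [_root_.csize, ← hee]
        exact (e.size_eval_le_cost _).trans he
      have h6 := h4.trans (hGm h5)
      simp only [Prog.cost] at hc ⊢
      rw [hev, hee]
      refine Nat.add_le_add_right (Nat.add_le_add hc ?_) 1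
      change e.cost (Coded.code a) + r.cost (Coded.code (a, b, t)) + 1 ≤ _
      omega

@[fun_prop]
theorem cons {f : γ → α} {l : γ → List α} (hf : PolyTime f) (hl : PolyTime l) :
    PolyTime fun x => f x :: l x :=
  (hf.prodMk hl).of_code_eq fun _ => rfl

@[fun_prop]
theorem tail {l : γ → List α} (hl : PolyTime l) : PolyTime fun x => (l x).tail := by
  have := listCases (f := fun _ => ([] : List α)) (g := fun _ _ t => t) hl (by fun_prop)
    (by fun_prop)
  refine this.of_code_eq fun x => ?_
  cases l x <;> rfl

@[fun_prop]
theorem headD {l : γ → List α} {d : γ → α} (hl : PolyTime l) (hd : PolyTime d) :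
    PolyTime fun x => (l x).headD (d x) := by
  have := listCases (f := d) (g := fun _ a _ => a) hl hd (by fun_prop)
  refine this.of_code_eq fun x => ?_
  cases l x <;> rfl

theorem foldl {l : γ → List α} {init : γ → σ} {step : γ → σ → α → σ} (hl : PolyTime l)
    (hi : PolyTime init) (hs : PolyTime fun z : γ × σ × α => step z.1 z.2.1 z.2.2) {F : ℕ → ℕ}
    (hF : PolyBounded F)
    (hb : ∀ c i, _root_.csize (((l c).take i).foldl (step c) (init c)) ≤ F (_root_.csize c)) :
    PolyTime fun c => (l c).foldl (step c) (init c) := by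
  obtain ⟨B, hB, -, hlB⟩ := hl.csize_bound
  let st : γ → List α × σ → List α × σ := fun c z => match z.1 with
    | [] => ([], z.2)
    | a :: t => (t, step c z.2 a)
  have hst : PolyTime fun z : γ × List α × σ => st z.1 z.2 :=
    listCases (l := fun z : γ × List α × σ => z.2.1) (f := fun z => (([] : List α), z.2.2))
      (g := fun z a t => (t, step z.1 z.2.2 a)) (by fun_prop) (by fun_prop)
      ((prodMk (by fun_prop) (PolyTime.comp (f := fun z : γ × σ × α => step z.1 z.2.1 z.2.2)
        (g := fun z : (γ × List α × σ) × α × List α => (z.1.1, z.1.2.2, z.2.1)) hs (by fun_prop))))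
  have hiter : ∀ c i, (st c)^[i] (l c, init c)
      = ((l c).drop i, ((l c).take i).foldl (step c) (init c)) := by
    intro c i
    induction i with
    | zero => simp
    | succ i ih =>
      rw [Function.iterate_succ_apply', ih]
      rcases h : (l c).drop i with _ | ⟨a, t⟩
      · have hlen : (l c).length ≤ i := List.drop_eq_nil_iff.1 h
        simp only [st]
        rw [List.drop_of_length_le (by omega), List.take_of_length_le hlen,
          List.take_of_length_le (by omega)]
      · have hlen : i < (l c).length := by
          by_contra hlen
          rw [List.drop_of_length_le (by omega)] at h
          cases h
        rw [List.drop_eq_getElem_cons hlen] at h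
        injection h with h1 h2
        simp only [st]
        rw [← h2, ← h1, List.take_succ_eq_append_getElem hlen, List.foldl_append]
        rfl
  -- The number of rounds is the size of the list, which exceeds its length; the superfluous rounds
  -- see an empty list and change nothing.
  have := iterate (N := fun c => _root_.csize (l c)) (init := fun c => (l c, init c)) (step := st)
    (by fun_prop) (by fun_prop) hst (F := fun n => B n + F n + 1)
    ((hB.add hF).add (PolyBounded.const 1)) (fun c => by have := hlB c; omega) fun c i _ => by
      rw [hiter, csize_prod]
      have h1 := csize_drop_le (l c) i
      have h2 := hb c i
      have h3 := hlB c
      omega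
  refine this.snd.of_code_eq fun c => ?_
  rw [hiter, List.take_of_length_le (length_lt_csize _).le]

/-- Folding with a state whose size is bounded. -/
theorem foldl_of_bounded {l : γ → List α} {init : γ → σ} {step : γ → σ → α → σ} (hl : PolyTime l)
    (hi : PolyTime init) (hs : PolyTime fun z : γ × σ × α => step z.1 z.2.1 z.2.2) {F : ℕ → ℕ}
    (hF : PolyBounded F)
    (hb : ∀ c s, ∀ a ∈ l c, _root_.csize (step c s a) ≤ F (_root_.csize c)) :
    PolyTime fun c => (l c).foldl (step c) (init c) := by
  obtain ⟨B, hB, -, hiB⟩ := hi.csize_bound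
  refine foldl hl hi hs (hB.add hF) fun c i => ?_
  rcases List.eq_nil_or_concat ((l c).take i) with h | ⟨t, a, h⟩
  · rw [h]
    exact (hiB c).trans (Nat.le_add_right _ _)
  · have ha : a ∈ l c := List.mem_of_mem_take (i := i) (by rw [h]; simp)
    rw [h, List.concat_eq_append, List.foldl_append]
    exact (hb c _ a ha).trans (Nat.le_add_left _ _)

/-- Folding with a state that grows slowly. -/
theorem foldl_of_growth {l : γ → List α} {init : γ → σ} {step : γ → σ → α → σ} (hl : PolyTime l)
    (hi : PolyTime init) (hs : PolyTime fun z : γ × σ × α => step z.1 z.2.1 z.2.2) {F : ℕ → ℕ}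
    (hF : PolyBounded F)
    (hb : ∀ c s, ∀ a ∈ l c, _root_.csize (step c s a) ≤ _root_.csize s + F (_root_.csize c)) :
    PolyTime fun c => (l c).foldl (step c) (init c) := by
  obtain ⟨B, hB, -, hiB⟩ := hi.csize_bound
  obtain ⟨G, hG, -, hlG⟩ := hl.csize_bound
  refine foldl hl hi hs (hB.add (hG.mul hF)) fun c i => ?_
  have key : ∀ (t : List α) (s : σ), (∀ a ∈ t, a ∈ l c) → _root_.csize (t.foldl (step c) s)
      ≤ _root_.csize s + t.length * F (_root_.csize c) := by
    intro t
    induction t with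
    | nil => simp
    | cons a t ih =>
      intro s ht
      have h1 := ih (step c s a) fun b hb => ht b (by simp [hb])
      have h2 := hb c s a (ht a (by simp))
      simp only [List.foldl_cons, List.length_cons, Nat.add_mul]
      omega
  have h1 := key ((l c).take i) (init c) fun a ha => List.mem_of_mem_take ha
  have h2 : ((l c).take i).length ≤ G (_root_.csize c) := by
    have h3 := length_lt_csize (l c)
    have h4 := hlG c
    rw [List.length_take]
    omega
  have h3 := Nat.mul_le_mul_right (F (_root_.csize c)) h2
  have h4 := hiB c
  omega

@[fun_prop]
theorem reverse {l : γ → List α} (hl : PolyTime l) : PolyTime fun x => (l x).reverse := by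
  have := foldl (init := fun _ => ([] : List α)) (step := fun _ s a => a :: s) hl (by fun_prop)
    (by fun_prop) hl.csize_bound.choose_spec.1 fun c i => by
      have h : ∀ t : List α, t.foldl (fun s a => a :: s) [] = t.reverse := by simp
      rw [h, csize_reverse]
      exact (csize_take_le _ _).trans (hl.csize_bound.choose_spec.2.2 c)
  refine this.of_code_eq fun x => ?_
  simp

@[fun_prop]
theorem append {l₁ l₂ : γ → List α} (h₁ : PolyTime l₁) (h₂ : PolyTime l₂) :
    PolyTime fun x => l₁ x ++ l₂ x := by
  obtain ⟨B, hB, -, hlB⟩ := h₁.csize_bound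
  have := foldl_of_growth (l := fun x => (l₁ x).reverse) (init := l₂) (step := fun _ s a => a :: s)
    (by fun_prop) h₂ (by fun_prop) (hB.add (PolyBounded.const 1)) fun c s a ha => by
      have h3 := csize_le_of_mem (List.mem_reverse.1 ha)
      have h4 := hlB c
      rw [csize_cons]
      omega
  refine this.of_code_eq fun x => ?_
  simp

theorem map {l : γ → List α} {f : γ → α → β} (hl : PolyTime l)
    (hf : PolyTime fun z : γ × α => f z.1 z.2) : PolyTime fun x => (l x).map (f x) := by
  obtain ⟨B, hB, -, hlB⟩ := hl.csize_bound
  obtain ⟨F, hF, hFm, hfF⟩ := hf.csize_bound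
  have := foldl_of_growth (init := fun _ => ([] : List β)) (step := fun x s a => f x a :: s)
    hl (by fun_prop) (PolyTime.cons (PolyTime.comp (f := fun z : γ × α => f z.1 z.2)
      (g := fun z : γ × List β × α => (z.1, z.2.2)) hf (by fun_prop)) (by fun_prop))
    (F := fun n => F (n + B n + 1) + 1)
    ((hF.comp ((PolyBounded.id.add hB).add (PolyBounded.const 1))).add (PolyBounded.const 1))
    fun c s a ha => by
      have h1 := (csize_le_of_mem ha).trans (hlB c)
      have h2 := (hfF (c, a)).trans (hFm (b := _root_.csize c + B (_root_.csize c) + 1) (by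
        rw [csize_prod]
        omega))
      rw [csize_cons]
      simp only at h2
      omega
  refine this.reverse.of_code_eq fun x => congrArg Coded.code ?_
  have h : ∀ (t : List α) (s : List β), (t.foldl (fun s a => f x a :: s) s).reverse
      = s.reverse ++ t.map (f x) := by
    intro t
    induction t with
    | nil => simp
    | cons a t ih =>
      intro s
      simp
  simp

end PolyTime

end

/-! ### More functions computable in polynomial time -/

section

variable {α β γ σ : Type}

/-- Reduction modulo `q`, with values at most `q` also for `q = 0`. -/
def clip (a q : ℕ) : ℕ := a % ((q - 1) + 1)

theorem clip_le (a q : ℕ) : clip a q ≤ q := by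
  have : a % ((q - 1) + 1) < (q - 1) + 1 := Nat.mod_lt a (Nat.succ_pos (q - 1))
  unfold clip
  omega

theorem clip_eq (a : ℕ) {q : ℕ} (hq : 0 < q) : clip a q = a % q := by
  rw [clip, Nat.sub_add_cancel hq]

theorem clip_of_lt {a q : ℕ} (h : a < q) : clip a q = a := by
  rw [clip_eq a (by omega), Nat.mod_eq_of_lt h]

theorem csize_clip_le (a q : ℕ) : csize (clip a q) ≤ csize q := by
  rw [csize_nat, csize_nat]
  exact Nat.add_le_add_right (Nat.size_le_size (clip_le a q)) 1

/-- The power `b ^ e` modulo `N`. -/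
def powMod (b e N : ℕ) : ℕ := clip (b ^ e) N

/-- The value at `x` of the polynomial with the given coefficients, modulo `N`. -/
def evalMod (l : List ℕ) (x N : ℕ) : ℕ := l.foldr (fun a acc => clip (a + x * acc) N) 0

/-- The number with the given binary digits. -/
def ofDigits (l : List ℕ) : ℕ := l.foldr (fun a acc => a + 2 * acc) 0

/-- The numbers listed in a value. -/
def Val.entries (v : Val) (n : ℕ) : List ℕ := (List.range n).map v.entry

/-- The value that a table lists for a key. -/
def tabGet (tab : List (List ℕ × ℕ)) (κ : List ℕ) (d : ℕ) : ℕ :=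
  tab.foldr (fun e r => if e.1 = κ then e.2 else r) d

theorem Nat.size_two_mul_add_le (a b : ℕ) : Nat.size (a + 2 * b) ≤ Nat.size a + Nat.size b + 2 := by
  rw [Nat.size_le]
  have h1 := Nat.lt_size_self a
  have h2 := Nat.lt_size_self b
  have h3 : 2 ^ Nat.size a ≤ 2 ^ (Nat.size a + Nat.size b) :=
    Nat.pow_le_pow_right (by omega) (by omega)
  have h4 : 2 ^ Nat.size b ≤ 2 ^ (Nat.size a + Nat.size b) :=
    Nat.pow_le_pow_right (by omega) (by omega)
  simp only [pow_succ]
  omega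

namespace PolyTime

variable [Coded α] [Coded β] [Coded γ] [Coded σ]

@[fun_prop]
theorem valNat {f : γ → ℕ} (hf : PolyTime f) : PolyTime fun x => Val.nat (f x) :=
  hf.of_code_eq fun _ => rfl

@[fun_prop]
theorem valPair {f g : γ → Val} (hf : PolyTime f) (hg : PolyTime g) :
    PolyTime fun x => Val.pair (f x) (g x) :=
  (hf.prodMk hg).of_code_eq fun _ => rfl

@[fun_prop]
theorem valOfList {f : γ → List Val} (hf : PolyTime f) : PolyTime fun x => Val.ofList (f x) :=
  hf.of_code_eq fun x => by
    change _ = Val.ofList ((f x).map _root_.id)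
    rw [List.map_id]
    rfl

@[fun_prop]
theorem iteLe {f g : α → ℕ} {u v : α → β} (hf : PolyTime f) (hg : PolyTime g) (hu : PolyTime u)
    (hv : PolyTime v) : PolyTime fun x => if f x ≤ g x then u x else v x :=
  (iteLt hg hf hv hu).of_code_eq fun x => by
    by_cases h : f x ≤ g x
    · rw [if_pos h, if_neg (by omega)]
    · rw [if_neg h, if_pos (by omega)]

@[fun_prop]
theorem clip {f g : α → ℕ} (hf : PolyTime f) (hg : PolyTime g) :
    PolyTime fun x => clip (f x) (g x) := by
  unfold _root_.clip
  fun_prop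

@[fun_prop]
theorem some {f : γ → α} (hf : PolyTime f) : PolyTime fun x => Option.some (f x) :=
  (prodMk (const (0 : ℕ)) hf).of_code_eq fun _ => rfl

@[fun_prop]
theorem getD' {o : γ → Option α} {d : γ → α} (ho : PolyTime o) (hd : PolyTime d) :
    PolyTime fun x => (o x).getD (d x) := by
  have h : PolyTime fun x => if (Coded.code (o x)).isPair = 0 then Coded.code (d x)
      else (Coded.code (o x)).snd := by fun_prop
  refine h.of_code_eq fun x => ?_
  cases o x <;> rfl

@[fun_prop]
theorem elim' {o : γ → Option α} {d : γ → β} {f : γ → α → β} (ho : PolyTime o) (hd : PolyTime d)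
    (hf : PolyTime fun z : γ × α => f z.1 z.2) : PolyTime fun x => (o x).elim (d x) (f x) := by
  have hl : PolyTime fun x => (o x).toList := by
    have : PolyTime fun x => if (Coded.code (o x)).isPair = 0 then Val.nat 0
      else .pair (Coded.code (o x)).snd (.nat 0) := by fun_prop
    refine this.of_code_eq fun x => ?_
    cases o x <;> rfl
  have := listCases (f := d) (g := fun x a _ => f x a) hl hd
    (PolyTime.comp (f := fun z : γ × α => f z.1 z.2) (g := fun z : γ × α × List α => (z.1, z.2.1))
      hf (by fun_prop))
  refine this.of_code_eq fun x => ?_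
  cases o x <;> rfl

@[fun_prop]
theorem length {l : γ → List α} (hl : PolyTime l) : PolyTime fun x => (l x).length := by
  have := foldl_of_growth (init := fun _ => 0) (step := fun _ s _ => s + 1) hl
    (by fun_prop) (by fun_prop) (PolyBounded.const 1) fun c s a ha => by
      rw [csize_nat, csize_nat]
      have : Nat.size (s + 1) ≤ Nat.size s + 1 := by
        rw [Nat.size_le, pow_succ]
        have := Nat.lt_size_self s
        omega
      omega
  refine this.of_code_eq fun x => congrArg Coded.code ?_
  have h : ∀ (t : List α) (s : ℕ), t.foldl (fun s _ => s + 1) s = t.length + s := by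
    intro t
    induction t with
    | nil => simp
    | cons a t ih =>
      intro s
      simp only [List.foldl_cons, List.length_cons, ih]
      omega
  simp [h]

/-- Numbers below the length of a list. -/
@[fun_prop]
theorem range {l : γ → List α} (hl : PolyTime l) : PolyTime fun x => List.range (l x).length := by
  obtain ⟨B, hB, -, hlB⟩ := hl.csize_bound
  have hfold : ∀ t : List α, t.foldl (fun s _ => s ++ [s.length]) [] = List.range t.length := by
    intro t
    induction t using List.reverseRecOn with
    | nil => rfl
    | append_singleton t a ih => simp [ih, List.range_succ]
  have := foldl (init := fun _ => ([] : List ℕ)) (step := fun _ s _ => s ++ [s.length]) hl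
    (by fun_prop) (by fun_prop) (F := fun n => B n * (B n + 1 + 1) + 1)
    ((hB.mul ((hB.add (PolyBounded.const 1)).add (PolyBounded.const 1))).add (PolyBounded.const 1))
    fun c i => by
      rw [hfold]
      have h1 : ((l c).take i).length ≤ B (_root_.csize c) := by
        have h3 := length_lt_csize (l c)
        have h4 := hlB c
        rw [List.length_take]
        omega
      refine (csize_le_of_forall (m := B (_root_.csize c) + 1) fun a ha => ?_).trans ?_
      · have h2 := List.mem_range.1 ha
        have h3 := Nat.size_le_self' a
        rw [csize_nat]
        omega
      · rw [List.length_range]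
        have := Nat.mul_le_mul_right (B (_root_.csize c) + 1 + 1) h1
        omega
  refine this.of_code_eq fun x => ?_
  rw [hfold]

@[fun_prop]
theorem drop {l : γ → List α} {i : γ → ℕ} (hl : PolyTime l) (hi : PolyTime i) :
    PolyTime fun x => (l x).drop (i x) := by
  obtain ⟨B, hB, -, hlB⟩ := hl.csize_bound
  have hit : ∀ (t : List α) (j : ℕ), List.tail^[j] t = t.drop j := by
    intro t j
    induction j with
    | zero => rfl
    | succ j ih => rw [Function.iterate_succ_apply', ih, List.tail_drop]
  -- The number `i x` may be exponentially large in its length, so the rounds are capped by the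
  -- length of the list.
  have := iterate (N := fun x => if i x < (l x).length then i x else (l x).length) (init := l)
    (step := fun _ => List.tail) (by fun_prop) hl (by fun_prop) hB (fun c => by
      have h3 := length_lt_csize (l c)
      have h4 := hlB c
      split_ifs <;> omega) fun c j _ => by
      rw [hit]
      exact (csize_drop_le _ _).trans (hlB c)
  refine this.of_code_eq fun x => ?_
  rw [hit]
  split_ifs with h
  · rfl
  · rw [List.drop_of_length_le le_rfl, List.drop_of_length_le (by omega)]

@[fun_prop]
theorem take {l : γ → List α} {i : γ → ℕ} (hl : PolyTime l) (hi : PolyTime i) :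
    PolyTime fun x => (l x).take (i x) := by
  have : PolyTime fun x => ((l x).reverse.drop ((l x).length - i x)).reverse := by fun_prop
  refine this.of_code_eq fun x => ?_
  rw [List.drop_reverse, List.reverse_reverse]
  by_cases h : i x ≤ (l x).length
  · rw [Nat.sub_sub_self h]
  · rw [List.take_of_length_le (by omega), List.take_of_length_le (by omega)]

@[fun_prop]
theorem getD {l : γ → List α} {i : γ → ℕ} {d : γ → α} (hl : PolyTime l) (hi : PolyTime i)
    (hd : PolyTime d) : PolyTime fun x => (l x).getD (i x) (d x) := by
  have : PolyTime fun x => ((l x).drop (i x)).headD (d x) := by fun_prop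
  refine this.of_code_eq fun x => ?_
  rw [List.headD_eq_head?_getD, List.head?_drop, List.getD_eq_getElem?_getD]

theorem foldr_of_bounded {l : γ → List α} {init : γ → σ} {step : γ → α → σ → σ} (hl : PolyTime l)
    (hi : PolyTime init) (hs : PolyTime fun z : γ × σ × α => step z.1 z.2.2 z.2.1) {F : ℕ → ℕ}
    (hF : PolyBounded F)
    (hb : ∀ c s, ∀ a ∈ l c, _root_.csize (step c a s) ≤ F (_root_.csize c)) :
    PolyTime fun c => (l c).foldr (step c) (init c) := by
  have := foldl_of_bounded (l := fun c => (l c).reverse) (init := init)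
    (step := fun c s a => step c a s) hl.reverse hi hs hF fun c s a ha =>
      hb c s a (List.mem_reverse.1 ha)
  refine this.of_code_eq fun x => ?_
  rw [List.foldl_reverse]

theorem foldr_of_growth {l : γ → List α} {init : γ → σ} {step : γ → α → σ → σ} (hl : PolyTime l)
    (hi : PolyTime init) (hs : PolyTime fun z : γ × σ × α => step z.1 z.2.2 z.2.1) {F : ℕ → ℕ}
    (hF : PolyBounded F)
    (hb : ∀ c s, ∀ a ∈ l c, _root_.csize (step c a s) ≤ _root_.csize s + F (_root_.csize c)) :
    PolyTime fun c => (l c).foldr (step c) (init c) := by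
  have := foldl_of_growth (l := fun c => (l c).reverse) (init := init)
    (step := fun c s a => step c a s) hl.reverse hi hs hF fun c s a ha =>
      hb c s a (List.mem_reverse.1 ha)
  refine this.of_code_eq fun x => ?_
  rw [List.foldl_reverse]

@[fun_prop]
theorem sum {l : γ → List ℕ} (hl : PolyTime l) : PolyTime fun x => (l x).sum := by
  obtain ⟨B, hB, -, hlB⟩ := hl.csize_bound
  refine foldr_of_growth (step := fun _ a s => a + s) hl (const 0) (by fun_prop)
    (F := fun n => B n + 2) (hB.add (PolyBounded.const 2)) fun c s a ha => ?_
  have h1 := (csize_le_of_mem ha).trans (hlB c)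
  have h2 := Nat.size_le_size (show a + s ≤ a + 2 * s by omega)
  have h3 := Nat.size_two_mul_add_le a s
  simp only [csize_nat] at *
  omega

@[fun_prop]
theorem ofDigits {l : γ → List ℕ} (hl : PolyTime l) : PolyTime fun x => ofDigits (l x) := by
  obtain ⟨B, hB, -, hlB⟩ := hl.csize_bound
  refine foldr_of_growth (step := fun _ a s => a + 2 * s) hl (const 0) (by fun_prop)
    (F := fun n => B n + 2) (hB.add (PolyBounded.const 2)) fun c s a ha => ?_
  have h1 := (csize_le_of_mem ha).trans (hlB c)
  have h3 := Nat.size_two_mul_add_le a s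
  simp only [csize_nat] at *
  omega

@[fun_prop]
theorem evalMod {l : γ → List ℕ} {x N : γ → ℕ} (hl : PolyTime l) (hx : PolyTime x)
    (hN : PolyTime N) : PolyTime fun z => evalMod (l z) (x z) (N z) := by
  obtain ⟨B, hB, -, hNB⟩ := hN.csize_bound
  exact foldr_of_bounded (step := fun z a s => _root_.clip (a + x z * s) (N z)) hl (const 0)
    (by fun_prop) hB fun c s a ha => (csize_clip_le _ _).trans (hNB c)

@[fun_prop]
theorem powMod {b e N : γ → ℕ} (hb : PolyTime b) (he : PolyTime e) (hN : PolyTime N) :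
    PolyTime fun z => powMod (b z) (e z) (N z) := by
  obtain ⟨B, hB, -, hNB⟩ := hN.csize_bound
  obtain ⟨D, hD, -, heD⟩ := he.csize_bound
  let step : γ → ℕ × ℕ × ℕ → ℕ × ℕ × ℕ := fun z s =>
    (if s.2.2 % 2 = 1 then _root_.clip (s.1 * s.2.1) (N z) else s.1,
      _root_.clip (s.2.1 * s.2.1) (N z), s.2.2 / 2)
  let init : γ → ℕ × ℕ × ℕ := fun z => (_root_.clip 1 (N z), _root_.clip (b z) (N z), e z)
  -- Repeated squaring: the accumulator times the current base to the remaining exponent is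
  -- invariant modulo `(N z - 1) + 1`, which is the modulus used by `clip` and is positive even for
  -- `N z = 0`.
  have hinv : ∀ z i, ((step z)^[i] (init z)).1 ≤ N z ∧ ((step z)^[i] (init z)).2.1 ≤ N z ∧
      ((step z)^[i] (init z)).2.2 = e z / 2 ^ i ∧
      _root_.clip ((step z)^[i] (init z)).1 (N z) = ((step z)^[i] (init z)).1 ∧
      ((step z)^[i] (init z)).1 * ((step z)^[i] (init z)).2.1 ^ ((step z)^[i] (init z)).2.2 ≡
        b z ^ e z [MOD (N z - 1) + 1] := by
    intro z i
    induction i with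
    | zero =>
      refine ⟨clip_le _ _, clip_le _ _, by simp [init], Nat.mod_mod _ _, ?_⟩
      simp only [Function.iterate_zero, id_eq, init, _root_.clip]
      simpa using ((Nat.mod_modEq 1 (N z - 1 + 1)).mul ((Nat.mod_modEq (b z) _).pow (e z)))
    | succ i ih =>
      rw [Function.iterate_succ_apply']
      obtain ⟨h1, h2, h3, h4, h5⟩ := ih
      set s := (step z)^[i] (init z)
      refine ⟨?_, clip_le _ _, ?_, ?_, ?_⟩
      · simp only [step]
        split_ifs
        · exact clip_le _ _
        · exact h1
      · simp only [step, h3, Nat.div_div_eq_div_mul, pow_succ]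
      · simp only [step]
        split_ifs
        · exact Nat.mod_mod _ _
        · exact h4
      · refine Nat.ModEq.trans ?_ h5
        have hd := Nat.div_add_mod s.2.2 2
        have hsq : (_root_.clip (s.2.1 * s.2.1) (N z)) ^ (s.2.2 / 2) ≡
            s.2.1 ^ (2 * (s.2.2 / 2)) [MOD N z - 1 + 1] := by
          rw [pow_mul, pow_two]
          exact (Nat.mod_modEq _ _).pow _
        simp only [step]
        split_ifs with hodd
        · conv_rhs => rw [← hd, hodd, pow_succ, mul_comm (_ ^ _), ← mul_assoc]
          exact (Nat.mod_modEq _ _).mul hsq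
        · conv_rhs => rw [← hd, show s.2.2 % 2 = 0 by omega, add_zero]
          exact Nat.ModEq.mul_left _ hsq
  have hsz : ∀ z i, _root_.csize ((step z)^[i] (init z))
      ≤ 2 * B (_root_.csize z) + D (_root_.csize z) + 2 := by
    intro z i
    obtain ⟨h1, h2, h3, -, -⟩ := hinv z i
    have h4 : ((step z)^[i] (init z)).2.2 ≤ e z := h3 ▸ Nat.div_le_self _ _
    have h5 := Nat.size_le_size h1
    have h6 := Nat.size_le_size h2
    have h7 := Nat.size_le_size h4
    have h8 := hNB z
    have h9 := heD z
    generalize (step z)^[i] (init z) = s at *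
    obtain ⟨s1, s2, s3⟩ := s
    simp only [csize_prod, csize_nat] at *
    omega
  -- The size of the exponent exceeds its number of binary digits, so after that many halvings
  -- nothing remains of it.
  have := iterate (N := fun z => _root_.csize (e z)) (init := init) (step := step)
    (by fun_prop) (by simp only [init]; fun_prop) (by simp only [step]; fun_prop)
    (F := fun n => 2 * B n + D n + 2)
    ((((PolyBounded.const 2).mul hB).add hD).add (PolyBounded.const 2)) (fun c => by
      have := heD c
      omega) fun c i _ => hsz c i
  refine this.fst.of_code_eq fun z => congrArg Coded.code ?_
  obtain ⟨-, -, h3, h4, h5⟩ := hinv z (_root_.csize (e z))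
  have h0 : e z / 2 ^ _root_.csize (e z) = 0 := by
    rw [Nat.div_eq_zero_iff]
    right
    refine (Nat.lt_size_self (e z)).trans_le (Nat.pow_le_pow_right (by omega) ?_)
    rw [csize_nat]
    omega
  rw [h3, h0, pow_zero, mul_one] at h5
  rw [← h4]
  exact h5.symm

@[fun_prop]
theorem valEntry {v : γ → Val} (hv : PolyTime v) (i : ℕ) : PolyTime fun x => (v x).entry i := by
  have : PolyTime fun x => Val.snd^[i] (v x) := by
    induction i with
    | zero => exact hv
    | succ i ih =>
      simp only [Function.iterate_succ_apply']
      fun_prop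
  unfold Val.entry
  fun_prop

/-- The number of entries is given by the length of a list, since a number in binary could ask for
exponentially many of them. -/
theorem valEntries {v : γ → Val} {l : γ → List α} (hv : PolyTime v) (hl : PolyTime l) :
    PolyTime fun x => (v x).entries (l x).length := by
  obtain ⟨B, hB, -, hvB⟩ := hv.csize_bound
  obtain ⟨G, hG, -, hlG⟩ := hl.csize_bound
  have hfold : ∀ (u : Val) (t : List α),
      t.foldl (fun s _ => (s.1.snd, s.2 ++ [s.1.fst.toNat])) (u, ([] : List ℕ))
        = (Val.snd^[t.length] u, u.entries t.length) := by
    intro u t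
    induction t using List.reverseRecOn with
    | nil => rfl
    | append_singleton t a ih =>
      simp only [List.foldl_append, ih, List.foldl_cons, List.foldl_nil, List.length_append,
        List.length_cons, List.length_nil, zero_add, Function.iterate_succ_apply', Val.entries,
        List.range_succ, List.map_append, List.map_cons, List.map_nil, Val.entry]
  have hit : ∀ (u : Val) i, (Val.snd^[i] u).size ≤ u.size := by
    intro u i
    induction i with
    | zero => exact le_rfl
    | succ i ih =>
      rw [Function.iterate_succ_apply']
      exact (Val.size_snd_le _).trans ih
  have hen : ∀ (u : Val) i, _root_.csize (u.entry i) ≤ u.size := by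
    intro u i
    refine le_trans ?_ ((Val.size_fst_le _).trans (hit u i))
    unfold Val.entry
    cases (Val.snd^[i] u).fst with
    | nat a => exact le_rfl
    | pair a b =>
      simp only [Val.toNat, csize_nat, Nat.size_zero, Val.size]
      omega
  have := foldl (init := fun x => (v x, ([] : List ℕ)))
    (step := fun _ s _ => (s.1.snd, s.2 ++ [s.1.fst.toNat])) hl (by fun_prop) (by fun_prop)
    (F := fun n => B n + (G n * (B n + 1) + 1) + 1)
    ((hB.add ((hG.mul (hB.add (PolyBounded.const 1))).add (PolyBounded.const 1))).add
      (PolyBounded.const 1)) fun c i => by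
      rw [hfold, csize_prod]
      have h1 : ((l c).take i).length ≤ G (_root_.csize c) := by
        have h3 := length_lt_csize (l c)
        have h4 := hlG c
        rw [List.length_take]
        omega
      have h2 : (v c).size ≤ B (_root_.csize c) := hvB c
      have h3 := (hit (v c) ((l c).take i).length).trans h2
      have h4 : _root_.csize ((v c).entries ((l c).take i).length)
          ≤ ((l c).take i).length * (B (_root_.csize c) + 1) + 1 := by
        refine (csize_le_of_forall fun a ha => ?_).trans_eq (by
          rw [Val.entries, List.length_map, List.length_range])
        obtain ⟨j, -, rfl⟩ := List.mem_map.1 ha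
        exact (hen _ _).trans h2
      have h5 := Nat.mul_le_mul_right (B (_root_.csize c) + 1) h1
      have h6 : _root_.csize (Val.snd^[((l c).take i).length] (v c))
        = (Val.snd^[((l c).take i).length] (v c)).size := rfl
      omega
  refine this.snd.of_code_eq fun x => ?_
  rw [hfold]

@[fun_prop]
theorem iteListEq {l₁ l₂ : γ → List ℕ} {u v : γ → β} (h₁ : PolyTime l₁) (h₂ : PolyTime l₂)
    (hu : PolyTime u) (hv : PolyTime v) : PolyTime fun x => if l₁ x = l₂ x then u x else v x := by
  obtain ⟨B, hB, -, hlB⟩ := h₂.csize_bound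
  -- The fold compares the first list with an initial piece of the second. The default `a + 1` for a
  -- missing entry differs from `a`, so running out of entries counts as a difference.
  have hfold : ∀ (t r : List ℕ) (c : ℕ),
      (t.foldl (fun s a => (s.1.tail, if a = s.1.headD (a + 1) then s.2 else 0)) (r, c))
        = (r.drop t.length, if t = r.take t.length then c else 0) := by
    intro t
    induction t with
    | nil => simp
    | cons a t ih =>
      intro r c
      rw [List.foldl_cons, ih]
      cases r with
      | nil => simp
      | cons b r =>
        by_cases hab : a = b <;> simp [hab]
  have := foldl (init := fun x => (l₂ x, 1))
    (step := fun _ s a => (s.1.tail, if a = s.1.headD (a + 1) then s.2 else 0)) h₁ (by fun_prop)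
    (by fun_prop) (F := fun n => B n + 3) (hB.add (PolyBounded.const 3)) fun c i => by
      rw [hfold, csize_prod]
      have h1 := (csize_drop_le (l₂ c) ((l₁ c).take i).length).trans (hlB c)
      have h2 : _root_.csize (if (l₁ c).take i = (l₂ c).take ((l₁ c).take i).length then 1 else 0)
          ≤ 2 := by
        split_ifs <;> simp
      omega
  have h : PolyTime fun x => if ((l₁ x).foldl (fun s a =>
      (s.1.tail, if a = s.1.headD (a + 1) then s.2 else 0)) (l₂ x, 1)).2 = 1
      then (if (l₁ x).length = (l₂ x).length then u x else v x) else v x := by fun_prop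
  refine h.of_code_eq fun x => congrArg Coded.code ?_
  rw [hfold]
  by_cases h : l₁ x = l₂ x
  · simp [h]
  · by_cases hl : (l₁ x).length = (l₂ x).length
    · have : (l₂ x).take (l₁ x).length = l₂ x := List.take_of_length_le hl.ge
      simp [h, this]
    · simp [h, hl]

@[fun_prop]
theorem tabGet {tab : γ → List (List ℕ × ℕ)} {κ : γ → List ℕ} {d : γ → ℕ} (ht : PolyTime tab)
    (hκ : PolyTime κ) (hd : PolyTime d) : PolyTime fun x => tabGet (tab x) (κ x) (d x) := by
  obtain ⟨B, hB, -, htB⟩ := ht.csize_bound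
  refine foldr_of_growth (step := fun x e r => if e.1 = κ x then e.2 else r) ht hd (by fun_prop)
    hB fun c s a ha => ?_
  have h1 := (csize_le_of_mem ha).trans (htB c)
  obtain ⟨a, b⟩ := a
  rw [csize_prod] at h1
  split_ifs
  · simp only
    omega
  · omega

attribute [fun_prop] valEntries map

end PolyTime

end

/-! ### Machines that work in batches -/

theorem Val.size_toNat_lt (v : Val) : Nat.size v.toNat < v.size := by
  cases v with
  | nat a => exact Nat.lt_succ_self _
  | pair a b =>
    simp only [toNat, Nat.size_zero, size]
    omega

namespace Prog

/-- Run a program on an optional argument. -/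
def guarded (E : Prog) : Prog := .branch .isPair (.comp E .snd) (.const 0)

theorem guarded_eval (E : Prog) (o : Option Val) :
    E.guarded.eval (code o) = o.elim (.nat 0) E.eval := by
  cases o <;> rfl

theorem guarded_cost_le (E : Prog) (o : Option Val) :
    E.guarded.cost (code o) ≤ 4 * csize o + o.elim 0 E.cost + 6 := by
  cases o with
  | none =>
    simp [Prog.guarded, Prog.cost, Prog.eval, code, Val.isPair, Val.size]
  | some v =>
    have h : E.guarded.cost (code (some v)) = ((code (some v)).size + (Val.nat 1).size) +
        ((code (some v)).size + v.size + E.cost v + 1) + 1 := rfl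
    have h2 : csize (some v) = v.size + 2 := csize_some v
    have h3 : (code (some v)).size = v.size + 2 := h2
    have h4 : (Val.nat 1).size = 2 := by decide
    rw [h, h2, h3, h4, Option.elim_some]
    omega

end Prog

/-- What a batch machine looks at: its input, the message that started the batch, its persistent
state and the buffer of answers in the current batch. -/
abbrev BatchCtx (S : Type) : Type := Val × Val × S × List ℕ

/-- A machine that reacts to a message as follows: it tosses coins, draws exponents and calls its
oracle, a fixed number of times each, collecting the answers in a buffer. Then it computes a new
state and either an output or the decision to start another batch; this computation uses two given
programs, on arguments prepared by `pre₁` and `pre₂`. -/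
structure BatchScript (S : Type) where
  coins : Val → ℕ
  draws : Val → ℕ
  calls : Val → ℕ
  query : BatchCtx S → ℕ → Val
  pre₁ : BatchCtx S → Option Val
  pre₂ : BatchCtx S × Val → Option Val
  post : (BatchCtx S × Val) × Val → S × Option Val
  init : S

namespace BatchScript

variable {S : Type}

/-- The memory: the buffer, which is empty when no batch is in progress and starts with `0`
otherwise, the message that started the batch, and the state. -/
abbrev Mem (S : Type) : Type := List ℕ × Val × S

def idle (s : S) : Mem S := ([], .nat 0, s)

/-- A message arrives. -/
def advance (y : Val × Mem S × Val) : BatchCtx S :=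
  if y.2.1.1.length = 0 then (y.1, y.2.2, y.2.1.2.2, [0])
  else (y.1, y.2.1.2.1, y.2.1.2.2, y.2.1.1 ++ [y.2.2.toNat])

variable (σ : BatchScript S)

/-- The number of answers in a batch. -/
def total (inp : Val) : ℕ := σ.coins inp + σ.draws inp + σ.calls inp

/-- The given programs are run only at the end of a batch. Until then there is no argument, and no
running time of theirs has to be accounted for. -/
def arg₁ (x : BatchCtx S) : Option Val :=
  if x.2.2.2.length ≤ σ.total x.1 then none else σ.pre₁ x

def arg₂ (z : BatchCtx S × Val) : Option Val :=
  if z.1.2.2.2.length ≤ σ.total z.1.1 then none else σ.pre₂ z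

/-- Without an output the next batch is opened within the same activation, by its first coin toss.
This presupposes that a batch contains at least one coin. -/
def finish (z : (BatchCtx S × Val) × Val) : Mem S × Val :=
  (σ.post z).2.elim (([0], z.1.1.2.1, (σ.post z).1), .pair (.nat 1) (.nat 0))
    fun v => (idle (σ.post z).1, .pair (.nat 0) v)

/-- The new memory and the next action. -/
def next (z : (BatchCtx S × Val) × Val) : Mem S × Val :=
  if z.1.1.2.2.2.length ≤ σ.coins z.1.1.1 then
    ((z.1.1.2.2.2, z.1.1.2.1, z.1.1.2.2.1), .pair (.nat 1) (.nat 0))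
  else if z.1.1.2.2.2.length ≤ σ.coins z.1.1.1 + σ.draws z.1.1.1 then
    ((z.1.1.2.2.2, z.1.1.2.1, z.1.1.2.2.1), .pair (.nat 2) (.nat 0))
  else if z.1.1.2.2.2.length ≤ σ.total z.1.1.1 then
    ((z.1.1.2.2.2, z.1.1.2.1, z.1.1.2.2.1), .pair (.nat 3)
      (σ.query (z.1.1.1, z.1.1.2.1, z.1.1.2.2.1,
        z.1.1.2.2.2.take (σ.coins z.1.1.1 + σ.draws z.1.1.1 + 1))
        (z.1.1.2.2.2.length - (σ.coins z.1.1.1 + σ.draws z.1.1.1 + 1))))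
  else σ.finish z

variable (E A : Prog)

def res₁ (x : BatchCtx S) : Val := (σ.arg₁ x).elim (.nat 0) E.eval

def res₂ (z : BatchCtx S × Val) : Val := (σ.arg₂ z).elim (.nat 0) A.eval

def react (x : BatchCtx S) : Mem S × Val :=
  σ.next ((x, σ.res₁ E x), σ.res₂ A (x, σ.res₁ E x))

variable [Coded S]

/-- The functions in the description are computable in polynomial time. -/
structure Feasible : Prop where
  coins : PolyTime σ.coins
  draws : PolyTime σ.draws
  calls : PolyTime σ.calls
  query : PolyTime fun z : BatchCtx S × ℕ => σ.query z.1 z.2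
  pre₁ : PolyTime σ.pre₁
  pre₂ : PolyTime σ.pre₂
  post : PolyTime σ.post
  init : code σ.init = .nat 0

/-- A program for a batch machine. -/
structure Computes (M : Prog) : Prop where
  init_eval : ∀ inp a, M.eval (.pair inp (.pair (.nat 0) a)) =
    code (σ.react E A (advance (inp, idle σ.init, a)))
  eval : ∀ inp m a, M.eval (.pair inp (.pair (code m) a)) =
    code (σ.react E A (advance (inp, m, a)))

variable {σ}

/-- The program is a composition: normalize the memory, append the message, run `E` and `A` on their
optional arguments, compute the next memory and action. The costs of `E` and `A` enter as they are,
because these programs need not be polynomial on all values. -/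
theorem exists_computes (hσ : σ.Feasible) : ∃ (M : Prog) (F : ℕ → ℕ), PolyBounded F ∧ Monotone F ∧
    σ.Computes E A M ∧ ∀ inp m a s, (s = code m ∨ (s = .nat 0 ∧ m = idle σ.init)) →
      M.cost (.pair inp (.pair s a)) ≤ F (csize (inp, m, a) +
        (σ.arg₁ (advance (inp, m, a))).elim 0 E.cost +
        (σ.arg₂ (advance (inp, m, a), σ.res₁ E (advance (inp, m, a)))).elim 0 A.cost) := by
  have hc := hσ.coins
  have hd := hσ.draws
  have hl := hσ.calls
  have hq := hσ.query
  have hp₁ := hσ.pre₁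
  have hp₂ := hσ.pre₂
  have hp := hσ.post
  have hq' : ∀ {γ : Type} [Coded γ] (f : γ → BatchCtx S) (g : γ → ℕ), PolyTime f → PolyTime g →
      PolyTime fun x => σ.query (f x) (g x) := fun f g hf hg =>
    PolyTime.comp (f := fun z : BatchCtx S × ℕ => σ.query z.1 z.2) hq (hf.prodMk hg)
  -- The initial memory `nat 0` is not the code of a triple. Taking the memory apart and putting it
  -- together again leaves codes of triples alone and turns `nat 0` into a triple of values `nat 0`,
  -- the code of the idle initial state.
  have hnorm : PolyTime fun v : Val => Val.pair v.fst (.pair (.pair v.snd.fst.fst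
      (.pair v.snd.fst.snd.fst v.snd.fst.snd.snd)) v.snd.snd) := by fun_prop
  have hadv : PolyTime (advance : Val × Mem S × Val → BatchCtx S) := by
    unfold advance
    fun_prop
  have ht : PolyTime σ.total := by
    unfold total
    fun_prop
  have h₁ : PolyTime σ.arg₁ := by
    unfold arg₁
    fun_prop
  have h₂ : PolyTime σ.arg₂ := by
    unfold arg₂
    fun_prop
  have h₃ : PolyTime σ.next := by
    unfold next finish idle
    refine PolyTime.iteLe (by fun_prop) (by fun_prop) (by fun_prop) (PolyTime.iteLe (by fun_prop)
      (by fun_prop) (by fun_prop) (PolyTime.iteLe (by fun_prop) (by fun_prop) ?_ (by fun_prop)))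
    exact PolyTime.prodMk (by fun_prop) (PolyTime.valPair (by fun_prop)
      (hq' _ _ (by fun_prop) (by fun_prop)))
  obtain ⟨p, F, hF, hFm, hpF⟩ := (PolyTime.comp hadv (PolyTime.id : PolyTime fun y : _ => y)).elim
  obtain ⟨p₀, F₀, hF₀, hFm₀, hp₀⟩ := hnorm.elim
  obtain ⟨p₁, F₁, hF₁, hFm₁, hp₁⟩ := h₁.elim
  obtain ⟨p₂, F₂, hF₂, hFm₂, hp₂⟩ := h₂.elim
  obtain ⟨p₃, F₃, hF₃, hFm₃, hp₃⟩ := h₃.elim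
  let Q₁ : Prog := .pair .id (.comp E.guarded p₁)
  let Q₂ : Prog := .pair .id (.comp A.guarded p₂)
  let M : Prog := .comp p₃ (.comp Q₂ (.comp Q₁ (.comp p p₀)))
  have e₀ : ∀ inp (m : Mem S) a s, (s = code m ∨ (s = .nat 0 ∧ m = idle σ.init)) →
      p₀.eval (.pair inp (.pair s a)) = code (inp, m, a) := by
    intro inp m a s hs
    refine (hp₀ _).1.trans ?_
    rcases hs with rfl | ⟨rfl, rfl⟩
    · rfl
    · change Val.pair inp (.pair (.pair (.nat 0) (.pair (.nat 0) (.nat 0))) a) =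
        .pair inp (.pair (.pair (.nat 0) (.pair (.nat 0) (code σ.init))) a)
      rw [hσ.init]
  have e₁ : ∀ x, Q₁.eval (code x) = code (x, σ.res₁ E x) := by
    intro x
    simp only [Q₁, Prog.eval, (hp₁ x).1, Prog.guarded_eval]
    rfl
  have e₂ : ∀ z, Q₂.eval (code z) = code (z, σ.res₂ A z) := by
    intro z
    simp only [Q₂, Prog.eval, (hp₂ z).1, Prog.guarded_eval]
    rfl
  have eM : ∀ inp (m : Mem S) a s, (s = code m ∨ (s = .nat 0 ∧ m = idle σ.init)) →
      M.eval (.pair inp (.pair s a)) = code (σ.react E A (advance (inp, m, a))) := by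
    intro inp m a s hs
    simp only [M, Prog.eval, e₀ inp m a s hs, (hpF (inp, m, a)).1, e₁, e₂, (hp₃ _).1]
    rfl
  let c₁ : ℕ → ℕ := fun n => 2 * n + (F₁ n + (4 * F₁ n + n + 6) + 1) + 1
  let c₂ : ℕ → ℕ := fun n => 2 * n + (F₂ n + (4 * F₂ n + n + 6) + 1) + 1
  have hc₁ : PolyBounded c₁ := (((PolyBounded.const 2).mul PolyBounded.id).add
    ((hF₁.add ((((PolyBounded.const 4).mul hF₁).add PolyBounded.id).add (PolyBounded.const 6))).add
      (PolyBounded.const 1))).add (PolyBounded.const 1)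
  have hc₂ : PolyBounded c₂ := (((PolyBounded.const 2).mul PolyBounded.id).add
    ((hF₂.add ((((PolyBounded.const 4).mul hF₂).add PolyBounded.id).add (PolyBounded.const 6))).add
      (PolyBounded.const 1))).add (PolyBounded.const 1)
  have hcm₁ : Monotone c₁ := fun a b hab => by
    have := hFm₁ hab
    simp only [c₁]
    omega
  have hcm₂ : Monotone c₂ := fun a b hab => by
    have := hFm₂ hab
    simp only [c₂]
    omega
  have k₁ : ∀ x n, csize x + (σ.arg₁ x).elim 0 E.cost ≤ n → Q₁.cost (code x) ≤ c₁ n := by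
    intro x n hn
    have h1 := (hp₁ x).2.1
    have h2 := (hp₁ x).2.2
    have h3 := E.guarded_cost_le (σ.arg₁ x)
    have h4 := hFm₁ (show csize x ≤ n by omega)
    simp only [Q₁, Prog.cost, (hp₁ x).1, c₁]
    have h5 : (code x).size = csize x := rfl
    omega
  have k₂ : ∀ x n, csize x + (σ.arg₂ x).elim 0 A.cost ≤ n → Q₂.cost (code x) ≤ c₂ n := by
    intro x n hn
    have h1 := (hp₂ x).2.1
    have h2 := (hp₂ x).2.2
    have h3 := A.guarded_cost_le (σ.arg₂ x)
    have h4 := hFm₂ (show csize x ≤ n by omega)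
    simp only [Q₂, Prog.cost, (hp₂ x).1, c₂]
    have h5 : (code x).size = csize x := rfl
    omega
  let n₁ : ℕ → ℕ := fun n => F n + n
  let n₂ : ℕ → ℕ := fun n => c₁ (n₁ n) + n
  let n₃ : ℕ → ℕ := fun n => c₂ (n₂ n)
  have hn₁ : PolyBounded n₁ := hF.add PolyBounded.id
  have hn₂ : PolyBounded n₂ := (hc₁.comp hn₁).add PolyBounded.id
  have hn₃ : PolyBounded n₃ := hc₂.comp hn₂
  let t : ℕ → ℕ := fun n => F₀ (n + 3) + F n + c₁ (n₁ n) + c₂ (n₂ n) + F₃ (n₃ n) + 4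
  refine ⟨M, t, ?_, ?_, ⟨fun inp a => eM _ _ _ _ (Or.inr ⟨rfl, rfl⟩), fun inp m a =>
    eM _ _ _ _ (Or.inl rfl)⟩, fun inp m a s hs => ?_⟩
  · exact (((((hF₀.comp (PolyBounded.id.add (PolyBounded.const 3))).add hF).add
      (hc₁.comp hn₁)).add (hc₂.comp hn₂)).add (hF₃.comp hn₃)).add (PolyBounded.const 4)
  · intro a b hab
    have h1 : n₁ a ≤ n₁ b := Nat.add_le_add (hFm hab) hab
    have h2 : n₂ a ≤ n₂ b := Nat.add_le_add (hcm₁ h1) hab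
    have h3 : n₃ a ≤ n₃ b := hcm₂ h2
    have := hFm₀ (Nat.add_le_add_right hab 3)
    have := hFm hab
    have := hcm₁ h1
    have := hcm₂ h2
    have := hFm₃ h3
    simp only [t]
    omega
  · set x := advance (inp, m, a)
    set n := csize (inp, m, a) + (σ.arg₁ x).elim 0 E.cost +
      (σ.arg₂ (x, σ.res₁ E x)).elim 0 A.cost with hn
    have h0 : p₀.cost (.pair inp (.pair s a)) ≤ F₀ (n + 3) := by
      refine (hp₀ _).2.1.trans (hFm₀ ?_)
      have h : csize (Val.pair inp (.pair s a)) = inp.size + (s.size + a.size + 1) + 1 := rfl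
      have h' : csize (inp, m, a) = inp.size + ((code m).size + a.size + 1) + 1 := rfl
      have h'' := (code m).one_le_size
      have : s.size ≤ (code m).size := by
        rcases hs with rfl | ⟨rfl, rfl⟩
        · exact le_rfl
        · exact h''
      omega
    have ha : p.cost (code (inp, m, a)) ≤ F n :=
      (hpF _).2.1.trans (hFm (by omega))
    have hx : csize x ≤ F n := (hpF (inp, m, a)).2.2.trans (hFm (by omega))
    have h1 : Q₁.cost (code x) ≤ c₁ (n₁ n) := k₁ x _ (by simp only [n₁]; omega)
    have hs1 : csize (x, σ.res₁ E x) ≤ c₁ (n₁ n) := by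
      rw [csize, ← e₁]
      exact (Q₁.size_eval_le_cost _).trans h1
    have h2 : Q₂.cost (code (x, σ.res₁ E x)) ≤ c₂ (n₂ n) := k₂ _ _ (by simp only [n₂]; omega)
    have hs2 : csize ((x, σ.res₁ E x), σ.res₂ A (x, σ.res₁ E x)) ≤ n₃ n := by
      rw [csize, ← e₂]
      exact (Q₂.size_eval_le_cost _).trans h2
    have h3 := (hp₃ ((x, σ.res₁ E x), σ.res₂ A (x, σ.res₁ E x))).2.1.trans (hFm₃ hs2)
    simp only [M, Prog.cost, Prog.eval, e₀ inp m a s hs, (hpF (inp, m, a)).1, e₁, e₂, t]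
    have hx' : advance (inp, m, a) = x := rfl
    rw [hx']
    omega

variable (σ)

/-- The memory after some messages. -/
def memoryOf (inp : Val) (as : List Val) : Mem S :=
  as.foldl (fun m a => (σ.react E A (advance (inp, m, a))).1) (idle σ.init)

variable {σ E A}

theorem Computes.activate {M : Prog} (hM : σ.Computes E A M) (inp : Val) (m : Mem S) (s a : Val)
    (hs : s = code m ∨ (s = .nat 0 ∧ m = idle σ.init)) : M.activate inp s a =
      (code (σ.react E A (advance (inp, m, a))).1,
        MachineAction.ofVal (σ.react E A (advance (inp, m, a))).2) := by
  unfold Prog.activate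
  rcases hs with rfl | ⟨rfl, rfl⟩
  · rw [hM.eval]
    rfl
  · rw [hM.init_eval]
    rfl

theorem Computes.memory {M : Prog} (hM : σ.Computes E A M) (inp : Val) (as : List Val) :
    M.memory inp as = code (σ.memoryOf E A inp as) ∨
      (M.memory inp as = .nat 0 ∧ σ.memoryOf E A inp as = idle σ.init) := by
  induction as using List.reverseRecOn with
  | nil => exact Or.inr ⟨rfl, rfl⟩
  | append_singleton as a ih =>
    left
    have h1 : M.memory inp (as ++ [a]) = (M.activate inp (M.memory inp as) a).1 := by
      simp [Prog.memory]
    have h2 : σ.memoryOf E A inp (as ++ [a])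
        = (σ.react E A (advance (inp, σ.memoryOf E A inp as, a))).1 := by
      simp [memoryOf]
    rw [h1, h2, hM.activate inp _ _ a ih]

/-- A criterion for polynomial time: the state satisfies a bound `R k N` that depends on the
security parameter and the total size `N` of the messages so far. -/
theorem exists_efficient (hσ : σ.Feasible) {inp : ℕ → Val} {G : ℕ → ℕ} (hG : PolyBounded G)
    (hGm : Monotone G) (R : ℕ → ℕ → S → Prop) (hinp : ∀ k, (inp k).size ≤ G k)
    (h0 : ∀ k, R k 0 σ.init) (hmono : ∀ k N N' s, N ≤ N' → R k N s → R k N' s)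
    (hsize : ∀ k N s, R k N s → csize s ≤ G (k + N))
    (hstep : ∀ k N N' w s buf, R k N s → N < N' → csize buf ≤ 2 * N' + 3 → csize w ≤ N' + 1 →
      σ.total (inp k) < buf.length →
      (σ.pre₁ (inp k, w, s, buf)).elim 0 E.cost ≤ G (k + N') ∧
      ∀ e, e = (σ.pre₁ (inp k, w, s, buf)).elim (.nat 0) E.eval →
        (σ.pre₂ ((inp k, w, s, buf), e)).elim 0 A.cost ≤ G (k + N') ∧
        R k N' (σ.post (((inp k, w, s, buf), e),
          (σ.pre₂ ((inp k, w, s, buf), e)).elim (.nat 0) A.eval)).1) :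
    ∃ M : Prog, σ.Computes E A M ∧ M.Efficient inp := by
  obtain ⟨M, F, hF, hFm, hM, hcost⟩ := exists_computes E A hσ
  let size : List Val → ℕ := fun as => (as.map Val.size).sum
  -- An answer occupies less than twice the size of the message that brought it, so the buffer is
  -- bounded linearly by the total size `N` of the messages; the constant covers the leading `0` and
  -- the end of the list.
  let Inv : ℕ → ℕ → Mem S → Prop := fun k N m => R k N m.2.2 ∧ csize m.1 ≤ 2 * N + 3 ∧
    csize m.2.1 ≤ N + 1
  have hadv : ∀ k N m (a : Val), Inv k N m → ∃ w buf,
      advance (inp k, m, a) = (inp k, w, m.2.2, buf) ∧ csize buf ≤ 2 * (N + a.size) + 3 ∧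
        csize w ≤ N + a.size + 1 := by
    rintro k N ⟨buf, w, s⟩ a ⟨hR, hb, hw⟩
    simp only at hb hw
    by_cases h : buf.length = 0
    · refine ⟨a, [0], by simp [advance, h], ?_, ?_⟩
      · simp
      · have : csize a = a.size := rfl
        omega
    · refine ⟨w, buf ++ [a.toNat], by simp [advance, h], ?_, ?_⟩
      · have h1 := csize_append buf [a.toNat]
        have h2 := a.size_toNat_lt
        simp only [csize_cons, csize_nil, csize_nat] at h1
        omega
      · omega
  have hone : ∀ k N m (a : Val), Inv k N m →
      (σ.arg₁ (advance (inp k, m, a))).elim 0 E.cost ≤ G (k + (N + a.size)) ∧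
      (σ.arg₂ (advance (inp k, m, a), σ.res₁ E (advance (inp k, m, a)))).elim 0 A.cost
        ≤ G (k + (N + a.size)) ∧
      Inv k (N + a.size) (σ.react E A (advance (inp k, m, a))).1 := by
    intro k N m a hm
    obtain ⟨w, buf, hx, hb, hw⟩ := hadv k N m a hm
    have ha := a.one_le_size
    have hR := hm.1
    rw [hx]
    by_cases ht : buf.length ≤ σ.total (inp k)
    · have hRN := hmono k N (N + a.size) _ (by omega) hR
      refine ⟨by simp [arg₁, ht], by simp [arg₂, ht], ?_⟩
      unfold react next
      split_ifs
      · exact ⟨hRN, hb, hw⟩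
      · exact ⟨hRN, hb, hw⟩
      · exact ⟨hRN, hb, hw⟩
    · obtain ⟨h1, h2⟩ := hstep k N (N + a.size) w m.2.2 buf hR (by omega) hb hw (not_le.1 ht)
      obtain ⟨h2, h3⟩ := h2 _ rfl
      have e₁ : σ.res₁ E (inp k, w, m.2.2, buf)
          = (σ.pre₁ (inp k, w, m.2.2, buf)).elim (.nat 0) E.eval := by
        simp only [res₁, arg₁, ht, if_false]
      have e₂ : ∀ e, σ.res₂ A ((inp k, w, m.2.2, buf), e)
          = (σ.pre₂ ((inp k, w, m.2.2, buf), e)).elim (.nat 0) A.eval := by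
        intro e
        simp only [res₂, arg₂, ht, if_false]
      refine ⟨by simpa only [arg₁, ht, if_false] using h1, ?_, ?_⟩
      · rw [e₁]
        simpa only [arg₂, ht, if_false] using h2
      · unfold total at ht
        have ht1 : ¬ buf.length ≤ σ.coins (inp k) := by omega
        have ht2 : ¬ buf.length ≤ σ.coins (inp k) + σ.draws (inp k) := by omega
        simp only [react, next, ht1, ht2, total, ht, if_false, finish]
        rw [e₂, e₁]
        cases (σ.post _).2 with
        | none => exact ⟨h3, by simp, hw⟩
        | some v => exact ⟨h3, by simp [idle], by
            have : csize (Val.nat 0) = 1 := rfl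
            simp only [Option.elim_some, idle, this]
            omega⟩
  have hinv : ∀ k as, Inv k (size as) (σ.memoryOf E A (inp k) as) := by
    intro k as
    induction as using List.reverseRecOn with
    | nil => exact ⟨h0 k, by simp [memoryOf, idle], by
        have : csize (Val.nat 0) = 1 := rfl
        simp only [memoryOf, List.foldl_nil, idle, this]
        omega⟩
    | append_singleton as a ih =>
      have := (hone k _ _ a ih).2.2
      simpa [memoryOf, size] using this
  obtain ⟨c, hc⟩ : PolyBounded fun n => F (G n + (2 * n + 3 + (n + 1 + G n + 1) + 1 + n + 1) + 1
      + G n + G n) := by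
    have h1 := PolyBounded.const 1
    have h2 := (PolyBounded.const 2).mul PolyBounded.id
    exact hF.comp ((((hG.add (((((h2.add (PolyBounded.const 3)).add
      (((PolyBounded.id.add h1).add hG).add h1)).add h1).add PolyBounded.id).add h1)).add h1).add
      hG).add hG)
  refine ⟨M, hM, c, fun k as a => ?_⟩
  have hi := hinv k as
  obtain ⟨h1, h2, -⟩ := hone k _ _ a hi
  refine (hcost (inp k) _ a _ (hM.memory (inp k) as)).trans (le_trans (hFm ?_)
    (hc (k + (as.map Val.size).sum + a.size)))
  have hk : k + (as.map Val.size).sum + a.size = k + (size as + a.size) := by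
    simp only [size]
    omega
  rw [hk]
  have h3 := (hinp k).trans (hGm (show k ≤ k + (size as + a.size) by omega))
  have h4 := (hsize k _ _ hi.1).trans (hGm (show k + size as ≤ k + (size as + a.size) by omega))
  have h5 := hi.2.1
  have h6 := hi.2.2
  have h7 : csize (inp k, σ.memoryOf E A (inp k) as, a) = (inp k).size + (csize
    (σ.memoryOf E A (inp k) as).1 + (csize (σ.memoryOf E A (inp k) as).2.1 +
      csize (σ.memoryOf E A (inp k) as).2.2 + 1) + 1 + a.size + 1) + 1 := rfl
  omega

end BatchScript

/-! ### Lists of independent samples -/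

namespace PMF

variable {α β : Type}

/-- A list of independent samples. -/
noncomputable def samples (d : PMF α) : ℕ → PMF (List α)
  | 0 => PMF.pure []
  | n + 1 => d.bind fun a => (samples d n).map (List.cons a)

theorem samples_add (d : PMF α) (m n : ℕ) :
    samples d (m + n) = (samples d m).bind fun l => (samples d n).map fun l' => l ++ l' := by
  refine ext_ev fun f => ?_
  induction m generalizing f with
  | zero => simp [samples]
  | succ m ih =>
    rw [Nat.succ_add]
    simp only [samples, ev_bind, ev_map]
    refine ev_congr fun a => ?_
    rw [ih fun l => f (a :: l)]
    simp

/-- Restricts attention to lists of the right length, so that the positions of the parts of a buffer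
can be computed. -/
theorem samples_length (d : PMF α) (n : ℕ) (f : List α → ℝ≥0∞) :
    (samples d n).ev f = (samples d n).ev fun l => if l.length = n then f l else 0 := by
  induction n generalizing f with
  | zero => simp [samples]
  | succ n ih =>
    simp only [samples, ev_bind, ev_map]
    refine ev_congr fun a => ?_
    rw [ih]
    simp

theorem samples_congr (d : PMF α) (n : ℕ) {f g : List α → ℝ≥0∞}
    (h : ∀ l : List α, l.length = n → f l = g l) : (samples d n).ev f = (samples d n).ev g := by
  rw [samples_length, samples_length d n g]
  refine ev_congr fun l => ?_
  split_ifs with hl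
  · exact h l hl
  · rfl

/-- Independent uniform samples form a uniform vector. -/
theorem samples_uniform [Fintype β] [Nonempty β] (g : β → α) (n : ℕ) :
    samples ((PMF.uniformOfFintype β).map g) n =
      (PMF.uniformOfFintype (Fin n → β)).map fun v => List.ofFn fun i => g (v i) := by
  refine ext_ev fun f => ?_
  induction n generalizing f with
  | zero =>
    simp only [samples, ev_pure, ev_map]
    rw [ev_congr (g := fun _ => f []) fun v => by simp, ev_const]
  | succ n ih =>
    rw [← map_uniform_of_bijective (Fin.consEquiv fun _ : Fin (n + 1) => β).bijective]
    simp only [samples, ev_bind, ev_map, uniform_prod, ih]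
    refine ev_congr fun a => ev_congr fun v => ?_
    simp [Fin.consEquiv, List.ofFn_succ]

/-- A fair bit as a number. -/
noncomputable def bit : PMF ℕ := (PMF.uniformOfFintype Bool).map Bool.toNat

/-- A uniform exponent as a number. -/
noncomputable def expo (q : ℕ) [NeZero q] : PMF ℕ := (PMF.uniformOfFintype (ZMod q)).map ZMod.val

/-- Fair bits are the binary digits of a uniform number below `2 ^ k`, with the lowest digit first.
-/
theorem samples_bit (k : ℕ) : (samples bit k).map ofDigits =
    (PMF.uniformOfFintype (Fin (2 ^ k))).map Fin.val := by
  refine ext_ev fun f => ?_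
  induction k generalizing f with
  | zero =>
    simp only [samples, ev_pure, ev_map]
    rw [ev_congr (g := fun _ => f 0) fun v => by
      congr 1
      have := v.isLt
      omega, ev_const]
    rfl
  | succ k ih =>
    -- A uniform number below `2 * m` consists of an independent last digit and a uniform quotient
    -- by `2`.
    have key : ∀ (m : ℕ) [NeZero m] (g : ℕ → ℝ≥0∞),
        (PMF.uniformOfFintype (Fin (m * 2))).ev (fun x => g x) =
          (PMF.uniformOfFintype Bool).ev fun b =>
            (PMF.uniformOfFintype (Fin m)).ev fun x => g (b.toNat + 2 * x) := by
      intro m _ g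
      rw [← map_uniform_of_bijective (finProdFinEquiv : Fin m × Fin 2 ≃ Fin (m * 2)).bijective,
        ev_map, uniform_prod, ev_comm,
        ← map_uniform_of_bijective (finTwoEquiv.symm : Bool ≃ Fin 2).bijective, ev_map]
      refine ev_congr fun b => ev_congr fun x => ?_
      simp only [finProdFinEquiv, Equiv.coe_fn_mk]
      cases b <;> rfl
    simp only [samples, ev_bind, ev_map]
    rw [bit, ev_map, ← bit]
    refine Eq.trans (ev_congr fun b => ?_) (key (2 ^ k) f).symm
    have := ih fun x => f (b.toNat + 2 * x)
    simp only [ev_map] at this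
    exact this

end PMF

/-! ### The result of a batch -/

namespace Prog

variable {σ : Type} (M : Prog) (inp : Val) (q : ℕ) [NeZero q] (O : σ → Val → PMF (Val × σ))

/-- The rest of a run when the action `act` is due, with `T` activations left. -/
noncomputable def resume (T : ℕ) (s : Val) (e : σ) : MachineAction → PMF (Val × Val × σ)
  | .halt v => PMF.pure (v, s, e)
  | .coin => PMF.bit.bind fun b => M.run inp q O T s (.nat b) e
  | .draw => (PMF.expo q).bind fun z => M.run inp q O T s (.nat z) e
  | .call v => (O e v).bind fun r => M.run inp q O T s r.1 r.2

theorem run_succ (T : ℕ) (s a : Val) (e : σ) : M.run inp q O (T + 1) s a e =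
    M.resume inp q O T (M.activate inp s a).1 e (M.activate inp s a).2 := by
  rw [run]
  rcases h : M.activate inp s a with ⟨s₁, _ | _ | _ | _⟩ <;>
    simp [resume, PMF.bit, PMF.expo, PMF.bind_map, Function.comp_def]

end Prog

namespace BatchScript

variable {S : Type} [Coded S] {σ : BatchScript S} {E A M : Prog} (q : ℕ) [NeZero q]

/-- An oracle without randomness and memory. -/
noncomputable def answering (ans : Val → Val) : Unit → Val → PMF (Val × Unit) :=
  fun _ v => PMF.pure (ans v, ())

/-- The rest of a run from a given situation, without the state of the oracle. -/
noncomputable def rest (σ : BatchScript S) (E A M : Prog) (ans : Val → Val) (T : ℕ)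
    (x : BatchCtx S) : PMF (Val × Val × Unit) :=
  M.resume x.1 q (answering ans) T (code (σ.react E A x).1) ()
    (MachineAction.ofVal (σ.react E A x).2)

variable (hM : σ.Computes E A M) (ans : Val → Val)
include hM

theorem run_idle (T : ℕ) (inp a : Val) (s : S) (s₀ : Val)
    (hs : s₀ = code (idle s) ∨ (s₀ = .nat 0 ∧ s = σ.init)) :
    M.run inp q (answering ans) (T + 1) s₀ a () = rest q σ E A M ans T (inp, a, s, [0]) := by
  rw [Prog.run_succ, hM.activate inp (idle s) s₀ a
    (hs.imp_right fun h => ⟨h.1, by rw [h.2]⟩)]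
  rfl

theorem run_busy (T : ℕ) (inp w a : Val) (s : S) (buf : List ℕ) (hbuf : 0 < buf.length) :
    M.run inp q (answering ans) (T + 1) (code ((buf, w, s) : Mem S)) a () =
      rest q σ E A M ans T (inp, w, s, buf ++ [a.toNat]) := by
  rw [Prog.run_succ, hM.activate inp (buf, w, s) _ a (Or.inl rfl)]
  simp [rest, advance, hbuf.ne']

/-- While coins are due, the reaction does not depend on the contents of the buffer, and each
activation appends one bit. Thus a block of activations amounts to one list of independent samples.
-/
theorem rest_coins (T j : ℕ) (inp w : Val) (s : S) (buf : List ℕ) (hb : 0 < buf.length)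
    (hj : buf.length + j = σ.coins inp + 1) :
    rest q σ E A M ans (T + j) (inp, w, s, buf) =
      (PMF.samples PMF.bit j).bind fun l => rest q σ E A M ans T (inp, w, s, buf ++ l) := by
  induction j generalizing buf with
  | zero => simp [PMF.samples]
  | succ j ih =>
    have hr : σ.react E A (inp, w, s, buf) = ((buf, w, s), .pair (.nat 1) (.nat 0)) := by
      simp only [react, next]
      rw [if_pos (by omega)]
    rw [rest, hr]
    simp only [PMF.samples, Prog.resume, MachineAction.ofVal, PMF.bind_bind, PMF.bind_map,
      ← Nat.add_assoc]
    congr 1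
    funext b
    rw [run_busy q hM ans _ _ _ _ _ _ hb, ih _ (by simp) (by simp; omega)]
    simp [Val.toNat, Function.comp_def]

theorem rest_draws (T j : ℕ) (inp w : Val) (s : S) (buf : List ℕ) (hb : σ.coins inp < buf.length)
    (hj : buf.length + j = σ.coins inp + σ.draws inp + 1) :
    rest q σ E A M ans (T + j) (inp, w, s, buf) =
      (PMF.samples (PMF.expo q) j).bind fun l => rest q σ E A M ans T (inp, w, s, buf ++ l) := by
  induction j generalizing buf with
  | zero => simp [PMF.samples]
  | succ j ih =>
    have hr : σ.react E A (inp, w, s, buf) = ((buf, w, s), .pair (.nat 2) (.nat 0)) := by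
      simp only [react, next]
      rw [if_neg (by omega), if_pos (by omega)]
    rw [rest, hr]
    simp only [PMF.samples, Prog.resume, MachineAction.ofVal, PMF.bind_bind, PMF.bind_map,
      ← Nat.add_assoc]
    congr 1
    funext b
    rw [run_busy q hM ans _ _ _ _ _ _ (by omega), ih _ (by simp; omega) (by simp; omega)]
    simp [Val.toNat, Function.comp_def]

/-- The answers to the calls numbered from `i`. -/
def answersFrom (σ : BatchScript S) (ans : Val → Val) (x : BatchCtx S) (i j : ℕ) : List ℕ :=
  (List.range' i j).map fun i => (ans (σ.query x i)).toNat

theorem rest_calls (T i j : ℕ) (inp w : Val) (s : S) (buf l : List ℕ)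
    (hb : buf.length = σ.coins inp + σ.draws inp + 1) (hl : l.length = i)
    (hj : i + j = σ.calls inp) :
    rest q σ E A M ans (T + j) (inp, w, s, buf ++ l) =
      rest q σ E A M ans T (inp, w, s, buf ++ (l ++ answersFrom σ ans (inp, w, s, buf) i j)) := by
  induction j generalizing i l with
  | zero => simp [answersFrom]
  | succ j ih =>
    have hr : σ.react E A (inp, w, s, buf ++ l) = ((buf ++ l, w, s), .pair (.nat 3)
        (σ.query (inp, w, s, buf) i)) := by
      simp only [react, next]
      have ht : σ.total inp = σ.coins inp + σ.draws inp + σ.calls inp := rfl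
      have hlen : (buf ++ l).length = σ.coins inp + σ.draws inp + 1 + i := by
        rw [List.length_append]
        omega
      rw [if_neg (by omega), if_neg (by omega), if_pos (by omega), hlen, ← hb,
        List.take_left' rfl, Nat.add_sub_cancel_left]
    rw [rest, hr]
    have ha : ∀ v, answering ans () v = PMF.pure (ans v, ()) := fun _ => rfl
    simp only [Prog.resume, MachineAction.ofVal, ha, PMF.pure_bind, ← Nat.add_assoc]
    rw [run_busy q hM ans _ _ _ _ _ _ (by simp; omega), List.append_assoc,
      ih (i + 1) _ (by simp [hl]) (by omega)]
    simp [answersFrom, List.range'_succ]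

/-- A batch: random bits, random exponents and answers are collected. -/
theorem rest_batch (T : ℕ) (inp w : Val) (s : S) :
    rest q σ E A M ans (T + (σ.calls inp + (σ.draws inp + σ.coins inp))) (inp, w, s, [0]) =
      (PMF.samples PMF.bit (σ.coins inp)).bind fun cs =>
        (PMF.samples (PMF.expo q) (σ.draws inp)).bind fun ds =>
          rest q σ E A M ans T (inp, w, s, ([0] ++ cs ++ ds) ++
            answersFrom σ ans (inp, w, s, [0] ++ cs ++ ds) 0 (σ.calls inp)) := by
  refine PMF.ext_ev fun f => ?_
  rw [← Nat.add_assoc, ← Nat.add_assoc, rest_coins q hM ans _ _ _ _ _ _ (by simp) (by simp; omega)]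
  simp only [PMF.ev_bind]
  refine PMF.samples_congr _ _ fun cs hcs => ?_
  rw [rest_draws q hM ans _ _ _ _ _ _ (by simp; omega) (by simp; omega)]
  simp only [PMF.ev_bind]
  refine PMF.samples_congr _ _ fun ds hds => ?_
  have := rest_calls q hM ans T 0 (σ.calls inp) inp w s ([0] ++ cs ++ ds) []
    (by simp; omega) rfl (by omega)
  rw [List.append_nil, List.nil_append] at this
  rw [this]

omit hM in
/-- The end of a batch. -/
theorem rest_finish (T : ℕ) (inp w : Val) (s : S) (buf : List ℕ)
    (hb : σ.total inp < buf.length) (hc : 0 < σ.coins inp) :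
    let e := (σ.pre₁ (inp, w, s, buf)).elim (.nat 0) E.eval
    let r := (σ.pre₂ ((inp, w, s, buf), e)).elim (.nat 0) A.eval
    rest q σ E A M ans T (inp, w, s, buf) =
      match σ.post (((inp, w, s, buf), e), r) with
      | (s', some v) => PMF.pure (v, code (idle s'), ())
      | (s', none) => rest q σ E A M ans T (inp, w, s', [0]) := by
  intro e r
  have hb' := hb
  unfold total at hb'
  have hr : σ.react E A (inp, w, s, buf) = σ.finish (((inp, w, s, buf), e), r) := by
    simp only [react, next, res₁, res₂, arg₁, arg₂]
    rw [if_neg (by omega), if_neg (by omega), if_neg (by omega), if_neg (by omega),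
      if_neg (by omega)]
  rw [rest, hr, finish]
  rcases σ.post (((inp, w, s, buf), e), r) with ⟨s', _ | v⟩
  -- The machine has already emitted the first coin toss of the next batch, which is also its
  -- reaction to a buffer that holds only the leading `0`. So the rest of the run is the same.
  · have hr' : σ.react E A (inp, w, s', [0]) = (([0], w, s'), .pair (.nat 1) (.nat 0)) := by
      simp only [react, next]
      rw [if_pos (by simp; omega)]
    simp only [rest, hr']
    rfl
  · rfl

end BatchScript

/-! ### Numbers for group elements, exponents and passwords -/

section Numerics

variable (P : Params)

/-- The number that represents a group element. -/
def Params.num (x : P.Grp) : ℕ := (x : ZMod (2 * P.q + 1)).val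

theorem Params.q_pos : 0 < P.q := P.prime_q.pos

theorem Params.powMod_num (x : P.Grp) (e : ℕ) : powMod (P.num x) e (2 * P.q + 1) = P.num (x ^ e) := by
  rw [powMod, clip_eq _ (by omega), Params.num, Params.num, Units.val_pow_eq_pow_val,
    ← ZMod.val_natCast, Nat.cast_pow, ZMod.natCast_zmod_val]

theorem Params.powMod_g (e : ℕ) :
    powMod (P.num P.g) e (2 * P.q + 1) = P.num (P.pow P.g (e : ZMod P.q)) := by
  rw [P.powMod_num, P.pow_natCast]

theorem Params.clip_mul (x y : P.Grp) :
    clip (P.num x * P.num y) (2 * P.q + 1) = P.num (x * y) := by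
  rw [clip_eq _ (by omega), Params.num, Params.num, Params.num, Units.val_mul, ZMod.val_mul]

/-- The list of the values of a vector of exponents. -/
def valList {n q : ℕ} (v : Fin n → ZMod q) : List ℕ := List.ofFn fun i => (v i).val

theorem valList_getD {n q : ℕ} (v : Fin n → ZMod q) (i : Fin n) (d : ℕ) :
    (valList v).getD i d = (v i).val := by
  simp [valList]

theorem length_valList {n q : ℕ} (v : Fin n → ZMod q) : (valList v).length = n := by
  simp [valList]

/-- The list of the letters of a password. -/
def Params.letters (p : P.Password) : List ℕ := List.ofFn fun i => (p i : ℕ)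

theorem Params.letters_getD (p : P.Password) (i : Fin P.n) (d : ℕ) :
    (P.letters p).getD i d = p i := by
  simp [Params.letters]

theorem Params.letters_injective : Function.Injective P.letters := by
  intro p p' h
  have := List.ofFn_injective h
  funext i
  exact Fin.ext (congrFun this i)

theorem Val.entry_ofList (l : List Val) (i : ℕ) :
    (Val.ofList l).entry i = (l.getD i (.nat 0)).toNat := by
  induction l generalizing i with
  | nil =>
    have : ∀ j, Val.snd^[j] (.nat 0) = .nat 0 := by
      intro j
      induction j with
      | zero => rfl
      | succ j ih => rw [Function.iterate_succ_apply', ih]; rfl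
    change (Val.snd^[i] (.nat 0)).fst.toNat = _
    rw [this]
    rfl
  | cons a l ih =>
    cases i with
    | zero => rfl
    | succ i =>
      have := ih i
      rw [Val.entry] at this ⊢
      rw [Function.iterate_succ_apply]
      exact this

theorem Params.entry_passwordVal (p : P.Password) (i : Fin P.n) : (P.passwordVal p).entry i = p i := by
  rw [Params.passwordVal, Val.entry_ofList]
  simp [Val.toNat]

theorem map_range_eq_ofFn {α : Type} (n : ℕ) (f : ℕ → α) :
    (List.range n).map f = List.ofFn fun i : Fin n => f i := by
  refine List.ext_getElem (by simp) fun i h1 h2 => by simp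

theorem Params.entries_passwordVal (p : P.Password) : (P.passwordVal p).entries P.n = P.letters p := by
  rw [Val.entries, map_range_eq_ofFn, Params.letters]
  congr 1
  funext i
  exact P.entry_passwordVal p i

theorem Params.readPassword_eq (p : P.Password) (v : Val) :
    P.readPassword v = some p ↔ v.entries P.n = P.letters p := by
  unfold Params.readPassword
  rw [Val.entries, map_range_eq_ofFn, Params.letters]
  constructor
  · intro h
    split_ifs at h with hv
    injection h with h
    subst h
    rfl
  · intro h
    have h := congrFun (List.ofFn_injective h)
    have hv : ∀ i : Fin P.n, v.entry i < P.m := fun i => (h i).trans_lt (p i).isLt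
    rw [dif_pos hv]
    congr 1
    funext i
    exact Fin.ext (h i)

theorem Params.code_letters (p : P.Password) : code (P.letters p) = P.passwordVal p := by
  change Val.ofList ((P.letters p).map Val.nat) = _
  rw [Params.letters, List.map_ofFn]
  rfl

theorem cast_clip (a q : ℕ) [NeZero q] : ((clip a q : ℕ) : ZMod q) = a := by
  rw [clip_eq a (NeZero.pos q), ZMod.natCast_mod]

/-- Horner's scheme; the reductions after each step are invisible modulo `q`. -/
theorem cast_evalMod {t : ℕ} (a : Fin t → ZMod P.q) (x : ℕ) :
    ((evalMod (valList a) x P.q : ℕ) : ZMod P.q) = ∑ j : Fin t, a j * (x : ZMod P.q) ^ (j : ℕ) := by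
  induction t with
  | zero => simp [valList, evalMod]
  | succ t ih =>
    have h : evalMod (valList a) x P.q =
        clip ((a 0).val + x * evalMod (valList fun j : Fin t => a j.succ) x P.q) P.q := by
      simp [valList, evalMod, List.ofFn_succ]
    rw [h, cast_clip, Fin.sum_univ_succ]
    push_cast
    rw [ih, ZMod.natCast_zmod_val, Finset.mul_sum]
    simp only [Fin.val_zero, _root_.pow_zero, mul_one, Fin.val_succ, pow_succ]
    congr 1
    refine Finset.sum_congr rfl fun j _ => ?_
    ring

/-- The sum of a list of bits counts positions. -/
theorem sum_map_range_ite (n : ℕ) (p : ℕ → Prop) [DecidablePred p] :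
    ((List.range n).map fun i => if p i then 1 else 0).sum =
      (Finset.univ.filter fun i : Fin n => p i).card := by
  rw [map_range_eq_ofFn, List.sum_ofFn, Finset.card_filter]

end Numerics

/-! ### The random choices of a batch -/

/-- The parts of the public parameters. -/
def pubK (v : Val) : ℕ := v.entry 0
def pubQ (v : Val) : ℕ := v.entry 1
def pubG (v : Val) : ℕ := v.entry 2
def pubN (v : Val) : ℕ := v.entry 3
def pubT (v : Val) : ℕ := v.entry 4
def pubM (v : Val) : ℕ := v.entry 5

section Pub

variable (P : Params) (k : ℕ)

@[simp] theorem pubK_pub : pubK (P.pub k) = k := rfl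
@[simp] theorem pubQ_pub : pubQ (P.pub k) = P.q := rfl
@[simp] theorem pubG_pub : pubG (P.pub k) = P.num P.g := rfl
@[simp] theorem pubN_pub : pubN (P.pub k) = P.n := rfl
@[simp] theorem pubT_pub : pubT (P.pub k) = P.t := rfl
@[simp] theorem pubM_pub : pubM (P.pub k) = P.m := rfl

end Pub

/-- The random choices for one batch, as numbers. -/
structure Sample where
  bit : ℕ
  κ₁ : ℕ
  κ₂ : ℕ
  s : ℕ
  u : ℕ
  us : List ℕ
  vs : List ℕ
  ws : List ℕ

/-- The numbers of bits and exponents in a batch. -/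
def bitCount (v : Val) : ℕ := 1 + (pubK v + pubK v)
def expoCount (v : Val) : ℕ := 1 + (1 + (pubN v + (pubN v + pubN v)))

/-- The parts of a list of answers. -/
def readSample (v : Val) (buf : List ℕ) : Sample where
  bit := buf.getD 1 0
  κ₁ := ofDigits ((buf.drop 2).take (pubK v))
  κ₂ := ofDigits ((buf.drop (2 + pubK v)).take (pubK v))
  s := (buf.drop (1 + bitCount v)).getD 0 0
  u := (buf.drop (1 + bitCount v)).getD 1 0
  us := ((buf.drop (1 + bitCount v)).drop 2).take (pubN v)
  vs := ((buf.drop (1 + bitCount v)).drop (2 + pubN v)).take (pubN v)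
  ws := ((buf.drop (1 + bitCount v)).drop (2 + pubN v + pubN v)).take (pubN v)

/-- The random choices for one batch. -/
abbrev Batch (P : Params) (k : ℕ) : Type :=
  Bool × BitString k × BitString k × ZMod P.q × ZMod P.q × (Fin P.n → ZMod P.q) ×
    (Fin P.n → ZMod P.q) × (Fin P.n → ZMod P.q)

def Batch.sample {P : Params} {k : ℕ} (b : Batch P k) : Sample :=
  ⟨b.1.toNat, b.2.1, b.2.2.1, b.2.2.2.1.val, b.2.2.2.2.1.val, valList b.2.2.2.2.2.1,
    valList b.2.2.2.2.2.2.1, valList b.2.2.2.2.2.2.2⟩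

theorem readSample_append (v : Val) (b : ℕ) (l₁ l₂ : List ℕ) (s u : ℕ) (us vs ws : List ℕ)
    (ls : List ℕ) (h₁ : l₁.length = pubK v) (h₂ : l₂.length = pubK v) (h₃ : us.length = pubN v)
    (h₄ : vs.length = pubN v) (h₅ : ws.length = pubN v) :
    readSample v ([0] ++ ([b] ++ (l₁ ++ l₂)) ++ ([s] ++ ([u] ++ (us ++ (vs ++ ws)))) ++ ls) =
      ⟨b, ofDigits l₁, ofDigits l₂, s, u, us, vs, ws⟩ := by
  have hd : ([0] ++ ([b] ++ (l₁ ++ l₂)) ++ ([s] ++ ([u] ++ (us ++ (vs ++ ws)))) ++ ls).drop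
      (1 + bitCount v) = s :: u :: (us ++ (vs ++ (ws ++ ls))) := by
    rw [List.append_assoc, List.drop_left' (by simp [bitCount, h₁, h₂]; omega)]
    simp
  have t₁ : 2 + pubN v = pubN v + 1 + 1 := by omega
  have t₂ : 2 + pubN v + pubN v = pubN v + pubN v + 1 + 1 := by omega
  unfold readSample
  rw [hd]
  congr 1
  · simp only [List.cons_append, List.nil_append, List.append_assoc, List.drop_succ_cons,
      List.drop_zero]
    rw [List.take_left' h₁]
  · rw [Nat.add_comm 2]
    simp only [List.cons_append, List.nil_append, List.append_assoc, List.drop_succ_cons]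
    rw [List.drop_left' h₁, List.take_left' h₂]
  · simp only [List.drop_succ_cons, List.drop_zero]
    rw [List.take_left' h₃]
  · rw [t₁]
    simp only [List.drop_succ_cons]
    rw [List.drop_left' h₃, List.take_left' h₄]
  · rw [t₂]
    simp only [List.drop_succ_cons]
    rw [← List.drop_drop, List.drop_left' h₃, List.drop_left' h₄, List.take_left' h₅]

/-- The answers in a batch are uniform random choices. -/
theorem ev_batch (P : Params) (k : ℕ) (v : Val) (hk : pubK v = k) (hn : pubN v = P.n)
    (F : Sample → ℝ≥0∞) (G : List ℕ → List ℕ → ℝ≥0∞)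
    (hG : ∀ cs ds, cs.length = bitCount v → ds.length = expoCount v →
      G cs ds = F (readSample v ([0] ++ cs ++ ds))) :
    ((PMF.samples PMF.bit (bitCount v)).ev fun cs =>
      (PMF.samples (PMF.expo P.q) (expoCount v)).ev fun ds => G cs ds) =
      (PMF.uniformOfFintype (Batch P k)).ev fun b => F b.sample := by
  have h1 : ∀ {α : Type} (d : PMF α) (f : List α → ℝ≥0∞),
      (PMF.samples d 1).ev f = d.ev fun a => f [a] := by
    intro α d f
    simp [PMF.samples]
  have hdig : ∀ f : ℕ → ℝ≥0∞, ((PMF.samples PMF.bit k).ev fun l => f (ofDigits l)) =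
      (PMF.uniformOfFintype (BitString k)).ev fun x => f x := by
    intro f
    have := congrArg (fun d => PMF.ev d f) (PMF.samples_bit k)
    simpa only [PMF.ev_map] using this
  have hvec : ∀ f : List ℕ → ℝ≥0∞, (PMF.samples (PMF.expo P.q) P.n).ev f =
      (PMF.uniformOfFintype (Fin P.n → ZMod P.q)).ev fun x => f (valList x) := by
    intro f
    have := congrArg (fun d => PMF.ev d f) (PMF.samples_uniform (ZMod.val : ZMod P.q → ℕ) P.n)
    rw [PMF.ev_map] at this
    exact this
  calc _ = (PMF.samples PMF.bit (bitCount v)).ev fun cs =>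
      (PMF.samples (PMF.expo P.q) (expoCount v)).ev fun ds =>
        F (readSample v ([0] ++ cs ++ ds ++ [])) :=
        PMF.samples_congr _ _ fun cs hcs => PMF.samples_congr _ _ fun ds hds => by
          rw [hG cs ds hcs hds, List.append_nil]
    _ = _ := by
      unfold bitCount expoCount
      rw [hk, hn]
      simp only [PMF.samples_add, PMF.ev_bind, PMF.ev_map, h1, PMF.uniform_prod]
      rw [PMF.bit, PMF.ev_map, ← PMF.bit]
      refine PMF.ev_congr fun b => ?_
      have hs : ∀ l₁ l₂ : List ℕ, l₁.length = k → l₂.length = k → ∀ s u,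
          ((PMF.samples (PMF.expo P.q) P.n).ev fun us => (PMF.samples (PMF.expo P.q) P.n).ev fun vs =>
            (PMF.samples (PMF.expo P.q) P.n).ev fun ws => F (readSample v
              ([0] ++ ([b.toNat] ++ (l₁ ++ l₂)) ++ ([s] ++ ([u] ++ (us ++ (vs ++ ws)))) ++ []))) =
          (PMF.uniformOfFintype (Fin P.n → ZMod P.q)).ev fun us =>
            (PMF.uniformOfFintype (Fin P.n → ZMod P.q)).ev fun vs =>
              (PMF.uniformOfFintype (Fin P.n → ZMod P.q)).ev fun ws =>
                F ⟨b.toNat, ofDigits l₁, ofDigits l₂, s, u, valList us, valList vs, valList ws⟩ := by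
        intro l₁ l₂ h₁ h₂ s u
        rw [hvec]
        refine PMF.ev_congr fun us => ?_
        rw [hvec]
        refine PMF.ev_congr fun vs => ?_
        rw [hvec]
        refine PMF.ev_congr fun ws => ?_
        rw [readSample_append v _ _ _ _ _ _ _ _ _ (h₁.trans hk.symm) (h₂.trans hk.symm)
          ((length_valList _).trans hn.symm) ((length_valList _).trans hn.symm)
          ((length_valList _).trans hn.symm)]
      have he : ∀ f : ℕ → ℝ≥0∞, (PMF.expo P.q).ev f =
          (PMF.uniformOfFintype (ZMod P.q)).ev fun z => f z.val := fun f => PMF.ev_map _ _ _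
      refine (PMF.samples_congr _ _ fun l₁ h₁ => PMF.samples_congr _ _ fun l₂ h₂ =>
        PMF.ev_congr fun s => PMF.ev_congr fun u => hs l₁ l₂ h₁ h₂ s u).trans ?_
      simp only [he]
      refine (PMF.ev_congr fun l₁ => hdig fun κ₂ => (PMF.uniformOfFintype (ZMod P.q)).ev fun s =>
        (PMF.uniformOfFintype (ZMod P.q)).ev fun u =>
          (PMF.uniformOfFintype (Fin P.n → ZMod P.q)).ev fun us =>
            (PMF.uniformOfFintype (Fin P.n → ZMod P.q)).ev fun vs =>
              (PMF.uniformOfFintype (Fin P.n → ZMod P.q)).ev fun ws =>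
                F ⟨b.toNat, ofDigits l₁, κ₂, s.val, u.val, valList us, valList vs,
                  valList ws⟩).trans ?_
      exact hdig fun κ₁ => (PMF.uniformOfFintype (BitString k)).ev fun κ₂ =>
        (PMF.uniformOfFintype (ZMod P.q)).ev fun s =>
          (PMF.uniformOfFintype (ZMod P.q)).ev fun u =>
            (PMF.uniformOfFintype (Fin P.n → ZMod P.q)).ev fun us =>
              (PMF.uniformOfFintype (Fin P.n → ZMod P.q)).ev fun vs =>
                (PMF.uniformOfFintype (Fin P.n → ZMod P.q)).ev fun ws =>
                  F ⟨b.toNat, κ₁, κ₂, s.val, u.val, valList us, valList vs, valList ws⟩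

/-! ### The program of the simulator -/

section SampleCode

variable {γ : Type} [Coded γ]

instance : Coded Sample := ⟨fun r => code (r.bit, r.κ₁, r.κ₂, r.s, r.u, r.us, r.vs, r.ws)⟩

namespace Sample

theorem polyTime_parts {f : γ → Sample} (hf : PolyTime f) : PolyTime fun x =>
    ((f x).bit, (f x).κ₁, (f x).κ₂, (f x).s, (f x).u, (f x).us, (f x).vs, (f x).ws) :=
  hf.of_code_eq fun _ => rfl

@[fun_prop] theorem polyTime_bit {f : γ → Sample} (hf : PolyTime f) : PolyTime fun x => (f x).bit :=
  (polyTime_parts hf).fst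
@[fun_prop] theorem polyTime_κ₁ {f : γ → Sample} (hf : PolyTime f) : PolyTime fun x => (f x).κ₁ :=
  (polyTime_parts hf).snd.fst
@[fun_prop] theorem polyTime_κ₂ {f : γ → Sample} (hf : PolyTime f) : PolyTime fun x => (f x).κ₂ :=
  (polyTime_parts hf).snd.snd.fst
@[fun_prop] theorem polyTime_s {f : γ → Sample} (hf : PolyTime f) : PolyTime fun x => (f x).s :=
  (polyTime_parts hf).snd.snd.snd.fst
@[fun_prop] theorem polyTime_u {f : γ → Sample} (hf : PolyTime f) : PolyTime fun x => (f x).u :=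
  (polyTime_parts hf).snd.snd.snd.snd.fst
@[fun_prop] theorem polyTime_us {f : γ → Sample} (hf : PolyTime f) : PolyTime fun x => (f x).us :=
  (polyTime_parts hf).snd.snd.snd.snd.snd.fst
@[fun_prop] theorem polyTime_vs {f : γ → Sample} (hf : PolyTime f) : PolyTime fun x => (f x).vs :=
  (polyTime_parts hf).snd.snd.snd.snd.snd.snd.fst
@[fun_prop] theorem polyTime_ws {f : γ → Sample} (hf : PolyTime f) : PolyTime fun x => (f x).ws :=
  (polyTime_parts hf).snd.snd.snd.snd.snd.snd.snd

end Sample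

variable {v : γ → Val} (hv : PolyTime v)
include hv

@[fun_prop] theorem polyTime_pubK : PolyTime fun x => pubK (v x) := hv.valEntry 0
@[fun_prop] theorem polyTime_pubQ : PolyTime fun x => pubQ (v x) := hv.valEntry 1
@[fun_prop] theorem polyTime_pubG : PolyTime fun x => pubG (v x) := hv.valEntry 2
@[fun_prop] theorem polyTime_pubN : PolyTime fun x => pubN (v x) := hv.valEntry 3
@[fun_prop] theorem polyTime_pubT : PolyTime fun x => pubT (v x) := hv.valEntry 4
@[fun_prop] theorem polyTime_pubM : PolyTime fun x => pubM (v x) := hv.valEntry 5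

@[fun_prop] theorem polyTime_bitCount : PolyTime fun x => bitCount (v x) := by
  unfold bitCount
  fun_prop

@[fun_prop] theorem polyTime_expoCount : PolyTime fun x => expoCount (v x) := by
  unfold expoCount
  fun_prop

@[fun_prop] theorem polyTime_readSample {buf : γ → List ℕ} (hb : PolyTime buf) :
    PolyTime fun x => readSample (v x) (buf x) := by
  have : PolyTime fun x => ((readSample (v x) (buf x)).bit, (readSample (v x) (buf x)).κ₁,
      (readSample (v x) (buf x)).κ₂, (readSample (v x) (buf x)).s, (readSample (v x) (buf x)).u,
      (readSample (v x) (buf x)).us, (readSample (v x) (buf x)).vs,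
      (readSample (v x) (buf x)).ws) := by
    simp only [readSample]
    fun_prop
  exact this.of_code_eq fun _ => rfl

end SampleCode

/-- The message of a recovery, with numbers for the group elements. -/
def groupMessage (v : Val) (κ pk a b : ℕ) (cs : List ℕ) : Val :=
  .ofList [.nat κ, .ofList [.nat (pubQ v), .nat (pubG v), .nat pk], .ofList [.nat a, .nat b], code cs]

/-- The number of the power of the generator. -/
def powG (v : Val) (e : ℕ) : ℕ := powMod (pubG v) e (2 * pubQ v + 1)

section GroupMessage

variable {γ : Type} [Coded γ]

@[fun_prop] theorem polyTime_groupMessage {v : γ → Val} {κ pk a b : γ → ℕ} {cs : γ → List ℕ}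
    (hv : PolyTime v) (hκ : PolyTime κ) (hpk : PolyTime pk) (ha : PolyTime a) (hb : PolyTime b)
    (hcs : PolyTime cs) : PolyTime fun x => groupMessage (v x) (κ x) (pk x) (a x) (b x) (cs x) := by
  unfold groupMessage
  fun_prop

@[fun_prop] theorem polyTime_powG {v : γ → Val} {e : γ → ℕ} (hv : PolyTime v) (he : PolyTime e) :
    PolyTime fun x => powG (v x) (e x) := by
  unfold powG
  fun_prop

variable (P : Params) {k : ℕ}

theorem powG_pub (e : ℕ) : powG (P.pub k) e = P.num (P.pow P.g (e : ZMod P.q)) := P.powMod_g e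

theorem groupMessage_pub (κ : BitString k) (pk a b : P.Grp) (c : Fin P.n → P.Grp) :
    groupMessage (P.pub k) κ (P.num pk) (P.num a) (P.num b) (List.ofFn fun i => P.num (c i)) =
      recoveryMessage P κ pk a b c := by
  unfold groupMessage recoveryMessage
  have : code (List.ofFn fun i => P.num (c i)) = Val.ofList (List.ofFn fun i => P.elt (c i)) := by
    change Val.ofList ((List.ofFn fun i => P.num (c i)).map Val.nat) = _
    rw [List.map_ofFn]
    rfl
  rw [this]
  rfl

end GroupMessage

/-- The number of positions, bounded by the length of a list. -/
def padded (v : Val) (buf : List ℕ) : ℕ := (buf.take (pubN v)).length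

theorem padded_eq (v : Val) (buf : List ℕ) (h : pubN v ≤ buf.length) : padded v buf = pubN v := by
  simp [padded, h]

namespace Simulator

def hit (w : Val) : ℕ := w.snd.snd.fst.isPair

def guess (w : Val) (n : ℕ) : List ℕ := w.snd.fst.entries n

def secret (w : Val) (n : ℕ) : List ℕ := w.snd.snd.fst.snd.entries n

/-- The keys and the coefficients. -/
def setup (v : Val) (S : List ℕ) (r : Sample) : List ℕ :=
  if S.length = 0 then r.κ₁ :: r.κ₂ :: r.vs.take (pubT v) else S

def hashQuery (tag i κ l : ℕ) : Val := .pair (.nat tag) (.ofList [.nat i, .nat κ, .nat l])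

/-- The calls to the random oracles: for the letters of the password both hash functions, for those
of the guess the second one. -/
def queryWith (v w : Val) (T : List ℕ) (n j : ℕ) : Val :=
  if j < pubN v then hashQuery 0 j (T.getD 0 0) ((secret w n).getD j 0)
  else if j < pubN v + pubN v then
    hashQuery 1 (j - pubN v) (T.getD 1 0) ((secret w n).getD (j - pubN v) 0)
  else
    hashQuery 1 (j - (pubN v + pubN v)) (T.getD 1 0) ((guess w n).getD (j - (pubN v + pubN v)) 0)

/-- The password, if it has to be encoded. -/
def encodeArg (x : BatchCtx (List ℕ)) : Option Val :=
  if hit x.2.1 = 0 then none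
  else some (.pair x.1 (code ((secret x.2.1 (padded x.1 x.2.2.2)).map fun a => clip a (pubM x.1))))

/-- The exponent for position `i`, computed from the answers `ls` of the random oracles. -/
def exponent (v : Val) (as ls : List ℕ) (i : ℕ) : ℕ :=
  evalMod as (ls.getD i 0) (pubQ v) + (pubQ v - ls.getD (pubN v + i) 0) +
    ls.getD (pubN v + pubN v + i) 0

def recoverReply (v w : Val) (T : List ℕ) (r : Sample) (ls : List ℕ) (e n : ℕ) : Val :=
  if hit w = 0 then
    groupMessage v (T.getD 0 0) (powG v (T.getD 2 0)) (powG v r.s) (powG v r.u)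
      ((List.range n).map fun i => powG v (r.us.getD i 0))
  else
    groupMessage v (T.getD 0 0) (powG v (T.getD 2 0)) (powG v r.s)
      (clip (e * powG v (T.getD 2 0 * r.s)) (2 * pubQ v + 1))
      ((List.range n).map fun i => powG v (r.s * exponent v (T.drop 2) ls i))

/-- A guess equal to the password agrees with it everywhere and therefore matches, because `t ≤ n`.
So a correct log in always shows the password to the simulator, and rejecting a guess without a
match is never wrong for comparison of passwords. -/
def reply (v w : Val) (T : List ℕ) (r : Sample) (ls : List ℕ) (e n : ℕ) : Val :=
  if w.entry 0 = 0 then recoverReply v w T r ls e n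
  else if hit w = 0 then .nat 0
  else if guess w n = secret w n then .nat 1 else .nat 0

/-- The simulator as a batch machine. -/
def script : BatchScript (List ℕ) where
  coins := bitCount
  draws := expoCount
  calls v := pubN v + (pubN v + pubN v)
  query x := queryWith x.1 x.2.1 (setup x.1 x.2.2.1 (readSample x.1 x.2.2.2)) (padded x.1 x.2.2.2)
  pre₁ := encodeArg
  pre₂ _ := none
  post z := (setup z.1.1.1 z.1.1.2.2.1 (readSample z.1.1.1 z.1.1.2.2.2),
    some (reply z.1.1.1 z.1.1.2.1 (setup z.1.1.1 z.1.1.2.2.1 (readSample z.1.1.1 z.1.1.2.2.2))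
      (readSample z.1.1.1 z.1.1.2.2.2)
      (z.1.1.2.2.2.drop (1 + bitCount z.1.1.1 + expoCount z.1.1.1)) z.1.2.toNat
      (padded z.1.1.1 z.1.1.2.2.2)))
  init := []

section

variable {γ : Type} [Coded γ]

@[fun_prop] theorem polyTime_hit {w : γ → Val} (hw : PolyTime w) : PolyTime fun x => hit (w x) := by
  unfold hit
  fun_prop

@[fun_prop] theorem polyTime_guess {w : γ → Val} {l : γ → List ℕ} (hw : PolyTime w)
    (hl : PolyTime l) : PolyTime fun x => guess (w x) (l x).length := by
  unfold guess
  fun_prop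

@[fun_prop] theorem polyTime_secret {w : γ → Val} {l : γ → List ℕ} (hw : PolyTime w)
    (hl : PolyTime l) : PolyTime fun x => secret (w x) (l x).length := by
  unfold secret
  fun_prop

@[fun_prop] theorem polyTime_setup {v : γ → Val} {S : γ → List ℕ} {r : γ → Sample}
    (hv : PolyTime v) (hS : PolyTime S) (hr : PolyTime r) :
    PolyTime fun x => setup (v x) (S x) (r x) := by
  unfold setup
  fun_prop

@[fun_prop] theorem polyTime_exponent {v : γ → Val} {as ls : γ → List ℕ} {i : γ → ℕ}
    (hv : PolyTime v) (ha : PolyTime as) (hl : PolyTime ls) (hi : PolyTime i) :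
    PolyTime fun x => exponent (v x) (as x) (ls x) (i x) := by
  unfold exponent
  fun_prop

theorem script_feasible : script.Feasible where
  coins := by
    change PolyTime bitCount
    fun_prop
  draws := by
    change PolyTime expoCount
    fun_prop
  calls := by
    simp only [script]
    fun_prop
  query := by
    simp only [script, queryWith, hashQuery, padded]
    fun_prop
  pre₁ := by
    simp only [script]
    unfold encodeArg padded
    fun_prop
  pre₂ := PolyTime.const _
  post := by
    simp only [script, reply, recoverReply, padded]
    fun_prop
  init := rfl

end

end Simulator

/-- The program for the encoding reads the public description, and its cost is at least the size of
what it reads. -/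
theorem size_pub_le {P : ℕ → Params} {E : Prog} {c : ℕ}
    (hE : ∀ (k : ℕ) (p : (P k).Password),
      E.cost (.pair ((P k).pub k) ((P k).passwordVal p)) ≤ polyBound c k) (k : ℕ) :
    ((P k).pub k).size ≤ polyBound c k := by
  have h1 := hE k fun _ => 0
  have h2 := E.size_le_cost (.pair ((P k).pub k) ((P k).passwordVal fun _ => 0))
  simp only [Val.size] at h2
  omega

/-- A list of the right length, with its entries reduced, is the code of a password. -/
theorem exists_passwordVal (P : Params) (l : List ℕ) (hl : l.length = P.n) :
    ∃ p : P.Password, code (l.map fun a => clip a P.m) = P.passwordVal p := by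
  refine ⟨fun i => ⟨clip (l.getD i 0) P.m, by
    rw [clip_eq _ P.m_pos]
    exact Nat.mod_lt _ P.m_pos⟩, ?_⟩
  rw [← Params.code_letters, Params.letters]
  congr 1
  refine List.ext_getElem (by simp [hl]) fun i h1 h2 => ?_
  have hi : i < l.length := by simpa using h1
  simp [List.getD, hi]

theorem Val.length_entries (v : Val) (n : ℕ) : (v.entries n).length = n := by
  simp [Val.entries]

/-! ### The running time of the simulator. -/

namespace Simulator

/-- The state is drawn once and never grows. The cost of the encoding program is known only for
codes of passwords; the entries of its argument are reduced below `m`, so that the bound holds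
whatever messages arrive. -/
theorem exists_efficient {P : ℕ → Params} {E : Prog} {c : ℕ}
    (hE : ∀ (k : ℕ) (p : (P k).Password),
      E.cost (.pair ((P k).pub k) ((P k).passwordVal p)) ≤ polyBound c k) :
    ∃ M : Prog, script.Computes E (.const 0) M ∧ M.Efficient fun k => (P k).pub k := by
  have hset : PolyTime fun z : Val × List ℕ => setup z.1 [] (readSample z.1 z.2) := by fun_prop
  obtain ⟨F, hF, hFm, hFb⟩ := hset.csize_bound
  have hpub := size_pub_le hE
  let G : ℕ → ℕ := fun n => F (polyBound c n + 2 * n + 4) + polyBound c n + 1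
  have hG : PolyBounded G :=
    ((hF.comp (((PolyBounded.id.polyBound c).add ((PolyBounded.const 2).mul PolyBounded.id)).add
      (PolyBounded.const 4))).add (PolyBounded.id.polyBound c)).add (PolyBounded.const 1)
  have hGm : Monotone G := fun a b h => by
    have h1 := polyBound_mono c h
    have h2 := hFm (show polyBound c a + 2 * a + 4 ≤ polyBound c b + 2 * b + 4 by omega)
    simp only [G]
    omega
  refine BatchScript.exists_efficient script_feasible hG hGm
    (fun k N S => _root_.csize S ≤ G (k + N)) (fun k => ?_) (fun k => ?_) (fun k N N' S h hS => ?_)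
    (fun k N S h => h) fun k N N' w S buf hS hN hbuf hw hlen => ⟨?_, fun e he => ⟨?_, ?_⟩⟩
  · have := hpub k
    simp only [G]
    omega
  · simp [script, G]
  · exact hS.trans (hGm (by omega))
  · change (encodeArg ((P k).pub k, w, S, buf)).elim 0 E.cost ≤ _
    unfold encodeArg
    split_ifs
    · exact Nat.zero_le _
    · have hn : padded ((P k).pub k) buf = (P k).n := by
        refine padded_eq _ _ ?_
        simp only [BatchScript.total, script, expoCount] at hlen
        omega
      obtain ⟨p, hp⟩ := exists_passwordVal (P k)
        (secret w (padded ((P k).pub k) buf)) (by rw [secret, Val.length_entries, hn])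
      simp only [pubM_pub, Option.elim_some]
      rw [hp]
      refine (hE k p).trans ((polyBound_mono c (show k ≤ k + N' by omega)).trans ?_)
      simp only [G]
      omega
  · simp [script]
  · simp only [script]
    unfold setup
    split_ifs with hS0
    · have h1 := hFb ((P k).pub k, buf)
      simp only [setup, List.length_nil, if_true, csize_prod] at h1
      refine h1.trans ?_
      have h2 := hpub k
      have h3 := polyBound_mono c (show k ≤ k + N' by omega)
      have h4 := hFm (show _root_.csize ((P k).pub k) + _root_.csize buf + 1
        ≤ polyBound c (k + N') + 2 * (k + N') + 4 by
          have : _root_.csize ((P k).pub k) = ((P k).pub k).size := rfl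
          omega)
      simp only [G]
      omega
    · exact hS.trans (hGm (by omega))

end Simulator

theorem readSample_append_right (v : Val) (l ls : List ℕ) (h : l.length = 1 + bitCount v + expoCount v) :
    readSample v (l ++ ls) = readSample v l := by
  have hd : ∀ i j : ℕ, i + j ≤ l.length → ((l ++ ls).drop i).take j = (l.drop i).take j := by
    intro i j hij
    rw [List.drop_append_of_le_length (by omega), List.take_append_of_le_length (by simp; omega)]
  have hg : ∀ i : ℕ, i < l.length → (l ++ ls).getD i 0 = l.getD i 0 := by
    intro i hi
    simp [List.getD, List.getElem?_append_left hi]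
  have hdg : ∀ i j : ℕ, i + j < l.length → ((l ++ ls).drop i).getD j 0 = (l.drop i).getD j 0 := by
    intro i j hij
    simp [List.getD, List.getElem?_append_left hij]
  unfold readSample
  simp only [List.drop_drop]
  simp only [bitCount, expoCount] at h ⊢
  rw [hg _ (by omega), hd _ _ (by omega), hd _ _ (by omega), hdg _ _ (by omega),
    hdg _ _ (by omega), hd _ _ (by omega), hd _ _ (by omega), hd _ _ (by omega)]

/-- The restriction of a uniform vector. -/
theorem PMF.map_uniform_castLE {α : Type} [Fintype α] [AddGroup α] {t n : ℕ} (h : t ≤ n) :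
    (PMF.uniformOfFintype (Fin n → α)).map (fun v (j : Fin t) => v (j.castLE h)) =
      PMF.uniformOfFintype (Fin t → α) := by
  let π : (Fin n → α) →+ (Fin t → α) :=
    { toFun := fun v j => v (j.castLE h)
      map_zero' := rfl
      map_add' := fun _ _ => rfl }
  have := PMF.map_uniform_of_surjective π 0 fun w =>
    ⟨fun i => if hi : (i : ℕ) < t then w ⟨i, hi⟩ else 0, by
      funext j
      simp [π]⟩
  simpa [π] using this

theorem valList_take {t n q : ℕ} (h : t ≤ n) (v : Fin n → ZMod q) :
    (valList v).take t = valList fun j : Fin t => v (j.castLE h) := by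
  refine List.ext_getElem (by simp [length_valList, h]) fun i h1 h2 => by simp [valList]

/-! ### The replies of the simulator. -/

namespace Simulator

variable {P : Params} {k : ℕ}

/-- The state of the simulator after its first request. -/
def setupList (z : Setup P k) : List ℕ := (z.1.1 : ℕ) :: (z.1.2 : ℕ) :: valList z.2

def memOf (o : Option (Setup P k)) : Val :=
  o.elim (.nat 0) fun z => code (BatchScript.idle (setupList z))

def message (b : Bool) (p x : P.Password) : Val :=
  .ofList [.nat b.toNat, P.passwordVal x, idealAnswerVal P (idealOracle P p x)]

theorem hit_message (b : Bool) (p x : P.Password) :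
    hit (message b p x) = if P.Matches x p then 1 else 0 := by
  unfold message idealOracle
  split_ifs <;> rfl

theorem guess_message (b : Bool) (p x : P.Password) :
    guess (message b p x) P.n = P.letters x := P.entries_passwordVal x

theorem secret_message (b : Bool) {p x : P.Password} (h : P.Matches x p) :
    secret (message b p x) P.n = P.letters p := by
  rw [← P.entries_passwordVal p]
  unfold message idealOracle
  rw [if_pos h]
  rfl

theorem matches_self (p : P.Password) : P.Matches p p := by
  simp [Params.Matches, P.t_le]

theorem setupList_head (z : Setup P k) : (setupList z).getD 2 0 = z.2.secret.val := by
  simp only [setupList, List.getD_cons_succ]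
  exact valList_getD z.2 ⟨0, P.t_pos⟩ 0

/-- The answers of the random oracles in a batch. -/
def hashList (ρ : HashFunctions P k) (w : Val) (T : List ℕ) : List ℕ :=
  (List.range (P.n + (P.n + P.n))).map fun j =>
    (hashAnswer P k ρ (queryWith (P.pub k) w T P.n j)).toNat

theorem hashList_getD (ρ : HashFunctions P k) (w : Val) (T : List ℕ) (j : ℕ)
    (hj : j < P.n + (P.n + P.n)) : (hashList ρ w T).getD j 0 =
      (hashAnswer P k ρ (queryWith (P.pub k) w T P.n j)).toNat := by
  simp [hashList, hj]

theorem keyedAnswer_eq (f : Fin P.n → BitString k → Fin P.m → ZMod P.q) (i : Fin P.n)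
    (κ : BitString k) (l : Fin P.m) :
    keyedAnswer P k f (.ofList [.nat i, .nat κ, .nat l]) = .nat (f i κ l).val := by
  have h0 : (Val.ofList [.nat i, .nat κ, .nat l]).entry 0 = i := rfl
  have h1 : (Val.ofList [.nat i, .nat κ, .nat l]).entry 1 = κ := rfl
  have h2 : (Val.ofList [.nat i, .nat κ, .nat l]).entry 2 = l := rfl
  unfold keyedAnswer
  rw [dif_pos ⟨h0 ▸ i.isLt, h1 ▸ κ.isLt, h2 ▸ l.isLt⟩]
  rfl

theorem exponent_eq (ρ : HashFunctions P k) (b : Bool) {p x : P.Password} (h : P.Matches x p)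
    (z : Setup P k) (i : Fin P.n) :
    ((exponent (P.pub k) ((setupList z).drop 2) (hashList ρ (message b p x) (setupList z)) i : ℕ) :
      ZMod P.q) = keyedExponents ρ z.1.1 z.1.2 z.2 p x i := by
  have hi := i.isLt
  have e₀ : (hashList ρ (message b p x) (setupList z)).getD i 0 = (ρ.1 i z.1.1 (p i)).val := by
    rw [hashList_getD _ _ _ _ (by omega), queryWith, pubN_pub, if_pos hi, secret_message b h,
      P.letters_getD]
    exact congrArg Val.toNat (keyedAnswer_eq ρ.1 i z.1.1 (p i))
  have e₁ : (hashList ρ (message b p x) (setupList z)).getD (P.n + i) 0 =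
      (ρ.2.1 i z.1.2 (p i)).val := by
    rw [hashList_getD _ _ _ _ (by omega), queryWith, pubN_pub, if_neg (by omega),
      if_pos (by omega), Nat.add_sub_cancel_left, secret_message b h, P.letters_getD]
    exact congrArg Val.toNat (keyedAnswer_eq ρ.2.1 i z.1.2 (p i))
  have e₂ : (hashList ρ (message b p x) (setupList z)).getD (P.n + P.n + i) 0 =
      (ρ.2.1 i z.1.2 (x i)).val := by
    rw [hashList_getD _ _ _ _ (by omega), queryWith, pubN_pub, if_neg (by omega),
      if_neg (by omega), Nat.add_sub_cancel_left, guess_message, P.letters_getD]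
    exact congrArg Val.toNat (keyedAnswer_eq ρ.2.1 i z.1.2 (x i))
  have hd : (setupList z).drop 2 = valList z.2 := rfl
  unfold exponent
  simp only [pubN_pub, pubQ_pub, e₀, e₁, e₂, hd]
  -- The truncated difference of `q` and a hash value is a genuine one, since hash values are below
  -- `q`, and `q` itself vanishes modulo `q`.
  push_cast [(ZMod.val_lt (ρ.2.1 i z.1.2 (p i))).le]
  rw [cast_evalMod]
  simp only [ZMod.natCast_zmod_val, CharP.cast_eq_zero, keyedExponents, Coeffs.share]
  ring

/-- The reply for given random choices. -/
def replyOf (ρ : HashFunctions P k) (b : Bool) (p x : P.Password) (z : Setup P k)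
    (u : ZMod P.q × ZMod P.q × (Fin P.n → ZMod P.q)) : Val :=
  bif b then loginReply (x = p)
  else if true = true ∧ ¬ P.Matches x p then
    expMessage z.1.1 z.2.secret u.1 (P.pow P.g u.2.1) u.2.2
  else honestReply z.1.1 p z.2.secret (keyedExponents ρ z.1.1 z.1.2 z.2 p x) u.1

theorem reply_eq (ρ : HashFunctions P k) (b : Bool) (p x : P.Password) (z : Setup P k)
    (r : Batch P k) (e : ℕ) (he : P.Matches x p → e = P.num (P.encode p)) :
    reply (P.pub k) (message b p x) (setupList z) r.sample
      (hashList ρ (message b p x) (setupList z)) e P.n =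
      replyOf ρ b p x z (r.2.2.2.1, r.2.2.2.2.1, r.2.2.2.2.2.1) := by
  unfold reply replyOf
  have h0 : (message b p x).entry 0 = b.toNat := rfl
  rw [h0]
  cases b
  · simp only [Bool.toNat_false, if_true, cond_false, recoverReply, hit_message]
    by_cases h : P.Matches x p
    · simp only [h, if_true, not_true_eq_false, and_false, if_false, one_ne_zero]
      rw [setupList_head, powG_pub, powG_pub, powG_pub, he h, pubQ_pub, P.clip_mul,
        map_range_eq_ofFn]
      simp only [powG_pub, Nat.cast_mul, exponent_eq ρ false h, ZMod.natCast_zmod_val,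
        Batch.sample]
      exact groupMessage_pub P z.1.1 _ _ _ _
    · simp only [h, if_true, not_false_eq_true, and_self, if_false]
      rw [setupList_head, powG_pub, powG_pub, powG_pub, map_range_eq_ofFn]
      simp only [powG_pub, Batch.sample, valList_getD, ZMod.natCast_zmod_val]
      exact groupMessage_pub P z.1.1 _ _ _ _
  · simp only [Bool.toNat_true, one_ne_zero, if_false, cond_true, hit_message, loginReply]
    by_cases h : P.Matches x p
    · simp only [h, if_true, one_ne_zero, if_false, guess_message, secret_message true h,
        P.letters_injective.eq_iff]
      split_ifs <;> rfl
    · have : x ≠ p := fun hx => h (hx ▸ matches_self x)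
      simp [h, this]

/-- The keys and coefficients used in a batch. -/
def setupOf (o : Option (Setup P k)) (r : Batch P k) : Setup P k :=
  o.getD ((r.2.1, r.2.2.1), fun j => r.2.2.2.2.2.2.1 (j.castLE P.t_le))

theorem setup_eq (o : Option (Setup P k)) (r : Batch P k) :
    setup (P.pub k) (o.elim [] setupList) r.sample = setupList (setupOf o r) := by
  cases o with
  | none =>
    simp only [setup, Option.elim_none, List.length_nil, if_true, Batch.sample, pubT_pub,
      valList_take P.t_le]
    rfl
  | some z => rfl

/-- Every batch draws material for a setup, whether it is needed or not, and `n` exponents of which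
a polynomial uses `t`. What is not used is integrated out. -/
theorem ev_setupOf (o : Option (Setup P k))
    (F : Setup P k → ZMod P.q × ZMod P.q × (Fin P.n → ZMod P.q) → ℝ≥0∞) :
    ((PMF.uniformOfFintype (Batch P k)).ev fun r =>
      F (setupOf o r) (r.2.2.2.1, r.2.2.2.2.1, r.2.2.2.2.2.1)) =
      (fillSetup P k o).ev fun z => (PMF.uniformOfFintype
        (ZMod P.q × ZMod P.q × (Fin P.n → ZMod P.q))).ev (F z) := by
  cases o with
  | some z =>
    simp only [setupOf, Option.getD_some, fillSetup, PMF.ev_pure, PMF.uniform_prod, PMF.ev_const]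
  | none =>
    have h : ∀ G : Coeffs P → ℝ≥0∞, (PMF.uniformOfFintype (Coeffs P)).ev G =
        (PMF.uniformOfFintype (Fin P.n → ZMod P.q)).ev fun v => G fun j => v (j.castLE P.t_le) := by
      intro G
      rw [← PMF.map_uniform_castLE P.t_le, PMF.ev_map]
    simp only [setupOf, Option.getD_none, fillSetup, PMF.uniform_prod, PMF.ev_const]
    refine PMF.ev_congr fun κ₁ => PMF.ev_congr fun κ₂ => ?_
    rw [h, PMF.ev_comm (PMF.uniformOfFintype (Fin P.n → ZMod P.q))]
    refine PMF.ev_congr fun s => ?_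
    rw [PMF.ev_comm (PMF.uniformOfFintype (Fin P.n → ZMod P.q))]
    refine PMF.ev_congr fun u => ?_
    rw [PMF.ev_comm]

/-- One request to the simulator. -/
theorem run_eq {M E : Prog} (hM : script.Computes E (.const 0) M)
    (hE : ∀ p : P.Password, E.eval (.pair (P.pub k) (P.passwordVal p)) = P.elt (P.encode p))
    (ρ : HashFunctions P k) (b : Bool) (p x : P.Password) (o : Option (Setup P k)) (T : ℕ) 
    (hT : 1 + (P.n + (P.n + P.n) + (expoCount (P.pub k) + bitCount (P.pub k))) ≤ T) :
    (M.run (P.pub k) P.q (fun (_ : Unit) v => PMF.pure (hashAnswer P k ρ v, ())) T (memOf o)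
      (message b p x) ()).map (fun z => (z.1, z.2.1)) =
      (fillSetup P k o).bind fun z => (PMF.uniformOfFintype
        (ZMod P.q × ZMod P.q × (Fin P.n → ZMod P.q))).map fun u =>
          (replyOf ρ b p x z u, memOf (some z)) := by
  obtain ⟨T, rfl⟩ := Nat.exists_eq_add_of_le hT
  refine PMF.ext_ev fun f => ?_
  have hT' : 1 + (P.n + (P.n + P.n) + (expoCount (P.pub k) + bitCount (P.pub k))) + T =
      (T + (script.calls (P.pub k) + (script.draws (P.pub k) + script.coins (P.pub k)))) + 1 := by
    simp only [script, pubN_pub]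
    omega
  have hrun := BatchScript.run_idle P.q hM (hashAnswer P k ρ)
    (T + (script.calls (P.pub k) + (script.draws (P.pub k) + script.coins (P.pub k)))) (P.pub k)
    (message b p x) (o.elim [] setupList) (memOf o) (by
      cases o with
      | none => exact Or.inr ⟨rfl, rfl⟩
      | some z => exact Or.inl rfl)
  rw [BatchScript.rest_batch P.q hM] at hrun
  rw [PMF.ev_map, hT', show (fun (_ : Unit) v => PMF.pure (hashAnswer P k ρ v, ())) =
    BatchScript.answering (hashAnswer P k ρ) from rfl, hrun]
  simp only [PMF.ev_bind]
  let w := message b p x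
  let enc : ℕ := ((if hit w = 0 then none
    else some (Val.pair (P.pub k) (code ((secret w P.n).map fun a => clip a P.m)))).elim
      (.nat 0) E.eval).toNat
  -- For a match the message contains a genuine password, so the reduction of its entries has no
  -- effect and `E` returns its encoding.
  have henc : P.Matches x p → enc = P.num (P.encode p) := by
    intro h
    have h1 : hit w ≠ 0 := by simp [w, hit_message, h]
    have h2 : (P.letters p).map (fun a => clip a P.m) = P.letters p := by
      rw [Params.letters, List.map_ofFn]
      congr 1
      funext i
      exact clip_of_lt (p i).isLt
    simp only [enc, h1, if_false, Option.elim_some, w, secret_message b h, h2, P.code_letters, hE]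
    rfl
  refine (ev_batch P k (P.pub k) rfl rfl (fun r => f
    (reply (P.pub k) w (setup (P.pub k) (o.elim [] setupList) r) r
      (hashList ρ w (setup (P.pub k) (o.elim [] setupList) r)) enc P.n,
      code (BatchScript.idle (setup (P.pub k) (o.elim [] setupList) r)))) _
      fun cs ds hcs hds => ?_).trans ?_
  · have hl0 : ([0] ++ cs ++ ds).length = 1 + bitCount (P.pub k) + expoCount (P.pub k) := by
      simp [hcs, hds]
      omega
    have hn : expoCount (P.pub k) = 1 + (1 + (P.n + (P.n + P.n))) := rfl
    have hpad : ∀ ls, padded (P.pub k) ([0] ++ cs ++ ds ++ ls) = P.n := fun ls =>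
      padded_eq _ _ (by rw [List.length_append, hl0, pubN_pub]; omega)
    have hpad0 : padded (P.pub k) ([0] ++ cs ++ ds) = P.n :=
      padded_eq _ _ (by rw [hl0, pubN_pub]; omega)
    have hans : BatchScript.answersFrom script (hashAnswer P k ρ)
        (P.pub k, message b p x, o.elim [] setupList, [0] ++ cs ++ ds) 0
          (script.calls (P.pub k)) = hashList ρ w (setup (P.pub k) (o.elim [] setupList)
            (readSample (P.pub k) ([0] ++ cs ++ ds))) := by
      rw [BatchScript.answersFrom, hashList, List.range_eq_range']
      simp only [script, hpad0]
      rfl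
    rw [hans, BatchScript.rest_finish]
    · simp only [script, encodeArg, hpad, readSample_append_right _ _ _ hl0, List.drop_left' hl0,
        pubM_pub, PMF.ev_pure, Option.elim_none]
      rfl
    · rw [List.length_append, hl0]
      simp only [BatchScript.total, script, hashList, List.length_map, List.length_range, pubN_pub]
      omega
    · simp only [script, bitCount]
      omega
  · simp only [setup_eq, w, reply_eq ρ b p x _ _ enc henc, PMF.ev_map]
    exact ev_setupOf o fun z u => f (replyOf ρ b p x z u, memOf (some z))

end Simulator

/-! ### The attack on the simulator as a game. -/

namespace Simulator

variable {P : Params} {k : ℕ}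

/-- The attack on the simulator is the game with keys chosen in advance in which all replies hide
the password. -/
theorem attackProb_eq_keyed {M E : Prog} (hM : script.Computes E (.const 0) M)
    (hE : ∀ p : P.Password, E.eval (.pair (P.pub k) (P.passwordVal p)) = P.elt (P.encode p))
    {T₀ : ℕ} (hT : 1 + (P.n + (P.n + P.n) + (expoCount (P.pub k) + bitCount (P.pub k))) ≤ T₀)
    (A : Prog) (inp : Val) (T : ℕ) :
    attackProb P k (fun ρ => simulatedServer P k ρ M T₀) inp A T =
      ((PMF.uniformOfFintype (HashFunctions P k × BitString k × BitString k)).ev fun e =>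
        gameWin P k A inp (keyedGame P k (fun _ => true) false) T (e, none)).toReal := by
  rw [attackProb_eq, PMF.uniform_prod (α := HashFunctions P k)]
  congr 2
  funext ρ
  rw [simulatorGame_eq_keyed]
  have h := gameOracle_intertwine (P := P) (k := k) (W₀ := Unit) (W₁ := Unit)
    (hash := fun (_ : Unit) _ r => r.hashReply ρ) (hash' := fun (_ : Unit) _ r => r.hashReply ρ)
    (reg := fun _ p => PMF.pure (p, none, 0))
    (reg' := fun _ p => PMF.pure ((p, .nat 0) : P.Password × Val))
    (serve := fun _ (s : P.Password × Option (Setup P k) × ℕ) b x =>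
      (fillSetup P k s.2.1).bind fun z =>
        bif b then PMF.pure (loginReply (x = s.1), (s.1, some z, s.2.2))
        else (replyDist true z.1.1 s.1 z.2.secret
          (keyedExponents ρ z.1.1 z.1.2 z.2 s.1 x) x).map fun m => (m, (s.1, some z, s.2.2 + 1)))
    (serve' := fun _ s b x => bif b then
      (M.run (P.pub k) P.q (fun (_ : Unit) v => PMF.pure (hashAnswer P k ρ v, ())) T₀ s.2
        (.ofList [.nat 1, P.passwordVal x, idealAnswerVal P (idealOracle P s.1 x)]) ()).map
          fun z => (z.1, (s.1, z.2.1))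
      else
      (M.run (P.pub k) P.q (fun (_ : Unit) v => PMF.pure (hashAnswer P k ρ v, ())) T₀ s.2
        (.ofList [.nat 0, P.passwordVal x, idealAnswerVal P (idealOracle P s.1 x)]) ()).map
          fun z => (z.1, (s.1, z.2.1)))
    (PMF.pure ()) (fun _ _ => ()) (fun _ _ => PMF.pure ())
    -- The memory of the program is a function of the setup; the counter of recoveries exists only
    -- in the game.
    (fun _ s _ => ((), (s.1, memOf s.2.1))) (fun _ _ _ => rfl) (fun _ _ _ _ => rfl)
    (by
      intro e p
      refine PMF.ext_ev fun f => ?_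
      simp [memOf])
    (by
      intro e s b x
      refine PMF.ext_ev fun f => ?_
      have h1 := congrArg (fun d => PMF.ev d fun z => f (z.1, (), (s.1, z.2)))
        (run_eq hM hE ρ b s.1 x s.2.1 T₀ hT)
      simp only [PMF.ev_bind, PMF.ev_map] at h1
      cases b
      · simp only [cond_false, PMF.ev_bind, PMF.ev_map, PMF.ev_pure, replyDist]
        refine h1.trans (PMF.ev_congr fun z => PMF.ev_congr fun u => ?_)
        simp [replyOf]
      · simp only [cond_true, PMF.ev_bind, PMF.ev_map, PMF.ev_pure]
        refine h1.trans (PMF.ev_congr fun z => ?_)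
        simp only [replyOf, cond_true]
        exact PMF.ev_const _ _)
  have := A.win_intertwine_game inp _ h T ((), none)
  simp only [PMF.ev_map, PMF.ev_pure] at this
  exact this

end Simulator

/-! ### Random functions that are sampled when they are used -/

/-- Resampling a part of a uniform object. -/
theorem PMF.ev_uniform_lens {F β : Type} [Fintype F] [Nonempty F] [Fintype β] [Nonempty β]
    (get : F → β) (set : F → β → F) (h₁ : ∀ f b, get (set f b) = b)
    (h₂ : ∀ f b c, set (set f b) c = set f c) (h₃ : ∀ f, set f (get f) = f) (G : F → ℝ≥0∞) :
    ((PMF.uniformOfFintype β).ev fun b => (PMF.uniformOfFintype F).ev fun f => G (set f b)) =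
      (PMF.uniformOfFintype F).ev G := by
  -- Exchanging the visible part of the object with an independent sample is an involution.
  have h : Function.Involutive fun u : β × F => (get u.2, set u.2 u.1) := by
    rintro ⟨b, f⟩
    simp [h₁, h₂, h₃]
  rw [← PMF.uniform_prod (fun u : β × F => G (set u.2 u.1)), ← PMF.ev_uniform_snd (α := β) G]
  exact PMF.ev_uniform_congr _ (PMF.map_uniform_of_bijective h.bijective) fun u => rfl

abbrev Table : Type := List (List ℕ × ℕ)

theorem tabGet_cons (κ' κ : List ℕ) (a d : ℕ) (tab : Table) :
    tabGet ((κ', a) :: tab) κ d = if κ' = κ then a else tabGet tab κ d := rfl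

theorem tabGet_ofFn_append {n : ℕ} (key : Fin n → List ℕ) (val : Fin n → ℕ) (tab : Table)
    (i : Fin n) (hkey : Function.Injective key) (d : ℕ) :
    tabGet ((List.ofFn fun i => (key i, val i)) ++ tab) (key i) d = val i := by
  induction n with
  | zero => exact i.elim0
  | succ n ih =>
    rw [List.ofFn_succ, List.cons_append, tabGet_cons]
    refine Fin.cases ?_ (fun i => ?_) i
    · rw [if_pos rfl]
    · rw [if_neg fun h => (Fin.succ_ne_zero i).symm (hkey h)]
      exact ih (fun i => key i.succ) (fun i => val i.succ) i
        (hkey.comp (Fin.succ_injective n))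

theorem tabGet_ofFn_append_of_ne {n : ℕ} (key : Fin n → List ℕ) (val : Fin n → ℕ) (tab : Table)
    (κ : List ℕ) (h : ∀ i, key i ≠ κ) (d : ℕ) :
    tabGet ((List.ofFn fun i => (key i, val i)) ++ tab) κ d = tabGet tab κ d := by
  induction n with
  | zero => rfl
  | succ n ih =>
    rw [List.ofFn_succ, List.cons_append, tabGet_cons, if_neg (h 0)]
    exact ih _ _ fun i => h i.succ

section Lazy

variable {P : Params} {k : ℕ}

/-- The exponent that a table lists for a key. -/
def expoAt (tab : Table) (κ : List ℕ) (u : ZMod P.q) : ZMod P.q := (tabGet tab κ u.val : ℕ)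

/-- The bit string that a table lists for a key. -/
def bitsAt (tab : Table) (κ : List ℕ) (u : BitString k) : BitString k :=
  ⟨clip (tabGet tab κ u) (2 ^ k), by
    rw [clip_eq _ (by positivity)]
    exact Nat.mod_lt _ (by positivity)⟩

theorem expoAt_cons (κ' κ : List ℕ) (a u : ZMod P.q) (tab : Table) :
    expoAt ((κ', a.val) :: tab) κ u = if κ' = κ then a else expoAt tab κ u := by
  unfold expoAt
  rw [tabGet_cons]
  split_ifs
  · simp
  · rfl

theorem bitsAt_cons (κ' κ : List ℕ) (a u : BitString k) (tab : Table) :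
    bitsAt ((κ', (a : ℕ)) :: tab) κ u = if κ' = κ then a else bitsAt tab κ u := by
  unfold bitsAt
  simp only [tabGet_cons]
  split_ifs
  · exact Fin.ext (clip_of_lt a.isLt)
  · rfl

/-- Hash functions with the values listed in a table. -/
def fillHash (tab : Table) (ρ : HashFunctions P k) : HashFunctions P k :=
  (fun i κ l => expoAt tab [0, i, κ, l] (ρ.1 i κ l),
    fun i κ l => expoAt tab [1, i, κ, l] (ρ.2.1 i κ l),
    fun p => bitsAt tab (2 :: P.letters p) (ρ.2.2 p))

/-- Exponents for all positions and letters with the values listed in a table. -/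
def fillRow (tag : ℕ) (rows : Table) (X : LetterTable P) : LetterTable P :=
  fun i l => expoAt rows [tag, i, l] (X i l)

@[simp] theorem fillRow_nil (tag : ℕ) (X : LetterTable P) : fillRow tag [] X = X := by
  funext i l
  simp [fillRow, expoAt, tabGet]

/-- The uniform value at the queried point is split off as `u`. If the point is already listed, `u`
is ignored and the repeated entry changes nothing; otherwise `u` becomes the answer and is recorded.
So a query can always consume a sample and prepend an entry, without a case distinction. -/
theorem ev_fillHash_letter (tab : Table) (i : Fin P.n) (κ : BitString k) (l : Fin P.m)
    (G : ZMod P.q → HashFunctions P k → ℝ≥0∞) :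
    ((PMF.uniformOfFintype (HashFunctions P k)).ev fun ρ =>
      G ((fillHash tab ρ).1 i κ l) (fillHash tab ρ)) =
    (PMF.uniformOfFintype (ZMod P.q)).ev fun u => (PMF.uniformOfFintype (HashFunctions P k)).ev
      fun ρ => G (expoAt tab [0, i, κ, l] u)
        (fillHash (([0, (i : ℕ), (κ : ℕ), (l : ℕ)], (expoAt tab [0, i, κ, l] u).val) :: tab) ρ) := by
  rw [← PMF.ev_uniform_lens (fun ρ : HashFunctions P k => ρ.1 i κ l)
    (fun ρ b => (fun i' κ' l' => if i' = i ∧ κ' = κ ∧ l' = l then b else ρ.1 i' κ' l', ρ.2))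
    (by simp) (by
      rintro ρ b c
      refine Prod.ext ?_ rfl
      funext i' κ' l'
      by_cases h : i' = i ∧ κ' = κ ∧ l' = l <;> simp [h]) (by
      rintro ρ
      refine Prod.ext ?_ rfl
      funext i' κ' l'
      by_cases h : i' = i ∧ κ' = κ ∧ l' = l
      · obtain ⟨rfl, rfl, rfl⟩ := h
        simp
      · simp [h])]
  refine PMF.ev_congr fun u => PMF.ev_congr fun ρ => ?_
  congr 1
  · simp [fillHash]
  · refine Prod.ext ?_ (Prod.ext ?_ ?_)
    · funext i' κ' l'
      simp only [fillHash]
      rw [expoAt_cons]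
      by_cases h : i' = i ∧ κ' = κ ∧ l' = l
      · obtain ⟨rfl, rfl, rfl⟩ := h
        simp
      · rw [if_neg h, if_neg]
        rintro h'
        simp only [List.cons.injEq, true_and, and_true, Fin.val_inj] at h'
        exact h ⟨h'.1.symm, h'.2.1.symm, h'.2.2.symm⟩
    · funext i' κ' l'
      simp [fillHash, expoAt_cons]
    · funext p
      simp [fillHash, bitsAt, tabGet_cons]

theorem ev_fillHash_mask (tab : Table) (i : Fin P.n) (κ : BitString k) (l : Fin P.m)
    (G : ZMod P.q → HashFunctions P k → ℝ≥0∞) :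
    ((PMF.uniformOfFintype (HashFunctions P k)).ev fun ρ =>
      G ((fillHash tab ρ).2.1 i κ l) (fillHash tab ρ)) =
    (PMF.uniformOfFintype (ZMod P.q)).ev fun u => (PMF.uniformOfFintype (HashFunctions P k)).ev
      fun ρ => G (expoAt tab [1, i, κ, l] u)
        (fillHash (([1, (i : ℕ), (κ : ℕ), (l : ℕ)], (expoAt tab [1, i, κ, l] u).val) :: tab) ρ) := by
  rw [← PMF.ev_uniform_lens (fun ρ : HashFunctions P k => ρ.2.1 i κ l)
    (fun ρ b => (ρ.1, fun i' κ' l' => if i' = i ∧ κ' = κ ∧ l' = l then b else ρ.2.1 i' κ' l',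
      ρ.2.2))
    (by simp) (by
      rintro ρ b c
      refine Prod.ext rfl (Prod.ext ?_ rfl)
      funext i' κ' l'
      by_cases h : i' = i ∧ κ' = κ ∧ l' = l <;> simp [h]) (by
      rintro ρ
      refine Prod.ext rfl (Prod.ext ?_ rfl)
      funext i' κ' l'
      by_cases h : i' = i ∧ κ' = κ ∧ l' = l
      · obtain ⟨rfl, rfl, rfl⟩ := h
        simp
      · simp [h])]
  refine PMF.ev_congr fun u => PMF.ev_congr fun ρ => ?_
  congr 1
  · simp [fillHash]
  · refine Prod.ext ?_ (Prod.ext ?_ ?_)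
    · funext i' κ' l'
      simp [fillHash, expoAt_cons]
    · funext i' κ' l'
      simp only [fillHash]
      rw [expoAt_cons]
      by_cases h : i' = i ∧ κ' = κ ∧ l' = l
      · obtain ⟨rfl, rfl, rfl⟩ := h
        simp
      · rw [if_neg h, if_neg]
        rintro h'
        simp only [List.cons.injEq, true_and, and_true, Fin.val_inj] at h'
        exact h ⟨h'.1.symm, h'.2.1.symm, h'.2.2.symm⟩
    · funext p
      simp [fillHash, bitsAt, tabGet_cons]

theorem ev_fillHash_password (tab : Table) (p : P.Password)
    (G : BitString k → HashFunctions P k → ℝ≥0∞) :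
    ((PMF.uniformOfFintype (HashFunctions P k)).ev fun ρ =>
      G ((fillHash tab ρ).2.2 p) (fillHash tab ρ)) =
    (PMF.uniformOfFintype (BitString k)).ev fun u => (PMF.uniformOfFintype (HashFunctions P k)).ev
      fun ρ => G (bitsAt tab (2 :: P.letters p) u)
        (fillHash ((2 :: P.letters p, (bitsAt tab (2 :: P.letters p) u : ℕ)) :: tab) ρ) := by
  rw [← PMF.ev_uniform_lens (fun ρ : HashFunctions P k => ρ.2.2 p)
    (fun ρ b => (ρ.1, ρ.2.1, fun p' => if p' = p then b else ρ.2.2 p'))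
    (by simp) (by
      rintro ρ b c
      refine Prod.ext rfl (Prod.ext rfl ?_)
      funext p'
      by_cases h : p' = p <;> simp [h]) (by
      rintro ρ
      refine Prod.ext rfl (Prod.ext rfl ?_)
      funext p'
      by_cases h : p' = p <;> simp [h])]
  refine PMF.ev_congr fun u => PMF.ev_congr fun ρ => ?_
  congr 1
  · simp [fillHash]
  · refine Prod.ext ?_ (Prod.ext ?_ ?_)
    · funext i' κ' l'
      simp [fillHash, expoAt, tabGet_cons]
    · funext i' κ' l'
      simp [fillHash, expoAt, tabGet_cons]
    · funext p'
      simp only [fillHash]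
      rw [bitsAt_cons]
      by_cases h : p' = p
      · subst h
        simp
      · rw [if_neg h, if_neg]
        rintro h'
        simp only [List.cons.injEq, true_and, P.letters_injective.eq_iff] at h'
        exact h h'.symm

theorem ev_fillRow (tag : ℕ) (rows : Table) (i : Fin P.n) (l : Fin P.m)
    (G : ZMod P.q → LetterTable P → ℝ≥0∞) :
    ((PMF.uniformOfFintype (LetterTable P)).ev fun X =>
      G (fillRow tag rows X i l) (fillRow tag rows X)) =
    (PMF.uniformOfFintype (ZMod P.q)).ev fun u => (PMF.uniformOfFintype (LetterTable P)).ev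
      fun X => G (expoAt rows [tag, i, l] u)
        (fillRow tag (([tag, (i : ℕ), (l : ℕ)], (expoAt rows [tag, i, l] u).val) :: rows) X) := by
  rw [← PMF.ev_uniform_lens (fun X : LetterTable P => X i l)
    (fun X b i' l' => if i' = i ∧ l' = l then b else X i' l')
    (by simp) (by
      rintro X b c
      funext i' l'
      by_cases h : i' = i ∧ l' = l <;> simp [h]) (by
      rintro X
      funext i' l'
      by_cases h : i' = i ∧ l' = l
      · obtain ⟨rfl, rfl⟩ := h
        simp
      · simp [h])]
  refine PMF.ev_congr fun u => PMF.ev_congr fun X => ?_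
  congr 1
  · simp [fillRow]
  · funext i' l'
    simp only [fillRow]
    rw [expoAt_cons]
    by_cases h : i' = i ∧ l' = l
    · obtain ⟨rfl, rfl⟩ := h
      simp
    · rw [if_neg h, if_neg]
      rintro h'
      simp only [List.cons.injEq, true_and, and_true, Fin.val_inj] at h'
      exact h ⟨h'.1.symm, h'.2.symm⟩

theorem fillRow_cons_of_ne {tag tag' : ℕ} (h : tag' ≠ tag) (κ : List ℕ) (a : ℕ) (rows : Table)
    (X : LetterTable P) : fillRow tag ((tag' :: κ, a) :: rows) X = fillRow tag rows X := by
  funext i l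
  simp [fillRow, expoAt, tabGet_cons, h]

/-- The entries for the letters of a password. -/
def rowEntries (tag : ℕ) (y : P.Password) (d : Fin P.n → ZMod P.q) : Table :=
  List.ofFn fun i => ([tag, (i : ℕ), (y i : ℕ)], (d i).val)

theorem fillRow_rowEntries_of_ne {tag tag' : ℕ} (h : tag' ≠ tag) (y : P.Password)
    (d : Fin P.n → ZMod P.q) (rows : Table) (X : LetterTable P) :
    fillRow tag (rowEntries tag' y d ++ rows) X = fillRow tag rows X := by
  funext i l
  unfold fillRow expoAt rowEntries
  rw [tabGet_ofFn_append_of_ne]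
  simp [h]

/-- The listed values at the letters of a password. -/
def rowValues (tag : ℕ) (rows : Table) (y : P.Password) (u : Fin P.n → ZMod P.q) (i : Fin P.n) :
    ZMod P.q :=
  expoAt rows [tag, i, y i] (u i)

/-- Recording fresh samples for all letters of `y`, where entries listed before take precedence, has
the same effect as placing these samples in the underlying table and keeping the list. -/
theorem fillRow_rowEntries (tag : ℕ) (y : P.Password) (u : Fin P.n → ZMod P.q) (rows : Table)
    (X : LetterTable P) : fillRow tag (rowEntries tag y (rowValues tag rows y u) ++ rows) X =
      fillRow tag rows (overwrite y u X) := by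
  funext i l
  unfold fillRow expoAt rowEntries
  by_cases hl : l = y i
  · subst hl
    rw [tabGet_ofFn_append (fun i => [tag, (i : ℕ), (y i : ℕ)]) _ _ i fun i j h => by
      simp only [List.cons.injEq, true_and, Fin.val_inj] at h
      exact h.1]
    simp [rowValues, overwrite, expoAt]
  · rw [tabGet_ofFn_append_of_ne]
    · simp [overwrite, hl]
    · intro j h
      simp only [List.cons.injEq, true_and, and_true, Fin.val_inj] at h
      obtain ⟨rfl, h⟩ := h
      exact hl h.symm

/-- A reply uses one letter at every position, so `n` values of the table are sampled at once. -/
theorem ev_fillRow_password (tag : ℕ) (rows : Table) (y : P.Password)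
    (G : (Fin P.n → ZMod P.q) → LetterTable P → ℝ≥0∞) :
    ((PMF.uniformOfFintype (LetterTable P)).ev fun X =>
      G (fun i => fillRow tag rows X i (y i)) (fillRow tag rows X)) =
    (PMF.uniformOfFintype (Fin P.n → ZMod P.q)).ev fun u =>
      (PMF.uniformOfFintype (LetterTable P)).ev fun X => G (rowValues tag rows y u)
        (fillRow tag (rowEntries tag y (rowValues tag rows y u) ++ rows) X) := by
  rw [← PMF.ev_uniform_lens (fun X : LetterTable P => fun i => X i (y i))
    (fun X b => overwrite y b X) (by simp [overwrite]) (by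
      rintro X b c
      funext i' l'
      by_cases h : l' = y i' <;> simp [overwrite, h]) (by
      rintro X
      funext i' l'
      by_cases h : l' = y i' <;> simp [overwrite, h])]
  refine PMF.ev_congr fun u => PMF.ev_congr fun X => ?_
  rw [fillRow_rowEntries]
  congr 1
  funext i
  simp [fillRow, rowValues, overwrite]

end Lazy

/-! ### The game for a Diffie-Hellman instance -/

theorem PMF.ev_comm₄ {α β γ δ : Type} (d₁ : PMF α) (d₂ : PMF β) (d₃ : PMF γ) (d₄ : PMF δ)
    (f : α → β → γ → δ → ℝ≥0∞) :
    (d₁.ev fun a => d₂.ev fun b => d₃.ev fun c => d₄.ev fun e => f a b c e) =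
      d₄.ev fun e => d₁.ev fun a => d₂.ev fun b => d₃.ev fun c => f a b c e := by
  rw [PMF.ev_comm d₄]
  refine PMF.ev_congr fun a => ?_
  rw [PMF.ev_comm d₄]
  refine PMF.ev_congr fun b => ?_
  rw [PMF.ev_comm d₄]

section LazyGame

variable {P : Params} {k : ℕ}

/-- The reply for given random choices. -/
def hybridReply (J : ℕ) (δ : ZMod P.q) (θ : Mask P) (s : IdealState P k) (w : P.Password)
    (u : ZMod P.q × ZMod P.q × (Fin P.n → ZMod P.q)) : Val :=
  if UsesMask J s w then maskedReply δ θ s w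
  else if below J s.2.2 = true ∧ ¬ P.Matches w s.2.1 then
    expMessage s.1.1 s.1.2.2.2.2.secret u.1 (P.pow P.g u.2.1) u.2.2
  else honestReply s.1.1 s.2.1 s.1.2.2.2.2.secret (idealExponents s.1 s.2.1 w) u.1

theorem fixedMaskReply_eq (J : ℕ) (δ : ZMod P.q) (θ : Mask P) (s : IdealState P k)
    (w : P.Password) : fixedMaskReply J δ θ s w =
      (PMF.uniformOfFintype (ZMod P.q × ZMod P.q × (Fin P.n → ZMod P.q))).map
        (hybridReply J δ θ s w) := by
  unfold fixedMaskReply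
  refine PMF.ext_ev fun f => ?_
  by_cases h : UsesMask J s w
  · simp [h, hybridReply]
  · simp only [h, if_false, idealReply, replyDist, PMF.ev_map]
    refine PMF.ev_congr fun u => ?_
    simp only [hybridReply, h, if_false]

/-- The game with a mask as a part of the state. -/
noncomputable def maskGame (J : ℕ) (δ : ZMod P.q) (e : Mask P × HashFunctions P k ×
    Option (IdealState P k)) (r : Req P k) : PMF (Val × Mask P × HashFunctions P k ×
      Option (IdealState P k)) :=
  (idealGame (fixedMaskReply J δ e.1) e.2 r).map fun z => (z.1, (e.1, z.2))

/-- What a machine knows about the account when it holds `g ^ y` instead of `y`: the coefficients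
of the sharing polynomial are `y * av + aw`, and the exponents are decomposed in the same way. -/
structure LazyAccount (P : Params) (k : ℕ) where
  p : P.Password
  κ : BitString k
  xs : Fin P.n → ZMod P.q
  av : Coeffs P
  aw : Coeffs P
  num : ℕ
  rows : Table

namespace LazyAccount

/-- The state of the ideal game. -/
def ideal (a : LazyAccount P k) (y : ZMod P.q) (X Δv Δw : LetterTable P) : IdealState P k :=
  ((a.κ, a.xs, X, fun i l => y * Δv i l + Δw i l, fun j => y * a.av j + a.aw j), a.p, a.num)

/-- The reply to the guess `w` when the exponents for its letters are `dv` and `dw`. -/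
def reply (a : LazyAccount P k) (J : ℕ) (x y z : ZMod P.q) (dv dw : Fin P.n → ZMod P.q)
    (w : P.Password) (u : ZMod P.q × ZMod P.q × (Fin P.n → ZMod P.q)) : Val :=
  hybridReply J (z - x * y) (x, a.av, fun i _ => dv i)
    (a.ideal y (fun _ _ => 0) (fun i _ => dv i) fun i _ => dw i) w u

/-- A reply depends on the tables only through the letters of the guess, which is why they can be
sampled request by request. -/
theorem hybridReply_ideal (a : LazyAccount P k) (J : ℕ) (x y z : ZMod P.q)
    (X Δv Δw : LetterTable P) (w : P.Password)
    (u : ZMod P.q × ZMod P.q × (Fin P.n → ZMod P.q)) :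
    hybridReply J (z - x * y) (x, a.av, Δv) (a.ideal y X Δv Δw) w u =
      a.reply J x y z (fun i => Δv i (w i)) (fun i => Δw i (w i)) w u := by
  rfl

end LazyAccount

abbrev LazyState (P : Params) (k : ℕ) : Type := Table × Option (LazyAccount P k)

/-- A reaction to a request, where the random functions are sampled when they are used. -/
def lazyStep (J : ℕ) (x y z : ZMod P.q) (r : Batch P k) : LazyState P k → Req P k →
    Val × LazyState P k
  | (tab, some a), .letterHash i κ l =>
    if κ = a.κ then
      if l = a.p i then (.nat (a.xs i).val, (tab, some a))
      else (.nat (expoAt a.rows [0, i, l] r.2.2.2.1).val, (tab, some { a with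
        rows := ([0, (i : ℕ), (l : ℕ)], (expoAt a.rows [0, i, l] r.2.2.2.1).val) :: a.rows }))
    else (.nat (expoAt tab [0, i, κ, l] r.2.2.2.1).val,
      (([0, (i : ℕ), (κ : ℕ), (l : ℕ)], (expoAt tab [0, i, κ, l] r.2.2.2.1).val) :: tab, some a))
  | (tab, none), .letterHash i κ l => (.nat (expoAt tab [0, i, κ, l] r.2.2.2.1).val,
      (([0, (i : ℕ), (κ : ℕ), (l : ℕ)], (expoAt tab [0, i, κ, l] r.2.2.2.1).val) :: tab, none))
  | (tab, o), .maskHash i κ l => (.nat (expoAt tab [1, i, κ, l] r.2.2.2.1).val,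
      (([1, (i : ℕ), (κ : ℕ), (l : ℕ)], (expoAt tab [1, i, κ, l] r.2.2.2.1).val) :: tab, o))
  | (tab, o), .passwordHash p => (.nat (bitsAt tab (2 :: P.letters p) r.2.2.1),
      ((2 :: P.letters p, (bitsAt tab (2 :: P.letters p) r.2.2.1 : ℕ)) :: tab, o))
  | (tab, none), .register p => (.nat 0, (tab, some ⟨p, r.2.1, r.2.2.2.2.2.1,
      fun j => r.2.2.2.2.2.2.1 (j.castLE P.t_le), fun j => r.2.2.2.2.2.2.2 (j.castLE P.t_le), 0, []⟩))
  | (tab, some a), .ask true w => (loginReply (w = a.p), (tab, some a))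
  | (tab, some a), .ask false w =>
    (a.reply J x y z (rowValues 1 a.rows w r.2.2.2.2.2.2.1) (rowValues 2 a.rows w r.2.2.2.2.2.2.2)
      w (r.2.2.2.1, r.2.2.2.2.1, r.2.2.2.2.2.1), (tab, some { a with
        num := a.num + 1
        rows := rowEntries 1 w (rowValues 1 a.rows w r.2.2.2.2.2.2.1) ++
          (rowEntries 2 w (rowValues 2 a.rows w r.2.2.2.2.2.2.2) ++ a.rows) }))
  | e, _ => (.nat 0, e)

noncomputable def lazyGame (J : ℕ) (x y z : ZMod P.q) (e : LazyState P k) (r : Req P k) :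
    PMF (Val × LazyState P k) :=
  (PMF.uniformOfFintype (Batch P k)).map fun b => lazyStep J x y z b e r

/-- The states of the game with a mask that belong to the tables. -/
noncomputable def lazyKernel (x y : ZMod P.q) : LazyState P k →
    PMF (Mask P × HashFunctions P k × Option (IdealState P k))
  | (tab, none) => (PMF.uniformOfFintype (HashFunctions P k × Coeffs P × LetterTable P)).map
      fun u => ((x, u.2.1, u.2.2), (fillHash tab u.1, none))
  | (tab, some a) => (PMF.uniformOfFintype (HashFunctions P k × LetterTable P × LetterTable P ×
      LetterTable P)).map fun u => ((x, a.av, fillRow 1 a.rows u.2.2.1), (fillHash tab u.1,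
        some (a.ideal y (fillRow 0 a.rows u.2.1) (fillRow 1 a.rows u.2.2.1)
          (fillRow 2 a.rows u.2.2.2))))

theorem ev_uniform_batch (F : Batch P k → ℝ≥0∞) : (PMF.uniformOfFintype (Batch P k)).ev F =
    (PMF.uniformOfFintype Bool).ev fun b => (PMF.uniformOfFintype (BitString k)).ev fun κ₁ =>
      (PMF.uniformOfFintype (BitString k)).ev fun κ₂ => (PMF.uniformOfFintype (ZMod P.q)).ev fun s =>
        (PMF.uniformOfFintype (ZMod P.q)).ev fun u =>
          (PMF.uniformOfFintype (Fin P.n → ZMod P.q)).ev fun us =>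
            (PMF.uniformOfFintype (Fin P.n → ZMod P.q)).ev fun vs =>
              (PMF.uniformOfFintype (Fin P.n → ZMod P.q)).ev fun ws =>
                F (b, κ₁, κ₂, s, u, us, vs, ws) := by
  simp only [PMF.uniform_prod]

theorem ev_lazyKernel_none (x y : ZMod P.q) (tab : Table)
    (F : Mask P × HashFunctions P k × Option (IdealState P k) → ℝ≥0∞) :
    (lazyKernel x y (tab, none)).ev F = (PMF.uniformOfFintype (HashFunctions P k)).ev fun ρ =>
      (PMF.uniformOfFintype (Coeffs P)).ev fun a => (PMF.uniformOfFintype (LetterTable P)).ev fun Δ =>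
        F ((x, a, Δ), (fillHash tab ρ, none)) := by
  simp only [lazyKernel, PMF.ev_map, PMF.uniform_prod (α := HashFunctions P k),
    PMF.uniform_prod (α := Coeffs P)]

theorem ev_lazyKernel_some (x y : ZMod P.q) (tab : Table) (a : LazyAccount P k)
    (F : Mask P × HashFunctions P k × Option (IdealState P k) → ℝ≥0∞) :
    (lazyKernel x y (tab, some a)).ev F = (PMF.uniformOfFintype (HashFunctions P k)).ev fun ρ =>
      (PMF.uniformOfFintype (LetterTable P)).ev fun X =>
        (PMF.uniformOfFintype (LetterTable P)).ev fun Δv =>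
          (PMF.uniformOfFintype (LetterTable P)).ev fun Δw =>
            F ((x, a.av, fillRow 1 a.rows Δv), (fillHash tab ρ, some (a.ideal y
              (fillRow 0 a.rows X) (fillRow 1 a.rows Δv) (fillRow 2 a.rows Δw)))) := by
  simp only [lazyKernel, PMF.ev_map, PMF.uniform_prod (α := HashFunctions P k),
    PMF.uniform_prod (α := LetterTable P)]

/-- Registration is the interesting case. The mask has been fixed with the polynomial `av` and the
table `Δv`; as `aw` and `Δw` are uniform and independent of it, so are `y * av + aw` and `y * Δv +
Δw`. The account is thus distributed as in the ideal game and says nothing about the mask. -/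
theorem lazyGame_intertwine_none (J : ℕ) (x y z : ZMod P.q) (tab : Table) (r : Req P k) :
    (lazyKernel x y (tab, none)).bind (fun e' => maskGame J (z - x * y) e' r) =
      (lazyGame J x y z (tab, none) r).bind fun s =>
        (lazyKernel x y s.2).map fun e' => (s.1, e') := by
  refine PMF.ext_ev fun f => ?_
  rw [PMF.ev_bind, ev_lazyKernel_none, PMF.ev_bind, lazyGame, PMF.ev_map]
  simp only [PMF.ev_map, maskGame]
  rw [ev_uniform_batch]
  cases r with
  | letterHash i κ l =>
    simp only [lazyStep, idealGame, gameOracle, PMF.ev_pure, ev_lazyKernel_none, PMF.ev_const]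
    exact ev_fillHash_letter tab i κ l fun v ρ => (PMF.uniformOfFintype (Coeffs P)).ev fun a =>
      (PMF.uniformOfFintype (LetterTable P)).ev fun Δ => f (.nat v.val, ((x, a, Δ), (ρ, none)))
  | maskHash i κ l =>
    simp only [lazyStep, idealGame, gameOracle, PMF.ev_pure, ev_lazyKernel_none, PMF.ev_const]
    exact ev_fillHash_mask tab i κ l fun v ρ => (PMF.uniformOfFintype (Coeffs P)).ev fun a =>
      (PMF.uniformOfFintype (LetterTable P)).ev fun Δ => f (.nat v.val, ((x, a, Δ), (ρ, none)))
  | passwordHash p =>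
    simp only [lazyStep, idealGame, gameOracle, PMF.ev_pure, ev_lazyKernel_none, PMF.ev_const]
    exact ev_fillHash_password tab p fun v ρ => (PMF.uniformOfFintype (Coeffs P)).ev fun a =>
      (PMF.uniformOfFintype (LetterTable P)).ev fun Δ => f (.nat v, ((x, a, Δ), (ρ, none)))
  | register p =>
    simp only [lazyStep, idealGame, gameOracle, PMF.ev_map, ev_lazyKernel_some, PMF.ev_const,
      fillRow_nil, LazyAccount.ideal]
    have hC : ∀ G : Coeffs P → ℝ≥0∞, ((PMF.uniformOfFintype (Fin P.n → ZMod P.q)).ev fun v =>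
        G fun j => v (j.castLE P.t_le)) = (PMF.uniformOfFintype (Coeffs P)).ev G := by
      intro G
      rw [← PMF.map_uniform_castLE P.t_le, PMF.ev_map]
    have hΔ : ∀ (c : LetterTable P) (G : LetterTable P → ℝ≥0∞),
        ((PMF.uniformOfFintype (LetterTable P)).ev fun Δ => G fun i l => c i l + Δ i l) =
        (PMF.uniformOfFintype (LetterTable P)).ev G := fun c G =>
      PMF.ev_uniform_congr _ (PMF.map_uniform_add c) fun _ => rfl
    have ha : ∀ (c : Coeffs P) (G : Coeffs P → ℝ≥0∞),
        ((PMF.uniformOfFintype (Coeffs P)).ev fun a => G fun j => c j + a j) =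
        (PMF.uniformOfFintype (Coeffs P)).ev G := fun c G =>
      PMF.ev_uniform_congr _ (PMF.map_uniform_add c) fun _ => rfl
    have hD : ∀ F : Draws P k → ℝ≥0∞, (PMF.uniformOfFintype (Draws P k)).ev F =
        (PMF.uniformOfFintype (BitString k)).ev fun κ =>
          (PMF.uniformOfFintype (Fin P.n → ZMod P.q)).ev fun xs =>
            (PMF.uniformOfFintype (LetterTable P)).ev fun X =>
              (PMF.uniformOfFintype (LetterTable P)).ev fun Δ =>
                (PMF.uniformOfFintype (Coeffs P)).ev fun a => F (κ, xs, X, Δ, a) := by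
      intro F
      simp only [PMF.uniform_prod]
    simp only [hD]
    rw [PMF.ev_comm₄]
    refine PMF.ev_congr fun κ => ?_
    rw [PMF.ev_comm₄]
    refine PMF.ev_congr fun xs => ?_
    rw [PMF.ev_comm]
    rw [hC fun av => (PMF.uniformOfFintype (Fin P.n → ZMod P.q)).ev fun ws =>
      (PMF.uniformOfFintype (HashFunctions P k)).ev fun ρ =>
        (PMF.uniformOfFintype (LetterTable P)).ev fun X =>
          (PMF.uniformOfFintype (LetterTable P)).ev fun Δv =>
            (PMF.uniformOfFintype (LetterTable P)).ev fun Δw =>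
              f (.nat 0, ((x, av, Δv), (fillHash tab ρ, some ((κ, xs, X, fun i l => y * Δv i l +
                Δw i l, fun j => y * av j + ws (j.castLE P.t_le)), p, 0))))]
    refine PMF.ev_congr fun av => ?_
    rw [hC fun aw => (PMF.uniformOfFintype (HashFunctions P k)).ev fun ρ =>
        (PMF.uniformOfFintype (LetterTable P)).ev fun X =>
          (PMF.uniformOfFintype (LetterTable P)).ev fun Δv =>
            (PMF.uniformOfFintype (LetterTable P)).ev fun Δw =>
              f (.nat 0, ((x, av, Δv), (fillHash tab ρ, some ((κ, xs, X, fun i l => y * Δv i l +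
                Δw i l, fun j => y * av j + aw j), p, 0)))),
      -- For a fixed `av` the polynomial `aw` is translated by `y * av`; the table `Δw` is treated
      -- in the same way at the end.
      ha (fun j => y * av j) fun a => (PMF.uniformOfFintype (HashFunctions P k)).ev fun ρ =>
        (PMF.uniformOfFintype (LetterTable P)).ev fun X =>
          (PMF.uniformOfFintype (LetterTable P)).ev fun Δv =>
            (PMF.uniformOfFintype (LetterTable P)).ev fun Δw =>
              f (.nat 0, ((x, av, Δv), (fillHash tab ρ, some ((κ, xs, X, fun i l => y * Δv i l +
                Δw i l, a), p, 0)))),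
      PMF.ev_comm (PMF.uniformOfFintype (Coeffs P))]
    refine PMF.ev_congr fun ρ => ?_
    rw [PMF.ev_comm₄]
    refine PMF.ev_congr fun a => ?_
    rw [PMF.ev_comm]
    refine PMF.ev_congr fun X => PMF.ev_congr fun Δv => ?_
    exact (hΔ (fun i l => y * Δv i l) fun Δ => f (.nat 0, ((x, av, Δv), (fillHash tab ρ,
      some ((κ, xs, X, Δ, a), p, 0))))).symm
  | ask b w =>
    simp only [lazyStep, idealGame, gameOracle, PMF.ev_pure, ev_lazyKernel_none, PMF.ev_const]
    rfl
  | other =>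
    simp only [lazyStep, idealGame, gameOracle, PMF.ev_pure, ev_lazyKernel_none, PMF.ev_const]
    rfl

/-- After the registration each request reveals entries of the hash functions or of the rows, and
recording them commutes with filling in the rest. The tags `0`, `1`, `2` keep the entries for `X`,
`Δv` and `Δw` apart within one table. -/
theorem lazyGame_intertwine_some (J : ℕ) (x y z : ZMod P.q) (tab : Table) (a : LazyAccount P k)
    (r : Req P k) :
    (lazyKernel x y (tab, some a)).bind (fun e' => maskGame J (z - x * y) e' r) =
      (lazyGame J x y z (tab, some a) r).bind fun s =>
        (lazyKernel x y s.2).map fun e' => (s.1, e') := by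
  refine PMF.ext_ev fun f => ?_
  rw [PMF.ev_bind, ev_lazyKernel_some, PMF.ev_bind, lazyGame, PMF.ev_map]
  simp only [PMF.ev_map, maskGame]
  rw [ev_uniform_batch]
  let F : Val → HashFunctions P k → LazyAccount P k → ℝ≥0∞ := fun v ρ a =>
    (PMF.uniformOfFintype (LetterTable P)).ev fun X =>
      (PMF.uniformOfFintype (LetterTable P)).ev fun Δv =>
        (PMF.uniformOfFintype (LetterTable P)).ev fun Δw => f (v, (x, a.av, fillRow 1 a.rows Δv),
          (ρ, some (a.ideal y (fillRow 0 a.rows X) (fillRow 1 a.rows Δv) (fillRow 2 a.rows Δw))))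
  cases r with
  | letterHash i κ l =>
    simp only [lazyStep, idealGame, gameOracle, PMF.ev_pure, rowReply, Option.map_some,
      Req.hashReply, withRow]
    by_cases hκ : κ = a.κ
    · by_cases hl : l = a.p i
      · simp [hκ, hl, LazyAccount.ideal, overwrite, ev_lazyKernel_some]
      · simp only [hκ, hl, if_true, if_false, LazyAccount.ideal, overwrite, ev_lazyKernel_some,
          PMF.ev_const]
        rw [PMF.ev_comm (PMF.uniformOfFintype (ZMod P.q))]
        refine PMF.ev_congr fun ρ => ?_
        have := ev_fillRow 0 a.rows i l fun v X => (PMF.uniformOfFintype (LetterTable P)).ev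
          fun Δv => (PMF.uniformOfFintype (LetterTable P)).ev fun Δw =>
            f (.nat v.val, (x, a.av, fillRow 1 a.rows Δv), (fillHash tab ρ,
              some (a.ideal y X (fillRow 1 a.rows Δv) (fillRow 2 a.rows Δw))))
        simp only [fillRow_cons_of_ne (show 0 ≠ 1 by decide),
          fillRow_cons_of_ne (show 0 ≠ 2 by decide)]
        exact this
    · simp only [LazyAccount.ideal, hκ, if_false, ev_lazyKernel_some, PMF.ev_const]
      exact ev_fillHash_letter tab i κ l fun v ρ => F (.nat v.val) ρ a
  | maskHash i κ l =>
    simp only [lazyStep, idealGame, gameOracle, PMF.ev_pure, ev_lazyKernel_some, PMF.ev_const]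
    exact ev_fillHash_mask tab i κ l fun v ρ => F (.nat v.val) ρ a
  | passwordHash p =>
    simp only [lazyStep, idealGame, gameOracle, PMF.ev_pure, ev_lazyKernel_some, PMF.ev_const]
    exact ev_fillHash_password tab p fun v ρ => F (.nat v) ρ a
  | register p =>
    simp only [lazyStep, idealGame, gameOracle, PMF.ev_pure, ev_lazyKernel_some, PMF.ev_const]
    rfl
  | ask b w =>
    cases b
    · simp only [lazyStep, idealGame, gameOracle, PMF.ev_map, ev_lazyKernel_some, PMF.ev_const,
        cond_false, fixedMaskReply_eq, LazyAccount.hybridReply_ideal]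
      -- The new entries of one tag are invisible to the rows with another tag, so both tables can
      -- be resampled separately.
      have h2 : ∀ d e : Fin P.n → ZMod P.q, fillRow (P := P) 2 (rowEntries 1 w d ++
          (rowEntries 2 w e ++ a.rows)) = fillRow 2 (rowEntries 2 w e ++ a.rows) := fun d e =>
        funext fun X => fillRow_rowEntries_of_ne (by decide) _ _ _ _
      have h0 : ∀ d e : Fin P.n → ZMod P.q, fillRow (P := P) 0 (rowEntries 1 w d ++
          (rowEntries 2 w e ++ a.rows)) = fillRow 0 a.rows := fun d e => funext fun X => by
        rw [fillRow_rowEntries_of_ne (by decide), fillRow_rowEntries_of_ne (by decide)]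
      have hu : ∀ G : ZMod P.q × ZMod P.q × (Fin P.n → ZMod P.q) → ℝ≥0∞,
          ((PMF.uniformOfFintype (ZMod P.q)).ev fun s => (PMF.uniformOfFintype (ZMod P.q)).ev fun u =>
            (PMF.uniformOfFintype (Fin P.n → ZMod P.q)).ev fun us => G (s, u, us)) =
          (PMF.uniformOfFintype (ZMod P.q × ZMod P.q × (Fin P.n → ZMod P.q))).ev G := fun G => by
        rw [PMF.uniform_prod]
        refine PMF.ev_congr fun s => ?_
        rw [PMF.uniform_prod]
      let K : (ZMod P.q × ZMod P.q × (Fin P.n → ZMod P.q)) → HashFunctions P k → LetterTable P →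
          (Fin P.n → ZMod P.q) → (Fin P.n → ZMod P.q) → LetterTable P → LetterTable P → ℝ≥0∞ :=
        fun u ρ X dv dw Δv Δw => f (a.reply J x y z dv dw w u, ((x, a.av, Δv), (fillHash tab ρ,
          some (LazyAccount.ideal { a with num := a.num + 1 } y (fillRow 0 a.rows X) Δv Δw))))
      have hR := hu fun u => (PMF.uniformOfFintype (Fin P.n → ZMod P.q)).ev fun vs =>
        (PMF.uniformOfFintype (Fin P.n → ZMod P.q)).ev fun ws =>
          (PMF.uniformOfFintype (HashFunctions P k)).ev fun ρ =>
            (PMF.uniformOfFintype (LetterTable P)).ev fun X =>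
              (PMF.uniformOfFintype (LetterTable P)).ev fun Δv =>
                (PMF.uniformOfFintype (LetterTable P)).ev fun Δw =>
                  K u ρ X (rowValues 1 a.rows w vs) (rowValues 2 a.rows w ws)
                    (fillRow 1 (rowEntries 1 w (rowValues 1 a.rows w vs) ++ a.rows) Δv)
                    (fillRow 2 (rowEntries 2 w (rowValues 2 a.rows w ws) ++ a.rows) Δw)
      have h1' : ∀ d e : Fin P.n → ZMod P.q, fillRow (P := P) 1 (rowEntries 1 w d ++
          (rowEntries 2 w e ++ a.rows)) = fillRow 1 (rowEntries 1 w d ++ a.rows) := by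
        intro d e
        funext X i l
        have := congrFun (congrFun (fillRow_rowEntries_of_ne (show 2 ≠ 1 by decide) w e a.rows X) i) l
        unfold fillRow expoAt at this ⊢
        by_cases hl : l = w i
        · subst hl
          have hkey : Function.Injective fun i : Fin P.n => [1, (i : ℕ), (w i : ℕ)] := fun i j h => by
            simp only [List.cons.injEq, true_and, Fin.val_inj] at h
            exact h.1
          rw [rowEntries, tabGet_ofFn_append (fun i => [1, (i : ℕ), (w i : ℕ)]) _ _ i hkey,
            tabGet_ofFn_append (fun i => [1, (i : ℕ), (w i : ℕ)]) _ _ i hkey]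
        · have hne : ∀ j : Fin P.n, [1, (j : ℕ), (w j : ℕ)] ≠ [1, (i : ℕ), (l : ℕ)] := by
            intro j h
            simp only [List.cons.injEq, true_and, and_true, Fin.val_inj] at h
            obtain ⟨rfl, h⟩ := h
            exact hl h.symm
          rw [rowEntries, tabGet_ofFn_append_of_ne _ _ _ _ hne, tabGet_ofFn_append_of_ne _ _ _ _ hne,
            this]
      simp only [h0, h1', h2]
      refine Eq.trans ?_ hR.symm
      refine (PMF.ev_congr fun ρ => PMF.ev_comm₄ _ _ _ _ _).trans ((PMF.ev_comm _ _ _).trans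
        (PMF.ev_congr fun u => ?_))
      conv_rhs => rw [PMF.ev_comm₄, PMF.ev_comm₄]
      refine PMF.ev_congr fun ρ => PMF.ev_congr fun X => ?_
      refine (ev_fillRow_password 1 a.rows w fun dv Δv => (PMF.uniformOfFintype (LetterTable P)).ev
        fun Δw => K u ρ X dv (fun i => fillRow 2 a.rows Δw i (w i)) Δv
          (fillRow 2 a.rows Δw)).trans (PMF.ev_congr fun vs => ?_)
      refine (PMF.ev_congr fun Δv => ev_fillRow_password 2 a.rows w fun dw Δw =>
        K u ρ X (rowValues 1 a.rows w vs) dw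
          (fillRow 1 (rowEntries 1 w (rowValues 1 a.rows w vs) ++ a.rows) Δv) Δw).trans ?_
      exact PMF.ev_comm _ _ _
    · simp only [lazyStep, idealGame, gameOracle, PMF.ev_map, PMF.ev_pure, ev_lazyKernel_some,
        PMF.ev_const, cond_true]
      rfl
  | other =>
    simp only [lazyStep, idealGame, gameOracle, PMF.ev_pure, ev_lazyKernel_some, PMF.ev_const]
    rfl

theorem gameWin_maskGame (J : ℕ) (δ : ZMod P.q) (A : Prog) (inp : Val) (T : ℕ) (θ : Mask P)
    (e : HashFunctions P k × Option (IdealState P k)) :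
    gameWin P k A inp (maskGame J δ) T (θ, e) =
      gameWin P k A inp (idealGame (fixedMaskReply J δ θ)) T e :=
  A.win_intertwine_map inp P.q (fun e => (θ, e)) (fun _ _ => rfl) T _ _ e

/-- Sampling the random functions when they are used makes no difference. -/
theorem gameWin_lazyGame (J : ℕ) (x y z : ZMod P.q) (A : Prog) (inp : Val) (T : ℕ) :
    gameWin P k A inp (lazyGame J x y z) T ([], none) =
      (PMF.uniformOfFintype (HashFunctions P k)).ev fun ρ =>
        (PMF.uniformOfFintype (Coeffs P × LetterTable P)).ev fun m =>
          gameWin P k A inp (idealGame (fixedMaskReply J (z - x * y) (x, m))) T (ρ, none) := by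
  have h : ∀ (e : LazyState P k) r,
      (lazyKernel x y e).bind (fun e' => maskGame J (z - x * y) e' r) =
        (lazyGame J x y z e r).bind fun s => (lazyKernel x y s.2).map fun e' => (s.1, e') := by
    rintro ⟨tab, _ | a⟩ r
    · exact lazyGame_intertwine_none J x y z tab r
    · exact lazyGame_intertwine_some J x y z tab a r
  rw [← A.win_intertwine_game inp _ h T ([], none), ev_lazyKernel_none]
  refine PMF.ev_congr fun ρ => ?_
  rw [PMF.uniform_prod]
  refine PMF.ev_congr fun a => PMF.ev_congr fun Δ => ?_
  have hρ : fillHash [] ρ = ρ := by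
    refine Prod.ext ?_ (Prod.ext ?_ ?_)
    · funext i κ l
      simp [fillHash, expoAt, tabGet]
    · funext i κ l
      simp [fillHash, expoAt, tabGet]
    · funext p
      exact Fin.ext (clip_of_lt (ρ.2.2 p).isLt)
  rw [hρ, gameWin_maskGame]

end LazyGame

/-! ### The program of the reduction -/

/-- A `LazyAccount` in terms of numbers. -/
structure Vault where
  p : List ℕ
  κ : ℕ
  xs : List ℕ
  av : List ℕ
  aw : List ℕ
  num : ℕ
  rows : Table

namespace Vault

instance : Coded Vault := ⟨fun b => code (b.p, b.κ, b.xs, b.av, b.aw, b.num, b.rows)⟩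

variable {γ : Type} [Coded γ] {f : γ → Vault} (hf : PolyTime f)
include hf

theorem polyTime_parts : PolyTime fun x =>
    ((f x).p, (f x).κ, (f x).xs, (f x).av, (f x).aw, (f x).num, (f x).rows) :=
  hf.of_code_eq fun _ => rfl

@[fun_prop] theorem polyTime_p : PolyTime fun x => (f x).p := (polyTime_parts hf).fst
@[fun_prop] theorem polyTime_κ : PolyTime fun x => (f x).κ := (polyTime_parts hf).snd.fst
@[fun_prop] theorem polyTime_xs : PolyTime fun x => (f x).xs := (polyTime_parts hf).snd.snd.fst
@[fun_prop] theorem polyTime_av : PolyTime fun x => (f x).av := (polyTime_parts hf).snd.snd.snd.fst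
@[fun_prop] theorem polyTime_aw : PolyTime fun x => (f x).aw :=
  (polyTime_parts hf).snd.snd.snd.snd.fst
@[fun_prop] theorem polyTime_num : PolyTime fun x => (f x).num :=
  (polyTime_parts hf).snd.snd.snd.snd.snd.fst
@[fun_prop] theorem polyTime_rows : PolyTime fun x => (f x).rows :=
  (polyTime_parts hf).snd.snd.snd.snd.snd.snd

omit hf in
@[fun_prop] theorem polyTime_mk {p : γ → List ℕ} {κ : γ → ℕ} {xs av aw : γ → List ℕ} {num : γ → ℕ}
    {rows : γ → Table} (hp : PolyTime p) (hκ : PolyTime κ) (hxs : PolyTime xs) (hav : PolyTime av)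
    (haw : PolyTime aw) (hnum : PolyTime num) (hrows : PolyTime rows) :
    PolyTime fun x => Vault.mk (p x) (κ x) (xs x) (av x) (aw x) (num x) (rows x) :=
  (PolyTime.prodMk hp (PolyTime.prodMk hκ (PolyTime.prodMk hxs (PolyTime.prodMk hav
    (PolyTime.prodMk haw (PolyTime.prodMk hnum hrows)))))).of_code_eq fun _ => rfl

end Vault

namespace Reduction

/-- The tag of a message or an action. -/
def tagOf (a : Val) : ℕ := if a.isPair = 0 then 6 else if a.fst.isPair = 0 then a.fst.toNat else 6

/-- Whether a message lists a position, a key and a letter. -/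
def validKey (v : Val) (two : ℕ) (a : Val) : ℕ :=
  if a.entry 0 < pubN v then if a.entry 1 < two then if a.entry 2 < pubM v then 1 else 0 else 0 else 0

abbrev Store : Type := Table × Option Vault

def addEntry (key : List ℕ) (d N : ℕ) (st : Store) : Val × Store :=
  (.nat (clip (tabGet st.1 key d) N), ((key, clip (tabGet st.1 key d) N) :: st.1, st.2))

def addRowEntry (key : List ℕ) (d N : ℕ) (tab : Table) (b : Vault) : Val × Store :=
  (.nat (clip (tabGet b.rows key d) N), (tab, some ⟨b.p, b.κ, b.xs, b.av, b.aw, b.num,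
    (key, clip (tabGet b.rows key d) N) :: b.rows⟩))

def letterStep (v : Val) (r : Sample) (st : Store) (a : Val) : Val × Store :=
  st.2.elim (addEntry [0, a.entry 0, a.entry 1, a.entry 2] r.s (pubQ v) st) fun b =>
    if a.entry 1 = b.κ then
      if a.entry 2 = b.p.getD (a.entry 0) 0 then (.nat (b.xs.getD (a.entry 0) 0), st)
      else addRowEntry [0, a.entry 0, a.entry 2] r.s (pubQ v) st.1 b
    else addEntry [0, a.entry 0, a.entry 1, a.entry 2] r.s (pubQ v) st

def register (v : Val) (r : Sample) (st : Store) (p : List ℕ) : Val × Store :=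
  st.2.elim (.nat 0, (st.1, some ⟨p, r.κ₁, r.us, r.vs.take (pubT v), r.ws.take (pubT v), 0, []⟩))
    fun _ => (.nat 0, st)

def rowList (tag : ℕ) (rows : Table) (y us : List ℕ) (N : ℕ) (l : List ℕ) : List ℕ :=
  (List.range l.length).map fun i => clip (tabGet rows [tag, i, y.getD i 0] (us.getD i 0)) N

def rowTable (tag : ℕ) (y ds l : List ℕ) : Table :=
  (List.range l.length).map fun i => ([tag, i, y.getD i 0], ds.getD i 0)

def exponentAt (v : Val) (b : Vault) (y as ds : List ℕ) (i : ℕ) : ℕ :=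
  if y.getD i 0 = b.p.getD i 0 then evalMod as (b.xs.getD i 0) (pubQ v) else ds.getD i 0

/-- The product of two powers. -/
def powers (v : Val) (B₁ B₂ e₁ e₂ : ℕ) : ℕ :=
  clip (powMod B₁ e₁ (2 * pubQ v + 1) * powMod B₂ e₂ (2 * pubQ v + 1)) (2 * pubQ v + 1)

/-- A reply whose exponents are applied to the bases `B₁` and `B₂`. -/
def replyWith (v w : Val) (e : ℕ) (b : Vault) (y dv dw l : List ℕ) (B₁ B₂ : ℕ) : Val :=
  groupMessage v b.κ (powers v (w.entry 1) (pubG v) (b.av.getD 0 0) (b.aw.getD 0 0)) B₂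
    (clip (e * powers v B₁ B₂ (b.av.getD 0 0) (b.aw.getD 0 0)) (2 * pubQ v + 1))
    ((List.range l.length).map fun i =>
      powers v B₁ B₂ (exponentAt v b y b.av dv i) (exponentAt v b y b.aw dw i))

def honestWith (v w : Val) (r : Sample) (e : ℕ) (b : Vault) (y dv dw l : List ℕ) : Val :=
  replyWith v w e b y dv dw l (powMod (w.entry 1) r.s (2 * pubQ v + 1)) (powG v r.s)

def matchCount (b : Vault) (y l : List ℕ) : ℕ :=
  ((List.range l.length).map fun i => if y.getD i 0 = b.p.getD i 0 then 1 else 0).sum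

def recoverReply (v w : Val) (J : ℕ) (r : Sample) (e : ℕ) (b : Vault) (y dv dw l : List ℕ) : Val :=
  if pubT v ≤ matchCount b y l then honestWith v w r e b y dv dw l
  else if b.num = J then replyWith v w e b y dv dw l (w.entry 2) (w.entry 0)
  else if b.num < J then
    groupMessage v b.κ (powers v (w.entry 1) (pubG v) (b.av.getD 0 0) (b.aw.getD 0 0)) (powG v r.s)
      (powG v r.u) ((List.range l.length).map fun i => powG v (r.us.getD i 0))
  else honestWith v w r e b y dv dw l

def recoverStep (v w : Val) (J : ℕ) (r : Sample) (e : ℕ) (l : List ℕ) (st : Store) (y : List ℕ) :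
    Val × Store :=
  st.2.elim (.nat 0, st) fun b =>
    (recoverReply v w J r e b y (rowList 1 b.rows y r.vs (pubQ v) l)
      (rowList 2 b.rows y r.ws (pubQ v) l) l, (st.1, some ⟨b.p, b.κ, b.xs, b.av, b.aw, b.num + 1,
        rowTable 1 y (rowList 1 b.rows y r.vs (pubQ v) l) l ++
          (rowTable 2 y (rowList 2 b.rows y r.ws (pubQ v) l) l ++ b.rows)⟩))

def loginStep (st : Store) (y : List ℕ) : Val × Store :=
  st.2.elim (.nat 0, st) fun b => if y = b.p then (.nat 1, st) else (.nat 0, st)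

/-- The reaction to a message that contains the password `y`. -/
def passwordStep (v w : Val) (J : ℕ) (r : Sample) (two e : ℕ) (l : List ℕ) (st : Store) (tag : ℕ)
    (y : List ℕ) : Val × Store :=
  if tag = 2 then addEntry (2 :: y) r.κ₂ two st
  else if tag = 3 then register v r st y
  else if tag = 4 then recoverStep v w J r e l st y
  else if tag = 5 then loginStep st y
  else (.nat 0, st)

/-- The reaction to a call of the adversary. -/
def step (v w : Val) (J : ℕ) (r : Sample) (two e : ℕ) (l : List ℕ) (st : Store) (a : Val) :
    Val × Store :=
  if tagOf a < 2 then
    if validKey v two a.snd = 0 then (.nat 0, st)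
    else if tagOf a = 0 then letterStep v r st a.snd
    else addEntry [1, a.snd.entry 0, a.snd.entry 1, a.snd.entry 2] r.s (pubQ v) st
  else if (a.snd.entries l.length).map (fun c => clip c (pubM v)) = a.snd.entries l.length then
    passwordStep v w J r two e l st (tagOf a) (a.snd.entries l.length)
  else (.nat 0, st)

section

variable {γ : Type} [Coded γ]

@[fun_prop] theorem polyTime_tagOf {a : γ → Val} (ha : PolyTime a) :
    PolyTime fun x => tagOf (a x) := by
  unfold tagOf
  fun_prop

@[fun_prop] theorem polyTime_validKey {v a : γ → Val} {two : γ → ℕ} (hv : PolyTime v)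
    (ha : PolyTime a) (h2 : PolyTime two) : PolyTime fun x => validKey (v x) (two x) (a x) := by
  unfold validKey
  fun_prop

@[fun_prop] theorem polyTime_addEntry {key : γ → List ℕ} {d N : γ → ℕ} {st : γ → Store}
    (hk : PolyTime key) (hd : PolyTime d) (hN : PolyTime N) (hs : PolyTime st) :
    PolyTime fun x => addEntry (key x) (d x) (N x) (st x) := by
  unfold addEntry
  fun_prop

@[fun_prop] theorem polyTime_addRowEntry {key : γ → List ℕ} {d N : γ → ℕ} {tab : γ → Table}
    {b : γ → Vault} (hk : PolyTime key) (hd : PolyTime d) (hN : PolyTime N) (hs : PolyTime tab)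
    (hb : PolyTime b) : PolyTime fun x => addRowEntry (key x) (d x) (N x) (tab x) (b x) := by
  unfold addRowEntry
  fun_prop

@[fun_prop] theorem polyTime_letterStep {v a : γ → Val} {r : γ → Sample} {st : γ → Store}
    (hv : PolyTime v) (ha : PolyTime a) (hr : PolyTime r) (hs : PolyTime st) :
    PolyTime fun x => letterStep (v x) (r x) (st x) (a x) := by
  unfold letterStep
  fun_prop

@[fun_prop] theorem polyTime_register {v : γ → Val} {r : γ → Sample} {st : γ → Store}
    {p : γ → List ℕ} (hv : PolyTime v) (hr : PolyTime r) (hs : PolyTime st) (hp : PolyTime p) :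
    PolyTime fun x => register (v x) (r x) (st x) (p x) := by
  unfold register
  fun_prop

@[fun_prop] theorem polyTime_rowList {rows : γ → Table} {y us l : γ → List ℕ} {N : γ → ℕ}
    (tag : ℕ) (hrows : PolyTime rows) (hy : PolyTime y) (hu : PolyTime us) (hl : PolyTime l)
    (hN : PolyTime N) : PolyTime fun x => rowList tag (rows x) (y x) (us x) (N x) (l x) := by
  unfold rowList
  fun_prop

@[fun_prop] theorem polyTime_rowTable {y ds l : γ → List ℕ} (tag : ℕ) (hy : PolyTime y)
    (hd : PolyTime ds) (hl : PolyTime l) : PolyTime fun x => rowTable tag (y x) (ds x) (l x) := by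
  unfold rowTable
  fun_prop

@[fun_prop] theorem polyTime_exponentAt {v : γ → Val} {b : γ → Vault} {y as ds : γ → List ℕ}
    {i : γ → ℕ} (hv : PolyTime v) (hb : PolyTime b) (hy : PolyTime y) (ha : PolyTime as)
    (hd : PolyTime ds) (hi : PolyTime i) :
    PolyTime fun x => exponentAt (v x) (b x) (y x) (as x) (ds x) (i x) := by
  unfold exponentAt
  fun_prop

@[fun_prop] theorem polyTime_powers {v : γ → Val} {B₁ B₂ e₁ e₂ : γ → ℕ} (hv : PolyTime v)
    (h₁ : PolyTime B₁) (h₂ : PolyTime B₂) (h₃ : PolyTime e₁) (h₄ : PolyTime e₂) :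
    PolyTime fun x => powers (v x) (B₁ x) (B₂ x) (e₁ x) (e₂ x) := by
  unfold powers
  fun_prop

@[fun_prop] theorem polyTime_replyWith {v w : γ → Val} {e B₁ B₂ : γ → ℕ} {b : γ → Vault}
    {y dv dw l : γ → List ℕ} (hv : PolyTime v) (hw : PolyTime w) (he : PolyTime e)
    (h₁ : PolyTime B₁) (h₂ : PolyTime B₂) (hb : PolyTime b) (hy : PolyTime y) (h₃ : PolyTime dv)
    (h₄ : PolyTime dw) (hl : PolyTime l) : PolyTime fun x =>
      replyWith (v x) (w x) (e x) (b x) (y x) (dv x) (dw x) (l x) (B₁ x) (B₂ x) := by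
  unfold replyWith
  fun_prop

@[fun_prop] theorem polyTime_matchCount {b : γ → Vault} {y l : γ → List ℕ} (hb : PolyTime b)
    (hy : PolyTime y) (hl : PolyTime l) : PolyTime fun x => matchCount (b x) (y x) (l x) := by
  unfold matchCount
  fun_prop

@[fun_prop] theorem polyTime_recoverReply {v w : γ → Val} {J e : γ → ℕ} {r : γ → Sample}
    {b : γ → Vault} {y dv dw l : γ → List ℕ} (hv : PolyTime v) (hw : PolyTime w) (hJ : PolyTime J)
    (he : PolyTime e) (hr : PolyTime r) (hb : PolyTime b) (hy : PolyTime y) (h₃ : PolyTime dv)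
    (h₄ : PolyTime dw) (hl : PolyTime l) : PolyTime fun x =>
      recoverReply (v x) (w x) (J x) (r x) (e x) (b x) (y x) (dv x) (dw x) (l x) := by
  unfold recoverReply honestWith
  fun_prop

@[fun_prop] theorem polyTime_recoverStep {v w : γ → Val} {J e : γ → ℕ} {r : γ → Sample}
    {st : γ → Store} {y l : γ → List ℕ} (hv : PolyTime v) (hw : PolyTime w) (hJ : PolyTime J)
    (he : PolyTime e) (hr : PolyTime r) (hs : PolyTime st) (hy : PolyTime y) (hl : PolyTime l) :
    PolyTime fun x => recoverStep (v x) (w x) (J x) (r x) (e x) (l x) (st x) (y x) := by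
  unfold recoverStep
  fun_prop

@[fun_prop] theorem polyTime_step {v w a : γ → Val} {J two e : γ → ℕ} {r : γ → Sample}
    {st : γ → Store} {l : γ → List ℕ} (hv : PolyTime v) (hw : PolyTime w) (ha : PolyTime a)
    (hJ : PolyTime J) (h2 : PolyTime two) (he : PolyTime e) (hr : PolyTime r) (hs : PolyTime st)
    (hl : PolyTime l) : PolyTime fun x =>
      step (v x) (w x) (J x) (r x) (two x) (e x) (l x) (st x) (a x) := by
  unfold step passwordStep loginStep
  fun_prop

end

end Reduction

theorem polyTime_polyBound {γ : Type} [Coded γ] {f : γ → ℕ} (c : ℕ) (hf : PolyTime f) :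
    PolyTime fun x => polyBound c (f x) := by
  have h : PolyTime fun x => f x ^ c := by
    induction c with
    | zero => simpa using PolyTime.const 1
    | succ c ih => simpa only [pow_succ] using ih.mul hf
  exact h.add (PolyTime.const c)

/-! ### The reduction as a batch machine that runs the adversary. -/

namespace Reduction

/-- The adversary inside the reduction: its memory, its pending action, the number of its
activations, the number of the hybrid, and what is known about the random functions and the
account. -/
abbrev Sim : Type := Val × Val × ℕ × ℕ × Store

variable (c : ℕ)

/-- The bound on the number of activations of the adversary. -/
def limit (v : Val) : ℕ := polyBound c (pubK v)

/-- The position of the first request that is not answered at random. -/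
def hybridIndex (v : Val) (s : ℕ) : ℕ := s / (pubQ v / limit c v)

/-- At first the adversary has empty memory and a pending call of `nat 0`. That call is answered by
`nat 0`, so its first activation receives the message with which a run starts. The number of the
hybrid is derived from the exponent drawn in the first batch and kept afterwards. -/
def current (x : BatchCtx (Option Sim)) : Sim :=
  x.2.2.1.getD (.nat 0, .pair (.nat 3) (.nat 0), 0,
    hybridIndex c x.1.fst (readSample x.1.fst x.2.2.2).s, [], none)

/-- A list with as many elements as there are positions. -/
def positions (x : BatchCtx (Option Sim)) : List ℕ := x.2.2.2.take (pubN x.1.fst)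

/-- The number `2 ^ k`. -/
def keyBound (x : BatchCtx (Option Sim)) : ℕ :=
  ofDigits ((x.2.2.2.take (pubK x.1.fst)).map fun _ => 1) + 1

/-- The registered password, to be encoded. -/
def encodeArg (x : BatchCtx (Option Sim)) : Option Val :=
  (current c x).2.2.2.2.2.elim none fun b => some (.pair x.1.fst
    (code ((List.range (positions x).length).map fun i => clip (b.p.getD i 0) (pubM x.1.fst))))

/-- The output, if the run of the adversary is over. -/
def outcome (s : Sim) (T : ℕ) : Option Val :=
  if tagOf s.2.1 = 0 then some s.2.1.snd
  else if 3 < tagOf s.2.1 then some (.nat 0)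
  else if T ≤ s.2.2.1 then some (.nat 0)
  else none

/-- The next message to the adversary. -/
def answer (v w : Val) (r : Sample) (two e : ℕ) (l : List ℕ) (s : Sim) : Val × Store :=
  if tagOf s.2.1 = 1 then (.nat r.bit, s.2.2.2.2)
  else if tagOf s.2.1 = 2 then (.nat r.s, s.2.2.2.2)
  else step v w s.2.2.2.1 r two e l s.2.2.2.2 s.2.1.snd

def answerOf (z : BatchCtx (Option Sim) × Val) : Val × Store :=
  answer z.1.1.fst z.1.2.1 (readSample z.1.1.fst z.1.2.2.2) (keyBound z.1) z.2.toNat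
    (positions z.1) (current c z.1)

def outcomeOf (x : BatchCtx (Option Sim)) : Option Val := outcome (current c x) (limit c x.1.fst)

def continued (z : (BatchCtx (Option Sim) × Val) × Val) : Sim :=
  (z.2.fst, z.2.snd, (current c z.1.1).2.2.1 + 1, (current c z.1.1).2.2.2.1, (answerOf c z.1).2)

/-- The reduction as a batch machine. -/
def script : BatchScript (Option Sim) where
  coins v := bitCount v.fst
  draws v := expoCount v.fst
  calls _ := 0
  query _ _ := .nat 0
  pre₁ := encodeArg c
  pre₂ z := (outcomeOf c z.1).elim
    (some (.pair z.1.1 (.pair (current c z.1).1 (answerOf c z).1))) fun _ => none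
  post z := (outcomeOf c z.1.1).elim (some (continued c z), none)
    fun v => (some (current c z.1.1), some v)
  init := none

section

variable {γ : Type} [Coded γ]

@[fun_prop] theorem polyTime_limit {v : γ → Val} (hv : PolyTime v) :
    PolyTime fun x => limit c (v x) := polyTime_polyBound c (polyTime_pubK hv)

@[fun_prop] theorem polyTime_current {f : γ → BatchCtx (Option Sim)} (hf : PolyTime f) :
    PolyTime fun x => current c (f x) := by
  unfold current hybridIndex
  fun_prop

@[fun_prop] theorem polyTime_positions {f : γ → BatchCtx (Option Sim)} (hf : PolyTime f) :
    PolyTime fun x => positions (f x) := by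
  unfold positions
  fun_prop

@[fun_prop] theorem polyTime_keyBound {f : γ → BatchCtx (Option Sim)} (hf : PolyTime f) :
    PolyTime fun x => keyBound (f x) := by
  unfold keyBound
  fun_prop

@[fun_prop] theorem polyTime_outcomeOf {f : γ → BatchCtx (Option Sim)} (hf : PolyTime f) :
    PolyTime fun x => outcomeOf c (f x) := by
  unfold outcomeOf outcome
  fun_prop

@[fun_prop] theorem polyTime_answerOf {f : γ → BatchCtx (Option Sim) × Val} (hf : PolyTime f) :
    PolyTime fun x => answerOf c (f x) := by
  unfold answerOf answer
  fun_prop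

theorem script_feasible : (script c).Feasible where
  coins := by
    simp only [script]
    fun_prop
  draws := by
    simp only [script]
    fun_prop
  calls := PolyTime.const _
  query := PolyTime.const _
  pre₁ := by
    simp only [script]
    unfold encodeArg
    fun_prop
  pre₂ := by
    simp only [script]
    fun_prop
  post := by
    simp only [script, continued]
    fun_prop
  init := rfl

end

end Reduction

/-! ### The reduction plays the game -/

/-- The numbers that stand for an account. -/
def LazyAccount.toVault {P : Params} {k : ℕ} (a : LazyAccount P k) : Vault :=
  ⟨P.letters a.p, a.κ, valList a.xs, valList a.av, valList a.aw, a.num, a.rows⟩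

namespace Reduction

variable {P : Params} {k : ℕ}

def storeOf (st : LazyState P k) : Store := (st.1, st.2.map LazyAccount.toVault)

/-- The three group elements of an instance. -/
def challenge (x y z : ZMod P.q) : Val :=
  .ofList [P.elt (P.pow P.g x), P.elt (P.pow P.g y), P.elt (P.pow P.g z)]

theorem expoAt_val (tab : Table) (key : List ℕ) (u : ZMod P.q) :
    (expoAt tab key u).val = clip (tabGet tab key u.val) P.q := by
  rw [expoAt, ZMod.val_natCast, clip_eq _ P.q_pos]

theorem powMod_pow (a : ZMod P.q) (e : ℕ) : powMod (P.num (P.pow P.g a)) e (2 * P.q + 1) =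
    P.num (P.pow P.g (a * e)) := by
  rw [P.powMod_num, Params.pow, ← pow_mul, ← P.pow_natCast]
  simp

theorem powers_eq (a b : ZMod P.q) (e₁ e₂ : ℕ) : powers (P.pub k) (P.num (P.pow P.g a))
    (P.num (P.pow P.g b)) e₁ e₂ = P.num (P.pow P.g (a * e₁ + b * e₂)) := by
  rw [powers, pubQ_pub, powMod_pow, powMod_pow, P.clip_mul, P.pow_add]

theorem rowList_eq (tag : ℕ) (rows : Table) (y : P.Password) (u : Fin P.n → ZMod P.q) (l : List ℕ)
    (hl : l.length = P.n) : rowList tag rows (P.letters y) (valList u) P.q l =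
      valList (rowValues tag rows y u) := by
  rw [rowList, hl, map_range_eq_ofFn]
  refine congrArg List.ofFn ?_
  funext i
  rw [P.letters_getD, valList_getD, rowValues, expoAt_val]

theorem rowTable_eq (tag : ℕ) (y : P.Password) (d : Fin P.n → ZMod P.q) (l : List ℕ)
    (hl : l.length = P.n) : rowTable tag (P.letters y) (valList d) l = rowEntries tag y d := by
  rw [rowTable, hl, map_range_eq_ofFn, rowEntries]
  congr 1
  funext i
  rw [P.letters_getD, valList_getD]

theorem exponentAt_eq (a : LazyAccount P k) (y : P.Password) (as : Coeffs P)
    (d : Fin P.n → ZMod P.q) (i : Fin P.n) :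
    ((exponentAt (P.pub k) a.toVault (P.letters y) (valList as) (valList d) i : ℕ) : ZMod P.q) =
      maskExponents a.xs a.p y as (fun i _ => d i) i := by
  simp only [exponentAt, LazyAccount.toVault, P.letters_getD, valList_getD, maskExponents,
    pubQ_pub, Fin.val_inj]
  split_ifs
  · rw [cast_evalMod, ZMod.natCast_zmod_val, Coeffs.share]
  · simp

theorem matchCount_eq (a : LazyAccount P k) (y : P.Password) (l : List ℕ) (hl : l.length = P.n) :
    matchCount a.toVault (P.letters y) l = (Finset.univ.filter fun i => y i = a.p i).card := by
  rw [matchCount, hl, sum_map_range_ite]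
  simp only [LazyAccount.toVault, P.letters_getD, Fin.val_inj]

theorem valList_head (a : Coeffs P) : (valList a).getD 0 0 = a.secret.val :=
  valList_getD a ⟨0, P.t_pos⟩ 0

section Replies

variable (a : LazyAccount P k) (w : P.Password) (dv dw : Fin P.n → ZMod P.q) (l : List ℕ)
  (hl : l.length = P.n)
include hl

theorem replyWith_eq (x y z b₁ b₂ : ZMod P.q) :
    replyWith (P.pub k) (challenge x y z) (P.num (P.encode a.p)) a.toVault (P.letters w)
      (valList dv) (valList dw) l (P.num (P.pow P.g b₁)) (P.num (P.pow P.g b₂)) =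
    expMessage a.κ (y * a.av.secret + a.aw.secret) b₂
      (P.encode a.p * P.pow P.g (b₁ * a.av.secret + b₂ * a.aw.secret)) fun i =>
        b₁ * maskExponents a.xs a.p w a.av (fun i _ => dv i) i +
          b₂ * maskExponents a.xs a.p w a.aw (fun i _ => dw i) i := by
  have h1 : (challenge x y z).entry 1 = P.num (P.pow P.g y) := rfl
  have hg : pubG (P.pub k) = P.num (P.pow P.g (1 : ZMod P.q)) := by
    rw [pubG_pub, ← Nat.cast_one, P.pow_natCast, pow_one]
  have ha : a.toVault.av.getD 0 0 = a.av.secret.val := valList_head _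
  have hb : a.toVault.aw.getD 0 0 = a.aw.secret.val := valList_head _
  have hκ : a.toVault.κ = a.κ := rfl
  have hav : a.toVault.av = valList a.av := rfl
  have haw : a.toVault.aw = valList a.aw := rfl
  rw [replyWith, ha, hb, h1, hg, hl, powers_eq, powers_eq, pubQ_pub, P.clip_mul, hκ, hav, haw,
    map_range_eq_ofFn]
  simp only [powers_eq, exponentAt_eq, ZMod.natCast_zmod_val, one_mul]
  exact groupMessage_pub P a.κ _ _ _ _

/-- With bases `g ^ z` and `g ^ x`, a pair of exponents `v`, `w` gives `z * v + x * w = x * (y * v +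
w) + (z - x * y) * v`, which is the masked reply. With bases `g ^ (y * s)` and `g ^ s` it gives the
honest reply with randomness `s`. -/
theorem recoverReply_eq (J : ℕ) (x y z : ZMod P.q) (r : Batch P k) :
    recoverReply (P.pub k) (challenge x y z) J r.sample (P.num (P.encode a.p)) a.toVault
      (P.letters w) (valList dv) (valList dw) l =
      a.reply J x y z dv dw w (r.2.2.2.1, r.2.2.2.2.1, r.2.2.2.2.2.1) := by
  have h0 : (challenge x y z).entry 0 = P.num (P.pow P.g x) := rfl
  have h1 : (challenge x y z).entry 1 = P.num (P.pow P.g y) := rfl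
  have h2 : (challenge x y z).entry 2 = P.num (P.pow P.g z) := rfl
  have hs : (a.ideal y (fun _ _ => 0) (fun i _ => dv i) fun i _ => dw i).1.2.2.2.2.secret =
      y * a.av.secret + a.aw.secret := rfl
  have hx : ∀ i, idealExponents (a.ideal y (fun _ _ => 0) (fun i _ => dv i) fun i _ => dw i).1 a.p w
      i = y * maskExponents a.xs a.p w a.av (fun i _ => dv i) i +
        maskExponents a.xs a.p w a.aw (fun i _ => dw i) i := by
    intro i
    have hsh : Coeffs.share (fun j => y * a.av j + a.aw j) (a.xs i) =
        y * a.av.share (a.xs i) + a.aw.share (a.xs i) := by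
      simp only [Coeffs.share, Finset.mul_sum, ← Finset.sum_add_distrib]
      exact Finset.sum_congr rfl fun j _ => by ring
    unfold idealExponents maskExponents
    split_ifs
    · exact hsh
    · rfl
  have hhonest : honestWith (P.pub k) (challenge x y z) r.sample (P.num (P.encode a.p)) a.toVault
      (P.letters w) (valList dv) (valList dw) l = honestReply a.κ a.p
        (y * a.av.secret + a.aw.secret) (idealExponents (a.ideal y (fun _ _ => 0) (fun i _ => dv i)
          fun i _ => dw i).1 a.p w) r.2.2.2.1 := by
    have hr : ((r.sample.s : ℕ) : ZMod P.q) = r.2.2.2.1 := ZMod.natCast_zmod_val _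
    rw [honestWith, h1, pubQ_pub, powMod_pow, powG_pub, hr, replyWith_eq a w dv dw l hl, honestReply]
    congr 1
    · congr 2
      ring
    · funext i
      rw [hx]
      ring
  have hcount : pubT (P.pub k) ≤ matchCount a.toVault (P.letters w) l ↔ P.Matches w a.p := by
    rw [matchCount_eq a w l hl]
    rfl
  rw [recoverReply, LazyAccount.reply, hybridReply]
  simp only [hcount]
  have hp : (a.ideal y (fun _ _ => 0) (fun i _ => dv i) fun i _ => dw i).2.1 = a.p := rfl
  have hn : (a.ideal y (fun _ _ => 0) (fun i _ => dv i) fun i _ => dw i).2.2 = a.num := rfl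
  have hv : a.toVault.num = a.num := rfl
  have hu : UsesMask J (a.ideal y (fun _ _ => 0) (fun i _ => dv i) fun i _ => dw i) w ↔
      a.num = J ∧ ¬ P.Matches w a.p := Iff.rfl
  simp only [hu, hp, hn, hs, hv]
  by_cases hm : P.Matches w a.p
  · simp only [hm, not_true_eq_false, and_false, if_true, if_false]
    exact hhonest
  · simp only [hm, not_false_eq_true, and_true, if_false]
    by_cases hJ : a.num = J
    · rw [if_pos hJ, if_pos hJ, h0, h2, replyWith_eq a w dv dw l hl, maskedReply, hp, hs]
      congr 1
      · congr 2
        ring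
      · funext i
        rw [hx]
        change _ = _ + (z - x * y) * maskExponents a.xs a.p w a.av (fun i _ => dv i) i
        ring
    · rw [if_neg hJ, if_neg hJ]
      by_cases hlt : a.num < J
      · have hb : below J a.num = true := by simp [below, hlt]
        have hg : pubG (P.pub k) = P.num (P.pow P.g (1 : ZMod P.q)) := by
          rw [pubG_pub, ← Nat.cast_one, P.pow_natCast, pow_one]
        have ha : a.toVault.av.getD 0 0 = a.av.secret.val := valList_head _
        have hb' : a.toVault.aw.getD 0 0 = a.aw.secret.val := valList_head _
        have hκ : a.toVault.κ = a.κ := rfl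
        rw [if_pos hlt, if_pos hb, ha, hb', h1, hg, powers_eq, powG_pub, powG_pub, hl,
          map_range_eq_ofFn, hκ]
        simp only [powG_pub, Batch.sample, valList_getD, ZMod.natCast_zmod_val, one_mul]
        exact groupMessage_pub P a.κ _ _ _ _
      · have hb : ¬ below J a.num = true := by simp [below, hlt]
        rw [if_neg hlt, if_neg hb]
        exact hhonest

end Replies

theorem clip_letters (p : P.Password) : (P.letters p).map (fun c => clip c P.m) = P.letters p := by
  rw [Params.letters, List.map_ofFn]
  congr 1
  funext i
  exact clip_of_lt (p i).isLt

/-- The reduction recognizes a password by the fact that reducing its entries below `m` changes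
nothing. -/
theorem readPassword_eq_none (v : Val) (h : P.readPassword v = none) :
    (v.entries P.n).map (fun c => clip c P.m) ≠ v.entries P.n := by
  intro h'
  unfold Params.readPassword at h
  split_ifs at h with hv
  refine hv fun i => ?_
  rw [Val.entries, map_range_eq_ofFn, List.map_ofFn] at h'
  have := congrFun (List.ofFn_injective h') i
  simp only [Function.comp_apply] at this
  rw [← this, clip_eq _ P.m_pos]
  exact Nat.mod_lt _ P.m_pos

theorem letterStep_eq (J : ℕ) (x y z : ZMod P.q) (r : Batch P k) (st : LazyState P k) (a : Val)
    (h : a.entry 0 < P.n ∧ a.entry 1 < 2 ^ k ∧ a.entry 2 < P.m) :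
    letterStep (P.pub k) r.sample (storeOf st) a =
      ((lazyStep J x y z r st (.letterHash ⟨_, h.1⟩ ⟨_, h.2.1⟩ ⟨_, h.2.2⟩)).1,
        storeOf (lazyStep J x y z r st (.letterHash ⟨_, h.1⟩ ⟨_, h.2.1⟩ ⟨_, h.2.2⟩)).2) := by
  have hs : r.sample.s = r.2.2.2.1.val := rfl
  obtain ⟨tab, _ | b⟩ := st
  · simp [letterStep, storeOf, lazyStep, addEntry, hs, expoAt_val]
  · have h1 : b.toVault.p.getD (a.entry 0) 0 = b.p ⟨_, h.1⟩ := P.letters_getD b.p ⟨_, h.1⟩ 0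
    have h2 : b.toVault.xs.getD (a.entry 0) 0 = (b.xs ⟨_, h.1⟩).val :=
      valList_getD b.xs ⟨_, h.1⟩ 0
    have h3 : b.toVault.κ = b.κ := rfl
    have h4 : b.toVault.rows = b.rows := rfl
    simp only [letterStep, storeOf, lazyStep, Option.map_some, Option.elim_some, h1, h2, h3,
      Fin.ext_iff]
    split_ifs
    · rfl
    · simp only [addRowEntry, hs, expoAt_val, pubQ_pub, h4]
      simp [LazyAccount.toVault]
    · simp [addEntry, hs, expoAt_val]

theorem passwordStep_eq (J : ℕ) (x y z : ZMod P.q) (r : Batch P k) (st : LazyState P k)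
    (l : List ℕ) (hl : l.length = P.n) (e : ℕ) (he : ∀ b ∈ st.2, e = P.num (P.encode b.p))
    (f : P.Password → Req P k) (tag : ℕ) (hf : (tag = 2 ∧ f = .passwordHash) ∨
      (tag = 3 ∧ f = .register) ∨ (tag = 4 ∧ f = .ask false) ∨ (tag = 5 ∧ f = .ask true))
    (p : P.Password) :
    passwordStep (P.pub k) (challenge x y z) J r.sample (2 ^ k) e l (storeOf st) tag (P.letters p) =
      ((lazyStep J x y z r st (f p)).1, storeOf (lazyStep J x y z r st (f p)).2) := by
  rcases hf with ⟨rfl, rfl⟩ | ⟨rfl, rfl⟩ | ⟨rfl, rfl⟩ | ⟨rfl, rfl⟩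
  · obtain ⟨tab, _ | b⟩ := st <;> rfl
  · obtain ⟨tab, _ | b⟩ := st
    · have hv : (Batch.sample r).vs.take P.t = valList fun j : Fin P.t =>
          r.2.2.2.2.2.2.1 (j.castLE P.t_le) := valList_take P.t_le _
      have hw : (Batch.sample r).ws.take P.t = valList fun j : Fin P.t =>
          r.2.2.2.2.2.2.2 (j.castLE P.t_le) := valList_take P.t_le _
      simp only [passwordStep, register, storeOf, lazyStep, pubT_pub, hv, hw]
      rfl
    · rfl
  · obtain ⟨tab, _ | b⟩ := st
    · rfl
    · obtain rfl := he b rfl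
      have hvs : r.sample.vs = valList r.2.2.2.2.2.2.1 := rfl
      have hws : r.sample.ws = valList r.2.2.2.2.2.2.2 := rfl
      have hrows : b.toVault.rows = b.rows := rfl
      simp only [passwordStep, recoverStep, storeOf, lazyStep, Option.map_some, Option.elim_some,
        hvs, hws, hrows, pubQ_pub, rowList_eq _ _ _ _ l hl, rowTable_eq _ _ _ l hl,
        recoverReply_eq b p _ _ l hl]
      rfl
  · obtain ⟨tab, _ | b⟩ := st
    · rfl
    · have hp : b.toVault.p = P.letters b.p := rfl
      simp only [passwordStep, loginStep, storeOf, lazyStep, Option.map_some, Option.elim_some, hp,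
        P.letters_injective.eq_iff, loginReply]
      split_ifs <;> first | rfl | simp_all

theorem lazyStep_other (J : ℕ) (x y z : ZMod P.q) (r : Batch P k) (st : LazyState P k) :
    lazyStep J x y z r st .other = (.nat 0, st) := by
  obtain ⟨tab, _ | b⟩ := st <;> rfl

theorem step_eq (J : ℕ) (x y z : ZMod P.q) (r : Batch P k) (st : LazyState P k) (l : List ℕ)
    (hl : l.length = P.n) (e : ℕ) (he : ∀ b ∈ st.2, e = P.num (P.encode b.p)) (a : Val) :
    step (P.pub k) (challenge x y z) J r.sample (2 ^ k) e l (storeOf st) a =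
      ((lazyStep J x y z r st (Req.parse a)).1, storeOf (lazyStep J x y z r st (Req.parse a)).2) := by
  have hother : ∀ (tag : ℕ) (y' : List ℕ), 6 ≤ tag → passwordStep (P.pub k) (challenge x y z) J
      r.sample (2 ^ k) e l (storeOf st) tag y' = (.nat 0, storeOf st) := by
    intro tag y' ht
    rw [passwordStep, if_neg (by omega), if_neg (by omega), if_neg (by omega), if_neg (by omega)]
  have hpw : ∀ (f : P.Password → Req P k) (tag : ℕ) (v : Val),
      ((tag = 2 ∧ f = .passwordHash) ∨ (tag = 3 ∧ f = .register) ∨ (tag = 4 ∧ f = .ask false) ∨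
        (tag = 5 ∧ f = .ask true)) →
      (if (v.entries P.n).map (fun c => clip c P.m) = v.entries P.n then
        passwordStep (P.pub k) (challenge x y z) J r.sample (2 ^ k) e l (storeOf st) tag
          (v.entries P.n) else (.nat 0, storeOf st)) =
      ((lazyStep J x y z r st (Req.withPassword f v)).1,
        storeOf (lazyStep J x y z r st (Req.withPassword f v)).2) := by
    intro f tag v hf
    unfold Req.withPassword
    cases hv : P.readPassword v with
    | none => rw [if_neg (readPassword_eq_none v hv), Option.elim_none, lazyStep_other]
    | some p =>
      have h := (P.readPassword_eq p v).1 hv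
      rw [h, if_pos (clip_letters p), passwordStep_eq J x y z r st l hl e he f tag hf p]
      rfl
  rcases a with t | ⟨t | ⟨t₁, t₂⟩, v⟩
  · simp [step, tagOf, Val.isPair, hother, Req.parse, lazyStep_other]
  · have ht : tagOf (.pair (.nat t) v) = t := rfl
    have hs : (Val.pair (.nat t) v).snd = v := rfl
    rw [step, ht, hs, hl, pubM_pub]
    have hkey : validKey (P.pub k) (2 ^ k) v = 0 ↔
        ¬ (v.entry 0 < P.n ∧ v.entry 1 < 2 ^ k ∧ v.entry 2 < P.m) := by
      unfold validKey
      simp only [pubN_pub, pubM_pub]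
      by_cases h₀ : v.entry 0 < P.n <;> by_cases h₁ : v.entry 1 < 2 ^ k <;>
        by_cases h₂ : v.entry 2 < P.m <;> simp [h₀, h₁, h₂]
    match t with
    | 0 =>
      simp only [Nat.zero_lt_succ, if_true, hkey, Req.parse, Req.keyed]
      by_cases hv : v.entry 0 < P.n ∧ v.entry 1 < 2 ^ k ∧ v.entry 2 < P.m
      · rw [if_neg (not_not.2 hv), dif_pos hv]
        exact letterStep_eq J x y z r st v hv
      · rw [if_pos hv, dif_neg hv, lazyStep_other]
    | 1 =>
      simp only [Nat.one_lt_ofNat, if_true, hkey, Req.parse, Req.keyed, one_ne_zero, if_false]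
      by_cases hv : v.entry 0 < P.n ∧ v.entry 1 < 2 ^ k ∧ v.entry 2 < P.m
      · rw [if_neg (not_not.2 hv), dif_pos hv]
        have hs : r.sample.s = r.2.2.2.1.val := rfl
        obtain ⟨tab, _ | b⟩ := st <;> simp [storeOf, lazyStep, addEntry, hs, expoAt_val]
      · rw [if_pos hv, dif_neg hv, lazyStep_other]
    | 2 => exact hpw .passwordHash 2 v (by simp)
    | 3 => exact hpw .register 3 v (by simp)
    | 4 => exact hpw (.ask false) 4 v (by simp)
    | 5 => exact hpw (.ask true) 5 v (by simp)
    | t + 6 =>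
      rw [if_neg (by omega), hother _ _ (by omega)]
      simp [Req.parse, lazyStep_other]
  · simp [step, tagOf, Val.isPair, Val.fst, hother, Req.parse, lazyStep_other]

end Reduction

/-! ### Batches of the reduction and activations of the adversary. -/

namespace Reduction

variable {P : Params} {k : ℕ} (c : ℕ)

/-- The adversary inside the reduction at the end of a batch. -/
def currentWith (v : Val) (o : Option Sim) (r : Sample) : Sim :=
  o.getD (.nat 0, .pair (.nat 3) (.nat 0), 0, hybridIndex c v r.s, [], none)

/-- The registered password, to be encoded. -/
def encodeWith (v : Val) (n : ℕ) (s : Sim) : Option Val :=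
  s.2.2.2.2.2.elim none fun b => some (.pair v
    (code ((List.range n).map fun i => clip (b.p.getD i 0) (pubM v))))

/-- The adversary after its activation with the given message. -/
def resumed (A : Prog) (inp : Val) (s : Sim) (a : Val × Store) : Sim :=
  ((A.eval (.pair inp (.pair s.1 a.1))).fst, (A.eval (.pair inp (.pair s.1 a.1))).snd, s.2.2.1 + 1,
    s.2.2.2.1, a.2)

/-- The list `l` serves only as a unary number, so it may be replaced by any list of the same
length, for instance by one that does not depend on the buffer. -/
theorem answer_congr {l l' : List ℕ} (h : l.length = l'.length) (v w : Val) (r : Sample)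
    (two e : ℕ) (s : Sim) : answer v w r two e l s = answer v w r two e l' s := by
  unfold answer step passwordStep recoverStep recoverReply honestWith replyWith rowList rowTable
    matchCount
  rw [h]

theorem ofDigits_ones (l : List ℕ) : ofDigits (l.map fun _ => 1) + 1 = 2 ^ l.length := by
  induction l with
  | nil => rfl
  | cons a l ih =>
    simp only [ofDigits] at ih
    simp only [List.map_cons, ofDigits, List.foldr_cons, List.length_cons, pow_succ]
    omega

/-- The number of activations in a batch. -/
def batchLength (v : Val) : ℕ := 0 + (expoCount v + bitCount v)

/-- The reply to a message, given the sample of a batch. -/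
def answerWith (E : Prog) (v w : Val) (s : Sim) (r : Sample) : Val × Store :=
  answer v w r (2 ^ pubK v) ((encodeWith v (pubN v) s).elim (.nat 0) E.eval).toNat
    (List.replicate (pubN v) 0) s

/-- One batch either notices that the run of the adversary is over, or answers its pending action
from the sample and activates it once. The oracle of the machine is never called. -/
theorem ev_rest {E A M : Prog} (hM : (script c).Computes E A M) (aux w : Val) (ans : Val → Val)
    (o : Option Sim) (T : ℕ) :
    ((BatchScript.rest P.q (script c) E A M ans (T + batchLength (P.pub k))
      (.pair (P.pub k) aux, w, o, [0])).ev fun z => z.1.accepts) =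
    (PMF.uniformOfFintype (Batch P k)).ev fun b =>
      (outcome (currentWith c (P.pub k) o b.sample) (limit c (P.pub k))).elim
        ((BatchScript.rest P.q (script c) E A M ans T (.pair (P.pub k) aux, w,
          some (resumed A (.pair (P.pub k) aux) (currentWith c (P.pub k) o b.sample)
            (answerWith E (P.pub k) w (currentWith c (P.pub k) o b.sample) b.sample)), [0])).ev
              fun z => z.1.accepts) Val.accepts := by
  have h := BatchScript.rest_batch P.q hM ans T (.pair (P.pub k) aux) w o
  have hB : (script c).calls (.pair (P.pub k) aux) + ((script c).draws (.pair (P.pub k) aux) +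
      (script c).coins (.pair (P.pub k) aux)) = batchLength (P.pub k) := rfl
  rw [hB] at h
  rw [h]
  simp only [PMF.ev_bind]
  refine ev_batch P k (P.pub k) rfl rfl (fun r =>
      (outcome (currentWith c (P.pub k) o r) (limit c (P.pub k))).elim
        ((BatchScript.rest P.q (script c) E A M ans T (.pair (P.pub k) aux, w,
          some (resumed A (.pair (P.pub k) aux) (currentWith c (P.pub k) o r)
            (answerWith E (P.pub k) w (currentWith c (P.pub k) o r) r)), [0])).ev
              fun z => z.1.accepts) Val.accepts) _ fun cs ds hcs hds => ?_
  have hl0 : ([0] ++ cs ++ ds).length = 1 + bitCount (P.pub k) + expoCount (P.pub k) := by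
    simp [hcs, hds]
    omega
  have hans : BatchScript.answersFrom (script c) ans (.pair (P.pub k) aux, w, o, [0] ++ cs ++ ds) 0
      ((script c).calls (.pair (P.pub k) aux)) = [] := rfl
  rw [hans, List.append_nil, BatchScript.rest_finish]
  · set buf := [0] ++ cs ++ ds
    let x : BatchCtx (Option Sim) := (.pair (P.pub k) aux, w, o, buf)
    have hcur : current c x = currentWith c (P.pub k) o (readSample (P.pub k) buf) := rfl
    have hpos : (positions x).length = P.n := by
      have : (positions x).length = min P.n buf.length := List.length_take
      have h2 : expoCount (P.pub k) = 1 + (1 + (P.n + (P.n + P.n))) := rfl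
      rw [this]
      omega
    have hkey : keyBound x = 2 ^ k := by
      have : (buf.take k).length = k := by
        have h2 : bitCount (P.pub k) = 1 + (k + k) := rfl
        rw [List.length_take]
        omega
      rw [keyBound]
      change ofDigits ((buf.take k).map fun _ => 1) + 1 = _
      rw [ofDigits_ones, this]
    have henc : encodeArg c x = encodeWith (P.pub k) P.n (current c x) := by
      rw [encodeArg, hpos]
      rfl
    have hansw : answerOf c (x, ((encodeArg c x).elim (.nat 0) E.eval)) =
        answerWith E (P.pub k) w (current c x) (readSample (P.pub k) buf) := by
      rw [answerOf, answerWith, henc, hkey]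
      exact answer_congr (by simp [hpos]) _ _ _ _ _ _
    have hpost : ∀ z : (BatchCtx (Option Sim) × Val) × Val, (script c).post z =
      (outcomeOf c z.1.1).elim (some (continued c z), none)
        fun v => (some (current c z.1.1), some v) := fun _ => rfl
    rw [hpost]
    rw [← hcur]
    change _ = (outcomeOf c x).elim _ _
    have hpre : (script c).pre₂ (x, (encodeArg c x).elim (.nat 0) E.eval) =
      (outcomeOf c x).elim (some (.pair x.1 (.pair (current c x).1
        (answerOf c (x, (encodeArg c x).elim (.nat 0) E.eval)).1))) fun _ => none := rfl
    cases hout : outcomeOf c x with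
    | some v => simp [x]
    | none =>
      rw [hout] at hpre
      simp only [x, Option.elim_none]
      have : continued c ((x, (encodeArg c x).elim (.nat 0) E.eval),
          ((script c).pre₂ (x, (encodeArg c x).elim (.nat 0) E.eval)).elim (.nat 0) A.eval) =
          resumed A (.pair (P.pub k) aux) (current c x)
            (answerWith E (P.pub k) w (current c x) (readSample (P.pub k) buf)) := by
        rw [hpre, continued, resumed, hansw]
        rfl
      rw [← this]
      rfl
  · have : (script c).total (.pair (P.pub k) aux) =
        bitCount (P.pub k) + expoCount (P.pub k) + 0 := rfl
    omega
  · change 0 < bitCount (P.pub k)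
    simp only [bitCount]
    omega

theorem ofVal_eq (a : Val) : MachineAction.ofVal a = if tagOf a = 0 then .halt a.snd
    else if tagOf a = 1 then .coin else if tagOf a = 2 then .draw
    else if tagOf a = 3 then .call a.snd else .halt (.nat 0) := by
  rcases a with t | ⟨t | ⟨t₁, t₂⟩, v⟩
  · rfl
  · match t with
    | 0 => rfl
    | 1 => rfl
    | 2 => rfl
    | 3 => rfl
    | t + 4 => rfl
  · rfl

theorem encodeWith_eq {E : Prog}
    (hE : ∀ p : P.Password, E.eval (.pair (P.pub k) (P.passwordVal p)) = P.elt (P.encode p))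
    (s : Sim) (st : LazyState P k) (hs : s.2.2.2.2 = storeOf st) (b : LazyAccount P k)
    (hb : b ∈ st.2) :
    ((encodeWith (P.pub k) P.n s).elim (.nat 0) E.eval).toNat = P.num (P.encode b.p) := by
  obtain ⟨tab, o⟩ := st
  obtain rfl : o = some b := hb
  have h : (List.range P.n).map (fun i => clip (b.toVault.p.getD i 0) P.m) = P.letters b.p := by
    rw [map_range_eq_ofFn, Params.letters]
    congr 1
    funext i
    have : b.toVault.p.getD i 0 = b.p i := P.letters_getD b.p i 0
    rw [this, clip_of_lt (b.p i).isLt]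
  rw [encodeWith, hs]
  simp only [storeOf, Option.map_some, Option.elim_some, pubM_pub, h, P.code_letters, hE]
  rfl

section Play

variable {c} {E A M : Prog} (hM : (script c).Computes E A M)
  (hE : ∀ p : P.Password, E.eval (.pair (P.pub k) (P.passwordVal p)) = P.elt (P.encode p))
  (aux : Val) (ans : Val → Val) (J : ℕ) (x y z : ZMod P.q)
include hM hE

/-- Induction on the activations that the adversary has left. A batch is needed to deliver each
answer, and one more to notice a halt or the exhaustion of the activations, hence `rem + 1` batches.
-/
theorem ev_play (T rem : ℕ) (sA act : Val) (n : ℕ) (hn : n + rem = limit c (P.pub k))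
    (st : LazyState P k) :
    ((BatchScript.rest P.q (script c) E A M ans (T + (rem + 1) * batchLength (P.pub k))
      (.pair (P.pub k) aux, challenge x y z, some (sA, act, n, J, storeOf st), [0])).ev
        fun z => z.1.accepts) =
      A.winAct (.pair (P.pub k) aux) P.q (onMessages (lazyGame J x y z)) rem sA st
        (MachineAction.ofVal act) := by
  induction rem generalizing sA act n st with
  | zero =>
    rw [Nat.zero_add, one_mul, ev_rest c hM, ofVal_eq]
    have hle : limit c (P.pub k) ≤ n := by omega
    simp only [currentWith, Option.getD_some, outcome, hle, if_true]
    split_ifs <;> first | omega | simp [Prog.winAct, Val.accepts]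
  | succ rem ih =>
    have hT : T + (rem + 1 + 1) * batchLength (P.pub k) =
        T + (rem + 1) * batchLength (P.pub k) + batchLength (P.pub k) := by ring
    have hle : ¬ limit c (P.pub k) ≤ n := by omega
    rw [hT, ev_rest c hM, ofVal_eq]
    simp only [currentWith, Option.getD_some, outcome, hle, if_false]
    have hgo : ∀ (a : Val) (st' : LazyState P k),
        ((BatchScript.rest P.q (script c) E A M ans (T + (rem + 1) * batchLength (P.pub k))
          (.pair (P.pub k) aux, challenge x y z, some (resumed A (.pair (P.pub k) aux)
            (sA, act, n, J, storeOf st) (a, storeOf st')), [0])).ev fun z => z.1.accepts) =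
        A.win (.pair (P.pub k) aux) P.q (onMessages (lazyGame J x y z)) (rem + 1) sA a st' := by
      intro a st'
      rw [resumed, ih _ _ (n + 1) (by omega) st', Prog.win_succ]
      rfl
    by_cases h0 : tagOf act = 0
    · simp [h0, Prog.winAct]
    by_cases h1 : tagOf act = 1
    · simp only [h1, answerWith, answer, if_true, one_ne_zero, if_false, Option.elim_none, hgo,
        Nat.not_ofNat_lt_one, Prog.winAct]
      rw [PMF.uniform_prod]
      simp only [Batch.sample, PMF.ev_const]
    by_cases h2 : tagOf act = 2
    · simp only [h2, answerWith, answer, if_true, OfNat.ofNat_ne_zero, OfNat.ofNat_ne_one, if_false,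
        Option.elim_none, hgo, Prog.winAct, show ¬ 3 < 2 by decide]
      rw [ev_uniform_batch]
      simp only [Batch.sample, PMF.ev_const]
    by_cases h3 : tagOf act = 3
    · have hans : ∀ r : Batch P k, answerWith E (P.pub k) (challenge x y z)
          (sA, act, n, J, storeOf st) r.sample = ((lazyStep J x y z r st (Req.parse act.snd)).1,
            storeOf (lazyStep J x y z r st (Req.parse act.snd)).2) := by
        intro r
        rw [answerWith, answer, if_neg h1, if_neg h2]
        exact step_eq J x y z r st _ (by simp) _
          (fun b hb => encodeWith_eq hE _ st rfl b hb) _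
      simp only [h3, hans, if_true, OfNat.ofNat_ne_zero, OfNat.ofNat_ne_one, if_false,
        Option.elim_none, hgo, Prog.winAct, show ¬ 3 < 3 by decide, show ¬ 3 = 2 by decide,
        onMessages, lazyGame, PMF.ev_map]
    · have h4 : 3 < tagOf act := by omega
      simp [h0, h1, h2, h3, h4, Prog.winAct]

end Play

end Reduction

/-! ### The size of the data of the reduction -/

theorem Val.size_entry_le (v : Val) (i : ℕ) : csize (v.entry i) ≤ v.size := by
  have h : ∀ j : ℕ, (Val.snd^[j] v).size ≤ v.size := by
    intro j
    induction j with
    | zero => exact le_rfl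
    | succ j ih =>
      rw [Function.iterate_succ_apply']
      exact (Val.size_snd_le _).trans ih
  have h1 := (Val.snd^[i] v).fst.size_toNat_lt
  have h2 := (Val.snd^[i] v).size_fst_le
  have h3 := h i
  rw [csize_nat, Val.entry]
  omega

theorem csize_le_of_le {a b : ℕ} (h : a ≤ b) : csize a ≤ csize b := by
  have := Nat.size_le_size h
  simp only [csize_nat]
  omega

theorem csize_getD_le (l : List ℕ) (i : ℕ) : csize (l.getD i 0) ≤ csize l := by
  by_cases h : i < l.length
  · rw [List.getD_eq_getElem _ _ h]
    exact csize_le_of_mem (List.getElem_mem h)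
  · rw [List.getD_eq_default _ _ (by omega)]
    exact one_le_csize l

namespace Reduction

/-- The bound on the size of a reply and on the growth of the data in one step. -/
def stepBound (L : ℕ) : ℕ := 40 * ((L + 1) * (L + 1))

theorem stepBound_mono {a b : ℕ} (h : a ≤ b) : stepBound a ≤ stepBound b :=
  Nat.mul_le_mul_left _ (Nat.mul_le_mul (by omega) (by omega))

theorem le_stepBound (L : ℕ) : 40 * L + 40 ≤ stepBound L := by
  have : 0 ≤ L * L := Nat.zero_le _
  unfold stepBound
  nlinarith

/-- A bound on the size of an account after `N` steps. -/
structure VaultBounded (L N : ℕ) (b : Vault) : Prop where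
  p : csize b.p ≤ stepBound L
  κ : csize b.κ ≤ L
  xs : csize b.xs ≤ L
  av : csize b.av ≤ L
  aw : csize b.aw ≤ L
  num : b.num ≤ N
  rows : csize b.rows ≤ N * stepBound L + 1

def StoreBounded (L N : ℕ) (st : Store) : Prop :=
  csize st.1 ≤ N * stepBound L + 1 ∧ ∀ b ∈ st.2, VaultBounded L N b

theorem StoreBounded.mono {L N L' N' : ℕ} {st : Store} (h : StoreBounded L N st) (hL : L ≤ L')
    (hN : N ≤ N') : StoreBounded L' N' st := by
  have hs := stepBound_mono hL
  have hm := Nat.mul_le_mul hN hs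
  refine ⟨by have := h.1; omega, fun b hb => ?_⟩
  obtain ⟨h1, h2, h3, h4, h5, h6, h7⟩ := h.2 b hb
  exact ⟨by omega, by omega, by omega, by omega, by omega, by omega, by omega⟩

/-- Everything that enters a step, except for the message of the adversary, is bounded. -/
structure InputBounded (L : ℕ) (v : Val) (r : Sample) (two : ℕ) (l : List ℕ) : Prop where
  pub : csize v ≤ L
  sample : csize r ≤ L
  two : csize two ≤ L
  list : csize l ≤ L

section Step

variable {L N : ℕ} {v : Val} {r : Sample} {two : ℕ} {l : List ℕ} (h : InputBounded L v r two l)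

/-- A reply and a store are bounded. -/
def ReplyBounded (L N : ℕ) (x : Val × Store) : Prop :=
  csize x.1 ≤ stepBound L ∧ StoreBounded L N x.2

theorem ReplyBounded.same {x : Val} {st : Store} (hx : csize x ≤ stepBound L)
    (hs : StoreBounded L N st) : ReplyBounded L (N + 1) (x, st) :=
  ⟨hx, hs.mono le_rfl (Nat.le_succ N)⟩

theorem csize_sample (r : Sample) : csize r = csize r.bit + (csize r.κ₁ + (csize r.κ₂ + (csize r.s +
    (csize r.u + (csize r.us + (csize r.vs + csize r.ws + 1) + 1) + 1) + 1) + 1) + 1) + 1 := rfl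

theorem addEntry_bounded {key : List ℕ} {d M : ℕ} {st : Store} (hs : StoreBounded L N st)
    (hk : csize key + L + 3 ≤ stepBound L) (hM : csize M ≤ L) :
    ReplyBounded L (N + 1) (addEntry key d M st) := by
  have h1 := csize_clip_le (tabGet st.1 key d) M
  have h2 := le_stepBound L
  have h3 := hs.1
  refine ⟨by change csize (clip _ _) ≤ _; omega, ?_, ?_⟩
  · change csize ((key, clip (tabGet st.1 key d) M) :: st.1) ≤ _
    rw [csize_cons, csize_prod, Nat.add_mul]
    omega
  · exact (hs.mono le_rfl (Nat.le_succ N)).2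

theorem addRowEntry_bounded {key : List ℕ} {d M : ℕ} {tab : Table} {b : Vault}
    (hs : StoreBounded L N (tab, some b)) (hk : csize key + L + 3 ≤ stepBound L)
    (hM : csize M ≤ L) : ReplyBounded L (N + 1) (addRowEntry key d M tab b) := by
  have h1 := csize_clip_le (tabGet b.rows key d) M
  have h2 := le_stepBound L
  have h' := hs.mono le_rfl (Nat.le_succ N)
  refine ⟨by change csize (clip _ _) ≤ _; omega, h'.1, ?_⟩
  rintro _ ⟨⟩
  obtain ⟨b1, b2, b3, b4, b5, b6, b7⟩ := h'.2 b rfl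
  refine ⟨b1, b2, b3, b4, b5, b6, ?_⟩
  have h3 := (hs.2 b rfl).rows
  rw [csize_cons, csize_prod, Nat.add_mul]
  omega

include h

theorem pub_entry_bounded (i : ℕ) : csize (v.entry i) ≤ L := (v.size_entry_le i).trans h.pub

/-- A query is recorded only after its position, key and letter have been checked against `n`, `2 ^
k` and `m`. The table therefore grows by a bounded amount, however long the message of the adversary
is. -/
theorem letterStep_bounded {st : Store} (hs : StoreBounded L N st) {a : Val}
    (ha : validKey v two a ≠ 0) : ReplyBounded L (N + 1) (letterStep v r st a) := by
  have hN := pub_entry_bounded h 3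
  have hM := pub_entry_bounded h 5
  have hQ : csize (pubQ v) ≤ L := pub_entry_bounded h 1
  have hB := le_stepBound L
  have h2 := h.two
  unfold validKey pubN pubM at ha
  split_ifs at ha with h₀ h₁ h₂ <;> try exact absurd rfl ha
  have k₀ := csize_le_of_le h₀.le
  have k₁ := csize_le_of_le h₁.le
  have k₂ := csize_le_of_le h₂.le
  have hsize0 : csize 0 = 1 := by simp
  have hk : csize [0, a.entry 0, a.entry 1, a.entry 2] + L + 3 ≤ stepBound L := by
    simp only [csize_cons, csize_nil, hsize0]
    omega
  have hk' : csize [0, a.entry 0, a.entry 2] + L + 3 ≤ stepBound L := by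
    simp only [csize_cons, csize_nil, hsize0]
    omega
  obtain ⟨tab, _ | b⟩ := st
  · exact addEntry_bounded hs hk hQ
  · simp only [letterStep, Option.elim_some]
    split_ifs
    · refine ReplyBounded.same ?_ hs
      have h4 := csize_getD_le b.xs (a.entry 0)
      have h5 := (hs.2 b rfl).xs
      change csize (b.xs.getD (a.entry 0) 0) ≤ _
      omega
    · exact addRowEntry_bounded hs hk' hQ
    · exact addEntry_bounded hs hk hQ

theorem groupMessage_bounded {κ pk a b : ℕ} {cs : List ℕ} (hκ : csize κ ≤ L)
    (hpk : csize pk ≤ L + 4) (ha : csize a ≤ L + 4) (hb : csize b ≤ L + 4) (hl : cs.length = l.length)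
    (hc : ∀ c ∈ cs, csize c ≤ L + 4) : csize (groupMessage v κ pk a b cs) ≤ stepBound L := by
  have hQ : csize (pubQ v) ≤ L := pub_entry_bounded h 1
  have hG : csize (pubG v) ≤ L := pub_entry_bounded h 2
  have h1 := csize_le_of_forall hc
  have h2 := length_lt_csize l
  have h3 := h.list
  have h4 : cs.length * (L + 4 + 1) ≤ L * (L + 4 + 1) := Nat.mul_le_mul_right _ (by omega)
  have h5 : csize (groupMessage v κ pk a b cs) = csize κ + ((csize (pubQ v) + (csize (pubG v) +
    (csize pk + 1 + 1) + 1) + 1) + ((csize a + (csize b + 1 + 1) + 1) + (csize cs + 1 + 1) + 1) + 1) +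
    1 := rfl
  rw [h5, stepBound]
  nlinarith

theorem csize_modulus_le : csize (2 * pubQ v + 1) ≤ L + 4 := by
  have h1 := Nat.size_two_mul_add_le 1 (pubQ v)
  have hQ : csize (pubQ v) ≤ L := pub_entry_bounded h 1
  rw [Nat.add_comm] at h1
  simp only [csize_nat, Nat.size_one] at *
  omega

theorem powers_bounded (B₁ B₂ e₁ e₂ : ℕ) : csize (powers v B₁ B₂ e₁ e₂) ≤ L + 4 :=
  (csize_clip_le _ _).trans (csize_modulus_le h)

theorem powG_bounded (e : ℕ) : csize (powG v e) ≤ L + 4 :=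
  (csize_clip_le _ _).trans (csize_modulus_le h)

theorem replyWith_bounded {w : Val} {e : ℕ} {b : Vault} (hb : csize b.κ ≤ L) {y dv dw : List ℕ}
    {B₁ B₂ : ℕ} (hB : csize B₂ ≤ L + 4) : csize (replyWith v w e b y dv dw l B₁ B₂) ≤ stepBound L := by
  refine groupMessage_bounded h hb (powers_bounded h _ _ _ _) hB
    ((csize_clip_le _ _).trans (csize_modulus_le h)) (by simp) fun c hc => ?_
  obtain ⟨i, -, rfl⟩ := List.mem_map.1 hc
  exact powers_bounded h _ _ _ _

theorem recoverReply_bounded {w : Val} {J e : ℕ} {b : Vault} (hb : csize b.κ ≤ L) {y dv dw : List ℕ}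
    (hw : csize (w.entry 0) ≤ L + 4) :
    csize (recoverReply v w J r e b y dv dw l) ≤ stepBound L := by
  unfold recoverReply honestWith
  split_ifs
  · exact replyWith_bounded h hb (powG_bounded h _)
  · exact replyWith_bounded h hb hw
  · refine groupMessage_bounded h hb (powers_bounded h _ _ _ _) (powG_bounded h _) (powG_bounded h _)
      (by simp) fun c hc => ?_
    obtain ⟨i, -, rfl⟩ := List.mem_map.1 hc
    exact powG_bounded h _
  · exact replyWith_bounded h hb (powG_bounded h _)

end Step

end Reduction

namespace Reduction

section Step

variable {L N : ℕ} {v : Val} {r : Sample} {two : ℕ} {l : List ℕ} (h : InputBounded L v r two l)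
include h

theorem rowList_bounded (tag : ℕ) (rows : Table) (y us : List ℕ) :
    ∀ d ∈ rowList tag rows y us (pubQ v) l, csize d ≤ L := by
  intro d hd
  obtain ⟨i, -, rfl⟩ := List.mem_map.1 hd
  exact (csize_clip_le _ _).trans (pub_entry_bounded h 1)

theorem rowTable_bounded {tag : ℕ} (htag : tag ≤ 2) {y ds : List ℕ} (hy : ∀ c ∈ y, csize c ≤ L)
    (hd : ∀ d ∈ ds, csize d ≤ L) : csize (rowTable tag y ds l) ≤ L * (4 * L + 15) + 1 := by
  have hget : ∀ (t : List ℕ) (i : ℕ), (∀ c ∈ t, csize c ≤ L) → csize (t.getD i 0) ≤ L + 1 := by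
    intro t i ht
    by_cases hi : i < t.length
    · rw [List.getD_eq_getElem _ _ hi]
      exact (ht _ (List.getElem_mem hi)).trans (Nat.le_succ L)
    · rw [List.getD_eq_default _ _ (by omega)]
      simp
  have h1 : csize (rowTable tag y ds l) ≤ (rowTable tag y ds l).length * (4 * L + 14 + 1) + 1 := by
    refine csize_le_of_forall fun e he => ?_
    obtain ⟨i, hi, rfl⟩ := List.mem_map.1 he
    have h2 := List.mem_range.1 hi
    have h3 := hget y i hy
    have h4 := hget ds i hd
    have h5 : csize i ≤ L := by
      have h6 := Nat.size_le_self' i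
      have h7 := length_lt_csize l
      have h8 := h.list
      rw [csize_nat]
      omega
    have h6 : csize tag ≤ 3 := csize_le_of_le htag
    simp only [csize_prod, csize_cons, csize_nil]
    omega
  refine h1.trans ?_
  have h2 := length_lt_csize l
  have h3 := h.list
  have h4 : (rowTable tag y ds l).length ≤ L := by
    simp only [rowTable, List.length_map, List.length_range]
    omega
  exact Nat.add_le_add_right (Nat.mul_le_mul_right (4 * L + 14 + 1) h4) 1

theorem recoverStep_bounded {w : Val} {J e : ℕ} (hw : csize w ≤ L) {st : Store}
    (hs : StoreBounded L N st) {y : List ℕ} (hy : ∀ c ∈ y, csize c ≤ L) :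
    ReplyBounded L (N + 1) (recoverStep v w J r e l st y) := by
  have hB := le_stepBound L
  obtain ⟨tab, _ | b⟩ := st
  · exact ReplyBounded.same (by change 1 ≤ _; omega) hs
  · have hs' := hs.mono le_rfl (Nat.le_succ N)
    have hb := hs'.2 b rfl
    have hw' : csize (w.entry 0) ≤ L + 4 := (w.size_entry_le 0).trans (hw.trans (by omega))
    refine ⟨recoverReply_bounded h hb.κ hw', hs'.1, ?_⟩
    rintro _ ⟨⟩
    obtain ⟨b1, b2, b3, b4, b5, b6, b7⟩ := hb
    refine ⟨b1, b2, b3, b4, b5, Nat.succ_le_succ (hs.2 b rfl).num, ?_⟩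
    have h1 := rowTable_bounded h (by decide : 1 ≤ 2) hy (rowList_bounded h 1 b.rows y r.vs)
    have h2 := rowTable_bounded h le_rfl hy (rowList_bounded h 2 b.rows y r.ws)
    have h3 := csize_append (rowTable 1 y (rowList 1 b.rows y r.vs (pubQ v) l) l)
      (rowTable 2 y (rowList 2 b.rows y r.ws (pubQ v) l) l ++ b.rows)
    have h4 := csize_append (rowTable 2 y (rowList 2 b.rows y r.ws (pubQ v) l) l) b.rows
    have h5 := (hs.2 b rfl).rows
    have h6 : L * (4 * L + 15) + (L * (4 * L + 15)) ≤ stepBound L := by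
      unfold stepBound
      nlinarith
    rw [Nat.add_mul]
    change csize (_ ++ (_ ++ b.rows)) ≤ _
    omega

theorem passwordStep_bounded {w : Val} {J e : ℕ} (hw : csize w ≤ L) {st : Store}
    (hs : StoreBounded L N st) (tag : ℕ) {y : List ℕ} (hy : ∀ c ∈ y, csize c ≤ L)
    (hl : y.length = l.length) :
    ReplyBounded L (N + 1) (passwordStep v w J r two e l st tag y) := by
  have hB := le_stepBound L
  have h0 : csize (Val.nat 0) ≤ stepBound L := by
    change 1 ≤ _
    omega
  have h1 : csize (Val.nat 1) ≤ stepBound L := by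
    change 2 ≤ _
    omega
  have hlen : y.length ≤ L := by
    have h2 := length_lt_csize l
    have h3 := h.list
    omega
  have hy' : csize y ≤ L * (L + 1) + 1 :=
    (csize_le_of_forall hy).trans (Nat.add_le_add_right (Nat.mul_le_mul_right _ hlen) 1)
  have hK : L * (L + 1) + 1 + 10 + L ≤ stepBound L := by
    unfold stepBound
    nlinarith
  have hr := h.sample
  rw [csize_sample] at hr
  unfold passwordStep
  split_ifs
  · refine addEntry_bounded hs ?_ h.two
    have h2 : csize 2 = 3 := rfl
    rw [csize_cons, h2]
    omega
  · obtain ⟨tab, _ | b⟩ := st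
    · have hs' := hs.mono le_rfl (Nat.le_succ N)
      refine ⟨h0, hs'.1, ?_⟩
      rintro _ ⟨⟩
      have h2 := csize_take_le r.vs (pubT v)
      have h3 := csize_take_le r.ws (pubT v)
      exact ⟨by change csize y ≤ _; omega, by change csize r.κ₁ ≤ _; omega,
        by change csize r.us ≤ _; omega, by change csize (r.vs.take _) ≤ _; omega,
        by change csize (r.ws.take _) ≤ _; omega, Nat.zero_le _, by
          change 1 ≤ _
          omega⟩
    · exact ReplyBounded.same h0 hs
  · exact recoverStep_bounded h hw hs hy
  · obtain ⟨tab, _ | b⟩ := st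
    · exact ReplyBounded.same h0 hs
    · simp only [loginStep, Option.elim_some]
      split_ifs
      · exact ReplyBounded.same h1 hs
      · exact ReplyBounded.same h0 hs
  · exact ReplyBounded.same h0 hs

/-- The bound does not involve the message `a`: keys are checked, and a password is accepted only if
its entries equal their reductions below `m`. Otherwise the adversary and its simulated oracle could
make each other's data grow by a factor in every round. -/
theorem step_bounded {w : Val} {J e : ℕ} (hw : csize w ≤ L) {st : Store}
    (hs : StoreBounded L N st) (a : Val) :
    ReplyBounded L (N + 1) (step v w J r two e l st a) := by
  have hB := le_stepBound L
  have h0 : csize (Val.nat 0) ≤ stepBound L := by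
    change 1 ≤ _
    omega
  unfold step
  by_cases ht : tagOf a < 2
  · rw [if_pos ht]
    by_cases hv : validKey v two a.snd = 0
    · rw [if_pos hv]
      exact ReplyBounded.same h0 hs
    · rw [if_neg hv]
      split_ifs
      · exact letterStep_bounded h hs hv
      · refine addEntry_bounded hs ?_ (pub_entry_bounded h 1)
        have hN := pub_entry_bounded h 3
        have hM := pub_entry_bounded h 5
        have h2 := h.two
        unfold validKey pubN pubM at hv
        split_ifs at hv with h₀ h₁ h₂ <;> try exact absurd rfl hv
        have k₀ := csize_le_of_le h₀.le
        have k₁ := csize_le_of_le h₁.le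
        have k₂ := csize_le_of_le h₂.le
        have hsize1 : csize 1 = 2 := rfl
        simp only [csize_cons, csize_nil, hsize1]
        omega
  · rw [if_neg ht]
    split_ifs with hv
    · refine passwordStep_bounded h hw hs _ (fun c hc => ?_) (Val.length_entries _ _)
      rw [← hv] at hc
      obtain ⟨c', -, rfl⟩ := List.mem_map.1 hc
      exact (csize_clip_le _ _).trans (pub_entry_bounded h 5)
    · exact ReplyBounded.same h0 hs

theorem answer_bounded {w : Val} {e : ℕ} (hw : csize w ≤ L) {s : Sim}
    (hs : StoreBounded L N s.2.2.2.2) : ReplyBounded L (N + 1) (answer v w r two e l s) := by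
  have hB := le_stepBound L
  have hr := h.sample
  rw [csize_sample] at hr
  unfold answer
  split_ifs
  · exact ReplyBounded.same (by change csize r.bit ≤ _; omega) hs
  · exact ReplyBounded.same (by change csize r.s ≤ _; omega) hs
  · exact step_bounded h hw hs _

end Step

/-- A bound on the size of the adversary inside the reduction after `N` steps, when the activations
of the adversary `A` have cost at most `polyBound d`. -/
structure SimBounded (A : Prog) (inp : Val) (d k L N : ℕ) (s : Sim) : Prop where
  memory : ∃ as, s.1 = A.memory inp as ∧ (as.map Val.size).sum ≤ N * stepBound L
  action : s.2.1.size ≤ polyBound d (k + N * stepBound L) + 5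
  count : s.2.2.1 ≤ N
  index : csize s.2.2.2.1 ≤ L
  store : StoreBounded L N s.2.2.2.2

theorem SimBounded.mono {A : Prog} {inp : Val} {d k L N L' N' : ℕ} {s : Sim}
    (h : SimBounded A inp d k L N s) (hL : L ≤ L') (hN : N ≤ N') :
    SimBounded A inp d k L' N' s := by
  have hm := Nat.mul_le_mul hN (stepBound_mono hL)
  obtain ⟨⟨as, h1, h2⟩, h3, h4, h5, h6⟩ := h
  have hp := polyBound_mono d (show k + N * stepBound L ≤ k + N' * stepBound L' by omega)
  exact ⟨⟨as, h1, h2.trans hm⟩, by omega, by omega, by omega, h6.mono hL hN⟩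

/-- The cost of an activation of the adversary after `N` steps. -/
def simCost (d k L N : ℕ) : ℕ := polyBound d (k + (N + 1) * stepBound L)

section Sim

variable {A : Prog} {inp : Val} {d k : ℕ} (hA : ∀ as a,
    A.cost (.pair inp (.pair (A.memory inp as) a)) ≤ polyBound d (k + (as.map Val.size).sum + a.size))
include hA

/-- The adversary is known to be fast only on memories produced by messages of known total size.
This is why the invariant records such a list of messages. -/
theorem SimBounded.cost_le {L N : ℕ} {s : Sim} (hs : SimBounded A inp d k L N s) {a : Val}
    (ha : a.size ≤ stepBound L) : A.cost (.pair inp (.pair s.1 a)) ≤ simCost d k L N := by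
  obtain ⟨as, h1, h2⟩ := hs.memory
  rw [h1]
  refine (hA as a).trans (polyBound_mono d ?_)
  rw [Nat.add_mul]
  omega

theorem SimBounded.resumed {L N J : ℕ} {s : Sim} (hs : SimBounded A inp d k L N s)
    {a : Val × Store} (ha : ReplyBounded L (N + 1) a) (hJ : csize J ≤ L) :
    SimBounded A inp d k L (N + 1)
      ((A.eval (.pair inp (.pair s.1 a.1))).fst, (A.eval (.pair inp (.pair s.1 a.1))).snd,
        s.2.2.1 + 1, J, a.2) := by
  have hcost := hs.cost_le hA ha.1
  obtain ⟨as, h1, h2⟩ := hs.memory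
  refine ⟨⟨as ++ [a.1], ?_, ?_⟩, ?_, Nat.succ_le_succ hs.count, hJ, ha.2⟩
  · rw [Prog.memory, List.foldl_append, h1]
    rfl
  · have h3 : a.1.size ≤ stepBound L := ha.1
    rw [Nat.add_mul]
    simp only [List.map_append, List.sum_append, List.map_cons, List.map_nil, List.sum_cons,
      List.sum_nil]
    omega
  · have h3 := A.size_eval_le_cost (.pair inp (.pair s.1 a.1))
    have h4 := (A.eval (.pair inp (.pair s.1 a.1))).size_snd_le
    exact (h4.trans (h3.trans hcost)).trans (Nat.le_add_right _ 5)

theorem SimBounded.csize_le {L N : ℕ} {s : Sim} (hs : SimBounded A inp d k L N s) :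
    csize s ≤ 2 * simCost d k L N + 20 * ((N + 1) * (stepBound L + 1)) + 20 := by
  have h1 : A.cost (.pair inp (.pair s.1 (.nat 0))) ≤ simCost d k L N :=
    hs.cost_le hA (by have := le_stepBound L; change 1 ≤ _; omega)
  have h2 := A.size_le_cost (.pair inp (.pair s.1 (.nat 0)))
  simp only [Val.size] at h2
  have h3 := hs.action
  have h4 : polyBound d (k + N * stepBound L) ≤ simCost d k L N :=
    polyBound_mono d (by rw [Nat.add_mul]; omega)
  have h5 := hs.count
  have h6 := Nat.size_le_self' s.2.2.1
  have h7 := hs.index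
  have h8 := hs.store.1
  have hL := le_stepBound L
  have hvault : csize s.2.2.2.2.2 ≤ N * stepBound L + stepBound L + 5 * L + N + 20 := by
    rcases hb : s.2.2.2.2.2 with _ | b
    · rw [csize_none]
      omega
    · obtain ⟨b1, b2, b3, b4, b5, b6, b7⟩ := hs.store.2 b hb
      have hb6 := Nat.size_le_self' b.num
      have : csize (some b) = csize b.p + (csize b.κ + (csize b.xs + (csize b.av + (csize b.aw +
          (csize b.num + csize b.rows + 1) + 1) + 1) + 1) + 1) + 1 + 2 := csize_some b
      rw [this]
      simp only [csize_nat] at *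
      omega
  have h9 : csize s = s.1.size + (s.2.1.size + (csize s.2.2.1 + (csize s.2.2.2.1 +
    (csize s.2.2.2.2.1 + csize s.2.2.2.2.2 + 1) + 1) + 1) + 1) + 1 := rfl
  have h10 : (N + 1) * (stepBound L + 1) = N * stepBound L + N + stepBound L + 1 := by ring
  rw [h9, h10]
  simp only [csize_nat] at *
  omega

end Sim

end Reduction

/-! ### Polynomial running time of the reduction. -/

namespace Reduction

/-- The total size `N` of the messages received by the reduction increases with each of its
activations, so it also bounds the number of activations of the simulated adversary. Each of these
adds a reply of size at most `stepBound L` to the messages of the adversary, so their total size,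
and hence its running time, remains polynomial. -/
theorem exists_efficient {P : ℕ → Params} {aux : ℕ → Val} {E A : Prog} {e : ℕ} (c : ℕ)
    (hE : ∀ (k : ℕ) (p : (P k).Password),
      E.cost (.pair ((P k).pub k) ((P k).passwordVal p)) ≤ polyBound e k)
    (hA : A.Efficient (advInput P aux)) :
    ∃ M : Prog, (script c).Computes E A M ∧ M.Efficient (advInput P aux) := by
  obtain ⟨d, hd⟩ := hA
  have hdata : PolyTime fun z : Val × List ℕ => (readSample z.1 z.2,
      ofDigits ((z.2.take (pubK z.1)).map fun _ => 1) + 1, z.2.take (pubN z.1),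
      hybridIndex c z.1 (readSample z.1 z.2).s) := by
    unfold hybridIndex
    fun_prop
  obtain ⟨F, hF, hFm, hFb⟩ := hdata.csize_bound
  have hpub := size_pub_le hE
  -- A common bound for the public description, the sample, `2 ^ k`, the list of positions, the
  -- number of the hybrid and the first message. The argument of `F` bounds the public description
  -- paired with the buffer.
  let L : ℕ → ℕ := fun n => F (polyBound e n + 2 * n + 4) + polyBound e n + n + 1
  have hL : PolyBounded L :=
    (((hF.comp (((PolyBounded.id.polyBound e).add ((PolyBounded.const 2).mul PolyBounded.id)).add
      (PolyBounded.const 4))).add (PolyBounded.id.polyBound e)).add PolyBounded.id).add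
        (PolyBounded.const 1)
  have hLm : Monotone L := fun a b h => by
    have h1 := polyBound_mono e h
    have h2 := hFm (show polyBound e a + 2 * a + 4 ≤ polyBound e b + 2 * b + 4 by omega)
    simp only [L]
    omega
  have hs : PolyBounded fun n => stepBound (L n) :=
    (PolyBounded.const 40).mul ((hL.add (PolyBounded.const 1)).mul (hL.add (PolyBounded.const 1)))
  have hN : PolyBounded fun n => n + 1 := PolyBounded.id.add (PolyBounded.const 1)
  let C : ℕ → ℕ := fun n => simCost d n (L n) n
  have hC : PolyBounded C := (PolyBounded.id.add (hN.mul hs)).polyBound d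
  let G : ℕ → ℕ := fun n => 2 * C n + 20 * ((n + 1) * (stepBound (L n) + 1)) + 25 +
    polyBound e n
  have hG : PolyBounded G :=
    ((((PolyBounded.const 2).mul hC).add ((PolyBounded.const 20).mul
      (hN.mul (hs.add (PolyBounded.const 1))))).add (PolyBounded.const 25)).add
        (PolyBounded.id.polyBound e)
  have hcost : ∀ {k N n}, k + N ≤ n → simCost d k (L (k + N)) N ≤ C n := by
    intro k N n h
    refine polyBound_mono d ?_
    have h1 := Nat.mul_le_mul (show N + 1 ≤ n + 1 by omega) (stepBound_mono (hLm h))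
    omega
  have hGm : Monotone G := fun a b h => by
    have h1 := polyBound_mono e h
    have h2 : C a ≤ C b := by
      refine polyBound_mono d ?_
      have h1 := Nat.mul_le_mul (show a + 1 ≤ b + 1 by omega) (stepBound_mono (hLm h))
      omega
    have h3 := Nat.mul_le_mul (show a + 1 ≤ b + 1 by omega)
      (Nat.add_le_add_right (stepBound_mono (hLm h)) 1)
    simp only [G]
    omega
  have hadv : ∀ k, (advInput P aux k).size ≤ G k := by
    intro k
    have h1 := A.size_le_cost (.pair (advInput P aux k) (.pair (A.memory (advInput P aux k) [])
      (.nat 0)))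
    have h2 := hd k [] (.nat 0)
    have h3 : polyBound d (k + 1) ≤ C k := by
      refine polyBound_mono d (Nat.add_le_add_left ?_ k)
      have := le_stepBound (L k)
      nlinarith
    have h4 : (k + (([] : List Val).map Val.size).sum + (Val.nat 0).size) ^ d + d =
        polyBound d (k + 1) := rfl
    simp only [Val.size] at h1
    simp only [G]
    omega
  refine BatchScript.exists_efficient (script_feasible c) hG hGm (fun k N S => ∀ s ∈ S,
    SimBounded A (advInput P aux k) d k (L (k + N)) N s) hadv
    (fun k s hs => by cases hs) (fun k N N' S h hS s hs => (hS s hs).mono (hLm (by omega)) h)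
    (fun k N S hS => ?_) fun k N N' w S buf hS hN hbuf hw hlen => ?_
  · rcases S with _ | s
    · simp only [csize_none, G]
      omega
    · have h1 := (hS s rfl).csize_le (hd k)
      have h2 := hcost (le_refl (k + N))
      have h3 := Nat.mul_le_mul_right (stepBound (L (k + N)) + 1)
        (show N + 1 ≤ (k + N) + 1 by omega)
      rw [csize_some]
      simp only [G]
      omega
  · have hdat := (hFb ((P k).pub k, buf)).trans (hFm (show csize ((P k).pub k, buf) ≤
        polyBound e (k + N') + 2 * (k + N') + 4 by
      have h1 := hpub k
      have h2 := polyBound_mono e (show k ≤ k + N' by omega)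
      have h3 : csize ((P k).pub k) = ((P k).pub k).size := rfl
      rw [csize_prod]
      omega))
    have hLe : F (polyBound e (k + N') + 2 * (k + N') + 4) + polyBound e (k + N') + (k + N') + 1 =
      L (k + N') := rfl
    simp only [csize_prod] at hdat
    set x : BatchCtx (Option Sim) := (advInput P aux k, w, S, buf) with hx
    have hin : InputBounded (L (k + N')) ((P k).pub k) (readSample ((P k).pub k) buf) (keyBound x)
        (positions x) := by
      have hk : keyBound x = ofDigits ((buf.take (pubK ((P k).pub k))).map fun _ => 1) + 1 := rfl
      have hp : positions x = buf.take (pubN ((P k).pub k)) := rfl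
      refine ⟨?_, by omega, by rw [hk]; omega, by rw [hp]; omega⟩
      have h1 := hpub k
      have h2 := polyBound_mono e (show k ≤ k + N' by omega)
      change ((P k).pub k).size ≤ _
      omega
    have hcur : SimBounded A (advInput P aux k) d k (L (k + N')) N (current c x) := by
      rcases S with _ | s
      · refine ⟨⟨[], rfl, Nat.zero_le _⟩, ?_, Nat.zero_le _, ?_, ?_, ?_⟩
        · exact Nat.le_add_left 5 _
        · change csize (hybridIndex c ((P k).pub k) (readSample ((P k).pub k) buf).s) ≤ _
          omega
        · exact Nat.le_add_left 1 _
        · rintro b ⟨⟩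
      · exact (hS s rfl).mono (hLm (by omega)) le_rfl
    have hw' : csize w ≤ L (k + N') := by omega
    refine ⟨?_, fun e' he => ?_⟩
    · change (encodeArg c x).elim 0 E.cost ≤ _
      have hpos : (positions x).length = (P k).n := by
        have h1 : (positions x).length = min (P k).n buf.length := List.length_take
        have h2 : (script c).total (advInput P aux k) =
          1 + (k + k) + (1 + (1 + ((P k).n + ((P k).n + (P k).n)))) + 0 := rfl
        omega
      rw [encodeArg]
      rcases (current c x).2.2.2.2.2 with _ | b
      · exact Nat.zero_le _
      · obtain ⟨p, hp⟩ := exists_passwordVal (P k)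
          ((List.range (positions x).length).map fun i => b.p.getD i 0) (by simp [hpos])
        rw [List.map_map] at hp
        simp only [Option.elim_some]
        change E.cost (.pair ((P k).pub k) (code ((List.range (positions x).length).map
          ((fun a => clip a (P k).m) ∘ fun i => b.p.getD i 0)))) ≤ _
        rw [hp]
        refine (hE k p).trans ((polyBound_mono e (show k ≤ k + N' by omega)).trans ?_)
        simp only [G]
        omega
    · have hpre : (script c).pre₂ (x, e') = (outcomeOf c x).elim (some (.pair x.1
        (.pair (current c x).1 (answerOf c (x, e')).1))) fun _ => none := rfl
      have hpost : ∀ z : (BatchCtx (Option Sim) × Val) × Val, (script c).post z =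
        (outcomeOf c z.1.1).elim (some (continued c z), none)
          fun v => (some (current c z.1.1), some v) := fun _ => rfl
      have hans : ReplyBounded (L (k + N')) (N + 1) (answerOf c (x, e')) :=
        answer_bounded hin hw' hcur.store
      rw [hpre, hpost]
      cases outcomeOf c x with
      | some v =>
        refine ⟨Nat.zero_le _, ?_⟩
        rintro _ ⟨⟩
        exact hcur.mono le_rfl hN.le
      | none =>
        refine ⟨?_, ?_⟩
        · refine (hcur.cost_le (hd k) hans.1).trans ?_
          have h1 : simCost d k (L (k + N')) N ≤ C (k + N') := by
            refine polyBound_mono d ?_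
            have h1 := Nat.mul_le_mul_right (stepBound (L (k + N')))
              (show N + 1 ≤ k + N' + 1 by omega)
            omega
          simp only [G]
          omega
        · rintro _ ⟨⟩
          exact (hcur.resumed (hd k) hans hcur.index).mono le_rfl hN

end Reduction

theorem polyBound_pos (c k : ℕ) : 0 < polyBound c k := by
  unfold polyBound
  rcases c with _ | c
  · simp
  · omega

/-! ### The output of the reduction in terms of hybrids. -/

namespace Reduction

variable {P : Params} {k c : ℕ} {E A M : Prog}

/-- The machine plays the game with a random number of the hybrid. -/
theorem ev_run (hM : (script c).Computes E A M)
    (hE : ∀ p : P.Password, E.eval (.pair (P.pub k) (P.passwordVal p)) = P.elt (P.encode p))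
    (aux : Val) (ans : Val → Val) (x y z : ZMod P.q) {T : ℕ}
    (hT : (polyBound c k + 1) * batchLength (P.pub k) + 1 ≤ T) :
    ((M.run (.pair (P.pub k) aux) P.q (BatchScript.answering ans) T (.nat 0)
      (challenge x y z) ()).ev fun r => r.1.accepts) =
      (PMF.uniformOfFintype (ZMod P.q)).ev fun s => gameWin P k A (.pair (P.pub k) aux)
        (lazyGame (hybridIndex c (P.pub k) s.val) x y z) (polyBound c k) ([], none) := by
  obtain ⟨T', rfl⟩ := Nat.exists_eq_add_of_le hT
  obtain ⟨m, hm⟩ : ∃ m, polyBound c k = m + 1 := ⟨_, (Nat.succ_pred (polyBound_pos c k).ne').symm⟩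
  have hlim : limit c (P.pub k) = m + 1 := hm
  have hfuel : (polyBound c k + 1) * batchLength (P.pub k) + 1 + T' =
      T' + (m + 1) * batchLength (P.pub k) + batchLength (P.pub k) + 1 := by
    rw [hm]
    ring
  -- The first batch only delivers the initial message. Nothing of its sample is used except for the
  -- exponent that selects the hybrid, so that exponent is independent of the game.
  have hfirst : ∀ b : Batch P k, answerWith E (P.pub k) (challenge x y z)
      (currentWith c (P.pub k) none b.sample) b.sample = (.nat 0, storeOf (P := P) (k := k) ([], none)) := by
    intro b
    have h := step_eq (hybridIndex c (P.pub k) b.sample.s) x y z b ([], none)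
      (List.replicate P.n 0) (by simp) (((encodeWith (P.pub k) P.n
        (currentWith c (P.pub k) none b.sample)).elim (.nat 0) E.eval).toNat)
        (fun b hb => by cases hb) (.nat 0)
    rw [answerWith, answer, if_neg (by simp [currentWith, tagOf, Val.isPair, Val.fst, Val.toNat]),
      if_neg (by simp [currentWith, tagOf, Val.isPair, Val.fst, Val.toNat])]
    refine h.trans ?_
    have hp : (Req.parse (.nat 0) : Req P k) = .other := rfl
    rw [hp, lazyStep_other]
  have hout : ∀ b : Batch P k,
      outcome (currentWith c (P.pub k) none b.sample) (limit c (P.pub k)) = none := by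
    intro b
    simp [outcome, currentWith, tagOf, Val.isPair, Val.fst, Val.toNat, hlim]
  rw [hfuel, BatchScript.run_idle P.q hM ans _ _ _ (none : Option Sim) _ (Or.inr ⟨rfl, rfl⟩),
    ev_rest c hM]
  simp only [hout, hfirst, Option.elim_none, resumed]
  have hplay := fun J => ev_play hM hE aux ans J x y z T' m
    (A.eval (.pair (.pair (P.pub k) aux) (.pair (.nat 0) (.nat 0)))).fst
    (A.eval (.pair (.pair (P.pub k) aux) (.pair (.nat 0) (.nat 0)))).snd 1 (by omega) ([], none)
  simp only [currentWith, Option.getD_none, Nat.zero_add, hplay]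
  rw [ev_uniform_batch]
  simp only [Batch.sample, PMF.ev_const]
  refine PMF.ev_congr fun s => ?_
  rw [hm, gameWin, Prog.win_succ]
  rfl

/-- The probability that the machine outputs `1`. -/
theorem ddhProb_eq (hM : (script c).Computes E A M)
    (hE : ∀ p : P.Password, E.eval (.pair (P.pub k) (P.passwordVal p)) = P.elt (P.encode p))
    (aux : Val) {T : ℕ} (hT : (polyBound c k + 1) * batchLength (P.pub k) + 1 ≤ T)
    (D : PMF (ZMod P.q × ZMod P.q × ZMod P.q)) :
    ddhProb P (.pair (P.pub k) aux) M T D = (D.ev fun d =>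
      (PMF.uniformOfFintype (ZMod P.q)).ev fun s => gameWin P k A (.pair (P.pub k) aux)
        (lazyGame (hybridIndex c (P.pub k) s.val) d.1 d.2.1 d.2.2) (polyBound c k)
          ([], none)).toReal := by
  rw [ddhProb, Prog.probOne_eq, PMF.ev_bind]
  congr 1
  refine PMF.ev_congr fun d => ?_
  exact ev_run hM hE aux (fun _ => .nat 0) d.1 d.2.1 d.2.2 hT

section Hybrids

variable (A) (inp : Val) (T J : ℕ)

/-- The game in which the first `J` recoveries without a match are answered at random. -/
noncomputable def hybrid (P : Params) (k : ℕ) (A : Prog) (inp : Val) (T J : ℕ) : ℝ≥0∞ :=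
  (PMF.uniformOfFintype (HashFunctions P k)).ev fun ρ =>
    gameWin P k A inp (idealGame (idealReply (below J))) T (ρ, none)

theorem ev_mask (F : ZMod P.q → Coeffs P × LetterTable P → ℝ≥0∞) :
    ((PMF.uniformOfFintype (ZMod P.q)).ev fun x =>
      (PMF.uniformOfFintype (Coeffs P × LetterTable P)).ev fun m => F x m) =
      (PMF.uniformOfFintype (Mask P)).ev fun θ => F θ.1 θ.2 :=
  (PMF.uniform_prod (α := ZMod P.q) fun θ => F θ.1 θ.2).symm

/-- With fresh masks, an instance only matters through the difference of its third exponent from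
the product of the others. -/
theorem ev_lazyGame (δ : ZMod P.q) :
    ((PMF.uniformOfFintype (ZMod P.q)).ev fun x => (PMF.uniformOfFintype (HashFunctions P k)).ev
      fun ρ => (PMF.uniformOfFintype (Coeffs P × LetterTable P)).ev fun m =>
        gameWin P k A inp (idealGame (fixedMaskReply J δ (x, m))) T (ρ, none)) =
      (PMF.uniformOfFintype (HashFunctions P k)).ev fun ρ =>
        gameWin P k A inp (idealGame (freshMaskReply J δ)) T (ρ, none) := by
  rw [PMF.ev_comm]
  refine PMF.ev_congr fun ρ => ?_
  rw [ev_mask, ← fixedMask_eq_fresh]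

/-- For a Diffie-Hellman triple the factor of the mask is `0`, so the reply number `J` is honest. -/
theorem ev_lazyGame_product :
    ((PMF.uniformOfFintype (ZMod P.q × ZMod P.q)).ev fun d =>
      gameWin P k A inp (lazyGame J d.1 d.2 (d.1 * d.2)) T ([], none)) = hybrid P k A inp T J := by
  rw [PMF.uniform_prod, PMF.ev_comm]
  simp only [gameWin_lazyGame, sub_self]
  rw [ev_lazyGame, PMF.ev_const, freshMaskReply_zero]
  rfl

/-- For a random triple the factor `z - x * y` is uniform and independent of `x` and `y`, by
translation of `z`. -/
theorem ev_lazyGame_random :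
    ((PMF.uniformOfFintype (ZMod P.q × ZMod P.q × ZMod P.q)).ev fun d =>
      gameWin P k A inp (lazyGame J d.1 d.2.1 d.2.2) T ([], none)) =
      (PMF.uniformOfFintype (ZMod P.q)).ev fun δ =>
        (PMF.uniformOfFintype (HashFunctions P k)).ev fun ρ =>
          gameWin P k A inp (idealGame (freshMaskReply J δ)) T (ρ, none) := by
  have hshift : ∀ (a : ZMod P.q) (F : ZMod P.q → ℝ≥0∞), ((PMF.uniformOfFintype (ZMod P.q)).ev
      fun z => F (z - a)) = (PMF.uniformOfFintype (ZMod P.q)).ev F := by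
    intro a F
    have h := congrArg (fun d => PMF.ev d F) (PMF.map_uniform_of_bijective
      (f := fun z : ZMod P.q => z - a) (Equiv.subRight a).bijective)
    simpa only [PMF.ev_map] using h
  rw [PMF.uniform_prod]
  simp only [PMF.uniform_prod (α := ZMod P.q) (β := ZMod P.q), gameWin_lazyGame]
  have h1 : ∀ x y : ZMod P.q, ((PMF.uniformOfFintype (ZMod P.q)).ev fun z =>
      (PMF.uniformOfFintype (HashFunctions P k)).ev fun ρ =>
        (PMF.uniformOfFintype (Coeffs P × LetterTable P)).ev fun m =>
          gameWin P k A inp (idealGame (fixedMaskReply J (z - x * y) (x, m))) T (ρ, none)) =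
      (PMF.uniformOfFintype (ZMod P.q)).ev fun δ =>
        (PMF.uniformOfFintype (HashFunctions P k)).ev fun ρ =>
        (PMF.uniformOfFintype (Coeffs P × LetterTable P)).ev fun m =>
          gameWin P k A inp (idealGame (fixedMaskReply J δ (x, m))) T (ρ, none) := fun x y =>
    hshift (x * y) fun δ => (PMF.uniformOfFintype (HashFunctions P k)).ev fun ρ =>
        (PMF.uniformOfFintype (Coeffs P × LetterTable P)).ev fun m =>
          gameWin P k A inp (idealGame (fixedMaskReply J δ (x, m))) T (ρ, none)
  simp only [h1, PMF.ev_const]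
  rw [PMF.ev_comm]
  exact PMF.ev_congr fun δ => ev_lazyGame A inp T J δ

end Hybrids

end Reduction

/-! ### The hybrid argument -/

theorem PMF.toReal_ev_uniform {α : Type} [Fintype α] [Nonempty α] {F : α → ℝ≥0∞}
    (hF : ∀ a, F a ≤ 1) : ((PMF.uniformOfFintype α).ev F).toReal =
      (∑ a, (F a).toReal) / Fintype.card α := by
  rw [PMF.ev_uniform, ENNReal.toReal_div, ENNReal.toReal_natCast,
    ENNReal.toReal_sum fun a _ => ((hF a).trans_lt ENNReal.one_lt_top).ne]

theorem ENNReal.abs_toReal_sub_le {a b e : ℝ≥0∞} (ha : a ≤ 1) (hb : b ≤ 1) (he : e ≠ ⊤)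
    (h₁ : a ≤ b + e) (h₂ : b ≤ a + e) : |a.toReal - b.toReal| ≤ e.toReal := by
  have ha' : a ≠ ⊤ := (ha.trans_lt ENNReal.one_lt_top).ne
  have hb' : b ≠ ⊤ := (hb.trans_lt ENNReal.one_lt_top).ne
  have k₁ := ENNReal.toReal_mono (ENNReal.add_ne_top.2 ⟨hb', he⟩) h₁
  have k₂ := ENNReal.toReal_mono (ENNReal.add_ne_top.2 ⟨ha', he⟩) h₂
  rw [ENNReal.toReal_add hb' he] at k₁
  rw [ENNReal.toReal_add ha' he] at k₂
  rw [abs_le]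
  constructor <;> linarith

theorem sum_range_mul_div {D : ℕ} (hD : 0 < D) (T : ℕ) (f : ℕ → ℝ) :
    ∑ i ∈ Finset.range (T * D), f (i / D) = D * ∑ j ∈ Finset.range T, f j := by
  induction T with
  | zero => simp
  | succ T ih =>
    rw [Nat.succ_mul, Finset.sum_range_add, ih, Finset.sum_range_succ, mul_add]
    congr 1
    rw [Finset.sum_congr rfl (g := fun _ => f T), Finset.sum_const, Finset.card_range, nsmul_eq_mul]
    intro i hi
    rw [Nat.mul_comm, Nat.mul_add_div hD, Nat.div_eq_of_lt (Finset.mem_range.1 hi), Nat.add_zero]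

theorem ZMod.sum_val (q : ℕ) [NeZero q] (f : ℕ → ℝ) :
    ∑ s : ZMod q, f s.val = ∑ i ∈ Finset.range q, f i := by
  refine Finset.sum_bij' (fun s _ => s.val) (fun i _ => (i : ZMod q)) ?_ ?_ ?_ ?_ ?_
  · intro s _
    exact Finset.mem_range.2 s.val_lt
  · simp
  · simp
  · intro i hi
    exact ZMod.val_cast_of_lt (Finset.mem_range.1 hi)
  · simp

/-- Summing over random hybrids: a bound for the average difference of successive hybrids leads to
a bound for the difference of the first and the last one. -/
theorem abs_sub_le_of_average {q T : ℕ} [NeZero q] (hT : 0 < T) {f : ℕ → ℝ} {ε : ℝ}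
    (hf : ∀ j, T ≤ j → f j = f T) (h1 : |f 0 - f T| ≤ 1)
    (h : |(∑ s : ZMod q, (f (s.val / (q / T)) - f (s.val / (q / T) + 1))) / q| ≤ ε) :
    |f 0 - f T| ≤ 2 * T * ε + T / q := by
  have hq : (0 : ℝ) < q := Nat.cast_pos.2 (NeZero.pos q)
  have hT' : (0 : ℝ) < T := Nat.cast_pos.2 hT
  have hε : 0 ≤ ε := (abs_nonneg _).trans h
  -- If `q < T`, the term `T / q` alone exceeds the trivial bound `1`.
  rcases Nat.eq_zero_or_pos (q / T) with hD | hD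
  · have hlt : q < T := by
      rcases Nat.div_eq_zero_iff.1 hD with h | h <;> omega
    have : (1 : ℝ) ≤ T / q := (one_le_div hq).2 (by exact_mod_cast hlt.le)
    have : 0 ≤ 2 * T * ε := by positivity
    linarith
  · set D := q / T with hDdef
    have hle : T * D ≤ q := Nat.mul_div_le q T
    -- Each of the first `T` quotients occurs `D` times and the sum telescopes. Leftover residues
    -- lead to quotients of at least `T`, where `f` is constant.
    have hsum : ∑ s : ZMod q, (f (s.val / D) - f (s.val / D + 1)) = D * (f 0 - f T) := by
      rw [ZMod.sum_val q fun i => f (i / D) - f (i / D + 1), ← Nat.add_sub_cancel' hle,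
        Finset.sum_range_add, sum_range_mul_div hD T fun j => f j - f (j + 1),
        Finset.sum_range_sub', add_eq_left]
      refine Finset.sum_eq_zero fun i _ => ?_
      have hi : T ≤ (T * D + i) / D := (Nat.le_div_iff_mul_le hD).2 (Nat.le_add_right _ _)
      rw [hf _ hi, hf _ (hi.trans (Nat.le_succ _)), sub_self]
    rw [hsum] at h
    have hD' : (0 : ℝ) < D := Nat.cast_pos.2 hD
    rw [mul_div_right_comm, abs_mul, abs_of_pos (div_pos hD' hq), div_mul_eq_mul_div,
      div_le_iff₀ hq] at h
    -- Rounding in `q / T` loses at most a factor `2`, since `D + 1 ≤ 2 * D`.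
    have h2 : (q : ℝ) ≤ 2 * T * D := by
      have h3 : q < T * (D + 1) := Nat.lt_mul_div_succ q hT
      have h4 : T * (D + 1) ≤ 2 * T * D := by nlinarith
      exact_mod_cast h3.le.trans h4
    have h5 : D * |f 0 - f T| ≤ D * (2 * T * ε) := by nlinarith
    have h6 := le_of_mul_le_mul_left h5 hD'
    have : (0 : ℝ) ≤ T / q := by positivity
    linarith

/-! ### The distance of the first and the last hybrid. -/

namespace Reduction

variable {P : Params} {k : ℕ} (A : Prog) (inp : Val) (T : ℕ)

theorem hybrid_le_one (J : ℕ) : hybrid P k A inp T J ≤ 1 :=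
  PMF.ev_le_const fun _ => A.win_le_one ..

theorem hybrid_of_le {J : ℕ} (hJ : T ≤ J) : hybrid P k A inp T J = hybrid P k A inp T T :=
  PMF.ev_congr fun ρ => idealGame_congr A inp T _ _ (fun c hc => by
    have h1 : c < J := by omega
    simp [below, hc, h1]) ρ

/-- The error in a step of the hybrid argument. -/
noncomputable def maskError (P : Params) : ℝ := ((P.n + P.n * P.n : ℕ) + 1 : ℝ) / P.q

/-- The game for random instances and the next hybrid. -/
theorem abs_random_sub_hybrid_le (J : ℕ) :
    |((PMF.uniformOfFintype (ZMod P.q)).ev fun δ =>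
        (PMF.uniformOfFintype (HashFunctions P k)).ev fun ρ =>
          gameWin P k A inp (idealGame (freshMaskReply J δ)) T (ρ, none)).toReal -
      (hybrid P k A inp T (J + 1)).toReal| ≤ maskError P := by
  classical
  have hq : (P.q : ℝ≥0∞) ≠ 0 := by exact_mod_cast P.prime_q.ne_zero
  set e : ℝ≥0∞ := (P.n + P.n * P.n : ℕ) / (P.q : ℕ) with he
  have he' : e ≠ ⊤ := ENNReal.div_ne_top (ENNReal.natCast_ne_top _) hq
  have hi : ((1 : ℝ≥0∞) / P.q) ≠ ⊤ := ENNReal.div_ne_top (by simp) hq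
  have hzero : ((PMF.uniformOfFintype (ZMod P.q)).ev fun δ => if δ = 0 then (1 : ℝ≥0∞) else 0) =
      1 / P.q := by
    rw [PMF.ev_uniform_eq, ZMod.card]
  have hR : ∀ δ : ZMod P.q, ((PMF.uniformOfFintype (HashFunctions P k)).ev fun ρ =>
      gameWin P k A inp (idealGame (freshMaskReply J δ)) T (ρ, none)) ≤ 1 := fun δ =>
    PMF.ev_le_const fun _ => A.win_le_one ..
  have hH := hybrid_le_one (P := P) (k := k) A inp T (J + 1)
  have key := fun (δ : ZMod P.q) (hδ : δ ≠ 0) =>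
    And.intro (PMF.ev_mono (d := PMF.uniformOfFintype (HashFunctions P k)) fun ρ =>
      (freshMask_hop hδ A inp T J ρ).1)
    (PMF.ev_mono (d := PMF.uniformOfFintype (HashFunctions P k)) fun ρ =>
      (freshMask_hop hδ A inp T J ρ).2)
  simp only [PMF.ev_add, PMF.ev_const] at key
  have := ENNReal.abs_toReal_sub_le (e := 1 / P.q + e)
    (PMF.ev_le_const (d := PMF.uniformOfFintype (ZMod P.q)) hR) hH
    (ENNReal.add_ne_top.2 ⟨hi, he'⟩) ?_ ?_
  · refine this.trans_eq ?_
    rw [ENNReal.toReal_add hi he', he, maskError, ENNReal.toReal_div, ENNReal.toReal_div,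
      ENNReal.toReal_natCast, ENNReal.toReal_natCast, ENNReal.toReal_one]
    ring
  -- The case `δ = 0`, in which the mask hides nothing, is paid for by its probability `1 / q`; all
  -- other factors incur only the error for bad nodes.
  · rw [← hzero, add_left_comm, ← PMF.ev_const (PMF.uniformOfFintype (ZMod P.q)) (_ + e),
      ← PMF.ev_add]
    refine PMF.ev_mono fun δ => ?_
    split_ifs with hδ
    · exact (hR δ).trans le_self_add
    · rw [zero_add]
      exact (key δ hδ).1
  · rw [← PMF.ev_const (PMF.uniformOfFintype (ZMod P.q)) (hybrid P k A inp T (J + 1)),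
      ← add_assoc, add_right_comm, ← PMF.ev_const (PMF.uniformOfFintype (ZMod P.q)) e, ← hzero,
      ← PMF.ev_add, ← PMF.ev_add]
    refine PMF.ev_mono fun δ => ?_
    split_ifs with hδ
    · exact hH.trans le_add_self
    · rw [add_zero]
      exact (key δ hδ).2

/-- The first and the last hybrid, in terms of the advantage of the reduction. -/
theorem abs_hybrid_sub_le {c : ℕ} {E M : Prog} (hM : (script c).Computes E A M)
    (hE : ∀ p : P.Password, E.eval (.pair (P.pub k) (P.passwordVal p)) = P.elt (P.encode p))
    (aux : Val) {T₀ : ℕ} (hT : (polyBound c k + 1) * batchLength (P.pub k) + 1 ≤ T₀) :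
    |(hybrid P k A (.pair (P.pub k) aux) (polyBound c k) 0).toReal -
      (hybrid P k A (.pair (P.pub k) aux) (polyBound c k) (polyBound c k)).toReal| ≤
    2 * polyBound c k * (|ddhProb P (.pair (P.pub k) aux) M T₀
          ((PMF.uniformOfFintype (ZMod P.q × ZMod P.q)).map fun d => (d.1, d.2, d.1 * d.2))
        - ddhProb P (.pair (P.pub k) aux) M T₀
          (PMF.uniformOfFintype (ZMod P.q × ZMod P.q × ZMod P.q))| + maskError P) +
      polyBound c k / P.q := by
  set inp := Val.pair (P.pub k) aux
  set T := polyBound c k with hTdef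
  let f : ℕ → ℝ := fun j => (hybrid P k A inp T j).toReal
  have hq : (0 : ℝ) < P.q := Nat.cast_pos.2 P.prime_q.pos
  have hf1 : ∀ j, 0 ≤ f j ∧ f j ≤ 1 := fun j => ⟨ENNReal.toReal_nonneg,
    ENNReal.toReal_le_of_le_ofReal zero_le_one (by simpa using hybrid_le_one A inp T j)⟩
  refine abs_sub_le_of_average (f := f) (polyBound_pos c k) (fun j hj => by
    simp only [f]
    rw [hybrid_of_le A inp T hj]) ?_ ?_
  · have h0 := hf1 0
    have hT := hf1 T
    rw [abs_le]
    constructor <;> linarith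
  · let R : ℕ → ℝ≥0∞ := fun J => (PMF.uniformOfFintype (ZMod P.q)).ev fun δ =>
      (PMF.uniformOfFintype (HashFunctions P k)).ev fun ρ =>
        gameWin P k A inp (idealGame (freshMaskReply J δ)) T (ρ, none)
    have hR : ∀ J, R J ≤ 1 := fun J => PMF.ev_le_const fun _ => PMF.ev_le_const fun _ =>
      A.win_le_one ..
    have hidx : ∀ s : ZMod P.q, hybridIndex c (P.pub k) s.val = s.val / (P.q / T) := fun _ => rfl
    rw [ddhProb_eq hM hE aux hT, ddhProb_eq hM hE aux hT, PMF.ev_map,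
      PMF.ev_comm (PMF.uniformOfFintype (ZMod P.q × ZMod P.q)),
      PMF.ev_comm (PMF.uniformOfFintype (ZMod P.q × ZMod P.q × ZMod P.q))]
    simp only [ev_lazyGame_product, ev_lazyGame_random, hidx]
    rw [PMF.toReal_ev_uniform fun s => hybrid_le_one A inp T _,
      PMF.toReal_ev_uniform fun s => hR _, ZMod.card, ← sub_div, ← Finset.sum_sub_distrib]
    -- The step from one hybrid to the next passes through the game for random triples: the first
    -- sum is the advantage of the reduction, the second one the statistical error.
    have hsplit : ∑ s : ZMod P.q, (f (s.val / (P.q / T)) - f (s.val / (P.q / T) + 1)) =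
        ∑ s : ZMod P.q, (f (s.val / (P.q / T)) - (R (s.val / (P.q / T))).toReal) +
          ∑ s : ZMod P.q, ((R (s.val / (P.q / T))).toReal - f (s.val / (P.q / T) + 1)) := by
      rw [← Finset.sum_add_distrib]
      exact Finset.sum_congr rfl fun s _ => by ring
    have herr : |(∑ s : ZMod P.q, ((R (s.val / (P.q / T))).toReal -
        f (s.val / (P.q / T) + 1))) / P.q| ≤ maskError P := by
      rw [abs_div, abs_of_pos hq, div_le_iff₀ hq]
      refine (Finset.abs_sum_le_sum_abs _ _).trans ?_
      refine (Finset.sum_le_card_nsmul _ _ (maskError P) fun s _ =>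
        abs_random_sub_hybrid_le A inp T _).trans_eq ?_
      rw [Finset.card_univ, ZMod.card, nsmul_eq_mul, mul_comm]
    rw [hsplit, add_div]
    exact (abs_add_le _ _).trans (add_le_add le_rfl herr)

end Reduction

/-! ### The order of the group -/

namespace Negligible

theorem add {f g : ℕ → ℝ} (hf : Negligible f) (hg : Negligible g) :
    Negligible fun k => f k + g k :=
  Asymptotics.SuperpolynomialDecay.add hf hg

theorem mono {f g : ℕ → ℝ} (hg : Negligible g) (h : ∀ k, |f k| ≤ g k) : Negligible f :=
  Asymptotics.SuperpolynomialDecay.trans_abs_le hg fun k => (h k).trans (le_abs_self _)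

theorem const_mul {f : ℕ → ℝ} (hf : Negligible f) (a : ℝ) : Negligible fun k => a * f k :=
  Asymptotics.SuperpolynomialDecay.const_mul hf a

theorem polyBound_mul {f : ℕ → ℝ} (hf : Negligible f) (c : ℕ) :
    Negligible fun k => polyBound c k * f k := by
  have h1 : Negligible fun k => (k : ℝ) ^ c * f k :=
    Asymptotics.SuperpolynomialDecay.param_pow_mul hf c
  have h2 := h1.add (hf.const_mul c)
  refine h2.congr fun k => ?_
  unfold polyBound
  push_cast
  ring

theorem polyBounded_mul {f : ℕ → ℝ} (hf : Negligible f) (h0 : ∀ k, 0 ≤ f k) {p : ℕ → ℕ}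
    (hp : PolyBounded p) : Negligible fun k => p k * f k := by
  obtain ⟨c, hc⟩ := hp
  refine (hf.polyBound_mul c).mono fun k => ?_
  rw [abs_of_nonneg (mul_nonneg (Nat.cast_nonneg _) (h0 k))]
  exact mul_le_mul_of_nonneg_right (by exact_mod_cast hc k) (h0 k)

theorem two_pow : Negligible fun k => (1 : ℝ) / 2 ^ k := by
  have h : Negligible fun k : ℕ => Real.exp (-(Real.log 2 * k)) := by
    intro n
    have h1 := (Real.tendsto_pow_mul_exp_neg_atTop_nhds_zero n).comp
      ((tendsto_natCast_atTop_atTop (R := ℝ)).const_mul_atTop (Real.log_pos one_lt_two))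
    have h2 := h1.const_mul (((Real.log 2) ^ n)⁻¹)
    rw [mul_zero] at h2
    refine h2.congr fun k => ?_
    have : Real.log 2 ^ n ≠ 0 := pow_ne_zero _ (Real.log_pos one_lt_two).ne'
    simp only [Function.comp_apply]
    rw [mul_pow]
    field_simp
  refine h.congr fun k => ?_
  rw [Real.exp_neg, mul_comm, Real.exp_nat_mul, Real.exp_log two_pos, one_div]

end Negligible

/-- Whether the third element of an instance is the neutral element. -/
def thirdIsOne (v : Val) : ℕ × ℕ × ℕ := (0, 0, if v.snd.snd.entry 2 = 1 then 1 else 0)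

theorem exists_thirdIsOne {inp : ℕ → Val} {G : ℕ → ℕ} (hG : PolyBounded G) (hGm : Monotone G)
    (hinp : ∀ k, (inp k).size ≤ G k) :
    ∃ M : Prog, (∀ v : Val, M.eval v = code (thirdIsOne v)) ∧ M.Efficient inp := by
  have h : PolyTime thirdIsOne := by
    unfold thirdIsOne
    fun_prop
  obtain ⟨M, F, hF, hFm, hM⟩ := h.elim
  have he : ∀ v : Val, M.eval v = code (thirdIsOne v) := fun v => (hM v).1
  have hmem : ∀ v as, (M.memory v as).size ≤ 1 := by
    intro v as
    induction as using List.reverseRecOn with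
    | nil => exact le_rfl
    | append_singleton as a ih =>
      rw [Prog.memory, List.foldl_append, List.foldl_cons, List.foldl_nil, Prog.activate, he]
      exact le_rfl
  obtain ⟨c, hc⟩ : PolyBounded fun n => F (G n + n + 3) :=
    hF.comp ((hG.add PolyBounded.id).add (PolyBounded.const 3))
  refine ⟨M, he, c, fun k as a => ?_⟩
  refine ((hM _).2.1.trans (hFm ?_)).trans (hc _)
  have h1 := hinp k
  have h2 := hmem (inp k) as
  have h3 := hGm (show k ≤ k + (as.map Val.size).sum + a.size by omega)
  change (Val.pair (inp k) (.pair (M.memory (inp k) as) a)).size ≤ _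
  simp only [Val.size]
  omega

theorem ddhProb_thirdIsOne {M : Prog} (hM : ∀ v : Val, M.eval v = code (thirdIsOne v)) (P : Params)
    (inp : Val) (T : ℕ) (D : PMF (ZMod P.q × ZMod P.q × ZMod P.q)) :
    ddhProb P inp M (T + 1) D = (D.ev fun d => if d.2.2 = 0 then 1 else 0).toReal := by
  rw [ddhProb, Prog.probOne_eq, PMF.ev_bind]
  congr 1
  refine PMF.ev_congr fun d => ?_
  have hone : (P.elt (P.pow P.g d.2.2)).toNat = 1 ↔ d.2.2 = 0 := by
    have h1 : (P.elt (1 : P.Grp)).toNat = 1 := by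
      have : Fact (1 < 2 * P.q + 1) := ⟨P.prime_modulus.one_lt⟩
      change ((1 : P.Grp) : ZMod (2 * P.q + 1)).val = 1
      rw [Units.val_one, ZMod.val_one]
    constructor
    · intro h
      refine P.pow_injective ?_
      rw [P.pow_zero]
      exact Units.ext (ZMod.val_injective _ (h.trans h1.symm))
    · rintro h
      rw [h, P.pow_zero, h1]
  simp only [Prog.run, Prog.activate, hM]
  change (PMF.pure (_, _)).ev _ = _
  rw [PMF.ev_pure]
  change Val.accepts (.nat (if (P.elt (P.pow P.g d.2.2)).toNat = 1 then 1 else 0)) = _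
  simp only [hone]
  split_ifs <;> simp [Val.accepts]

/-- The product of two uniform elements vanishes with probability `2 / q - 1 / q ^ 2`, a uniform
element with probability `1 / q`. The difference `1 / q - 1 / q ^ 2` is at least half of `1 / q`, as
`q ≥ 2`. -/
theorem one_div_le_advantage (q : ℕ) [Fact q.Prime] :
    (1 : ℝ) / q ≤ 2 * |((((PMF.uniformOfFintype (ZMod q × ZMod q)).map
        fun d => (d.1, d.2, d.1 * d.2)).ev fun d => if d.2.2 = 0 then 1 else 0).toReal -
      ((PMF.uniformOfFintype (ZMod q × ZMod q × ZMod q)).ev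
        fun d => if d.2.2 = 0 then 1 else 0).toReal)| := by
  have hq0 : (q : ℝ≥0∞) ≠ 0 := by exact_mod_cast NeZero.ne q
  have hq : (2 : ℝ) ≤ q := by exact_mod_cast (Fact.out : q.Prime).two_le
  have hle : (1 : ℝ≥0∞) / q ≤ 1 := by
    rw [ENNReal.div_le_iff hq0 (ENNReal.natCast_ne_top _), one_mul]
    exact_mod_cast (Fact.out : q.Prime).one_lt.le
  have hreal : ((1 : ℝ≥0∞) / q).toReal = 1 / q := by simp
  have h1 : ((PMF.uniformOfFintype (ZMod q × ZMod q × ZMod q)).ev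
      fun d => if d.2.2 = 0 then (1 : ℝ≥0∞) else 0) = 1 / q := by
    simp only [PMF.uniform_prod, PMF.ev_uniform_eq, PMF.ev_const, ZMod.card]
  have h2 : ∀ x : ZMod q, ((PMF.uniformOfFintype (ZMod q)).ev
      fun y => if x * y = 0 then (1 : ℝ≥0∞) else 0) = if x = 0 then 1 else 1 / (q : ℝ≥0∞) := by
    intro x
    by_cases hx : x = 0
    · simp [hx]
    · simp only [mul_eq_zero, hx, false_or, if_false, PMF.ev_uniform_eq, ZMod.card]
  have h3 : ((((PMF.uniformOfFintype (ZMod q × ZMod q)).map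
        fun d => (d.1, d.2, d.1 * d.2)).ev fun d => if d.2.2 = 0 then (1 : ℝ≥0∞) else 0)).toReal =
      (q * (1 / q) + (1 - 1 / q)) / q := by
    rw [PMF.ev_map, PMF.uniform_prod]
    simp only [h2]
    rw [PMF.toReal_ev_uniform fun x => by split_ifs <;> first | exact le_rfl | exact hle, ZMod.card]
    congr 1
    have : ∀ x : ZMod q, (if x = 0 then (1 : ℝ≥0∞) else 1 / q).toReal =
        1 / q + if x = 0 then (1 - 1 / q : ℝ) else 0 := by
      intro x
      split_ifs
      · simp
      · rw [hreal, add_zero]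
    simp only [this, Finset.sum_add_distrib, Finset.sum_const, Finset.card_univ, ZMod.card,
      nsmul_eq_mul, Finset.sum_ite_eq', Finset.mem_univ, if_true]
  rw [h1, h3, hreal, ← mul_le_mul_iff_of_pos_left (show (0 : ℝ) < 1 / 2 by norm_num), ← mul_assoc]
  norm_num
  refine le_trans ?_ (le_abs_self _)
  rw [div_eq_mul_inv (1 + _)]
  have h4 : (q : ℝ)⁻¹ ≤ 1 / 2 := by
    rw [inv_le_comm₀ (by positivity) (by norm_num)]
    simpa using hq
  have h5 : 0 < (q : ℝ)⁻¹ := by positivity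
  nlinarith

/-- No growth of `q` is assumed: a small group would let the test whether the third element is `1`
break the assumption. A single activation suffices for this test, which is the bound `polyBound 0 k
= 1`. -/
theorem DDH.one_div {P : ℕ → Params} {aux : ℕ → Val} (h : DDH P aux) {G : ℕ → ℕ}
    (hG : PolyBounded G) (hGm : Monotone G) (hinp : ∀ k, (advInput P aux k).size ≤ G k) :
    Negligible fun k => (1 : ℝ) / (P k).q := by
  obtain ⟨M, hM, he⟩ := exists_thirdIsOne hG hGm hinp
  refine ((h M 0 he).const_mul 2).mono fun k => ?_
  have : Fact (P k).q.Prime := ⟨(P k).prime_q⟩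
  rw [abs_of_nonneg (by positivity)]
  have h1 : polyBound 0 k = 0 + 1 := by simp [polyBound]
  rw [h1, ddhProb_thirdIsOne hM, ddhProb_thirdIsOne hM]
  exact one_div_le_advantage (P k).q

/-! ### The chain of games -/

section Chain

variable (P : Params) (k : ℕ) (A : Prog) (inp : Val) (T : ℕ)

/-- The game with keys chosen in advance, with random keys. -/
noncomputable def keyedWin (R : ℕ → Bool) (coll : Bool) : ℝ≥0∞ :=
  (PMF.uniformOfFintype (HashFunctions P k × BitString k × BitString k)).ev fun e =>
    gameWin P k A inp (keyedGame P k R coll) T (e, none)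

theorem keyedWin_le_one (R : ℕ → Bool) (coll : Bool) : keyedWin P k A inp T R coll ≤ 1 :=
  PMF.ev_le_const fun _ => A.win_le_one ..

theorem toReal_div_two_pow (a : ℕ) :
    ((a : ℝ≥0∞) / (2 ^ k : ℕ)).toReal = a * (1 / 2 ^ k) := by
  rw [ENNReal.toReal_div, ENNReal.toReal_natCast, ENNReal.toReal_natCast]
  push_cast
  ring

theorem abs_keyedWin_login_le (R : ℕ → Bool) :
    |(keyedWin P k A inp T R true).toReal - (keyedWin P k A inp T R false).toReal| ≤
      (T * T : ℕ) * (1 / 2 ^ k) := by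
  rw [← toReal_div_two_pow]
  exact ENNReal.abs_toReal_sub_le (keyedWin_le_one ..) (keyedWin_le_one ..)
    (ENNReal.div_ne_top (ENNReal.natCast_ne_top _) (by simp))
    (keyedGame_login A inp T R true) (keyedGame_login A inp T R false)

/-- The ideal game. -/
noncomputable def idealWin (R : ℕ → Bool) : ℝ≥0∞ :=
  (PMF.uniformOfFintype (HashFunctions P k)).ev fun ρ =>
    gameWin P k A inp (idealGame (idealReply R)) T (ρ, none)

theorem abs_keyedWin_sub_idealWin_le (R : ℕ → Bool) :
    |(keyedWin P k A inp T R false).toReal - (idealWin P k A inp T R).toReal| ≤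
      T * (1 / 2 ^ k) := by
  have h := keyedGame_rows (P := P) (k := k) A inp T R
  simp only [lateRowGame_eq_ideal] at h
  rw [← toReal_div_two_pow]
  exact ENNReal.abs_toReal_sub_le (keyedWin_le_one ..) (PMF.ev_le_const fun _ => A.win_le_one ..)
    (ENNReal.div_ne_top (ENNReal.natCast_ne_top _) (by simp)) h.1 h.2

theorem idealWin_false :
    idealWin P k A inp T (fun _ => false) = Reduction.hybrid P k A inp T 0 :=
  PMF.ev_congr fun ρ => idealGame_congr A inp T _ _ (fun c _ => by simp [below]) ρ

theorem idealWin_true :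
    idealWin P k A inp T (fun _ => true) = Reduction.hybrid P k A inp T T :=
  PMF.ev_congr fun ρ => idealGame_congr A inp T _ _ (fun c hc => by simp [below, hc]) ρ

/-- The real server and the simulator. -/
theorem abs_real_sub_keyedWin_le :
    |attackProb P k (realServer P k) inp A T -
        (keyedWin P k A inp T (fun _ => true) false).toReal| ≤
      |(Reduction.hybrid P k A inp T 0).toReal - (Reduction.hybrid P k A inp T T).toReal| +
        (T * T + 2 * T : ℕ) * (1 / 2 ^ k) := by
  have h0 : attackProb P k (realServer P k) inp A T =
      (keyedWin P k A inp T (fun _ => false) true).toReal := attackProb_real A inp T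
  have h1 := abs_keyedWin_login_le P k A inp T fun _ => false
  have h2 := abs_keyedWin_sub_idealWin_le P k A inp T fun _ => false
  have h3 := abs_keyedWin_sub_idealWin_le P k A inp T fun _ => true
  rw [idealWin_false] at h2
  rw [idealWin_true, abs_sub_comm] at h3
  rw [h0]
  set a := (keyedWin P k A inp T (fun _ => false) true).toReal
  set b := (keyedWin P k A inp T (fun _ => false) false).toReal
  set c := (Reduction.hybrid P k A inp T 0).toReal
  set d := (Reduction.hybrid P k A inp T T).toReal
  set e := (keyedWin P k A inp T (fun _ => true) false).toReal
  -- The chain runs from the real server through comparison of passwords, the first hybrid and the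
  -- last hybrid to the simulator; the rows are separated at the first hybrid and joined again at
  -- the last.
  have k1 := abs_sub_le a b e
  have k2 := abs_sub_le b c e
  have k3 := abs_sub_le c d e
  push_cast at *
  linarith

end Chain

/-! ### The bound is negligible -/

theorem PolyBounded.params_n_square {P : ℕ → Params} (h : PolyBounded fun k => (P k).n) :
    PolyBounded fun k => (P k).n + (P k).n * (P k).n + 1 :=
  (h.add (h.mul h)).add (PolyBounded.const 1)

theorem polyBounded_batchLength {P : ℕ → Params} (h : PolyBounded fun k => (P k).n) :
    PolyBounded fun k => Reduction.batchLength ((P k).pub k) := by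
  have h1 : ∀ k, Reduction.batchLength ((P k).pub k) =
    0 + ((1 + (1 + ((P k).n + ((P k).n + (P k).n)))) + (1 + (k + k))) := fun _ => rfl
  simp only [h1]
  exact (PolyBounded.const 0).add (((PolyBounded.const 1).add ((PolyBounded.const 1).add
    (h.add (h.add h)))).add ((PolyBounded.const 1).add (PolyBounded.id.add PolyBounded.id)))

theorem mainTheorem2 (P : ℕ → Params) (hP : Feasible P) :
    ∃ (I : Prog) (d : ℕ), I.Efficient (fun k => (P k).pub k) ∧
      ∀ aux : ℕ → Val, DDH P aux →
        ∀ (A : Prog) (c : ℕ), A.Efficient (advInput P aux) →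
          Negligible fun k =>
            |attackProb (P k) k (realServer (P k) k) (advInput P aux k) A (polyBound c k)
              - attackProb (P k) k
                  (fun ρ => simulatedServer (P k) k ρ I (polyBound d k))
                  (advInput P aux k) A (polyBound c k)| := by
  obtain ⟨-, hn, E, e, hE⟩ := hP
  have hcost := fun k p => (hE k p).2
  -- The simulator depends only on the program for the encoding, so it is fixed before the auxiliary
  -- input and the adversary.
  obtain ⟨I, hI, hIe⟩ := Simulator.exists_efficient hcost
  have hbatch := polyBounded_batchLength hn
  obtain ⟨d, hd⟩ : PolyBounded fun k => 1 + ((P k).n + ((P k).n + (P k).n)) +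
      Reduction.batchLength ((P k).pub k) :=
    ((PolyBounded.const 1).add (hn.add (hn.add hn))).add hbatch
  refine ⟨I, d, hIe, fun aux hddh A c hA => ?_⟩
  obtain ⟨M, hM, hMe⟩ := Reduction.exists_efficient c hcost hA
  -- Enough activations for one batch per activation of the adversary and an additional one, plus
  -- the activation that starts the machine.
  obtain ⟨m, hm⟩ : PolyBounded fun k =>
      (polyBound c k + 1) * Reduction.batchLength ((P k).pub k) + 1 :=
    (((PolyBounded.id.polyBound c).add (PolyBounded.const 1)).mul hbatch).add (PolyBounded.const 1)
  have hadv : Negligible _ := hddh M m hMe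
  -- The efficiency of the adversary at its very first activation bounds the length of the public
  -- and auxiliary input, which the test behind `DDH.one_div` has to read.
  have hq : Negligible fun k => (1 : ℝ) / (P k).q := by
    obtain ⟨a, ha⟩ := hA
    refine hddh.one_div (G := fun k => polyBound a (k + 1))
      ((PolyBounded.id.add (PolyBounded.const 1)).polyBound a)
      (fun x y h => polyBound_mono a (Nat.succ_le_succ h)) fun k => ?_
    have h1 := A.size_le_cost (.pair (advInput P aux k) (.pair (A.memory (advInput P aux k) [])
      (.nat 0)))
    have h2 := (h1.trans (ha k [] (.nat 0))).trans_eq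
      (show (k + (([] : List Val).map Val.size).sum + (Val.nat 0).size) ^ a + a =
        polyBound a (k + 1) from rfl)
    simp only [Val.size] at h2
    omega
  have hT : PolyBounded (polyBound c) := PolyBounded.id.polyBound c
  have hmask : Negligible fun k => Reduction.maskError (P k) := by
    refine (hq.polyBounded_mul (fun k => by positivity) hn.params_n_square).congr fun k => ?_
    rw [Reduction.maskError]
    push_cast
    ring
  have hpow := Negligible.two_pow.polyBounded_mul (fun k => by positivity)
    ((hT.mul hT).add ((PolyBounded.const 2).mul hT))
  refine ((((hadv.add hmask).polyBounded_mul (fun k => add_nonneg (abs_nonneg _) (by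
    unfold Reduction.maskError
    positivity)) ((PolyBounded.const 2).mul hT)).add
      (hq.polyBounded_mul (fun k => by positivity) hT)).add hpow).mono fun k => ?_
  rw [abs_abs]
  have hsim := Simulator.attackProb_eq_keyed hI (fun p => (hE k p).1) (T₀ := polyBound d k) (by
    refine le_trans (le_of_eq ?_) (hd k)
    unfold Reduction.batchLength
    ring) A (advInput P aux k) (polyBound c k)
  have h1 := abs_real_sub_keyedWin_le (P k) k A (advInput P aux k) (polyBound c k)
  have h2 := Reduction.abs_hybrid_sub_le A hM (fun p => (hE k p).1) (aux k) (hm k)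
  rw [hsim]
  refine h1.trans (add_le_add_left (h2.trans_eq ?_) _)
  unfold advInput
  push_cast
  ring
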